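/- Let $K$ be an algebraically closed field and $n\ge 1$. Let $\mathbb{L}_n$ be the graph with vertices $1,\dots,n$, one edge between $i$ and $i+1$ for each $1\le i<n$, and one loop at the vertex $1$. Let $\Lambda=P(\mathbb{L}_n)$ be its preprojective algebra: the quotient of the path algebra over $K$ of the quiver having the vertices $1,\dots,n$, a loop $\epsilon$ at $1$ and, for each $1\le i<n$, two opposite arrows $a_i:i\to i+1$ and $\bar a_i:i+1\to i$, by the relations $\sum_{a \text{ starting at } i} a\bar a=0$, one for each vertex $i$ (with $\bar{\bar a}=a$ and $\bar\epsilon=\epsilon$). Let $HH^*(\Lambda)=\bigoplus_{i\ge 0}\mathrm{Ext}^i_{\Lambda\otimes_K\Lambda^{op}}(\Lambda,\Lambda)$ be its Hochschild cohomology ring, with the Yoneda product. Suppose that $\mathrm{char}\,K\neq 2$ and that $\mathrm{char}\,K$ does not divide $2n+1$. Then $HH^*(\Lambda)$ is isomorphic, as a graded $K$-algebra, to the graded commutative $K$-algebra (that is, $ab=(-1)^{\deg a\deg b}ba$ for homogeneous $a,b$) given by the generators $$x_0,x_1,\dots,x_n \ (\text{degree } 0),\quad y\ (\text{degree } 1),\quad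 z_1,\dots,z_n\ (\text{degree } 2),\quad \gamma\ (\text{degree } 4),\quad h\ (\text{degree } 6)$$ and the relations 1. $x_i\xi=0$ for each $i=1,\dots,n$ and each generator $\xi$ (including $\xi=x_0,\dots,x_n$); 2. $x_0^n=0$, $y^2=0$, and $x_0z_j=0$ for $j=1,\dots,n$; 3. $z_jz_k=(-1)^{k-j+1}(2j-1)(n-k+1)\,x_0^{n-1}\gamma$ for $1\le j\le k\le n$; 4. $z_j\gamma=(-1)^j(n-j+1)\,x_0^{n-1}h$ for $j=1,\dots,n$; 5. $\gamma^2=z_1h$. -/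

import Mathlib

open CategoryTheory TensorProduct DirectSum

universe u

/-! ### Preprojective algebras of graphs -/

/-- A graph on the vertex set `V` without multiple edges, in which loops are allowed. -/
structure LoopGraph (V : Type) where
  /-- Adjacency; `Adj i i` means that there is a loop at `i`. -/
  Adj : V → V → Prop
  symm : ∀ i j, Adj i j → Adj j i

namespace LoopGraph

variable {V : Type}

/-- The arrows of the quiver of a graph. Each edge `i — j` with `i ≠ j` gives the two opposite
arrows `(i, j) : i → j` and `(j, i) : j → i`, and each loop at `i` gives one arrow `(i, i)`. -/
abbrev Arrow (Δ : LoopGraph V) : Type := {p : V × V // Δ.Adj p.1 p.2}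

/-- The initial vertex of an arrow. -/
def Arrow.src {Δ : LoopGraph V} (a : Δ.Arrow) : V := a.1.1

/-- The terminal vertex of an arrow. -/
def Arrow.tgt {Δ : LoopGraph V} (a : Δ.Arrow) : V := a.1.2

/-- The opposite arrow `ā`; for a loop, `ā = a`. -/
def Arrow.bar {Δ : LoopGraph V} (a : Δ.Arrow) : Δ.Arrow :=
  ⟨(a.1.2, a.1.1), Δ.symm _ _ a.2⟩

/-- Generators of the path algebra: the trivial paths `e i` and the arrows. -/
inductive PathGen (Δ : LoopGraph V) : Type
  | e (i : V) : PathGen Δ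
  | arrow (a : Δ.Arrow) : PathGen Δ

variable [Fintype V] [DecidableEq V]

/-- The relations of the preprojective algebra on the free algebra on vertices and arrows. The
first five present the path algebra of the quiver (paths are written from left to right, so
that `a = e_{src a} * a * e_{tgt a}`); the last one is the preprojective relation
`∑_{src a = i} a * ā = 0` at the vertex `i`. -/
inductive PreprojectiveRel (K : Type u) [Field K] (Δ : LoopGraph V) [DecidableRel Δ.Adj] :
    FreeAlgebra K Δ.PathGen → FreeAlgebra K Δ.PathGen → Prop
  | e_mul_self (i : V) : PreprojectiveRel K Δ
      (FreeAlgebra.ι K (PathGen.e i) * FreeAlgebra.ι K (PathGen.e i))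
      (FreeAlgebra.ι K (PathGen.e i))
  | e_mul_e (i j : V) (hij : i ≠ j) : PreprojectiveRel K Δ
      (FreeAlgebra.ι K (PathGen.e i) * FreeAlgebra.ι K (PathGen.e j)) 0
  | sum_e : PreprojectiveRel K Δ (∑ i : V, FreeAlgebra.ι K (PathGen.e i)) 1
  | e_mul_arrow (a : Δ.Arrow) : PreprojectiveRel K Δ
      (FreeAlgebra.ι K (PathGen.e a.src) * FreeAlgebra.ι K (PathGen.arrow a))
      (FreeAlgebra.ι K (PathGen.arrow a))
  | arrow_mul_e (a : Δ.Arrow) : PreprojectiveRel K Δ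
      (FreeAlgebra.ι K (PathGen.arrow a) * FreeAlgebra.ι K (PathGen.e a.tgt))
      (FreeAlgebra.ι K (PathGen.arrow a))
  | preprojective (i : V) : PreprojectiveRel K Δ
      (∑ a : Δ.Arrow with a.src = i,
        FreeAlgebra.ι K (PathGen.arrow a) * FreeAlgebra.ι K (PathGen.arrow a.bar)) 0

/-- The preprojective algebra `P(Δ)` over `K`. -/
abbrev PreprojectiveAlgebra (K : Type u) [Field K] (Δ : LoopGraph V) [DecidableRel Δ.Adj] :
    Type u :=
  RingQuot (PreprojectiveRel K Δ)

end LoopGraph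

/-- The graph `𝕃ₙ`: the path `0 — 1 — ⋯ — n-1` together with one loop at the end vertex `0`. -/
def graphL (n : ℕ) : LoopGraph (Fin n) where
  Adj i j := (i.val = 0 ∧ j.val = 0) ∨ i.val + 1 = j.val ∨ j.val + 1 = i.val
  symm i j h := by omega

instance (n : ℕ) : DecidableRel (graphL n).Adj := fun i j =>
  inferInstanceAs
    (Decidable ((i.val = 0 ∧ j.val = 0) ∨ i.val + 1 = j.val ∨ j.val + 1 = i.val))

/-! ### The Hochschild cohomology ring -/

noncomputable section Hochschild

/-- `Λ` as a module over its enveloping algebra `Λ ⊗ Λᵒᵖ`, with `(a ⊗ bᵒ) • m = a * m * b`. -/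
def diagonalBimodule (K Λ : Type u) [Field K] [Ring Λ] [Algebra K Λ] :
    ModuleCat.{u} (Λ ⊗[K] Λᵐᵒᵖ) :=
  letI : Module (Λ ⊗[K] Λᵐᵒᵖ) Λ := TensorProduct.Algebra.module
  ModuleCat.of (Λ ⊗[K] Λᵐᵒᵖ) Λ

/-- The Hochschild cohomology space `HHⁱ(Λ) = Extⁱ(Λ, Λ)` over the enveloping algebra. -/
abbrev HH (K Λ : Type u) [Field K] [Ring Λ] [Algebra K Λ] (i : ℕ) : Type u :=
  Abelian.Ext.{u} (diagonalBimodule K Λ) (diagonalBimodule K Λ) i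

variable (K Λ : Type u) [Field K] [Ring Λ] [Algebra K Λ]

/-- The unit of the Hochschild cohomology ring: the class of the identity. -/
def HH.one : HH K Λ 0 := Abelian.Ext.mk₀ (𝟙 (diagonalBimodule K Λ))

variable {K Λ}

/-- The Yoneda product: `ε * δ` is `δ` followed by `ε`. -/
def HH.mul {i j : ℕ} (ε : HH K Λ i) (δ : HH K Λ j) : HH K Λ (i + j) :=
  Abelian.Ext.comp δ ε (add_comm j i)

theorem HH.mk_comp_eq {a b c c' : ℕ} (δ : HH K Λ a) (ε : HH K Λ b) (h : a + b = c)
    (h' : a + b = c') :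
    GradedMonoid.mk (A := HH K Λ) c (Abelian.Ext.comp δ ε h) =
      GradedMonoid.mk c' (Abelian.Ext.comp δ ε h') := by
  subst h
  subst h'
  rfl

theorem HH.mk_smul_one_mul (r : K) {i : ℕ} (ε : HH K Λ i) :
    GradedMonoid.mk (A := HH K Λ) (0 + i) (HH.mul (r • HH.one K Λ) ε) =
      GradedMonoid.mk i (r • ε) := by
  refine (HH.mk_comp_eq ε (r • HH.one K Λ) _ (add_zero i)).trans ?_
  rw [Abelian.Ext.comp_smul, HH.one, Abelian.Ext.comp_mk₀_id]

theorem HH.mk_mul_smul_one (r : K) {i : ℕ} (ε : HH K Λ i) :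
    GradedMonoid.mk (A := HH K Λ) (i + 0) (HH.mul ε (r • HH.one K Λ)) =
      GradedMonoid.mk i (r • ε) := by
  refine (HH.mk_comp_eq (r • HH.one K Λ) ε _ (zero_add i)).trans ?_
  rw [Abelian.Ext.smul_comp, HH.one, Abelian.Ext.mk₀_id_comp]

theorem HH.mk_mul_assoc {i j k : ℕ} (ε : HH K Λ i) (δ : HH K Λ j) (η : HH K Λ k) :
    GradedMonoid.mk (A := HH K Λ) (i + j + k) (HH.mul (HH.mul ε δ) η) =
      GradedMonoid.mk (i + (j + k)) (HH.mul ε (HH.mul δ η)) :=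
  (congrArg (GradedMonoid.mk (A := HH K Λ) (i + j + k))
    (Abelian.Ext.comp_assoc η δ ε (add_comm k j) (add_comm j i) (by omega)).symm).trans
    (HH.mk_comp_eq (Abelian.Ext.comp η δ (add_comm k j)) ε (by omega) (by omega))

variable (K Λ)

instance HH.instGMul : GradedMonoid.GMul (HH K Λ) where
  mul := HH.mul

instance HH.instGOne : GradedMonoid.GOne (HH K Λ) where
  one := HH.one K Λ

instance HH.instGMonoid : GradedMonoid.GMonoid (HH K Λ) where
  one_mul := fun ⟨_, ε⟩ => by
    have h := HH.mk_smul_one_mul (1 : K) ε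
    rw [one_smul, one_smul] at h
    exact h
  mul_one := fun ⟨_, ε⟩ => by
    have h := HH.mk_mul_smul_one (1 : K) ε
    rw [one_smul, one_smul] at h
    exact h
  mul_assoc := fun ⟨_, ε⟩ ⟨_, δ⟩ ⟨_, η⟩ => HH.mk_mul_assoc ε δ η

/-- The graded ring structure given by the Yoneda product. -/
instance HH.instGRing : DirectSum.GRing (HH K Λ) where
  __ := HH.instGMonoid K Λ
  mul_zero {i j} ε := Abelian.Ext.zero_comp (n := j) _ ε _ (add_comm j i)
  zero_mul {i j} δ := Abelian.Ext.comp_zero δ _ i _ (add_comm j i)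
  mul_add {i j} ε δ δ' := Abelian.Ext.add_comp δ δ' ε (add_comm j i)
  add_mul {i j} ε ε' δ := Abelian.Ext.comp_add δ ε ε' (add_comm j i)
  natCast m := m • HH.one K Λ
  natCast_zero := zero_smul _ _
  natCast_succ _ := succ_nsmul _ _
  intCast m := m • HH.one K Λ
  intCast_ofNat _ := natCast_zsmul _ _
  intCast_negSucc_ofNat _ := negSucc_zsmul _ _

/-- The graded `K`-algebra structure; the scalar `r : K` is `r • 1` in degree zero. -/
instance HH.instGAlgebra : DirectSum.GAlgebra K (HH K Λ) where
  toFun :=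
    { toFun := fun r => r • HH.one K Λ
      map_zero' := zero_smul _ _
      map_add' := fun r s => add_smul _ _ _ }
  map_one := one_smul K (HH.one K Λ)
  map_mul r s := by
    refine Eq.trans ?_ (HH.mk_smul_one_mul r (s • HH.one K Λ)).symm
    rw [smul_smul]
    rfl
  commutes r := fun ⟨_, ε⟩ =>
    (HH.mk_smul_one_mul r ε).trans (HH.mk_mul_smul_one r ε).symm
  smul_def r := fun ⟨_, ε⟩ => (HH.mk_smul_one_mul r ε).symm

/-- The Hochschild cohomology ring `HH^*(Λ) = ⨁ᵢ HHⁱ(Λ)` with the Yoneda product. -/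
abbrev HochschildCohomology : Type u := ⨁ i : ℕ, HH K Λ i

/-- The homogeneous component of degree `d` of `HH^*(Λ)`, as a subspace. -/
def HochschildCohomology.component (d : ℕ) : Submodule K (HochschildCohomology K Λ) :=
  LinearMap.range (DirectSum.lof K ℕ (HH K Λ) d)

end Hochschild

/-! ### Graded commutative algebras given by generators and relations -/

section Presented

variable (K : Type u) [Field K] {G : Type} (deg : G → ℕ)
  (rel : FreeAlgebra K G → FreeAlgebra K G → Prop)

/-- Graded commutativity of the generators, together with the given relations. -/
inductive GradedCommRel : FreeAlgebra K G → FreeAlgebra K G → Prop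
  | comm (a b : G) : GradedCommRel
      (FreeAlgebra.ι K a * FreeAlgebra.ι K b)
      ((-1 : K) ^ (deg a * deg b) • (FreeAlgebra.ι K b * FreeAlgebra.ι K a))
  | of (r s : FreeAlgebra K G) (h : rel r s) : GradedCommRel r s

/-- The graded commutative `K`-algebra with generators `g : G` of degree `deg g` and relations
`rel`. -/
abbrev GradedCommAlgebra : Type u := RingQuot (GradedCommRel K deg rel)

/-- The homogeneous component of degree `d`: the span of the words in the generators of total
degree `d`. -/
def GradedCommAlgebra.component (d : ℕ) : Submodule K (GradedCommAlgebra K deg rel) :=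
  Submodule.span K {m | ∃ w : List G, (w.map deg).sum = d ∧
    m = RingQuot.mkAlgHom K (GradedCommRel K deg rel) (w.map (FreeAlgebra.ι K)).prod}

end Presented

/-! ### The presentation for type `𝕃ₙ` -/

/-- The generators. The families are indexed from `0`: for `i : Fin n` the generators `x i` and
`z i` are `x_{i+1}` and `z_{i+1}`. -/
inductive GenL (n : ℕ) : Type
  | x₀ : GenL n
  | x (i : Fin n) : GenL n
  | y : GenL n
  | z (j : Fin n) : GenL n
  | γ : GenL n
  | h : GenL n

/-- The degrees of the generators. -/
def GenL.deg {n : ℕ} : GenL n → ℕ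
  | x₀ => 0
  | x _ => 0
  | y => 1
  | z _ => 2
  | γ => 4
  | h => 6

open FreeAlgebra GenL in
/-- The relations. With `j' = j + 1` and `k' = k + 1` for the indices starting from `1`:
`z_{j'} z_{k'} = (-1)^{k'-j'+1} (2j'-1) (n-k'+1) x₀^{n-1} γ` for `j' ≤ k'`, and
`z_{j'} γ = (-1)^{j'} (n-j'+1) x₀^{n-1} h`. -/
inductive RelL (K : Type u) [Field K] (n : ℕ) :
    FreeAlgebra K (GenL n) → FreeAlgebra K (GenL n) → Prop
  | x_mul (i : Fin n) (ξ : GenL n) : RelL K n (ι K (x i) * ι K ξ) 0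
  | x₀_pow : RelL K n (ι K x₀ ^ n) 0
  | y_sq : RelL K n (ι K y ^ 2) 0
  | x₀_mul_z (j : Fin n) : RelL K n (ι K x₀ * ι K (z j)) 0
  | z_mul_z (j k : Fin n) (hjk : j ≤ k) : RelL K n (ι K (z j) * ι K (z k))
      (((-1 : K) ^ ((k + 1 : ℕ) - (j + 1 : ℕ) + 1) * (2 * ((j + 1 : ℕ) : K) - 1) *
        ((n : K) - ((k + 1 : ℕ) : K) + 1)) • (ι K x₀ ^ (n - 1) * ι K γ))
  | z_mul_γ (j : Fin n) : RelL K n (ι K (z j) * ι K γ)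
      (((-1 : K) ^ (j + 1 : ℕ) * ((n : K) - ((j + 1 : ℕ) : K) + 1)) •
        (ι K x₀ ^ (n - 1) * ι K h))
  | γ_sq (hn : 0 < n) : RelL K n (ι K γ ^ 2) (ι K (z ⟨0, hn⟩) * ι K h)

/-! After a change of sign of the left arrows, the preprojective relations say that the two detours
of length two at a vertex agree. Hence `Λ` has a basis with at most one path `b i j d` for given
ends and given length. Paths multiply by adding lengths, and the longest ones are the socle paths `b
k k (2 * n - 1)`. `PreprojectiveL.pathBasis` constructs this basis; everything else is a computation
in it.

`Λ` has a bimodule resolution of period six (`PathBasis.res`), whose terms are generated in turn by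
vertices, arrows, vertices, vertices, arrows, vertices. The first two differentials express arrows
and relations, the third is a signed sum over the factorisations of socle paths, and the second half
repeats the first with the sign of the loop reversed (`s = -1`). Exactness follows from left linear
homotopies that contract up to terms with longer left factors; this suffices because lengths are
bounded (`PathBasis.exact_of_homotopy`).

A cochain is a family of path coefficients on the generators, and the differentials compare
coefficients at neighbouring vertices. So cohomology is found by moving coefficients along the graph
towards the loop or off the far end. As `2 ≠ 0`, the degree zero part has dimension `2 * n` and
every other part has dimension `n` (`component_zero_eq_span`, `component_eq_span`,
`linearIndependent_cl_zero`, `linearIndependent_cl`).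

Products are computed with chain maps lifting cocycles. The class `h` is lifted by the identity, and
central elements by multiplication. The class `y` is that of the Euler derivation and is lifted by
commutators of the differentials with the operator measuring the length of the left factor
(`cl_mul_y`, `y_mul_cl`). Explicit lifts exist for `γ` and for the socle classes `clW k` of degree
three. No lift of the `z_j` is needed: `z_j y` is the combination of the `clW k` with coefficients
`theta n j k` (`clZ_mul_clY`), and `theta` is inverse to a tridiagonal matrix up to the factor `2 *
n + 1` (`theta_diff`). As `2 * n + 1 ≠ 0` in `K`, multiplication by `y` is injective in even
positive degrees (`mul_clY_injective`), so identities between products of even classes may be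
checked after multiplying by `y`.

In the presented algebra the relations reduce every word to monomials
(`PresentationL.component_eq`). In each degree the comparison map sends the spanning family to a
basis of the cohomology, so it is bijective. -/

/-! ### Extensions from a projective resolution cut into short exact sequences -/

section Resolution

universe w v u'

variable {C : Type u'} [Category.{v} C] [Abelian C]

/-- A projective resolution of `Ω 0`, cut into short exact sequences `Ω (i+1) ⟶ P i ⟶ Ω i`. -/
structure SyzygyResolution (C : Type u') [Category.{v} C] [Abelian C] where
  P : ℕ → C
  Ω : ℕ → C
  ι : ∀ i, Ω (i + 1) ⟶ P i
  π : ∀ i, P i ⟶ Ω i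
  zero : ∀ i, ι i ≫ π i = 0
  shortExact : ∀ i, (ShortComplex.mk (ι i) (π i) (zero i)).ShortExact
  projective : ∀ i, Projective (P i)

namespace SyzygyResolution

variable (S : SyzygyResolution C)

/-- The differential of the resolution. -/
def d (i : ℕ) : S.P (i + 1) ⟶ S.P i := S.π (i + 1) ≫ S.ι i

instance (i : ℕ) : Epi (S.π i) := (S.shortExact i).epi_g
instance (i : ℕ) : Mono (S.ι i) := (S.shortExact i).mono_f

lemma π_ι (i : ℕ) : S.π (i + 1) ≫ S.ι i = S.d i := rfl

lemma d_π (i : ℕ) : S.d i ≫ S.π i = 0 := by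
  rw [d, Category.assoc, S.zero, Limits.comp_zero]

lemma d_d (i : ℕ) : S.d (i + 1) ≫ S.d i = 0 := by
  rw [← S.π_ι i, ← Category.assoc, S.d_π, Limits.zero_comp]

variable {S} in
lemma ι_comp {i : ℕ} {N : C} {f : S.P i ⟶ N} (hf : S.d i ≫ f = 0) : S.ι i ≫ f = 0 := by
  rw [← cancel_epi (S.π (i + 1)), ← Category.assoc, S.π_ι, hf, Limits.comp_zero]

/-- The factorization of a cocycle through the syzygy. -/
noncomputable def desc {i : ℕ} {N : C} (f : S.P i ⟶ N) (hf : S.d i ≫ f = 0) : S.Ω i ⟶ N :=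
  (S.shortExact i).gIsCokernel.desc (Limits.CokernelCofork.ofπ f (ι_comp hf))

@[simp]
lemma π_desc {i : ℕ} {N : C} (f : S.P i ⟶ N) (hf : S.d i ≫ f = 0) :
    S.π i ≫ S.desc f hf = f :=
  (S.shortExact i).gIsCokernel.fac (Limits.CokernelCofork.ofπ f (ι_comp hf))
    Limits.WalkingParallelPair.one

variable [HasExt.{w} C]

/-- The class of the `i`-fold extension of `Ω 0` by `Ω i`. -/
noncomputable def κ : ∀ i, Abelian.Ext.{w} (S.Ω 0) (S.Ω i) i
  | 0 => Abelian.Ext.mk₀ (𝟙 _)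
  | i + 1 => (κ i).comp (S.shortExact i).extClass rfl

lemma κ_zero : S.κ 0 = Abelian.Ext.mk₀ (𝟙 _) := rfl

lemma κ_succ (i : ℕ) : S.κ (i + 1) = (S.κ i).comp (S.shortExact i).extClass rfl := rfl

/-- The extension class of a cocycle. -/
noncomputable def cls {i : ℕ} {N : C} (f : S.P i ⟶ N) (hf : S.d i ≫ f = 0) :
    Abelian.Ext.{w} (S.Ω 0) N i :=
  (S.κ i).comp (Abelian.Ext.mk₀ (S.desc f hf)) (add_zero i)

lemma cls_comp_mk₀ {i : ℕ} {N N' : C} (f : S.P i ⟶ N) (hf : S.d i ≫ f = 0) (g : N ⟶ N') :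
    (S.cls f hf).comp (Abelian.Ext.mk₀ g) (add_zero i) =
      S.cls (f ≫ g) (by rw [← Category.assoc, hf, Limits.zero_comp]) := by
  have h : S.desc f hf ≫ g =
      S.desc (f ≫ g) (by rw [← Category.assoc, hf, Limits.zero_comp]) := by
    rw [← cancel_epi (S.π i)]
    simp [← Category.assoc]
  rw [cls, cls, Abelian.Ext.comp_assoc (h₁₂ := add_zero i) (h₂₃ := add_zero 0) (h := by omega),
    Abelian.Ext.mk₀_comp_mk₀, h]

lemma cls_add {i : ℕ} {N : C} (f g : S.P i ⟶ N) (hf : S.d i ≫ f = 0) (hg : S.d i ≫ g = 0) :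
    S.cls (f + g) (by rw [Preadditive.comp_add, hf, hg, add_zero]) =
      S.cls f hf + S.cls g hg := by
  have h : S.desc (f + g) (by rw [Preadditive.comp_add, hf, hg, add_zero]) =
      S.desc f hf + S.desc g hg := by
    rw [← cancel_epi (S.π i)]
    simp
  rw [cls, h, Abelian.Ext.mk₀_add, Abelian.Ext.comp_add]
  rfl

/-- Dimension shifting: the neighbouring terms of the long exact sequence are extensions of positive
degree from the projective `P i`. Injectivity uses `1 ≤ m`. -/
lemma extClass_comp_bijective (i : ℕ) {N : C} {m k : ℕ} (hm : 1 ≤ m) (hk : 1 + m = k) :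
    Function.Bijective fun x : Abelian.Ext.{w} (S.Ω (i + 1)) N m =>
      ((S.shortExact i).extClass.comp x hk : Abelian.Ext.{w} (S.Ω i) N k) := by
  have := S.projective i
  obtain ⟨m, rfl⟩ : ∃ m', m = m' + 1 := ⟨m - 1, by omega⟩
  obtain ⟨k, rfl⟩ : ∃ k', k = k' + 1 := ⟨k - 1, by omega⟩
  constructor
  · intro x y hxy
    have h0 : (S.shortExact i).extClass.comp (x - y) hk = 0 := by
      rw [sub_eq_add_neg, Abelian.Ext.comp_add, Abelian.Ext.comp_neg]
      exact add_neg_eq_zero.mpr hxy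
    obtain ⟨z, hz⟩ := Abelian.Ext.contravariant_sequence_exact₁ (S.shortExact i) (Y := N) (x - y) hk h0
    have : z = 0 := Abelian.Ext.eq_zero_of_projective z
    rw [this, Abelian.Ext.comp_zero] at hz
    exact sub_eq_zero.mp hz.symm
  · intro y
    obtain ⟨x, hx⟩ := Abelian.Ext.contravariant_sequence_exact₃ (S.shortExact i) (Y := N) y
      (Abelian.Ext.eq_zero_of_projective _) hk
    exact ⟨x, hx⟩

/-- In the bottom degree the connecting map is only surjective. Its kernel, the maps extending over
`P i`, is what `cls_succ_eq_zero_iff` turns into coboundaries. -/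
lemma extClass_comp_surjective (i : ℕ) {N : C} (y : Abelian.Ext.{w} (S.Ω i) N 1) :
    ∃ g : S.Ω (i + 1) ⟶ N, (S.shortExact i).extClass.comp (Abelian.Ext.mk₀ g) (add_zero 1) = y := by
  have := S.projective i
  obtain ⟨x, hx⟩ := Abelian.Ext.contravariant_sequence_exact₃ (S.shortExact i) (Y := N) y
    (Abelian.Ext.eq_zero_of_projective _) (add_zero 1)
  obtain ⟨g, rfl⟩ := (Abelian.Ext.mk₀_bijective _ _).2 x
  exact ⟨g, hx⟩

lemma κ_comp_bijective (i : ℕ) {N : C} {m k : ℕ} (hm : 1 ≤ m) (hk : i + m = k) :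
    Function.Bijective fun x : Abelian.Ext.{w} (S.Ω i) N m => (S.κ i).comp x hk := by
  induction i generalizing m k with
  | zero =>
    obtain rfl : m = k := by omega
    simp only [κ_zero, Abelian.Ext.mk₀_id_comp]
    exact Function.bijective_id
  | succ i ih =>
    have h1 := S.extClass_comp_bijective i (N := N) hm rfl
    have h2 := ih (m := 1 + m) (k := k) (by omega) (by omega)
    convert h2.comp h1 using 1
    funext x
    rw [κ_succ]
    exact Abelian.Ext.comp_assoc (h₁₂ := rfl) (h₂₃ := rfl) (h := by omega) ..

/-- In positive degree `κ (i + 1)` is `κ i` followed by one more extension. Composition with `κ i`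
is bijective on extensions of degree one, and the last extension reaches all of those from honest
morphisms. -/
lemma cls_surjective (i : ℕ) {N : C} (x : Abelian.Ext.{w} (S.Ω 0) N i) :
    ∃ (f : S.P i ⟶ N) (hf : S.d i ≫ f = 0), S.cls f hf = x := by
  obtain ⟨g, hg⟩ : ∃ g : S.Ω i ⟶ N, (S.κ i).comp (Abelian.Ext.mk₀ g) (add_zero i) = x := by
    cases i with
    | zero =>
      obtain ⟨g, rfl⟩ := (Abelian.Ext.mk₀_bijective _ _).2 x
      exact ⟨g, by simp [κ_zero]⟩
    | succ i =>
      obtain ⟨y, rfl⟩ := (S.κ_comp_bijective i le_rfl rfl).2 x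
      obtain ⟨g, rfl⟩ := S.extClass_comp_surjective i y
      refine ⟨g, ?_⟩
      rw [κ_succ]
      exact Abelian.Ext.comp_assoc (h₁₂ := rfl) (h₂₃ := add_zero 1) (h := by omega) ..
  have hf : S.d i ≫ S.π i ≫ g = 0 := by
    rw [← Category.assoc, S.d_π, Limits.zero_comp]
  refine ⟨S.π i ≫ g, hf, ?_⟩
  rw [← hg, cls]
  congr 2
  rw [← cancel_epi (S.π i), π_desc]

lemma cls_zero_iff {N : C} (f : S.P 0 ⟶ N) (hf : S.d 0 ≫ f = 0) : S.cls f hf = 0 ↔ f = 0 := by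
  constructor
  · intro h
    rw [cls, κ_zero, Abelian.Ext.mk₀_comp_mk₀, Abelian.Ext.mk₀_eq_zero_iff, Category.id_comp] at h
    rw [← S.π_desc f hf, h, Limits.comp_zero]
  · rintro rfl
    rw [cls, κ_zero, Abelian.Ext.mk₀_comp_mk₀, Abelian.Ext.mk₀_eq_zero_iff, Category.id_comp,
      ← cancel_epi (S.π 0), π_desc, Limits.comp_zero]

/-- By injectivity of composition with `κ i`, the class vanishes exactly when the map induced on the
syzygy is killed by the last connecting map, that is, when it extends along `ι i`. -/
lemma cls_succ_eq_zero_iff {i : ℕ} {N : C} (f : S.P (i + 1) ⟶ N) (hf : S.d (i + 1) ≫ f = 0) :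
    S.cls f hf = 0 ↔ ∃ g : S.P i ⟶ N, f = S.d i ≫ g := by
  have key : S.cls f hf = (S.κ i).comp ((S.shortExact i).extClass.comp
      (Abelian.Ext.mk₀ (S.desc f hf)) (add_zero 1)) rfl := by
    rw [cls, κ_succ]
    exact Abelian.Ext.comp_assoc (h₁₂ := rfl) (h₂₃ := add_zero 1) (h := by omega) ..
  constructor
  · intro h
    rw [key] at h
    have h1 := (S.κ_comp_bijective i (N := N) le_rfl rfl).1
      (a₁ := (S.shortExact i).extClass.comp (Abelian.Ext.mk₀ (S.desc f hf)) (add_zero 1))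
      (a₂ := 0) (by simpa using h)
    obtain ⟨z, hz⟩ := Abelian.Ext.contravariant_sequence_exact₁ (S.shortExact i) (Y := N) _ _ h1
    obtain ⟨g, rfl⟩ := (Abelian.Ext.mk₀_bijective _ _).2 z
    rw [Abelian.Ext.mk₀_comp_mk₀] at hz
    have hg := (Abelian.Ext.mk₀_bijective _ _).1 hz
    refine ⟨g, ?_⟩
    rw [← S.π_desc f hf, ← hg, ← S.π_ι, Category.assoc]
  · rintro ⟨g, rfl⟩
    have : S.desc (S.d i ≫ g) hf = S.ι i ≫ g := by
      rw [← cancel_epi (S.π (i + 1)), π_desc, ← S.π_ι, Category.assoc]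
    rw [key, this, ← Abelian.Ext.mk₀_comp_mk₀,
      ← Abelian.Ext.comp_assoc (h₁₂ := add_zero 1) (h₂₃ := add_zero 0) (h := by omega)]
    have h0 := (S.shortExact i).extClass_comp
    simp only [] at h0
    rw [h0, Abelian.Ext.zero_comp, Abelian.Ext.comp_zero]

/-- The shifted differential, as a morphism from `P (i + 1 + j)`. -/
def dShift (i j : ℕ) : S.P (i + 1 + j) ⟶ S.P (i + j) :=
  eqToHom (congrArg S.P (by omega : i + 1 + j = i + j + 1)) ≫ S.d (i + j)

/-- The Yoneda product of the classes of two cocycles, computed with a lift of the first one to a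
chain map. -/
lemma cls_comp_cls {i j : ℕ} {N : C} (g : S.P j ⟶ S.Ω 0) (hg : S.d j ≫ g = 0)
    (f : S.P i ⟶ N) (hf : S.d i ≫ f = 0) (G : ∀ m, S.P (m + j) ⟶ S.P m)
    (h0 : G 0 ≫ S.π 0 = eqToHom (congrArg S.P (zero_add j)) ≫ g)
    (hG : ∀ m < i, G (m + 1) ≫ S.d m = S.dShift m j ≫ G m)
    (hc : S.d (i + j) ≫ G i ≫ f = 0) :
    (S.cls g hg).comp (S.cls f hf) (add_comm j i) = S.cls (G i ≫ f) hc := by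
  have hz : ∀ m ≤ i, S.d (m + j) ≫ G m ≫ S.π m = 0 := by
    intro m hm
    cases m with
    | zero =>
      rw [h0]
      -- The index is replaced by a variable, so that the transport along `0 + j = j` can be
      -- eliminated. The same device is used below for the other transports.
      have : ∀ a (ha : a = j), S.d a ≫ eqToHom (congrArg S.P ha) ≫ g = 0 := by
        rintro a rfl; simpa using hg
      exact this _ (zero_add j)
    | succ m =>
      have h1 : S.d (m + 1 + j) ≫ S.dShift m j = 0 := by
        have : ∀ a (ha : a = m + j + 1), S.d a ≫ eqToHom (congrArg S.P ha) ≫ S.d (m + j) = 0 := by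
          rintro a rfl; simpa using S.d_d _
        exact this _ (by omega)
      rw [← cancel_mono (S.ι m)]
      simp only [Category.assoc, S.π_ι, Limits.zero_comp, hG m (by omega)]
      rw [← Category.assoc, h1, Limits.zero_comp]
  -- Splicing the class of `g` with the first `m` extensions amounts to splicing `m + j` extensions
  -- and then applying the map of syzygies induced by `G m`.
  have key : ∀ m (hm : m ≤ i), (S.cls g hg).comp (S.κ m) (add_comm j m) =
      (S.κ (m + j)).comp (Abelian.Ext.mk₀ (S.desc (G m ≫ S.π m) (hz m hm))) (add_zero _) := by
    intro m
    induction m with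
    | zero =>
      intro _
      have h1 : S.desc (G 0 ≫ S.π 0) (hz 0 (Nat.zero_le i)) =
          eqToHom (congrArg S.Ω (zero_add j)) ≫ S.desc g hg := by
        rw [← cancel_epi (S.π (0 + j)), π_desc, h0]
        have : ∀ a (ha : a = j), eqToHom (congrArg S.P ha) ≫ g =
            S.π a ≫ eqToHom (congrArg S.Ω ha) ≫ S.desc g hg := by
          rintro a rfl; simp
        exact this _ (zero_add j)
      have h3 : ∀ a (ha : a = j) (e : j + 0 = a),
          (S.cls g hg).comp (Abelian.Ext.mk₀ (𝟙 (S.Ω 0))) e =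
            (S.κ a).comp (Abelian.Ext.mk₀ (eqToHom (congrArg S.Ω ha) ≫ S.desc g hg))
              (add_zero a) := by
        rintro a rfl e
        rw [Abelian.Ext.comp_mk₀_id, eqToHom_refl, Category.id_comp]
        rfl
      rw [h1, κ_zero]
      exact h3 _ (zero_add j) _
    | succ m ih =>
      intro hm
      have ih' := ih (by omega)
      have e : m + 1 + j = m + j + 1 := by omega
      let ω : S.Ω (m + j + 1) ⟶ S.Ω (m + 1) :=
        eqToHom (congrArg S.Ω e.symm) ≫ S.desc (G (m + 1) ≫ S.π (m + 1)) (hz (m + 1) hm)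
      have hω : S.π (m + j + 1) ≫ ω = eqToHom (congrArg S.P e.symm) ≫ G (m + 1) ≫ S.π (m + 1) := by
        have : ∀ a b (h : a = b), S.π a ≫ eqToHom (congrArg S.Ω h) =
            eqToHom (congrArg S.P h) ≫ S.π b := by
          rintro a b rfl; simp
        rw [← Category.assoc, this _ _ e.symm, Category.assoc, π_desc]
      -- The chain map induces a morphism between consecutive short exact sequences; naturality of
      -- the extension class under it is the inductive step.
      let τ : ShortComplex.mk (S.ι (m + j)) (S.π (m + j)) (S.zero _) ⟶
          ShortComplex.mk (S.ι m) (S.π m) (S.zero _) :=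
        { τ₁ := ω
          τ₂ := G m
          τ₃ := S.desc (G m ≫ S.π m) (hz m (by omega))
          comm₁₂ := by
            rw [← cancel_epi (S.π (m + j + 1)), ← Category.assoc, hω]
            simp only [Category.assoc, S.π_ι]
            rw [hG m (by omega), dShift]
            simp only [← Category.assoc, eqToHom_trans, eqToHom_refl, Category.id_comp]
            rfl
          comm₂₃ := by simp }
      have nat := ShortComplex.ShortExact.extClass_naturality (S.shortExact (m + j)) (S.shortExact m) τ
      have h5 : S.desc (G (m + 1) ≫ S.π (m + 1)) (hz (m + 1) hm) =
          eqToHom (congrArg S.Ω e) ≫ ω := by simp [ω]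
      have h6 : (S.cls g hg).comp (S.κ (m + 1)) (by omega : j + (m + 1) = m + j + 1) =
          (S.κ (m + j + 1)).comp (Abelian.Ext.mk₀ ω) (add_zero _) := by
        rw [κ_succ, ← Abelian.Ext.comp_assoc (h₁₂ := add_comm j m) (h₂₃ := rfl)
            (h := (by omega : j + m + 1 = m + j + 1)), ih',
          κ_succ, Abelian.Ext.comp_assoc (h₁₂ := add_zero _) (h₂₃ := zero_add 1) (h := by omega),
          Abelian.Ext.comp_assoc (h₁₂ := rfl) (h₂₃ := add_zero 1) (h := by omega)]
        exact congrArg (fun z => (S.κ (m + j)).comp z rfl) nat.symm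
      have h7 : ∀ a (ha : a = m + j + 1) (ea : j + (m + 1) = a),
          (S.cls g hg).comp (S.κ (m + 1)) ea =
            (S.κ a).comp (Abelian.Ext.mk₀ (eqToHom (congrArg S.Ω ha) ≫ ω)) (add_zero a) := by
        rintro a rfl ea
        rw [eqToHom_refl, Category.id_comp]
        exact h6
      rw [h5]
      exact h7 _ e _
  have h8 : S.desc (G i ≫ f) hc = S.desc (G i ≫ S.π i) (hz i le_rfl) ≫ S.desc f hf := by
    rw [← cancel_epi (S.π (i + j)), π_desc, ← Category.assoc, π_desc, Category.assoc, π_desc]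
  have h9 : S.cls f hf = (S.κ i).comp (Abelian.Ext.mk₀ (S.desc f hf)) (add_zero i) := rfl
  rw [h9, ← Abelian.Ext.comp_assoc (h₁₂ := add_comm j i) (h₂₃ := add_zero i)
    (h := by omega), key i le_rfl, cls, h8,
    Abelian.Ext.comp_assoc (h₁₂ := add_zero _) (h₂₃ := add_zero 0) (h := by omega),
    Abelian.Ext.mk₀_comp_mk₀]

end SyzygyResolution

end Resolution

/-! ### Hochschild classes of cocycles on a bimodule resolution -/

noncomputable section BimoduleResolution

/-- `Λ` as a module over its enveloping algebra. -/
instance diagonalModule (K Λ : Type u) [Field K] [Ring Λ] [Algebra K Λ] :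
    Module (Λ ⊗[K] Λᵐᵒᵖ) Λ :=
  TensorProduct.Algebra.module

variable (K Λ : Type u) [Field K] [Ring Λ] [Algebra K Λ]

/-- A projective resolution of `Λ` by bimodules. -/
structure BimoduleResolution where
  P : ℕ → ModuleCat.{u} (Λ ⊗[K] Λᵐᵒᵖ)
  d : ∀ i, P (i + 1) →ₗ[Λ ⊗[K] Λᵐᵒᵖ] P i
  ε : P 0 →ₗ[Λ ⊗[K] Λᵐᵒᵖ] Λ
  projective : ∀ i, Projective (P i)
  ε_surjective : Function.Surjective ε
  exact_zero : Function.Exact (d 0) ε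
  exact_succ : ∀ i, Function.Exact (d (i + 1)) (d i)

variable {K Λ}

lemma bimodule_smul (p q m : Λ) : (p ⊗ₜ[K] MulOpposite.op q) • m = p * m * q := by
  change p • (MulOpposite.op q • m) = _
  rw [MulOpposite.smul_eq_mul_unop, smul_eq_mul, mul_assoc, MulOpposite.unop_op]

namespace BimoduleResolution

variable (X : BimoduleResolution K Λ)

/-- The syzygies. -/
def Ω : ℕ → ModuleCat.{u} (Λ ⊗[K] Λᵐᵒᵖ)
  | 0 => diagonalBimodule K Λ
  | i + 1 => ModuleCat.of _ (LinearMap.range (X.d i))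

/-- The inclusion of a syzygy. -/
def ι (i : ℕ) : X.Ω (i + 1) ⟶ X.P i := ModuleCat.ofHom (LinearMap.range (X.d i)).subtype

/-- The projection to a syzygy. -/
def π : ∀ i, X.P i ⟶ X.Ω i
  | 0 => ModuleCat.ofHom X.ε
  | i + 1 => ModuleCat.ofHom (X.d i).rangeRestrict

/-- The syzygies of a bimodule resolution. -/
def syz : SyzygyResolution (ModuleCat.{u} (Λ ⊗[K] Λᵐᵒᵖ)) where
  P := X.P
  Ω := X.Ω
  ι := X.ι
  π := X.π
  zero i := by
    cases i with
    | zero =>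
      ext ⟨_, y, rfl⟩
      exact (X.exact_zero _).2 ⟨y, rfl⟩
    | succ i =>
      ext ⟨_, y, rfl⟩
      exact Subtype.ext ((X.exact_succ i _).2 ⟨y, rfl⟩)
  shortExact i := by
    refine ShortComplex.ShortExact.mk' ?_ ?_ ?_
    · rw [ShortComplex.ShortExact.moduleCat_exact_iff_function_exact]
      cases i with
      | zero =>
        intro y
        exact (X.exact_zero y).trans ⟨fun ⟨z, hz⟩ => ⟨⟨_, z, rfl⟩, hz⟩, fun ⟨⟨_, z, rfl⟩, hz⟩ => ⟨z, hz⟩⟩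
      | succ i =>
        intro y
        refine (Subtype.ext_iff.trans (X.exact_succ i y)).trans
          ⟨fun ⟨z, hz⟩ => ⟨⟨_, z, rfl⟩, hz⟩, fun ⟨⟨_, z, rfl⟩, hz⟩ => ⟨z, hz⟩⟩
    · exact (ModuleCat.mono_iff_injective _).2 Subtype.val_injective
    · rw [ModuleCat.epi_iff_surjective]
      cases i with
      | zero => exact X.ε_surjective
      | succ i => exact (X.d i).surjective_rangeRestrict
  projective := X.projective

variable {X} {i j : ℕ}

/-- A cochain as a morphism. -/
def toHom (f : X.P i →ₗ[Λ ⊗[K] Λᵐᵒᵖ] Λ) : X.syz.P i ⟶ diagonalBimodule K Λ :=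
  ModuleCat.ofHom f

lemma toHom_injective {f g : X.P i →ₗ[Λ ⊗[K] Λᵐᵒᵖ] Λ} (h : toHom f = toHom g) : f = g :=
  congrArg ModuleCat.Hom.hom h

lemma syz_d_toHom {f : X.P i →ₗ[Λ ⊗[K] Λᵐᵒᵖ] Λ} (hf : f ∘ₗ X.d i = 0) :
    X.syz.d i ≫ toHom f = 0 :=
  ModuleCat.hom_ext hf

/-- The Hochschild class of a cocycle. -/
def coh (f : X.P i →ₗ[Λ ⊗[K] Λᵐᵒᵖ] Λ) (hf : f ∘ₗ X.d i = 0) : HH K Λ i :=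
  X.syz.cls (toHom f) (syz_d_toHom hf)

lemma exists_coh_eq (x : HH K Λ i) :
    ∃ (f : X.P i →ₗ[Λ ⊗[K] Λᵐᵒᵖ] Λ) (hf : f ∘ₗ X.d i = 0), coh f hf = x := by
  obtain ⟨f, hf, hx⟩ := X.syz.cls_surjective i (N := diagonalBimodule K Λ) x
  exact ⟨f.hom, congrArg ModuleCat.Hom.hom hf, hx⟩

lemma coh_add {f g : X.P i →ₗ[Λ ⊗[K] Λᵐᵒᵖ] Λ} (hf : f ∘ₗ X.d i = 0) (hg : g ∘ₗ X.d i = 0)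
    (h : (f + g) ∘ₗ X.d i = 0) : coh (f + g) h = coh f hf + coh g hg :=
  X.syz.cls_add (toHom f) (toHom g) (syz_d_toHom hf) (syz_d_toHom hg)

lemma coh_zero_eq_zero_iff {f : X.P 0 →ₗ[Λ ⊗[K] Λᵐᵒᵖ] Λ} (hf : f ∘ₗ X.d 0 = 0) :
    coh f hf = 0 ↔ f = 0 :=
  (X.syz.cls_zero_iff (toHom f) (syz_d_toHom hf)).trans
    ⟨fun h => toHom_injective h, fun h => by rw [h]; rfl⟩

lemma coh_succ_eq_zero_iff {f : X.P (i + 1) →ₗ[Λ ⊗[K] Λᵐᵒᵖ] Λ} (hf : f ∘ₗ X.d (i + 1) = 0) :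
    coh f hf = 0 ↔ ∃ g : X.P i →ₗ[Λ ⊗[K] Λᵐᵒᵖ] Λ, f = g ∘ₗ X.d i :=
  (X.syz.cls_succ_eq_zero_iff (toHom f) (syz_d_toHom hf)).trans
    ⟨fun ⟨g, hg⟩ => ⟨g.hom, congrArg ModuleCat.Hom.hom hg⟩,
      fun ⟨g, hg⟩ => ⟨toHom g, congrArg toHom hg⟩⟩

lemma d_comp_d (i : ℕ) : X.d i ∘ₗ X.d (i + 1) = 0 := by
  ext x
  exact (X.exact_succ i _).2 ⟨x, rfl⟩

lemma ε_comp_d : X.ε ∘ₗ X.d 0 = 0 := by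
  ext x
  exact (X.exact_zero _).2 ⟨x, rfl⟩

/-- A bimodule endomorphism of `Λ` as a morphism. -/
def endHom (φ : Λ →ₗ[Λ ⊗[K] Λᵐᵒᵖ] Λ) : diagonalBimodule K Λ ⟶ diagonalBimodule K Λ :=
  ModuleCat.ofHom φ

lemma coh_comp_mk₀ (φ : Λ →ₗ[Λ ⊗[K] Λᵐᵒᵖ] Λ) {f : X.P i →ₗ[Λ ⊗[K] Λᵐᵒᵖ] Λ}
    (hf : f ∘ₗ X.d i = 0) (h : (φ ∘ₗ f) ∘ₗ X.d i = 0) :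
    (coh f hf).comp (Abelian.Ext.mk₀ (endHom φ)) (add_zero i) = coh (φ ∘ₗ f) h :=
  X.syz.cls_comp_mk₀ (toHom f) (syz_d_toHom hf) (endHom φ)

lemma coh_comp_ε (φ : Λ →ₗ[Λ ⊗[K] Λᵐᵒᵖ] Λ) (h : (φ ∘ₗ X.ε) ∘ₗ X.d 0 = 0) :
    coh (φ ∘ₗ X.ε) h = Abelian.Ext.mk₀ (endHom φ) := by
  have e : X.syz.desc (toHom (φ ∘ₗ X.ε)) (syz_d_toHom h) = endHom φ :=
    (cancel_epi (X.syz.π 0)).1 ((X.syz.π_desc (toHom (φ ∘ₗ X.ε)) (syz_d_toHom h)).trans rfl)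
  have e' : coh (φ ∘ₗ X.ε) h = (X.syz.κ 0).comp (Abelian.Ext.mk₀
      (X.syz.desc (toHom (φ ∘ₗ X.ε)) (syz_d_toHom h))) (add_zero 0) := rfl
  rw [e', e]
  exact Abelian.Ext.mk₀_id_comp _

open Classical in
/-- The class of a cochain in the Hochschild cohomology ring; it is `0` unless the cochain is a
cocycle. -/
def hc (i : ℕ) (f : X.P i →ₗ[Λ ⊗[K] Λᵐᵒᵖ] Λ) : HochschildCohomology K Λ :=
  if hf : f ∘ₗ X.d i = 0 then DirectSum.of (HH K Λ) i (coh f hf) else 0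

lemma hc_of_cocycle {f : X.P i →ₗ[Λ ⊗[K] Λᵐᵒᵖ] Λ} (hf : f ∘ₗ X.d i = 0) :
    hc i f = DirectSum.of (HH K Λ) i (coh f hf) := dif_pos hf

variable (X) in
lemma exists_hc_eq (x : HH K Λ i) :
    ∃ f : X.P i →ₗ[Λ ⊗[K] Λᵐᵒᵖ] Λ, f ∘ₗ X.d i = 0 ∧ hc i f = DirectSum.of (HH K Λ) i x := by
  obtain ⟨f, hf, rfl⟩ := X.exists_coh_eq x
  exact ⟨f, hf, hc_of_cocycle hf⟩

lemma hc_add {f g : X.P i →ₗ[Λ ⊗[K] Λᵐᵒᵖ] Λ} (hf : f ∘ₗ X.d i = 0) (hg : g ∘ₗ X.d i = 0) :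
    hc i (f + g) = hc i f + hc i g := by
  have h : (f + g) ∘ₗ X.d i = 0 := by rw [LinearMap.add_comp, hf, hg, add_zero]
  rw [hc_of_cocycle hf, hc_of_cocycle hg, hc_of_cocycle h, coh_add hf hg h, map_add]

lemma hc_zero_eq_zero_iff {f : X.P 0 →ₗ[Λ ⊗[K] Λᵐᵒᵖ] Λ} (hf : f ∘ₗ X.d 0 = 0) :
    hc 0 f = 0 ↔ f = 0 := by
  rw [hc_of_cocycle hf, ← coh_zero_eq_zero_iff hf]
  exact map_eq_zero_iff _ (DirectSum.of_injective 0)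

lemma hc_succ_eq_zero_iff {f : X.P (i + 1) →ₗ[Λ ⊗[K] Λᵐᵒᵖ] Λ} (hf : f ∘ₗ X.d (i + 1) = 0) :
    hc (i + 1) f = 0 ↔ ∃ g : X.P i →ₗ[Λ ⊗[K] Λᵐᵒᵖ] Λ, f = g ∘ₗ X.d i := by
  rw [hc_of_cocycle hf, ← coh_succ_eq_zero_iff hf]
  exact map_eq_zero_iff _ (DirectSum.of_injective (i + 1))

/-- The product `ε * δ` means `δ` followed by `ε`, whereas `Ext.comp` lists its factors in order of
application; hence the exchange. -/
lemma mul_of_eq {a b c : ℕ} (δ : HH K Λ a) (ε : HH K Λ b) (h : a + b = c) :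
    DirectSum.of (HH K Λ) b ε * DirectSum.of (HH K Λ) a δ =
      DirectSum.of (HH K Λ) c (Abelian.Ext.comp δ ε h) := by
  obtain rfl : c = b + a := by omega
  exact DirectSum.of_mul_of _ _

/-- The class of a bimodule endomorphism of `Λ` acts on cocycles by composition. -/
lemma hc_ε_mul (φ : Λ →ₗ[Λ ⊗[K] Λᵐᵒᵖ] Λ) {f : X.P i →ₗ[Λ ⊗[K] Λᵐᵒᵖ] Λ}
    (hf : f ∘ₗ X.d i = 0) : hc 0 (φ ∘ₗ X.ε) * hc i f = hc i (φ ∘ₗ f) := by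
  have h : (φ ∘ₗ f) ∘ₗ X.d i = 0 := by rw [LinearMap.comp_assoc, hf, LinearMap.comp_zero]
  have h0 : (φ ∘ₗ X.ε) ∘ₗ X.d 0 = 0 := by
    rw [LinearMap.comp_assoc, ε_comp_d, LinearMap.comp_zero]
  rw [hc_of_cocycle hf, hc_of_cocycle h, hc_of_cocycle h0, mul_of_eq _ _ (add_zero i),
    coh_comp_ε, coh_comp_mk₀ φ hf h]

/-- Multiplication by a scalar, as a bimodule endomorphism. -/
def scalar (r : K) : Λ →ₗ[Λ ⊗[K] Λᵐᵒᵖ] Λ :=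
  (r • 𝟙 (diagonalBimodule K Λ) : diagonalBimodule K Λ ⟶ diagonalBimodule K Λ).hom

lemma scalar_apply (r : K) (m : Λ) : scalar r m = r • m := by
  change (algebraMap K (Λ ⊗[K] Λᵐᵒᵖ) r) • m = r • m
  rw [Algebra.TensorProduct.algebraMap_apply, ← MulOpposite.op_one, bimodule_smul, mul_one,
    Algebra.smul_def]

lemma coh_smul (r : K) {f : X.P i →ₗ[Λ ⊗[K] Λᵐᵒᵖ] Λ} (hf : f ∘ₗ X.d i = 0)
    (h : (scalar r ∘ₗ f) ∘ₗ X.d i = 0) : coh (scalar r ∘ₗ f) h = r • coh f hf := by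
  rw [← coh_comp_mk₀ (scalar r) hf h]
  -- Definitional, because `scalar` is defined through the linear structure of the category of
  -- modules, which also governs `Ext`.
  have e : endHom (scalar r) = r • 𝟙 (diagonalBimodule K Λ) := rfl
  rw [e, Abelian.Ext.mk₀_smul, Abelian.Ext.comp_smul, Abelian.Ext.comp_mk₀_id]

lemma hc_smul (r : K) {f : X.P i →ₗ[Λ ⊗[K] Λᵐᵒᵖ] Λ} (hf : f ∘ₗ X.d i = 0) :
    hc i (scalar r ∘ₗ f) = r • hc i f := by
  have h : (scalar r ∘ₗ f) ∘ₗ X.d i = 0 := by rw [LinearMap.comp_assoc, hf, LinearMap.comp_zero]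
  rw [hc_of_cocycle hf, hc_of_cocycle h, coh_smul r hf h]
  exact (DirectSum.lof K ℕ (HH K Λ) i).map_smul r _

lemma hc_one : hc 0 X.ε = 1 := by
  have h := ε_comp_d (X := X)
  have h1 : coh X.ε h = HH.one K Λ := coh_comp_ε (X := X) LinearMap.id h
  rw [hc_of_cocycle h, h1]
  rfl

/-- The identification of equal terms of the resolution. -/
def cast {a b : ℕ} (h : a = b) : X.P a →ₗ[Λ ⊗[K] Λᵐᵒᵖ] X.P b :=
  (eqToHom (congrArg X.P h)).hom

/-- The product of the classes of two cocycles, by means of a lift to a chain map. -/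
lemma hc_mul_hc {g : X.P j →ₗ[Λ ⊗[K] Λᵐᵒᵖ] Λ} (hg : g ∘ₗ X.d j = 0)
    {f : X.P i →ₗ[Λ ⊗[K] Λᵐᵒᵖ] Λ} (hf : f ∘ₗ X.d i = 0)
    (G : ∀ m, X.P (m + j) →ₗ[Λ ⊗[K] Λᵐᵒᵖ] X.P m)
    (h0 : X.ε ∘ₗ G 0 = g ∘ₗ X.cast (zero_add j))
    (hG : ∀ m < i, X.d m ∘ₗ G (m + 1) =
      G m ∘ₗ X.d (m + j) ∘ₗ X.cast (by omega : m + 1 + j = m + j + 1))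
    (hc' : (f ∘ₗ G i) ∘ₗ X.d (i + j) = 0) :
    hc i f * hc j g = hc (i + j) (f ∘ₗ G i) := by
  rw [hc_of_cocycle hf, hc_of_cocycle hg, hc_of_cocycle hc', mul_of_eq _ _ (add_comm j i)]
  congr 1
  exact X.syz.cls_comp_cls (toHom g) (syz_d_toHom hg)
    (toHom f) (syz_d_toHom hf) (fun m => ModuleCat.ofHom (G m)) (ModuleCat.hom_ext h0)
    (fun m hm => ModuleCat.hom_ext (hG m hm)) (syz_d_toHom hc')

lemma exists_lift {N : Type u} [AddCommGroup N] [Module (Λ ⊗[K] Λᵐᵒᵖ) N] {N' : Type u}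
    [AddCommGroup N'] [Module (Λ ⊗[K] Λᵐᵒᵖ) N'] {N'' : Type u}
    [AddCommGroup N''] [Module (Λ ⊗[K] Λᵐᵒᵖ) N''] (a : N →ₗ[Λ ⊗[K] Λᵐᵒᵖ] N')
    (b : N' →ₗ[Λ ⊗[K] Λᵐᵒᵖ] N'')
    (hab : Function.Exact a b) {i : ℕ} (f : X.P i →ₗ[Λ ⊗[K] Λᵐᵒᵖ] N') (hf : b ∘ₗ f = 0) :
    ∃ g : X.P i →ₗ[Λ ⊗[K] Λᵐᵒᵖ] N, a ∘ₗ g = f := by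
  have := X.projective i
  have : Module.Projective (Λ ⊗[K] Λᵐᵒᵖ) (X.P i) := (IsProjective.iff_projective _).2 this
  let f' : X.P i →ₗ[Λ ⊗[K] Λᵐᵒᵖ] LinearMap.range a :=
    f.codRestrict _ fun x => (hab _).1 (LinearMap.congr_fun hf x)
  obtain ⟨g, hg⟩ := Module.projective_lifting_property a.rangeRestrict f'
    a.surjective_rangeRestrict
  exact ⟨g, LinearMap.ext fun x => congrArg Subtype.val (LinearMap.congr_fun hg x)⟩

end BimoduleResolution

end BimoduleResolution

/-! ### The path basis of the preprojective algebra of type `𝕃ₙ` -/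

/-- There is a nonzero path of length `d` from `i` to `j` in the preprojective algebra of `𝕃ₙ`.
The paths with `d + i + j` odd are those which pass an odd number of times through the loop. -/
def ValidPath (n i j d : ℕ) : Prop :=
  ((d + i + j) % 2 = 0 ∧ i ≤ j + d ∧ j ≤ i + d ∧ d + i + j + 2 ≤ 2 * n) ∨
    ((d + i + j) % 2 = 1 ∧ i + j + 1 ≤ d ∧ d + i + 1 ≤ 2 * n + j ∧ d + j + 1 ≤ 2 * n + i)

instance (n i j d : ℕ) : Decidable (ValidPath n i j d) := by
  unfold ValidPath; infer_instance

/-- A basis of an algebra consisting of elements `b i j d`, one for each valid path. -/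
structure PathBasis (K Λ : Type u) [Field K] [Ring Λ] [Algebra K Λ] (n : ℕ) where
  b : ℕ → ℕ → ℕ → Λ
  b_eq_zero : ∀ {i j d}, ¬ ValidPath n i j d → b i j d = 0
  b_mul_b : ∀ {i j k d e}, ValidPath n i j d → ValidPath n j k e →
    b i j d * b j k e = b i k (d + e)
  b_mul_b_of_ne : ∀ {i j j' k d e}, j ≠ j' → b i j d * b j' k e = 0
  sum_b : ∑ i ∈ Finset.range n, b i i 0 = 1
  linearIndependent : LinearIndependent K
    fun t : {t : ℕ × ℕ × ℕ // ValidPath n t.1 t.2.1 t.2.2} => b t.1.1 t.1.2.1 t.1.2.2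
  span_eq_top : ⊤ ≤ Submodule.span K (Set.range
    fun t : {t : ℕ × ℕ × ℕ // ValidPath n t.1 t.2.1 t.2.2} => b t.1.1 t.1.2.1 t.1.2.2)

/-- The data of vertices and arrows from which a path basis is constructed. -/
structure ArrowData (A : Type u) [Ring A] (n : ℕ) where
  e : ℕ → A
  R : ℕ → A
  L : ℕ → A
  e_eq_zero : ∀ {i}, n ≤ i → e i = 0
  e_mul_e_self : ∀ i, e i * e i = e i
  e_mul_e : ∀ {i j}, i ≠ j → e i * e j = 0
  sum_e : ∑ i ∈ Finset.range n, e i = 1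
  e_mul_R : ∀ i, e i * R i = R i
  e_mul_L : ∀ i, e i * L i = L i
  -- The rescaled preprojective relation: right and back equals left and back, the loop `L 0` being
  -- its own opposite. At `i = n - 1` the left side is zero, because `L n = e n * L n` and `e n =
  -- 0`.
  R_mul_L : ∀ i, i < n → R i * L (i + 1) = L i * if i = 0 then L 0 else R (i - 1)

namespace ArrowData

variable {A : Type u} [Ring A] {n : ℕ} (D : ArrowData A n)

/-- The path of length `d` from `i` to `j` in normal form. -/
def path (i j : ℕ) : ℕ → A
  | 0 => if i = j then D.e i else 0
  | d + 1 => if ValidPath n i j (d + 1) then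
      -- The normal form steps to the right as long as the remaining path is still valid.
      if ValidPath n (i + 1) j d then D.R i * path (i + 1) j d else D.L i * path (i - 1) j d
    else 0

lemma path_zero (i : ℕ) : D.path i i 0 = D.e i := by rw [path, if_pos rfl]

lemma path_succ (i j d : ℕ) : D.path i j (d + 1) = if ValidPath n i j (d + 1) then
    if ValidPath n (i + 1) j d then D.R i * D.path (i + 1) j d else D.L i * D.path (i - 1) j d
    else 0 := rfl

lemma path_eq_zero {i j d : ℕ} (h : ¬ ValidPath n i j d) : D.path i j d = 0 := by
  cases d with
  | zero =>
    rw [path]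
    split_ifs with hij
    · subst hij
      refine D.e_eq_zero ?_
      unfold ValidPath at h
      omega
    · rfl
  | succ d => rw [path, if_neg h]

lemma e_mul_path (i j d : ℕ) : D.e i * D.path i j d = D.path i j d := by
  cases d with
  | zero =>
    rw [path]
    split_ifs
    · exact D.e_mul_e_self i
    · exact mul_zero _
  | succ d =>
    rw [path]
    split_ifs
    · rw [← mul_assoc, D.e_mul_R]
    · rw [← mul_assoc, D.e_mul_L]
    · exact mul_zero _

/-- Multiplying a path by an arrow gives a path. -/
lemma arrow_mul_path (d : ℕ) : ∀ i j,
    (ValidPath n (i + 1) j d → D.R i * D.path (i + 1) j d = D.path i j (d + 1)) ∧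
    (ValidPath n (i - 1) j d → D.L i * D.path (i - 1) j d = D.path i j (d + 1)) := by
  induction d with
  | zero =>
    intro i j
    constructor
    · intro h
      have h2 : ValidPath n i j (0 + 1) := by unfold ValidPath at *; omega
      rw [D.path_succ]
      simp only [h2, h, if_true]
    · intro h
      by_cases hA : ValidPath n (i + 1) j 0
      · exfalso; unfold ValidPath at *; omega
      · by_cases h2 : ValidPath n i j (0 + 1)
        · rw [D.path_succ]
          simp only [h2, hA, if_true, if_false]
        · have : n ≤ i := by unfold ValidPath at *; omega
          rw [D.path_eq_zero h2, ← D.e_mul_L, D.e_eq_zero this, zero_mul, zero_mul]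
  | succ d ih =>
    -- Before a path from `i`, the two detours of length two agree by `R_mul_L`. This exchanges an
    -- initial left arrow for an initial right arrow.
    have key : ∀ i j, ValidPath n i j d → D.R i * D.path (i + 1) j (d + 1) =
        D.L i * D.path (i - 1) j (d + 1) := by
      intro i j hS
      have hi : i < n := by unfold ValidPath at *; omega
      have h1 := (ih (i + 1) j).2 hS
      rw [Nat.add_sub_cancel] at h1
      rw [← h1, ← mul_assoc, D.R_mul_L i hi, mul_assoc]
      congr 1
      by_cases h0 : i = 0
      · subst h0
        rw [if_pos rfl]
        exact (ih 0 j).2 hS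
      · obtain ⟨i, rfl⟩ := Nat.exists_eq_succ_of_ne_zero h0
        rw [if_neg h0]
        exact (ih i j).1 hS
    intro i j
    constructor
    · intro hA
      by_cases hT : ValidPath n i j (d + 1 + 1)
      · rw [D.path_succ i j (d + 1), if_pos hT, if_pos hA]
      · have hS : ValidPath n i j d := by unfold ValidPath at *; omega
        have hB : ¬ ValidPath n (i - 1) j (d + 1) := by unfold ValidPath at *; omega
        rw [key i j hS, D.path_eq_zero hB, D.path_eq_zero hT, mul_zero]
    · intro hB
      by_cases hi : n ≤ i
      · have hT : ¬ ValidPath n i j (d + 1 + 1) := by unfold ValidPath at *; omega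
        rw [D.path_eq_zero hT, ← D.e_mul_L, D.e_eq_zero hi, zero_mul, zero_mul]
      -- If the path can also start to the right, then the word starting to the left is not in
      -- normal form and `key` rewrites it.
      by_cases hA : ValidPath n (i + 1) j (d + 1)
      · have hS : ValidPath n i j d := by unfold ValidPath at *; omega
        have hT : ValidPath n i j (d + 1 + 1) := by unfold ValidPath at *; omega
        rw [← key i j hS, D.path_succ i j (d + 1), if_pos hT, if_pos hA]
      · by_cases hT : ValidPath n i j (d + 1 + 1)
        · rw [D.path_succ i j (d + 1), if_pos hT, if_neg hA]
        · have hS : ValidPath n i j d := by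
            clear ih key
            unfold ValidPath at *
            rcases hB with hB | hB <;> omega
          rw [← key i j hS, D.path_eq_zero hA, D.path_eq_zero hT, mul_zero]

/-- Induction on the left factor, whose first arrow is absorbed by `arrow_mul_path`. If the
remaining product leaves the valid range, then so does the whole product, and both sides vanish. -/
lemma path_mul_path {i j k d e : ℕ} (h : ValidPath n i j d) (h' : ValidPath n j k e) :
    D.path i j d * D.path j k e = D.path i k (d + e) := by
  induction d generalizing i with
  | zero =>
    have : i = j := by unfold ValidPath at *; omega
    subst this
    rw [path, if_pos rfl, e_mul_path, zero_add]
  | succ d ih =>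
    rw [D.path_succ]
    simp only [h, if_true]
    rw [show d + 1 + e = d + e + 1 by omega]
    split_ifs with hA
    · rw [mul_assoc, ih hA]
      by_cases h2 : ValidPath n (i + 1) k (d + e)
      · exact (D.arrow_mul_path _ i k).1 h2
      · have : ¬ ValidPath n i k (d + e + 1) := by
          clear ih h
          unfold ValidPath at *
          rcases hA with hA | hA <;> rcases h' with h' | h' <;> omega
        rw [D.path_eq_zero h2, D.path_eq_zero this, mul_zero]
    · have hB : ValidPath n (i - 1) j d := by
        clear ih h'
        unfold ValidPath at *
        rcases h with h | h <;> omega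
      rw [mul_assoc, ih hB]
      by_cases h2 : ValidPath n (i - 1) k (d + e)
      · exact (D.arrow_mul_path _ i k).2 h2
      · have : ¬ ValidPath n i k (d + e + 1) := by
          clear ih hA
          unfold ValidPath at *
          rcases h with h | h <;> rcases hB with hB | hB <;> rcases h' with h' | h' <;> omega
        rw [D.path_eq_zero h2, D.path_eq_zero this, mul_zero]

lemma path_mul_e (i j d : ℕ) : D.path i j d * D.e j = D.path i j d := by
  by_cases h : ValidPath n i j d
  · have h0 : ValidPath n j j 0 := by unfold ValidPath at *; omega
    have := D.path_mul_path h h0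
    rwa [D.path_zero] at this
  · rw [D.path_eq_zero h, zero_mul]

lemma path_mul_path_of_ne {i j j' k d e : ℕ} (h : j ≠ j') :
    D.path i j d * D.path j' k e = 0 := by
  rw [← D.path_mul_e, ← D.e_mul_path j', mul_assoc, ← mul_assoc (D.e j), D.e_mul_e h, zero_mul,
    mul_zero]

end ArrowData

/-! ### The preprojective algebra of `𝕃ₙ` and its action on paths. -/

noncomputable section Preprojective

/-- With truncated subtraction the loop is the arrow from `0` to `0 - 1 = 0`. This lets the loop be
treated as the left arrow at `0` throughout. -/
lemma graphL_adj_iff {n : ℕ} (i j : Fin n) :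
    (graphL n).Adj i j ↔ j.val = i.val + 1 ∨ j.val = i.val - 1 := by
  change ((i.val = 0 ∧ j.val = 0) ∨ i.val + 1 = j.val ∨ j.val + 1 = i.val) ↔ _
  omega

/-- The arrow from `i` to `j`, for natural numbers `i` and `j`. -/
def arrowTerm {M : Type*} [Zero M] {n : ℕ} (f : (graphL n).Arrow → M) (i j : ℕ) : M :=
  if h : (i < n ∧ j < n) ∧ (j = i + 1 ∨ j = i - 1) then
    f ⟨(⟨i, h.1.1⟩, ⟨j, h.1.2⟩), (graphL_adj_iff _ _).2 h.2⟩ else 0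

lemma arrowTerm_eq {M : Type*} [Zero M] {n : ℕ} (f : (graphL n).Arrow → M) (a : (graphL n).Arrow) :
    arrowTerm f a.src a.tgt = f a := by
  have h : (a.src.val < n ∧ a.tgt.val < n) ∧ (a.tgt.val = a.src + 1 ∨ a.tgt.val = a.src - 1) :=
    ⟨⟨a.src.2, a.tgt.2⟩, (graphL_adj_iff _ _).1 a.2⟩
  rw [arrowTerm, dif_pos h]
  rfl

lemma arrowTerm_cases {n : ℕ} (a : (graphL n).Arrow) :
    a.tgt.val = a.src.val + 1 ∨ a.tgt.val = a.src.val - 1 := (graphL_adj_iff _ _).1 a.2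

lemma sum_arrow {M : Type*} [AddCommMonoid M] {n : ℕ} (f : (graphL n).Arrow → M) (i : Fin n) :
    ∑ a : (graphL n).Arrow with a.src = i, f a =
      arrowTerm f i (i + 1) + arrowTerm f i (i - 1) := by
  have h1 : ∑ a : (graphL n).Arrow with a.src = i, f a = ∑ j ∈ Finset.range n, arrowTerm f i j := by
    refine Finset.sum_of_injOn (fun a => a.tgt.val) ?_ ?_ ?_ ?_
    · rintro ⟨⟨a, a'⟩, ha⟩ h ⟨⟨b, b'⟩, hb⟩ h' hab
      have h1 : a = i := (Finset.mem_filter.1 (Finset.mem_coe.1 h)).2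
      have h2 : b = i := (Finset.mem_filter.1 (Finset.mem_coe.1 h')).2
      have h3 : a' = b' := Fin.ext hab
      subst h1 h2 h3
      rfl
    · intro a _
      simp
    · intro j hj hne
      rw [arrowTerm, dif_neg]
      intro h
      refine hne ⟨⟨(⟨i, h.1.1⟩, ⟨j, h.1.2⟩), (graphL_adj_iff _ _).2 h.2⟩, ?_, rfl⟩
      exact Finset.mem_coe.2 (Finset.mem_filter.2 ⟨Finset.mem_univ _, rfl⟩)
    · intro a ha
      have : a.src = i := by simpa using ha
      rw [← this, arrowTerm_eq]
  rw [h1]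
  refine Finset.sum_eq_add (i.val + 1) (i.val - 1) (by omega) ?_ ?_ ?_
  · intro j _ hj
    rw [arrowTerm, dif_neg]
    omega
  · intro hj
    rw [arrowTerm, dif_neg]
    simp only [Finset.mem_range] at hj
    omega
  · intro hj
    rw [arrowTerm, dif_neg]
    simp only [Finset.mem_range] at hj
    omega

variable (K : Type u) [Field K] (n : ℕ)

namespace PreprojectiveL

/-- The preprojective algebra of type `𝕃ₙ`. -/
abbrev Alg : Type u := (graphL n).PreprojectiveAlgebra K

/-- The class of a generator. -/
def gen (g : (graphL n).PathGen) : Alg K n :=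
  RingQuot.mkAlgHom K (LoopGraph.PreprojectiveRel K (graphL n)) (FreeAlgebra.ι K g)

variable {n}

lemma rel {x y} (h : LoopGraph.PreprojectiveRel K (graphL n) x y) :
    RingQuot.mkAlgHom K (LoopGraph.PreprojectiveRel K (graphL n)) x =
      RingQuot.mkAlgHom K (LoopGraph.PreprojectiveRel K (graphL n)) y :=
  RingQuot.mkAlgHom_rel K h

variable (n)

/-- The arrow from `i` to `j` as an element of the preprojective algebra. -/
def arr (i j : ℕ) : Alg K n := arrowTerm (fun a => gen K n (.arrow a)) i j

/-- The idempotent of a vertex. -/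
def idem (i : ℕ) : Alg K n := if h : i < n then gen K n (.e ⟨i, h⟩) else 0

lemma arr_eq {i j : ℕ} (hi : i < n) (hj : j < n) (h : j = i + 1 ∨ j = i - 1) :
    arr K n i j = gen K n (.arrow ⟨(⟨i, hi⟩, ⟨j, hj⟩), (graphL_adj_iff _ _).2 h⟩) :=
  dif_pos ⟨⟨hi, hj⟩, h⟩

lemma arr_mul_arr (i : ℕ) (hi : i < n) :
    arr K n i (i + 1) * arr K n (i + 1) i + arr K n i (i - 1) * arr K n (i - 1) i = 0 := by
  have h := rel K (LoopGraph.PreprojectiveRel.preprojective (K := K) (Δ := graphL n) ⟨i, hi⟩)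
  rw [map_sum, map_zero, sum_arrow] at h
  rw [← h]
  congr 1
  · by_cases h : i + 1 < n
    · rw [arr_eq K n hi h (Or.inl rfl), arr_eq K n h hi (Or.inr (Nat.add_sub_cancel i 1).symm),
        arrowTerm, dif_pos ⟨⟨hi, h⟩, Or.inl rfl⟩, map_mul]
      rfl
    · rw [arr, arrowTerm, dif_neg (by omega), zero_mul, arrowTerm, dif_neg fun h' => h h'.1.2]
  · have h : i - 1 < n := by omega
    rw [arr_eq K n hi h (Or.inr rfl), arr_eq K n h hi (by omega),
      arrowTerm, dif_pos ⟨⟨hi, h⟩, Or.inr rfl⟩, map_mul]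
    rfl

lemma idem_mul_idem (i : ℕ) : idem K n i * idem K n i = idem K n i := by
  unfold idem
  split_ifs with h
  · have := rel K (LoopGraph.PreprojectiveRel.e_mul_self (K := K) (Δ := graphL n) ⟨i, h⟩)
    rwa [map_mul] at this
  · exact mul_zero _

lemma idem_mul_idem_of_ne {i j : ℕ} (hij : i ≠ j) : idem K n i * idem K n j = 0 := by
  unfold idem
  split_ifs with h h'
  · have := rel K (LoopGraph.PreprojectiveRel.e_mul_e (K := K) (Δ := graphL n) ⟨i, h⟩ ⟨j, h'⟩
      (by simpa using hij))
    rwa [map_mul, map_zero] at this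
  · exact mul_zero _
  · exact zero_mul _
  · exact zero_mul _

lemma sum_idem : ∑ i ∈ Finset.range n, idem K n i = 1 := by
  have := rel K (LoopGraph.PreprojectiveRel.sum_e (K := K) (Δ := graphL n))
  rw [map_sum, map_one] at this
  rw [← this, Finset.sum_range]
  refine Finset.sum_congr rfl fun i _ => ?_
  rw [idem, dif_pos i.2]
  rfl

lemma idem_mul_arr (i j : ℕ) : idem K n i * arr K n i j = arr K n i j := by
  unfold arr arrowTerm
  split_ifs with h
  · rw [idem, dif_pos h.1.1]
    have := rel K (LoopGraph.PreprojectiveRel.e_mul_arrow (K := K) (Δ := graphL n)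
      ⟨(⟨i, h.1.1⟩, ⟨j, h.1.2⟩), (graphL_adj_iff _ _).2 h.2⟩)
    rwa [map_mul] at this
  · exact mul_zero _

lemma arr_mul_idem (i j : ℕ) : arr K n i j * idem K n j = arr K n i j := by
  unfold arr arrowTerm
  split_ifs with h
  · rw [idem, dif_pos h.1.2]
    have := rel K (LoopGraph.PreprojectiveRel.arrow_mul_e (K := K) (Δ := graphL n)
      ⟨(⟨i, h.1.1⟩, ⟨j, h.1.2⟩), (graphL_adj_iff _ _).2 h.2⟩)
    rwa [map_mul] at this
  · exact zero_mul _

/-- The rescaled arrows, for which the preprojective relations become commutativity relations. -/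
def arrowData : ArrowData (Alg K n) n where
  e := idem K n
  R i := arr K n i (i + 1)
  -- The alternating sign absorbs the minus sign in `a ā = -b b̄`: the left side of `R_mul_L`
  -- acquires `(-1) ^ (i + 1)` and the right side `(-1) ^ i`.
  L i := (-1) ^ i * arr K n i (i - 1)
  e_eq_zero h := dif_neg (by omega)
  e_mul_e_self := idem_mul_idem K n
  e_mul_e := idem_mul_idem_of_ne K n
  sum_e := sum_idem K n
  e_mul_R i := idem_mul_arr K n _ _
  e_mul_L i := by
    rw [← mul_assoc, ← ((Commute.one_left (idem K n i)).neg_left.pow_left i).eq, mul_assoc,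
      idem_mul_arr]
  R_mul_L i hi := by
    have h := eq_neg_of_add_eq_zero_left (arr_mul_arr K n i hi)
    have h1 : (if i = 0 then (-1) ^ 0 * arr K n 0 (0 - 1) else arr K n (i - 1) (i - 1 + 1)) =
        arr K n (i - 1) i := by
      split_ifs with h0
      · subst h0; simp
      · rw [Nat.sub_add_cancel (by omega)]
    rw [h1, Nat.add_sub_cancel, ← mul_assoc,
      ← ((Commute.one_left (arr K n i (i + 1))).neg_left.pow_left (i + 1)).eq, mul_assoc, h,
      mul_assoc, pow_succ, mul_neg, mul_one, neg_mul_neg]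

/-- The space on which the preprojective algebra acts, with a basis of valid paths. -/
abbrev PathSpace : Type u := {t : ℕ × ℕ × ℕ // ValidPath n t.1 t.2.1 t.2.2} →₀ K

/-- The basis vectors of the path space, and `0` for invalid paths. -/
def vec (i j d : ℕ) : PathSpace K n :=
  if h : ValidPath n i j d then Finsupp.single ⟨(i, j, d), h⟩ 1 else 0

variable {K n} in
lemma hom_ext' {f g : PathSpace K n →ₗ[K] PathSpace K n}
    (h : ∀ i j d, ValidPath n i j d → f (vec K n i j d) = g (vec K n i j d)) : f = g := by
  refine Finsupp.lhom_ext' fun ⟨⟨i, j, d⟩, ht⟩ => LinearMap.ext_ring ?_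
  have := h i j d ht
  rwa [vec, dif_pos ht] at this

/-- The action of a vertex. -/
def opE (k : ℕ) : Module.End K (PathSpace K n) :=
  Finsupp.linearCombination K fun t => if t.1.1 = k then vec K n t.1.1 t.1.2.1 t.1.2.2 else 0

/-- The action of an arrow from `i` to `k`. -/
def opA (i k : ℕ) : Module.End K (PathSpace K n) :=
  Finsupp.linearCombination K fun t => if t.1.1 = k then vec K n i t.1.2.1 (t.1.2.2 + 1) else 0

lemma vec_eq_zero {i j d : ℕ} (h : ¬ ValidPath n i j d) : vec K n i j d = 0 := dif_neg h

lemma opE_vec (k i j d : ℕ) : opE K n k (vec K n i j d) = if i = k then vec K n i j d else 0 := by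
  by_cases h : ValidPath n i j d
  · conv_lhs => rw [vec, dif_pos h]
    rw [opE, Finsupp.linearCombination_single, one_smul]
  · rw [vec_eq_zero K n h, map_zero, ite_self]

lemma opA_vec {i k i' j d : ℕ} (h : ValidPath n i' j d) :
    opA K n i k (vec K n i' j d) = if i' = k then vec K n i j (d + 1) else 0 := by
  rw [vec, dif_pos h, opA, Finsupp.linearCombination_single, one_smul]

/-- The sign of an arrow. -/
def sgn (i k : ℕ) : K := if k = i + 1 then 1 else (-1) ^ i

/-- The action of the generators. -/
def opGen : (graphL n).PathGen → Module.End K (PathSpace K n)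
  | .e i => opE K n i
  | .arrow a => sgn K a.src a.tgt • opA K n a.src a.tgt

/-- The action of the preprojective algebra on the path space. -/
def rep : (Alg K n) →ₐ[K] Module.End K (PathSpace K n) :=
  RingQuot.liftAlgHom K ⟨FreeAlgebra.lift K (opGen K n), by
    intro x y h
    cases h with
    | e_mul_self i =>
      simp only [map_mul, FreeAlgebra.lift_ι_apply, opGen]
      refine hom_ext' fun i' j d h => ?_
      simp only [Module.End.mul_apply, opE_vec]
      split_ifs <;> simp_all [opE_vec]
    | e_mul_e i j hij =>
      simp only [map_mul, FreeAlgebra.lift_ι_apply, opGen, map_zero]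
      refine hom_ext' fun i' j' d h => ?_
      have : i.val ≠ j.val := fun h => hij (Fin.ext h)
      simp only [Module.End.mul_apply, opE_vec]
      split_ifs with h1
      · rw [opE_vec, if_neg (by omega), LinearMap.zero_apply]
      · simp
    | sum_e =>
      simp only [map_sum, FreeAlgebra.lift_ι_apply, opGen, map_one]
      refine hom_ext' fun i' j' d h => ?_
      have hi : i' < n := by unfold ValidPath at h; omega
      rw [LinearMap.sum_apply, Finset.sum_eq_single ⟨i', hi⟩]
      · simp [opE_vec]
      · intro k _ hk
        rw [opE_vec, if_neg]
        intro h
        exact hk (Fin.ext h.symm)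
      · simp
    | e_mul_arrow a =>
      simp only [map_mul, FreeAlgebra.lift_ι_apply, opGen]
      refine hom_ext' fun i' j d h => ?_
      simp only [Module.End.mul_apply, LinearMap.smul_apply, opA_vec K n h, map_smul]
      split_ifs <;> simp [opE_vec]
    | arrow_mul_e a =>
      simp only [map_mul, FreeAlgebra.lift_ι_apply, opGen]
      refine hom_ext' fun i' j d h => ?_
      simp only [Module.End.mul_apply, LinearMap.smul_apply, opA_vec K n h, opE_vec]
      split_ifs with h1
      · subst h1; simp [opA_vec K n h]
      · simp
    | preprojective i =>
      simp only [map_sum, map_mul, FreeAlgebra.lift_ι_apply, opGen, map_zero]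
      rw [sum_arrow]
      refine hom_ext' fun i' j d h => ?_
      have key : ∀ k : ℕ, (k = i.val + 1 ∨ k = i.val - 1) →
          (arrowTerm (n := n) (fun a => sgn K a.src a.tgt • opA K n a.src a.tgt *
            sgn K a.bar.src a.bar.tgt • opA K n a.bar.src a.bar.tgt) i k) (vec K n i' j d) =
          if i' = i ∧ ValidPath n k j (d + 1) then
            (sgn K i k * sgn K k i) • vec K n i j (d + 2) else 0 := by
        intro k hk
        unfold arrowTerm
        split_ifs with h1 h2 h2
        · obtain ⟨rfl, h2⟩ := h2
          simp only [LoopGraph.Arrow.src, LoopGraph.Arrow.tgt, LoopGraph.Arrow.bar,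
            Module.End.mul_apply, LinearMap.smul_apply, opA_vec K n h, map_smul, if_true,
            opA_vec K n h2, smul_smul]
          rw [mul_comm]
        · simp only [LoopGraph.Arrow.src, LoopGraph.Arrow.tgt, LoopGraph.Arrow.bar,
            Module.End.mul_apply, LinearMap.smul_apply, opA_vec K n h, map_smul]
          split_ifs with h3
          · rw [vec_eq_zero K n (fun h4 => h2 ⟨h3, h4⟩)]
            simp
          · simp
        · exfalso
          have := i.2
          have : k < n := by have := h2.2; unfold ValidPath at this; omega
          omega
        · simp
      rw [LinearMap.add_apply, key _ (Or.inl rfl), key _ (Or.inr rfl), LinearMap.zero_apply]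
      by_cases hi : i' = i.val
      · subst hi
        by_cases h2 : ValidPath n i j (d + 2)
        -- When the resulting path is nonzero, the detours to the right and to the left are both
        -- valid or both invalid. In the first case their signs cancel.
        · have h3 : ValidPath n (i + 1) j (d + 1) ↔ ValidPath n (i - 1) j (d + 1) := by
            unfold ValidPath at *
            constructor <;> intro <;> omega
          simp only [h3, true_and]
          split_ifs
          · rw [← add_smul]
            have : sgn K i (i + 1) * sgn K (i + 1) i + sgn K i (i - 1) * sgn K (i - 1) i = 0 := by
              unfold sgn
              rw [if_pos rfl, if_neg (by omega), if_neg (by omega)]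
              by_cases h0 : i.val = 0
              · simp [h0]
              · rw [if_pos (by omega), pow_succ]; ring
            rw [this, zero_smul]
          · simp
        · simp [vec_eq_zero K n h2]
      · simp [hi]⟩

lemma rep_gen (g : (graphL n).PathGen) : rep K n (gen K n g) = opGen K n g := by
  rw [rep, gen]
  erw [RingQuot.liftAlgHom_mkAlgHom_apply]
  rw [FreeAlgebra.lift_ι_apply]

lemma rep_idem (k : ℕ) (v : PathSpace K n) (hk : k < n) :
    rep K n (idem K n k) v = opE K n k v := by
  rw [idem, dif_pos hk, rep_gen]; rfl

lemma rep_arr {i k : ℕ} (hi : i < n) (hk : k < n) (h : k = i + 1 ∨ k = i - 1) (v) :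
    rep K n (arr K n i k) v = sgn K i k • opA K n i k v := by
  rw [arr, arrowTerm, dif_pos ⟨⟨hi, hk⟩, h⟩, rep_gen]; rfl

/-- Acting on trivial paths separates the normal forms, which is the source of their linear
independence. -/
lemma rep_path {i j d : ℕ} (h : ValidPath n i j d) :
    rep K n ((arrowData K n).path i j d) (vec K n j j 0) = vec K n i j d := by
  induction d generalizing i with
  | zero =>
    have : i = j := by unfold ValidPath at h; omega
    subst this
    rw [ArrowData.path_zero]
    change rep K n (idem K n i) _ = _
    rw [rep_idem _ _ _ _ (by unfold ValidPath at h; omega), opE_vec, if_pos rfl]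
  | succ d ih =>
    rw [ArrowData.path_succ, if_pos h]
    have hi : i < n := by unfold ValidPath at h; omega
    split_ifs with h1
    · rw [map_mul, Module.End.mul_apply, ih h1]
      change rep K n (arr K n i (i + 1)) _ = _
      rw [rep_arr K n hi (by unfold ValidPath at h1; omega) (Or.inl rfl), opA_vec K n h1,
        if_pos rfl, sgn, if_pos rfl, one_smul]
    · have h2 : ValidPath n (i - 1) j d := by unfold ValidPath at *; omega
      rw [map_mul, Module.End.mul_apply, ih h2]
      change rep K n ((-1) ^ i * arr K n i (i - 1)) _ = _
      have h3 : ((-1) ^ i : (Alg K n)) = algebraMap K (Alg K n) ((-1) ^ i) := by simp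
      rw [h3, map_mul, AlgHom.commutes, Module.End.mul_apply, Module.algebraMap_end_apply,
        rep_arr K n hi (by omega) (Or.inr rfl), opA_vec K n h2, if_pos rfl, sgn,
        if_neg (by omega), smul_smul, ← mul_pow]
      simp

lemma linearIndependent_path : LinearIndependent K
    fun t : {t : ℕ × ℕ × ℕ // ValidPath n t.1 t.2.1 t.2.2} =>
      (arrowData K n).path t.1.1 t.1.2.1 t.1.2.2 := by
  -- Evaluation at the sum of all trivial paths. A path ending at `j` absorbs the idempotent of `j`,
  -- so it only sees the trivial path at `j`.
  let ev : (Alg K n) →ₗ[K] PathSpace K n :=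
    (LinearMap.applyₗ (∑ j ∈ Finset.range n, vec K n j j 0)) ∘ₗ (rep K n).toLinearMap
  refine LinearIndependent.of_comp ev ?_
  have : (ev ∘ fun t : {t : ℕ × ℕ × ℕ // ValidPath n t.1 t.2.1 t.2.2} =>
      (arrowData K n).path t.1.1 t.1.2.1 t.1.2.2) = fun t => Finsupp.single t (1 : K) := by
    funext ⟨⟨i, j, d⟩, h⟩
    have hj : j < n := by unfold ValidPath at h; dsimp only at h; omega
    change rep K n ((arrowData K n).path i j d) (∑ j ∈ Finset.range n, vec K n j j 0) = _
    rw [map_sum, Finset.sum_eq_single j]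
    · rw [rep_path K n h, vec, dif_pos h]
    · intro k _ hk
      rw [← ArrowData.path_mul_e, map_mul, Module.End.mul_apply]
      change rep K n _ (rep K n (idem K n j) _) = 0
      rw [rep_idem _ _ _ _ hj, opE_vec, if_neg hk, map_zero]
    · intro h'
      exact absurd (Finset.mem_range.2 hj) h'
  rw [this]
  exact Finsupp.linearIndependent_single_one K _

/-- The span of the normal forms is a left ideal. Since it contains `1`, as the sum of the trivial
paths, it is the whole algebra. -/
lemma mul_path_mem (x : (Alg K n)) {y : (Alg K n)}
    (hy : y ∈ Submodule.span K (Set.range fun t : ℕ × ℕ × ℕ =>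
      (arrowData K n).path t.1 t.2.1 t.2.2)) :
    x * y ∈ Submodule.span K (Set.range fun t : ℕ × ℕ × ℕ =>
      (arrowData K n).path t.1 t.2.1 t.2.2) := by
  set S := Submodule.span K (Set.range fun t : ℕ × ℕ × ℕ =>
    (arrowData K n).path t.1 t.2.1 t.2.2)
  obtain ⟨x, rfl⟩ := RingQuot.mkAlgHom_surjective K _ x
  induction x using FreeAlgebra.induction generalizing y with
  | grade0 r =>
    rw [AlgHom.commutes, ← Algebra.smul_def]
    exact S.smul_mem _ hy
  | grade1 g =>
    change gen K n g * y ∈ S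
    induction hy using Submodule.span_induction with
    | zero => rw [mul_zero]; exact S.zero_mem
    | add a b _ _ ha hb => rw [mul_add]; exact S.add_mem ha hb
    | smul r a _ ha => rw [mul_smul_comm]; exact S.smul_mem _ ha
    | mem y hy =>
      obtain ⟨⟨i, j, d⟩, rfl⟩ := hy
      dsimp only
      rw [← ArrowData.e_mul_path]
      change gen K n g * (idem K n i * _) ∈ S
      by_cases hV : ValidPath n i j d
      swap
      · rw [ArrowData.path_eq_zero _ hV, mul_zero, mul_zero]; exact S.zero_mem
      cases g with
      | e k =>
        have hk : gen K n (.e k) = idem K n k := by rw [idem, dif_pos k.2]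
        by_cases h : k.val = i
        · subst h
          rw [hk, ← mul_assoc, idem_mul_idem]
          change (arrowData K n).e k * _ ∈ S
          rw [ArrowData.e_mul_path]
          exact Submodule.subset_span ⟨(k, j, d), rfl⟩
        · rw [hk, ← mul_assoc, idem_mul_idem_of_ne K n h, zero_mul]
          exact S.zero_mem
      | arrow a =>
        have ha : gen K n (.arrow a) = arr K n a.src a.tgt :=
          (arrowTerm_eq (fun a => gen K n (.arrow a)) a).symm
        rw [ha]
        by_cases h : a.tgt.val = i
        · subst h
          rw [← mul_assoc, arr_mul_idem]
          rcases arrowTerm_cases a with h | h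
          · have := ((arrowData K n).arrow_mul_path d a.src j).1 (h ▸ hV)
            rw [h]
            change arr K n a.src (a.src + 1) * _ = _ at this
            rw [this]
            exact Submodule.subset_span ⟨(a.src, j, d + 1), rfl⟩
          · have := ((arrowData K n).arrow_mul_path d a.src j).2 (h ▸ hV)
            rw [h]
            change (-1) ^ a.src.val * arr K n a.src (a.src - 1) * _ = _ at this
            have h3 : ((-1) ^ a.src.val : (Alg K n)) = algebraMap K (Alg K n) ((-1) ^ a.src.val) := by simp
            have h4 : arr K n a.src (a.src - 1) * (arrowData K n).path (a.src - 1) j d =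
                ((-1) ^ a.src.val : K) • (arrowData K n).path a.src j (d + 1) := by
              rw [← this, h3, mul_assoc, ← Algebra.smul_def, smul_smul, ← mul_pow]
              simp
            rw [h4]
            exact S.smul_mem _ (Submodule.subset_span ⟨(a.src, j, d + 1), rfl⟩)
        · rw [← arr_mul_idem, ← mul_assoc, mul_assoc (arr K n _ _), idem_mul_idem_of_ne K n h,
            mul_zero, zero_mul]
          exact S.zero_mem
  | mul a b ha hb => rw [map_mul, mul_assoc]; exact ha (hb hy)
  | add a b ha hb => rw [map_add, add_mul]; exact S.add_mem (ha hy) (hb hy)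

/-- The path basis of the preprojective algebra of type `𝕃ₙ`. -/
def pathBasis : PathBasis K (Alg K n) n where
  b := (arrowData K n).path
  b_eq_zero := (arrowData K n).path_eq_zero
  b_mul_b := (arrowData K n).path_mul_path
  b_mul_b_of_ne := (arrowData K n).path_mul_path_of_ne
  sum_b := by
    simp only [ArrowData.path_zero]
    exact sum_idem K n
  linearIndependent := linearIndependent_path K n
  span_eq_top := by
    intro x _
    have h1 : (1 : (Alg K n)) ∈ Submodule.span K (Set.range fun t : ℕ × ℕ × ℕ =>
        (arrowData K n).path t.1 t.2.1 t.2.2) := by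
      rw [← (arrowData K n).sum_e]
      refine Submodule.sum_mem _ fun i _ => Submodule.subset_span ⟨(i, i, 0), ?_⟩
      exact ArrowData.path_zero _ _
    have hx := mul_path_mem K n x h1
    rw [mul_one] at hx
    refine Submodule.span_le.2 ?_ hx
    rintro _ ⟨⟨i, j, d⟩, rfl⟩
    by_cases h : ValidPath n i j d
    · exact Submodule.subset_span ⟨⟨(i, j, d), h⟩, rfl⟩
    · dsimp only
      rw [ArrowData.path_eq_zero _ h]
      exact Submodule.zero_mem _

end PreprojectiveL

end Preprojective

noncomputable section Projectives

/-! ### Projective modules generated by idempotents -/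

variable {R : Type u} [Ring R] {G : Type} (ε : G → R)

/-- The module `⨁ R ε_g` for a family of idempotents `ε_g`, as a submodule. -/
def idemSubmodule : Submodule R (G →₀ R) where
  carrier := {f | ∀ g, f g * ε g = f g}
  add_mem' {f f'} hf hf' g := by rw [Finsupp.add_apply, add_mul, hf g, hf' g]
  zero_mem' g := zero_mul _
  smul_mem' r f hf g := by
    rw [Finsupp.smul_apply, smul_eq_mul, mul_assoc, hf g]

/-- The module `⨁ R ε_g` for a family of idempotents `ε_g`. -/
def IdemModule : Type u := idemSubmodule ε

namespace IdemModule

instance : AddCommGroup (IdemModule ε) := inferInstanceAs (AddCommGroup (idemSubmodule ε))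

instance : Module R (IdemModule ε) := inferInstanceAs (Module R (idemSubmodule ε))

instance {K : Type*} [CommRing K] [Algebra K R] : Module K (IdemModule ε) :=
  inferInstanceAs (Module K (idemSubmodule ε))

instance {K : Type*} [CommRing K] [Algebra K R] : IsScalarTower K R (IdemModule ε) :=
  inferInstanceAs (IsScalarTower K R (idemSubmodule ε))

/-- The inclusion into the free module. -/
def incl : IdemModule ε →ₗ[R] G →₀ R := (idemSubmodule ε).subtype

lemma incl_injective : Function.Injective (incl ε) := Subtype.val_injective

variable {ε} (hε : ∀ g, ε g * ε g = ε g)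

/-- The generators. -/
def gen (g : G) : IdemModule ε :=
  ⟨Finsupp.single g (ε g), fun g' => by
    classical
    rw [Finsupp.single_apply]
    split_ifs with h
    · rw [← h, hε]
    · exact zero_mul _⟩

lemma incl_gen (g : G) : incl ε (gen hε g) = Finsupp.single g (ε g) := rfl

/-- The map with given values on the generators. -/
def lift {M : Type*} [AddCommGroup M] [Module R M] (m : G → M) : IdemModule ε →ₗ[R] M :=
  Finsupp.linearCombination R m ∘ₗ incl ε

/-- The idempotent reappears in front of `m g`, so the values `m` may be arbitrary. -/
lemma lift_gen {M : Type*} [AddCommGroup M] [Module R M] (m : G → M) (g : G) :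
    lift m (gen hε g) = ε g • m g :=
  Finsupp.linearCombination_single R (ε g) g

lemma smul_gen (g : G) : ε g • gen hε g = gen hε g := by
  refine incl_injective ε ?_
  rw [map_smul, incl_gen, Finsupp.smul_single, smul_eq_mul, hε]

lemma linearCombination_gen (f : IdemModule ε) :
    Finsupp.linearCombination R (gen hε) (incl ε f) = f := by
  refine incl_injective ε ?_
  rw [Finsupp.linearCombination_apply, map_finsuppSum]
  conv_rhs => rw [← Finsupp.sum_single (incl ε f)]
  refine Finsupp.sum_congr fun g _ => ?_
  rw [map_smul, incl_gen, Finsupp.smul_single, smul_eq_mul]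
  exact congrArg _ (f.2 g)

include hε in
lemma hom_ext {M : Type*} [AddCommGroup M] [Module R M] {f f' : IdemModule ε →ₗ[R] M}
    (h : ∀ g, f (gen hε g) = f' (gen hε g)) : f = f' := by
  ext x
  rw [← linearCombination_gen hε x, Finsupp.linearCombination_apply, map_finsuppSum,
    map_finsuppSum]
  exact Finsupp.sum_congr fun g _ => by rw [map_smul, map_smul, h]

include hε in
lemma projective : Module.Projective R (IdemModule ε) :=
  Module.Projective.of_split (incl ε) (Finsupp.linearCombination R (gen hε))
    (LinearMap.ext fun f => linearCombination_gen hε f)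

lemma exists_eq_sum (f : IdemModule ε) : ∃ c : G →₀ R, c.sum (fun g r => r • gen hε g) = f :=
  ⟨_, linearCombination_gen hε f⟩

end IdemModule

end Projectives

noncomputable section

variable {K Λ : Type u} [Field K] [Ring Λ] [Algebra K Λ] {n : ℕ}

/-- The vertices `i` and `j` of `𝕃ₙ` are adjacent. -/
def Neighbor (i j : ℕ) : Prop := j = i + 1 ∨ j = i - 1

namespace PathBasis

variable (B : PathBasis K Λ n)

/-! ### Computation with paths -/

/-- The basis of valid paths. -/
def basis : Module.Basis {t : ℕ × ℕ × ℕ // ValidPath n t.1 t.2.1 t.2.2} K Λ :=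
  Module.Basis.mk B.linearIndependent B.span_eq_top

lemma basis_apply (t) : B.basis t = B.b t.1.1 t.1.2.1 t.1.2.2 := Module.Basis.mk_apply _ _ _

lemma linearMap_ext {M : Type*} [AddCommGroup M] [Module K M] {f g : Λ →ₗ[K] M}
    (h : ∀ i j d, ValidPath n i j d → f (B.b i j d) = g (B.b i j d)) : f = g :=
  B.basis.ext fun t => by rw [B.basis_apply]; exact h _ _ _ t.2

/-- The coefficient of a path. -/
def coef (i j d : ℕ) : Λ →ₗ[K] K :=
  if h : ValidPath n i j d then B.basis.coord ⟨(i, j, d), h⟩ else 0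

lemma coef_eq_zero {i j d : ℕ} (h : ¬ ValidPath n i j d) (x : Λ) : B.coef i j d x = 0 := by
  rw [coef, dif_neg h, LinearMap.zero_apply]

lemma coef_b (i j d i' j' d' : ℕ) : B.coef i j d (B.b i' j' d') =
    if (i = i' ∧ j = j' ∧ d = d') ∧ ValidPath n i j d then 1 else 0 := by
  by_cases h : ValidPath n i j d
  · by_cases h' : ValidPath n i' j' d'
    · rw [coef, dif_pos h]
      have := B.basis_apply ⟨(i', j', d'), h'⟩
      dsimp only at this
      rw [← this, Module.Basis.coord_apply, Module.Basis.repr_self, Finsupp.single_apply]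
      simp only [Subtype.mk.injEq, Prod.mk.injEq, h, and_true]
      exact if_congr ⟨fun ⟨a, b, c⟩ => ⟨a.symm, b.symm, c.symm⟩,
        fun ⟨a, b, c⟩ => ⟨a.symm, b.symm, c.symm⟩⟩ rfl rfl
    · rw [B.b_eq_zero h', map_zero, if_neg]
      rintro ⟨⟨rfl, rfl, rfl⟩, h⟩
      exact h' h
  · rw [coef_eq_zero B h, if_neg fun h' => h h'.2]

lemma ext_coef {x y : Λ} (h : ∀ i j d, ValidPath n i j d → B.coef i j d x = B.coef i j d y) :
    x = y := by
  refine B.basis.ext_elem fun ⟨⟨i, j, d⟩, ht⟩ => ?_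
  have := h i j d ht
  rwa [coef, dif_pos ht] at this

lemma b_mul (i j j' k d e : ℕ) : B.b i j d * B.b j' k e =
    if j = j' ∧ ValidPath n i j d ∧ ValidPath n j' k e then B.b i k (d + e) else 0 := by
  split_ifs with h
  · obtain ⟨rfl, h1, h2⟩ := h
    exact B.b_mul_b h1 h2
  · by_cases hj : j = j'
    · by_cases h1 : ValidPath n i j d
      · rw [B.b_eq_zero (fun h2 => h ⟨hj, h1, h2⟩), mul_zero]
      · rw [B.b_eq_zero h1, zero_mul]
    · exact B.b_mul_b_of_ne hj

/-- The idempotent of a vertex. -/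
def e (i : ℕ) : Λ := B.b i i 0

lemma e_eq_zero {i : ℕ} (h : n ≤ i) : B.e i = 0 :=
  B.b_eq_zero (by unfold ValidPath; omega)

lemma e_mul_b (i k d : ℕ) : B.e i * B.b i k d = B.b i k d := by
  rw [e, b_mul]
  split_ifs with h
  · rw [zero_add]
  · refine (B.b_eq_zero fun h' => h ⟨rfl, ?_, h'⟩).symm
    unfold ValidPath at *
    omega

lemma b_mul_e (i k d : ℕ) : B.b i k d * B.e k = B.b i k d := by
  rw [e, b_mul]
  split_ifs with h
  · rw [add_zero]
  · refine (B.b_eq_zero fun h' => h ⟨rfl, h', ?_⟩).symm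
    unfold ValidPath at *
    omega

lemma e_mul_e (i : ℕ) : B.e i * B.e i = B.e i := B.e_mul_b i i 0

lemma e_mul_b_of_ne {i j k d : ℕ} (h : i ≠ j) : B.e i * B.b j k d = 0 := B.b_mul_b_of_ne h

lemma b_mul_e_of_ne {i j k d : ℕ} (h : k ≠ j) : B.b i k d * B.e j = 0 := B.b_mul_b_of_ne h

/-- The condition cannot be dropped: `b k j (d + 1)` may be a genuine path although `b k i d` is
not. For example, the loop at `0` is not the extension of a path of length zero from `0` to `1`. -/
lemma b_mul_arrow {i j : ℕ} (h : Neighbor i j) (k d : ℕ) :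
    B.b k i d * B.b i j 1 = if ValidPath n k i d then B.b k j (d + 1) else 0 := by
  rw [b_mul]
  split_ifs with h1 h2 h2
  · rfl
  · exact absurd h1.2.1 h2
  · refine (B.b_eq_zero fun h' => h1 ⟨rfl, h2, ?_⟩).symm
    unfold ValidPath Neighbor at *
    omega
  · rfl

lemma arrow_mul_b {i j : ℕ} (h : Neighbor i j) (l d : ℕ) :
    B.b i j 1 * B.b j l d = if ValidPath n j l d then B.b i l (d + 1) else 0 := by
  rw [b_mul]
  split_ifs with h1 h2 h2
  · rw [add_comm]
  · exact absurd h1.2.2 h2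
  · refine (B.b_eq_zero fun h' => h1 ⟨rfl, ?_, h2⟩).symm
    unfold ValidPath Neighbor at *
    omega
  · rfl

/-- The action of `p ⊗ q` on bimodules. -/
abbrev _root_.bim (p q : Λ) : Λ ⊗[K] Λᵐᵒᵖ := p ⊗ₜ MulOpposite.op q

lemma _root_.bim_mul_bim (p q p' q' : Λ) :
    (bim p q * bim p' q' : Λ ⊗[K] Λᵐᵒᵖ) = bim (p * p') (q' * q) := by
  rw [Algebra.TensorProduct.tmul_mul_tmul, ← MulOpposite.op_mul]

/-- The action of `p ⊗ q` as a bilinear map. -/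
def _root_.bimSMul (M : Type*) [AddCommGroup M] [Module K M] [Module (Λ ⊗[K] Λᵐᵒᵖ) M]
    [IsScalarTower K (Λ ⊗[K] Λᵐᵒᵖ) M] (m : M) : Λ →ₗ[K] Λ →ₗ[K] M :=
  LinearMap.mk₂ K (fun p q => (bim p q : Λ ⊗[K] Λᵐᵒᵖ) • m)
    (fun p p' q => by
      rw [← add_smul]; exact congrArg (· • m) (TensorProduct.add_tmul p p' _))
    (fun c p q => by
      rw [← smul_assoc]; exact congrArg (· • m) (TensorProduct.smul_tmul' c p _).symm)
    (fun p q q' => by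
      rw [← add_smul]; exact congrArg (· • m) (TensorProduct.tmul_add p _ _))
    (fun c p q => by
      rw [← smul_assoc]; exact congrArg (· • m) (TensorProduct.tmul_smul c p _))

end PathBasis

/-! ### Bimodules generated by paths -/

/-- Arrows of the quiver of `𝕃ₙ`: `R i : i → i + 1` and `L i : i → i - 1`, where `L 0` is the
loop. -/
inductive LArrow : Type
  | R (i : ℕ)
  | L (i : ℕ)
  deriving DecidableEq

/-- A type of generators of bimodules, with their initial and terminal vertices. -/
class Ends (G : Type) where
  src : G → ℕ
  tgt : G → ℕ

instance : Ends ℕ := ⟨fun i => i, fun i => i⟩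

namespace LArrow

/-- The initial vertex. -/
def src : LArrow → ℕ
  | R i => i
  | L i => i

/-- The terminal vertex. -/
def tgt : LArrow → ℕ
  | R i => i + 1
  | L i => i - 1

instance : Ends LArrow := ⟨src, tgt⟩

/-- The opposite of the arrow `L i`. -/
def opp (i : ℕ) : LArrow := if i = 0 then L 0 else R (i - 1)

@[simp] lemma src_R (i : ℕ) : (R i).src = i := rfl
@[simp] lemma src_L (i : ℕ) : (L i).src = i := rfl
@[simp] lemma tgt_R (i : ℕ) : (R i).tgt = i + 1 := rfl
@[simp] lemma tgt_L (i : ℕ) : (L i).tgt = i - 1 := rfl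

@[simp] lemma src_opp (i : ℕ) : (opp i).src = i - 1 := by
  unfold opp; split_ifs with h <;> simp [h]

@[simp] lemma tgt_opp (i : ℕ) : (opp i).tgt = i := by
  unfold opp; split_ifs with h <;> simp [h]; omega

lemma neighbor (a : LArrow) : Neighbor a.src a.tgt := by
  cases a with
  | R i => exact Or.inl rfl
  | L i => exact Or.inr rfl

/-- The sign `s` for the loop and `1` for the other arrows. -/
def sign (s : ℤ) (a : LArrow) : ℤ := if a = L 0 then s else 1

@[simp] lemma sign_R (s : ℤ) (i : ℕ) : (R i).sign s = 1 := if_neg (by simp)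
@[simp] lemma sign_L_succ (s : ℤ) (i : ℕ) : (L (i + 1)).sign s = 1 := if_neg (by simp)
@[simp] lemma sign_L_zero (s : ℤ) : (L 0).sign s = s := if_pos rfl

@[simp] lemma sign_opp (s : ℤ) (i : ℕ) : (opp i).sign s = (L i).sign s := by
  unfold opp
  split_ifs with h
  · rw [h]
  · obtain ⟨i, rfl⟩ := Nat.exists_eq_succ_of_ne_zero h
    simp

lemma sign_mul_sign {s : ℤ} (hs : s * s = 1) (a : LArrow) : a.sign s * a.sign s = 1 := by
  unfold sign; split_ifs
  · exact hs
  · rfl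

end LArrow

namespace PathBasis

variable (B : PathBasis K Λ n)

section Cells

open Ends

variable {G : Type} [Ends G]

/-- The idempotents generating `⨁ Λ e_{src g} ⊗ e_{tgt g} Λ`. -/
def idem (g : G) : Λ ⊗[K] Λᵐᵒᵖ := bim (B.e (src g)) (B.e (tgt g))

/-- The bimodule `⨁ Λ e_{src g} ⊗ e_{tgt g} Λ`. -/
abbrev Bimod (G : Type) [Ends G] : Type u := IdemModule (B.idem (G := G))

lemma idem_mul_idem (g : G) : B.idem g * B.idem g = B.idem g := by
  rw [idem, bim_mul_bim, e_mul_e, e_mul_e]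

/-- The generators of the bimodule. -/
def gen (g : G) : B.Bimod G := IdemModule.gen B.idem_mul_idem g

/-- The element `p [g] q`. -/
def cell (g : G) : Λ →ₗ[K] Λ →ₗ[K] B.Bimod G :=
  bimSMul _ (B.gen g)

lemma cell_apply (g : G) (p q : Λ) :
    (B.cell g p q : B.Bimod G) = (bim p q : Λ ⊗[K] Λᵐᵒᵖ) • B.gen g := rfl

lemma bim_smul_cell (g : G) (p q p' q' : Λ) :
    (bim p' q' : Λ ⊗[K] Λᵐᵒᵖ) • (B.cell g p q : B.Bimod G) =
      B.cell g (p' * p) (q * q') := by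
  rw [cell_apply, smul_smul, bim_mul_bim, cell_apply]

lemma bim_smul_zsmul_cell (z : ℤ) (g : G) (p q p' q' : Λ) :
    (bim p' q' : Λ ⊗[K] Λᵐᵒᵖ) • z • (B.cell g p q : B.Bimod G) =
      z • B.cell g (p' * p) (q * q') := by
  rw [smul_comm, bim_smul_cell]

lemma gen_eq_cell (g : G) :
    (B.gen g : B.Bimod G) = B.cell g (B.e (src g)) (B.e (tgt g)) :=
  (IdemModule.smul_gen B.idem_mul_idem g).symm

lemma cell_e (g : G) (p q : Λ) :
    (B.cell g p q : B.Bimod G) = B.cell g (p * B.e (src g)) (B.e (tgt g) * q) := by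
  rw [cell_apply, gen_eq_cell, bim_smul_cell]

lemma map_cell {M : Type*} [AddCommGroup M] [Module (Λ ⊗[K] Λᵐᵒᵖ) M]
    (f : B.Bimod G →ₗ[Λ ⊗[K] Λᵐᵒᵖ] M) (g : G) (p q : Λ) :
    f (B.cell g p q) = (bim p q : Λ ⊗[K] Λᵐᵒᵖ) • f (B.gen g) := by
  rw [cell_apply, map_smul]

lemma hom_ext {M : Type*} [AddCommGroup M] [Module (Λ ⊗[K] Λᵐᵒᵖ) M]
    {f f' : B.Bimod G →ₗ[Λ ⊗[K] Λᵐᵒᵖ] M} (h : ∀ g, f (B.gen g) = f' (B.gen g)) : f = f' :=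
  IdemModule.hom_ext B.idem_mul_idem h

/-- The bimodule map with given values on the generators. -/
def lift {M : Type*} [AddCommGroup M] [Module (Λ ⊗[K] Λᵐᵒᵖ) M] (m : G → M) :
    B.Bimod G →ₗ[Λ ⊗[K] Λᵐᵒᵖ] M := IdemModule.lift m

lemma lift_gen {M : Type*} [AddCommGroup M] [Module (Λ ⊗[K] Λᵐᵒᵖ) M] (m : G → M) (g : G) :
    (B.lift m : B.Bimod G →ₗ[Λ ⊗[K] Λᵐᵒᵖ] M) (B.gen g) =
      (bim (B.e (src g)) (B.e (tgt g)) : Λ ⊗[K] Λᵐᵒᵖ) • m g :=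
  IdemModule.lift_gen B.idem_mul_idem m g

instance : Module.Projective (Λ ⊗[K] Λᵐᵒᵖ) (B.Bimod G) :=
  IdemModule.projective B.idem_mul_idem

/-- The cells of paths span the bimodule. -/
lemma span_cell : (⊤ : Submodule K (B.Bimod G)) ≤ Submodule.span K
    {x | ∃ g k l d m, x = B.cell g (B.b k (src g) d) (B.b (tgt g) l m)} := by
  set S := Submodule.span K
    {x : B.Bimod G | ∃ g k l d m, x = B.cell g (B.b k (src g) d) (B.b (tgt g) l m)}
  have h1 : ∀ g p q, (B.cell g p q : B.Bimod G) ∈ S := by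
    intro g p q
    have hp : ∀ p, p ∈ Submodule.span K (Set.range B.basis) := B.basis.mem_span
    induction hp p using Submodule.span_induction with
    | zero => rw [map_zero]; exact S.zero_mem
    | add a b _ _ ha hb => rw [map_add]; exact S.add_mem ha hb
    | smul r a _ ha => rw [map_smul]; exact S.smul_mem _ ha
    | mem p h =>
      obtain ⟨⟨⟨k, i, d⟩, h⟩, rfl⟩ := h
      induction hp q using Submodule.span_induction with
      | zero => rw [map_zero]; exact S.zero_mem
      | add a b _ _ ha hb => rw [map_add]; exact S.add_mem ha hb
      | smul r a _ ha => rw [map_smul]; exact S.smul_mem _ ha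
      | mem q h =>
        obtain ⟨⟨⟨j, l, m⟩, h'⟩, rfl⟩ := h
        rw [basis_apply, basis_apply, cell_e]
        dsimp only
        by_cases hi : i = src g
        · by_cases hj : j = tgt g
          · subst hi hj
            rw [b_mul_e, e_mul_b]
            exact Submodule.subset_span ⟨g, k, l, d, m, rfl⟩
          · rw [B.e_mul_b_of_ne (Ne.symm hj), map_zero]; exact S.zero_mem
        · rw [B.b_mul_e_of_ne hi, map_zero]; exact S.zero_mem
  intro x _
  obtain ⟨c, rfl⟩ := IdemModule.exists_eq_sum B.idem_mul_idem x
  refine Submodule.sum_mem _ fun g _ => ?_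
  have h2 : ∀ r : Λ ⊗[K] Λᵐᵒᵖ, (r • B.gen g : B.Bimod G) ∈ S := fun r => by
    induction r using TensorProduct.induction_on with
    | zero =>
      exact (congrArg (· ∈ S) (zero_smul (Λ ⊗[K] Λᵐᵒᵖ) (B.gen g))).mpr S.zero_mem
    | tmul p q => exact h1 g p q.unop
    | add a b ha hb => rw [add_smul]; exact S.add_mem ha hb
  exact h2 (c g)

end Cells

/-- The bimodule generated by the vertices. -/
abbrev PV : Type u := B.Bimod ℕ

/-- The bimodule generated by the arrows. -/
abbrev PA : Type u := B.Bimod LArrow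

@[simp] lemma ends_src_nat (i : ℕ) : Ends.src i = i := rfl
@[simp] lemma ends_tgt_nat (i : ℕ) : Ends.tgt i = i := rfl
@[simp] lemma ends_src_arrow (a : LArrow) : Ends.src a = a.src := rfl
@[simp] lemma ends_tgt_arrow (a : LArrow) : Ends.tgt a = a.tgt := rfl

/-- An arrow as an element of the algebra. -/
def arr (a : LArrow) : Λ := B.b a.src a.tgt 1

lemma e_mul_arr (a : LArrow) : B.e a.src * B.arr a = B.arr a := B.e_mul_b _ _ _
lemma arr_mul_e (a : LArrow) : B.arr a * B.e a.tgt = B.arr a := B.b_mul_e _ _ _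

/-- The augmentation. -/
def aug : B.PV →ₗ[Λ ⊗[K] Λᵐᵒᵖ] Λ := B.lift fun i => B.e i

/-- The first differential. -/
def d₁ (s : ℤ) : B.PA →ₗ[Λ ⊗[K] Λᵐᵒᵖ] B.PV :=
  -- For `s = -1` this is the usual differential with the right action twisted by the sign change of
  -- the loop.
  B.lift fun a => B.cell a.tgt (B.arr a) (B.e a.tgt) -
    a.sign s • B.cell a.src (B.e a.src) (B.arr a)

/-- The second differential. -/
def d₂ (s : ℤ) : B.PV →ₗ[Λ ⊗[K] Λᵐᵒᵖ] B.PA :=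
  -- The noncommutative derivative of the relation `R i * L (i + 1) - L i * opp i`, twisted on the
  -- right by the sign of the loop.
  B.lift fun i => B.cell (LArrow.L (i + 1)) (B.b i (i + 1) 1) (B.e i) +
    B.cell (LArrow.R i) (B.e i) (B.b (i + 1) i 1) -
    B.cell (LArrow.opp i) (B.b i (i - 1) 1) (B.e i) -
    (LArrow.L i).sign s • B.cell (LArrow.L i) (B.e i) (B.b (i - 1) i 1)

/-- The sign of a path: `1` if it passes the loop an even number of times, and `-s` otherwise. -/
def pathSign (s : ℤ) (k i d : ℕ) : ℤ := if (d + i + k) % 2 = 0 then 1 else -s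

/-- The third differential. -/
def d₃ (s : ℤ) : B.PV →ₗ[Λ ⊗[K] Λᵐᵒᵖ] B.PV :=
  -- A signed sum over all factorisations of the socle path `b k k (2 * n - 1)`. Terms with an
  -- invalid factor vanish, so all indices may be summed over.
  B.lift fun k => ∑ i ∈ Finset.range n, ∑ x ∈ Finset.HasAntidiagonal.antidiagonal (2 * n - 1),
    pathSign s k i x.1 • B.cell i (B.b k i x.1) (B.b i k x.2)

lemma aug_gen (i : ℕ) : B.aug (B.gen i) = B.e i := by
  rw [aug, lift_gen, bimodule_smul, ends_src_nat, ends_tgt_nat, e_mul_e, e_mul_e]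

lemma d₁_gen (s : ℤ) (a : LArrow) : B.d₁ s (B.gen a) = B.cell a.tgt (B.arr a) (B.e a.tgt) -
    a.sign s • B.cell a.src (B.e a.src) (B.arr a) := by
  rw [d₁, lift_gen, smul_sub, smul_comm, bim_smul_cell, bim_smul_cell,
    ends_src_arrow, ends_tgt_arrow, e_mul_arr, e_mul_e, e_mul_e,
    arr_mul_e]

lemma d₂_gen (s : ℤ) (i : ℕ) : B.d₂ s (B.gen i) =
    B.cell (LArrow.L (i + 1)) (B.b i (i + 1) 1) (B.e i) +
    B.cell (LArrow.R i) (B.e i) (B.b (i + 1) i 1) -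
    B.cell (LArrow.opp i) (B.b i (i - 1) 1) (B.e i) -
    (LArrow.L i).sign s • B.cell (LArrow.L i) (B.e i) (B.b (i - 1) i 1) := by
  rw [d₂, lift_gen, smul_sub, smul_sub, smul_add, smul_comm]
  simp only [bim_smul_cell, ends_src_nat, ends_tgt_nat, e_mul_b, b_mul_e, e_mul_e]

lemma d₃_gen (s : ℤ) (k : ℕ) : B.d₃ s (B.gen k) =
    ∑ i ∈ Finset.range n, ∑ x ∈ Finset.HasAntidiagonal.antidiagonal (2 * n - 1),
      pathSign s k i x.1 • B.cell i (B.b k i x.1) (B.b i k x.2) := by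
  rw [d₃, lift_gen, Finset.smul_sum]
  refine Finset.sum_congr rfl fun i _ => ?_
  rw [Finset.smul_sum]
  refine Finset.sum_congr rfl fun x _ => ?_
  rw [smul_comm, bim_smul_cell, ends_src_nat, ends_tgt_nat, e_mul_b, b_mul_e]

lemma aug_comp_d₁ : B.aug ∘ₗ B.d₁ 1 = 0 := by
  refine B.hom_ext fun a => ?_
  rw [LinearMap.comp_apply, d₁_gen, map_sub, map_zsmul, map_cell, map_cell, aug_gen, aug_gen,
    bimodule_smul, bimodule_smul, mul_assoc, e_mul_e, e_mul_e, arr_mul_e, e_mul_arr,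
    LinearMap.zero_apply]
  have : a.sign 1 = 1 := by unfold LArrow.sign; split_ifs <;> rfl
  rw [this, one_smul, sub_self]

lemma d₁_comp_d₂ {s : ℤ} (hs : s * s = 1) : B.d₁ s ∘ₗ B.d₂ s = 0 := by
  refine B.hom_ext fun i => ?_
  -- The preprojective relation at `i`. It also covers the last vertex, where both sides are zero.
  have h : B.b i (i - 1) 1 * B.b (i - 1) i 1 = B.b i (i + 1) 1 * B.b (i + 1) i 1 := by
    rw [B.b_mul_arrow (by unfold Neighbor; omega), B.b_mul_arrow (by unfold Neighbor; omega)]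
    by_cases hi : i < n
    · have h1 : ValidPath n i (i - 1) 1 := by unfold ValidPath; omega
      rw [if_pos h1]
      split_ifs with h2
      · rfl
      · exact B.b_eq_zero (by unfold ValidPath at *; omega)
    · rw [B.b_eq_zero (by unfold ValidPath at *; omega), ite_self, ite_self]
  simp only [LinearMap.comp_apply, d₂_gen, map_sub, map_add, map_zsmul, map_cell, d₁_gen,
    smul_sub, bim_smul_zsmul_cell, bim_smul_cell, arr, LArrow.src_R, LArrow.src_L,
    LArrow.tgt_R, LArrow.tgt_L, LArrow.src_opp, LArrow.tgt_opp, LArrow.sign_R,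
    LArrow.sign_L_succ, LArrow.sign_opp, Nat.add_sub_cancel, b_mul_e, e_mul_b, e_mul_e, one_smul,
    LinearMap.zero_apply, smul_smul, LArrow.sign_mul_sign hs, h]
  abel

end PathBasis

end

noncomputable section

variable {K Λ : Type u} [Field K] [Ring Λ] [Algebra K Λ] {n : ℕ}

namespace PathBasis

variable (B : PathBasis K Λ n)

/-! ### The third differential -/

section Shift

variable {M : Type*} [AddCommGroup M] [Module K M] (φ : Λ →ₗ[K] Λ →ₗ[K] M)

/-- The exceptional case of `b_mul_arrow` may be ignored next to a second factor whose validity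
excludes it. This is what makes the factorisation sums below uniform. -/
lemma b_mul_arrow_left {k j i t l d m : ℕ} (hji : Neighbor j i)
    (h : ValidPath n k i (d + 1) → ValidPath n t l m → ValidPath n k j d) :
    φ (B.b k j d * B.b j i 1) (B.b t l m) = φ (B.b k i (d + 1)) (B.b t l m) := by
  rw [B.b_mul_arrow hji]
  split_ifs with h1
  · rfl
  · by_cases h2 : ValidPath n t l m
    · rw [B.b_eq_zero fun h3 => h1 (h h3 h2), map_zero, LinearMap.zero_apply]
    · rw [B.b_eq_zero h2, map_zero, map_zero]

lemma arrow_mul_b_left {k j i t l d m : ℕ} (hji : Neighbor j i)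
    (h : ValidPath n j k (d + 1) → ValidPath n t l m → ValidPath n i k d) :
    φ (B.b j i 1 * B.b i k d) (B.b t l m) = φ (B.b j k (d + 1)) (B.b t l m) := by
  rw [B.arrow_mul_b hji]
  split_ifs with h1
  · rfl
  · by_cases h2 : ValidPath n t l m
    · rw [B.b_eq_zero fun h3 => h1 (h h3 h2), map_zero, LinearMap.zero_apply]
    · rw [B.b_eq_zero h2, map_zero, map_zero]

lemma b_mul_arrow_right {k j i t l d m : ℕ} (hji : Neighbor j i)
    (h : ValidPath n k i (d + 1) → ValidPath n t l m → ValidPath n k j d) :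
    φ (B.b t l m) (B.b k j d * B.b j i 1) = φ (B.b t l m) (B.b k i (d + 1)) :=
  B.b_mul_arrow_left φ.flip hji h

lemma arrow_mul_b_right {k j i t l d m : ℕ} (hji : Neighbor j i)
    (h : ValidPath n j k (d + 1) → ValidPath n t l m → ValidPath n i k d) :
    φ (B.b t l m) (B.b j i 1 * B.b i k d) = φ (B.b t l m) (B.b j k (d + 1)) :=
  B.arrow_mul_b_left φ.flip hji h

lemma b_two_mul (i j : ℕ) : B.b i j (2 * n - 1 + 1) = 0 :=
  B.b_eq_zero (by unfold ValidPath; omega)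

end Shift

/-- Absorbing an arrow into the left factor lengthens it by one; the only new term of the
antidiagonal, that with trivial left factor, must vanish. -/
lemma sum_shift_left {M : Type*} [AddCommMonoid M] {N : ℕ} {f g : ℕ × ℕ → M} (h0 : g (0, N + 1) = 0)
    (h : ∀ d m, d + m = N → f (d, m) = g (d + 1, m)) :
    ∑ x ∈ Finset.HasAntidiagonal.antidiagonal N, f x =
      ∑ x ∈ Finset.HasAntidiagonal.antidiagonal (N + 1), g x := by
  rw [Finset.Nat.sum_antidiagonal_succ, h0, zero_add]
  exact Finset.sum_congr rfl fun x hx => h _ _ (Finset.HasAntidiagonal.mem_antidiagonal.1 hx)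

lemma sum_shift_right {M : Type*} [AddCommMonoid M] {N : ℕ} {f g : ℕ × ℕ → M} (h0 : g (N + 1, 0) = 0)
    (h : ∀ d m, d + m = N → f (d, m) = g (d, m + 1)) :
    ∑ x ∈ Finset.HasAntidiagonal.antidiagonal N, f x =
      ∑ x ∈ Finset.HasAntidiagonal.antidiagonal (N + 1), g x := by
  rw [Finset.Nat.sum_antidiagonal_succ', h0, zero_add]
  exact Finset.sum_congr rfl fun x hx => h _ _ (Finset.HasAntidiagonal.mem_antidiagonal.1 hx)

lemma pathSign_congr (s : ℤ) {k i d k' i' d' : ℕ} (h : (d + i + k) % 2 = (d' + i' + k') % 2) :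
    pathSign s k i d = pathSign s k' i' d' := by
  unfold pathSign; rw [h]

lemma pathSign_succ {s : ℤ} (hs : s * s = 1) (k i d : ℕ) :
    pathSign s k i d = -s * pathSign s k i (d + 1) := by
  unfold pathSign
  rcases Nat.mod_two_eq_zero_or_one (d + i + k) with h | h
  · rw [if_pos h, if_neg (by omega)]; linear_combination -hs
  · rw [if_neg (by omega), if_pos (by omega)]; ring

/-- Once the arrows are absorbed, vertex `i` contributes the terms of the edge to its right minus
those of the edge to its left, so the sum over the vertices telescopes. At the loop the two terms
cancel because passing the loop changes `pathSign` by `-s`; beyond vertex `n - 1` there are no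
paths. -/
lemma d₂_comp_d₃ {s : ℤ} (hs : s * s = 1) : B.d₂ s ∘ₗ B.d₃ s = 0 := by
  refine B.hom_ext fun k => ?_
  rw [LinearMap.comp_apply, d₃_gen, map_sum, LinearMap.zero_apply]
  let A : LArrow → B.PA := fun g => ∑ x ∈ Finset.HasAntidiagonal.antidiagonal (2 * n - 1 + 1),
    pathSign s k g.src x.1 • B.cell g (B.b k g.src x.1) (B.b g.tgt k x.2)
  have h0 : ∀ (φ : Λ →ₗ[K] Λ →ₗ[K] B.PA) (z : ℤ) (a b c d x : ℕ),
      z • φ (B.b a b (2 * n - 1 + 1)) (B.b c d x) = 0 := fun φ z a b c d x => by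
    rw [b_two_mul, map_zero, LinearMap.zero_apply, smul_zero]
  have h0' : ∀ (φ : Λ →ₗ[K] Λ →ₗ[K] B.PA) (z : ℤ) (a b c d x : ℕ),
      z • φ (B.b a b x) (B.b c d (2 * n - 1 + 1)) = 0 := fun φ z a b c d x => by
    rw [b_two_mul, map_zero, smul_zero]
  have key : ∀ i ∈ Finset.range n, B.d₂ s (∑ x ∈ Finset.HasAntidiagonal.antidiagonal (2 * n - 1),
      pathSign s k i x.1 • B.cell i (B.b k i x.1) (B.b i k x.2)) =
      (A (LArrow.L (i + 1)) + A (LArrow.R i)) -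
        if i = 0 then 0 else (A (LArrow.L i) + A (LArrow.R (i - 1))) := by
    intro i hi
    rw [Finset.mem_range] at hi
    rw [map_sum]
    have hA : ∑ x ∈ Finset.HasAntidiagonal.antidiagonal (2 * n - 1), pathSign s k i x.1 •
        B.cell (LArrow.L (i + 1)) (B.b k i x.1 * B.b i (i + 1) 1) (B.b i k x.2) =
        A (LArrow.L (i + 1)) := by
      refine sum_shift_left (h0' _ _ _ _ _ _ _) fun d m hd => ?_
      dsimp only [LArrow.src_L, LArrow.tgt_L]
      rw [B.b_mul_arrow_left _ (Or.inl rfl) (by unfold ValidPath; omega), Nat.add_sub_cancel,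
        pathSign_congr s (k' := k) (i' := i + 1) (d' := d + 1) (by omega)]
    have hR : ∑ x ∈ Finset.HasAntidiagonal.antidiagonal (2 * n - 1), pathSign s k i x.1 •
        B.cell (LArrow.R i) (B.b k i x.1) (B.b (i + 1) i 1 * B.b i k x.2) =
        A (LArrow.R i) := by
      refine sum_shift_right (h0 _ _ _ _ _ _ _) fun d m hd => ?_
      dsimp only [LArrow.src_R, LArrow.tgt_R]
      rw [B.arrow_mul_b_right _ (j := i + 1) (i := i) (Or.inr rfl) (by unfold ValidPath; omega)]
    have hL : ∑ x ∈ Finset.HasAntidiagonal.antidiagonal (2 * n - 1), pathSign s k i x.1 •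
        B.cell (LArrow.L i) (B.b k i x.1) (B.b (i - 1) i 1 * B.b i k x.2) =
        A (LArrow.L i) := by
      refine sum_shift_right (h0 _ _ _ _ _ _ _) fun d m hd => ?_
      dsimp only [LArrow.src_L, LArrow.tgt_L]
      rw [B.arrow_mul_b_right _ (by unfold Neighbor; omega) (by unfold ValidPath; omega)]
    have hO : ∑ x ∈ Finset.HasAntidiagonal.antidiagonal (2 * n - 1), pathSign s k i x.1 •
        B.cell (LArrow.opp i) (B.b k i x.1 * B.b i (i - 1) 1) (B.b i k x.2) =
        if i = 0 then -s • A (LArrow.L 0) else A (LArrow.R (i - 1)) := by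
      split_ifs with h
      · subst h
        rw [Finset.smul_sum]
        refine sum_shift_left (by rw [h0', smul_zero]) fun d m hd => ?_
        rw [smul_smul, ← pathSign_succ hs,
          B.b_mul_arrow_left _ (by unfold Neighbor; omega) (by unfold ValidPath; omega)]
        rfl
      · obtain ⟨i, rfl⟩ := Nat.exists_eq_succ_of_ne_zero h
        refine sum_shift_left (h0' _ _ _ _ _ _ _) fun d m hd => ?_
        rw [B.b_mul_arrow_left _ (by unfold Neighbor; omega) (by unfold ValidPath; omega),
          LArrow.opp, if_neg h]
        dsimp only [LArrow.src_R, LArrow.tgt_R, Nat.succ_eq_add_one, Nat.add_sub_cancel]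
        rw [pathSign_congr s (k' := k) (i' := i) (d' := d + 1) (by omega), Nat.add_sub_cancel]
    have : ∀ x ∈ Finset.HasAntidiagonal.antidiagonal (2 * n - 1),
        B.d₂ s (pathSign s k i x.1 • B.cell i (B.b k i x.1) (B.b i k x.2)) =
        pathSign s k i x.1 •
            B.cell (LArrow.L (i + 1)) (B.b k i x.1 * B.b i (i + 1) 1) (B.b i k x.2) +
          pathSign s k i x.1 •
            B.cell (LArrow.R i) (B.b k i x.1) (B.b (i + 1) i 1 * B.b i k x.2) -
          pathSign s k i x.1 •
            B.cell (LArrow.opp i) (B.b k i x.1 * B.b i (i - 1) 1) (B.b i k x.2) -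
          (LArrow.L i).sign s • pathSign s k i x.1 •
            B.cell (LArrow.L i) (B.b k i x.1) (B.b (i - 1) i 1 * B.b i k x.2) := by
      intro x _
      rw [map_zsmul, map_cell, d₂_gen]
      simp only [smul_sub, smul_add, bim_smul_cell, bim_smul_zsmul_cell, b_mul_e, e_mul_b]
      rw [smul_comm (LArrow.sign _ _)]
    rw [Finset.sum_congr rfl this, Finset.sum_sub_distrib, Finset.sum_sub_distrib,
      Finset.sum_add_distrib, ← Finset.smul_sum, hA, hR, hL, hO]
    split_ifs with h
    · subst h
      rw [LArrow.sign_L_zero, neg_smul]; abel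
    · obtain ⟨i, rfl⟩ := Nat.exists_eq_succ_of_ne_zero h
      rw [LArrow.sign_L_succ, one_smul]; abel
  rw [Finset.sum_congr rfl key]
  have htel : ∀ m, ∑ i ∈ Finset.range m, ((A (LArrow.L (i + 1)) + A (LArrow.R i)) -
      if i = 0 then 0 else (A (LArrow.L i) + A (LArrow.R (i - 1)))) =
      if m = 0 then 0 else (A (LArrow.L m) + A (LArrow.R (m - 1))) := by
    intro m
    induction m with
    | zero => simp
    | succ m ih => rw [Finset.sum_range_succ, ih, if_neg (Nat.succ_ne_zero m)]; simp
  rw [htel]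
  split_ifs with h
  · rfl
  · have h1 : A (LArrow.L n) = 0 := Finset.sum_eq_zero fun x _ => by
      rw [B.b_eq_zero (by unfold ValidPath; dsimp only [LArrow.src_L]; omega), map_zero,
        LinearMap.zero_apply, smul_zero]
    have h2 : A (LArrow.R (n - 1)) = 0 := Finset.sum_eq_zero fun x _ => by
      rw [B.b_eq_zero (i := (LArrow.R (n - 1)).tgt)
        (by unfold ValidPath; dsimp only [LArrow.tgt_R]; omega), map_zero, smul_zero]
    rw [h1, h2, add_zero]

/-- Both halves of `d₁` yield the sum over factorisations of total length `2 * n` from the source to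
the target of the arrow. A loop moved into the left factor costs the sign `-s`, which is the loop
sign of `d₁ (-s)`. -/
lemma d₃_comp_d₁ {s : ℤ} (hs : s * s = 1) : B.d₃ s ∘ₗ B.d₁ (-s) = 0 := by
  refine B.hom_ext fun a => ?_
  rw [LinearMap.comp_apply, d₁_gen, map_sub, map_zsmul, map_cell, map_cell, d₃_gen, d₃_gen,
    Finset.smul_sum, Finset.smul_sum, Finset.smul_sum, LinearMap.zero_apply, sub_eq_zero]
  refine Finset.sum_congr rfl fun t ht => ?_
  rw [Finset.mem_range] at ht
  rw [Finset.smul_sum, Finset.smul_sum, Finset.smul_sum]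
  simp only [bim_smul_zsmul_cell, e_mul_b, b_mul_e]
  refine Eq.trans (b := ∑ x ∈ Finset.HasAntidiagonal.antidiagonal (2 * n - 1 + 1),
    a.sign (-s) • pathSign s a.src t x.1 • B.cell t (B.b a.src t x.1) (B.b t a.tgt x.2))
    (sum_shift_left ?_ fun d m hd => ?_) (sum_shift_right ?_ fun d m hd => ?_).symm
  · rw [b_two_mul, map_zero, smul_zero, smul_zero]
  · dsimp only
    rw [arr, B.arrow_mul_b_left _ a.neighbor, smul_smul]
    · congr 1
      rcases a with i | (_ | i)
      · rw [LArrow.sign_R, one_mul]; exact pathSign_congr s (by simp only [LArrow.src_R, LArrow.tgt_R]; omega)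
      · rw [LArrow.sign_L_zero]; exact pathSign_succ hs _ _ _
      · rw [LArrow.sign_L_succ, one_mul]; exact pathSign_congr s (by simp only [LArrow.src_L, LArrow.tgt_L]; omega)
    · rcases a with i | i
      · simp only [LArrow.src_R, LArrow.tgt_R]; unfold ValidPath; omega
      · simp only [LArrow.src_L, LArrow.tgt_L]; unfold ValidPath; omega
  · rw [b_two_mul, map_zero, LinearMap.zero_apply, smul_zero, smul_zero]
  · dsimp only
    rw [arr, B.b_mul_arrow_right _ a.neighbor]
    rcases a with i | i
    · simp only [LArrow.src_R, LArrow.tgt_R]; unfold ValidPath; omega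
    · simp only [LArrow.src_L, LArrow.tgt_L]; unfold ValidPath; omega

end PathBasis

end

noncomputable section

variable {K Λ : Type u} [Field K] [Ring Λ] [Algebra K Λ] {n : ℕ}

namespace PathBasis

open Ends

variable (B : PathBasis K Λ n)

/-! ### Left linear maps and the radical filtration -/

section LeftMap

variable {G : Type} [Ends G] {M : Type*} [AddCommGroup M] [Module K M]

/-- The linear map on the algebra with given values on the valid paths. -/
def lin (θ : ℕ → ℕ → ℕ → M) : Λ →ₗ[K] M :=
  B.basis.constr K fun t => θ t.1.1 t.1.2.1 t.1.2.2

lemma lin_b (θ : ℕ → ℕ → ℕ → M) {i j d : ℕ} (h : ValidPath n i j d) :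
    B.lin θ (B.b i j d) = θ i j d := by
  have := B.basis.constr_basis K (fun t => θ t.1.1 t.1.2.1 t.1.2.2) ⟨(i, j, d), h⟩
  rwa [basis_apply] at this

variable [Module (Λ ⊗[K] Λᵐᵒᵖ) M] [IsScalarTower K (Λ ⊗[K] Λᵐᵒᵖ) M]

/-- The left linear map with `[g] q ↦ φ g q`. -/
def leftMap (φ : G → Λ →ₗ[K] M) : B.Bimod G →ₗ[K] M :=
  Finsupp.lsum K (fun g => TensorProduct.lift (LinearMap.mk₂ K
    (fun (p : Λ) (q : Λᵐᵒᵖ) => (bim p 1 : Λ ⊗[K] Λᵐᵒᵖ) • φ g q.unop)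
    (fun p p' q => (bimSMul M (φ g q.unop)).map_add₂ p p' 1)
    (fun c p q => (bimSMul M (φ g q.unop)).map_smul₂ c p 1)
    (fun p q q' => by rw [MulOpposite.unop_add, map_add, smul_add])
    (fun c p q => by rw [MulOpposite.unop_smul, map_smul, smul_comm]))) ∘ₗ
    (IdemModule.incl (B.idem (G := G))).restrictScalars K

lemma leftMap_cell (φ : G → Λ →ₗ[K] M) (g : G) (p q : Λ) :
    B.leftMap φ (B.cell g p q) =
      (bim (p * B.e (src g)) 1 : Λ ⊗[K] Λᵐᵒᵖ) • φ g (B.e (tgt g) * q) := by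
  have : IdemModule.incl (B.idem (G := G)) (B.cell g p q) =
      Finsupp.single g (bim (p * B.e (src g)) (B.e (tgt g) * q)) := by
    rw [cell_apply, map_smul]
    refine (congrArg _ (IdemModule.incl_gen B.idem_mul_idem g)).trans ?_
    rw [Finsupp.smul_single, idem, smul_eq_mul, bim_mul_bim]
  rw [leftMap, LinearMap.comp_apply, LinearMap.restrictScalars_apply, this,
    Finsupp.lsum_single]
  rfl

lemma cell_eq_smul (g : G) (p q : Λ) : (B.cell g p q : B.Bimod G) =
    (bim p 1 : Λ ⊗[K] Λᵐᵒᵖ) • B.cell g (B.e (src g)) q := by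
  rw [bim_smul_cell, mul_one]
  conv_lhs => rw [cell_e]
  conv_rhs => rw [cell_e]
  rw [mul_assoc, e_mul_e]

lemma addHom_ext {N : Type*} [AddCommGroup N] {f f' : B.Bimod G →+ N}
    (h : ∀ g p q, f (B.cell g p q) = f' (B.cell g p q)) : f = f' := by
  ext x
  obtain ⟨c, rfl⟩ := IdemModule.exists_eq_sum B.idem_mul_idem x
  rw [map_finsuppSum, map_finsuppSum]
  refine Finsupp.sum_congr fun g _ => ?_
  have : ∀ r : Λ ⊗[K] Λᵐᵒᵖ, f (r • B.gen g : B.Bimod G) = f' (r • B.gen g) := fun r => by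
    induction r using TensorProduct.induction_on with
    | zero =>
      have h0 := zero_smul (Λ ⊗[K] Λᵐᵒᵖ) (B.gen g)
      exact (congrArg f h0).trans ((map_zero f).trans (((congrArg f' h0).trans (map_zero f')).symm))
    | tmul p q => exact h g p q.unop
    | add a b ha hb => rw [add_smul, map_add, map_add, ha, hb]
  exact this _

lemma leftMap_smul (φ : G → Λ →ₗ[K] M) (p : Λ) (x : B.Bimod G) :
    B.leftMap φ ((bim p 1 : Λ ⊗[K] Λᵐᵒᵖ) • x) = (bim p 1 : Λ ⊗[K] Λᵐᵒᵖ) • B.leftMap φ x := by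
  refine DFunLike.congr_fun (B.addHom_ext
    (f := (B.leftMap φ).toAddMonoidHom.comp (DistribSMul.toAddMonoidHom _ (bim p 1 : Λ ⊗[K] Λᵐᵒᵖ)))
    (f' := (DistribSMul.toAddMonoidHom _ (bim p 1 : Λ ⊗[K] Λᵐᵒᵖ)).comp
      (B.leftMap φ).toAddMonoidHom) fun g p' q => ?_) x
  change B.leftMap φ ((bim p 1 : Λ ⊗[K] Λᵐᵒᵖ) • _) = (bim p 1 : Λ ⊗[K] Λᵐᵒᵖ) • B.leftMap φ _
  rw [bim_smul_cell, leftMap_cell, leftMap_cell, smul_smul, bim_mul_bim, mul_one, mul_one,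
    mul_assoc]

end LeftMap

section Filtration

variable {G : Type} [Ends G]

/-- The elements of the bimodule whose left factors are paths of length at least `r`. -/
def filt (G : Type) [Ends G] (r : ℕ) : Submodule K (B.Bimod G) := Submodule.span K
  {x | ∃ g k l d m, r ≤ d ∧ ValidPath n (tgt g) l m ∧ x = B.cell g (B.b k (src g) d) (B.b (tgt g) l m)}

lemma filt_zero : B.filt G 0 = ⊤ := by
  refine top_le_iff.1 (B.span_cell.trans (Submodule.span_le.2 ?_))
  rintro _ ⟨g, k, l, d, m, rfl⟩
  by_cases h : ValidPath n (tgt g) l m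
  · exact Submodule.subset_span ⟨g, k, l, d, m, Nat.zero_le _, h, rfl⟩
  · rw [B.b_eq_zero h, map_zero]
    exact (B.filt G 0).zero_mem

lemma filt_top : B.filt G (2 * n) = ⊥ := by
  refine le_bot_iff.1 (Submodule.span_le.2 ?_)
  rintro _ ⟨g, k, l, d, m, hd, h, rfl⟩
  rw [B.b_eq_zero (i := k) (d := d) (by unfold ValidPath at *; omega), map_zero,
    LinearMap.zero_apply]
  exact zero_mem _

lemma bim_smul_mem_filt {r : ℕ} (k i d : ℕ) {x : B.Bimod G} (hx : x ∈ B.filt G r) :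
    (bim (B.b k i d) 1 : Λ ⊗[K] Λᵐᵒᵖ) • x ∈ B.filt G (r + d) := by
  induction hx using Submodule.span_induction with
  | zero => rw [smul_zero]; exact zero_mem _
  | add a b _ _ ha hb => rw [smul_add]; exact add_mem ha hb
  | smul c a _ ha => rw [smul_comm]; exact Submodule.smul_mem _ _ ha
  | mem x h =>
    obtain ⟨g, k', l, d', m, hd, h, rfl⟩ := h
    rw [bim_smul_cell, b_mul, mul_one]
    split_ifs
    · exact Submodule.subset_span ⟨g, k, l, _, m, by omega, h, rfl⟩
    · rw [map_zero, LinearMap.zero_apply]; exact zero_mem _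

lemma cell_mem_filt (g : G) (k i d : ℕ) (q : Λ) : B.cell g (B.b k i d) q ∈ B.filt G d := by
  rw [cell_eq_smul]
  have := B.bim_smul_mem_filt (r := 0) (G := G) k i d (x := B.cell g (B.e (src g)) q)
    (by rw [filt_zero]; trivial)
  rwa [zero_add] at this

lemma leftMap_mem_filt {G' : Type} [Ends G'] (φ : G → Λ →ₗ[K] B.Bimod G') {x : B.Bimod G}
    {r : ℕ} (hx : x ∈ B.filt G r) : B.leftMap φ x ∈ B.filt G' r := by
  suffices B.filt G r ≤ (B.filt G' r).comap (B.leftMap φ) from this hx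
  refine Submodule.span_le.2 ?_
  rintro _ ⟨g, k, l, d, m, hd, h, rfl⟩
  change B.leftMap φ _ ∈ B.filt G' r
  rw [cell_eq_smul, leftMap_smul]
  have := B.bim_smul_mem_filt (r := 0) (G := G') k (src g) d
    (x := B.leftMap φ (B.cell g (B.e (src g)) (B.b (tgt g) l m))) (by rw [filt_zero]; trivial)
  rw [zero_add] at this
  refine Submodule.span_mono ?_ this
  rintro _ ⟨g, k, l, d', m, hd', h, rfl⟩
  exact ⟨g, k, l, d', m, hd.trans hd', h, rfl⟩

/-- A left linear homotopy which is a contraction modulo the radical shows exactness. -/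
lemma exact_of_homotopy {Q S : Type*} [AddCommGroup Q] [Module K Q] [Module (Λ ⊗[K] Λᵐᵒᵖ) Q]
    [IsScalarTower K (Λ ⊗[K] Λᵐᵒᵖ) Q] [AddCommGroup S] [Module (Λ ⊗[K] Λᵐᵒᵖ) S]
    {f : Q →ₗ[Λ ⊗[K] Λᵐᵒᵖ] B.Bimod G} {g : B.Bimod G →ₗ[Λ ⊗[K] Λᵐᵒᵖ] S} (hgf : g ∘ₗ f = 0)
    (φ : G → Λ →ₗ[K] Q) (h : S →+ B.Bimod G)
    (hh : ∀ p x, h ((bim p 1 : Λ ⊗[K] Λᵐᵒᵖ) • x) = (bim p 1 : Λ ⊗[K] Λᵐᵒᵖ) • h x)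
    (H : ∀ a l m, ValidPath n (tgt a) l m → ∃ u v,
      h (g (B.cell a (B.e (src a)) (B.b (tgt a) l m)) - u) ∈ B.filt G 1 ∧
      f ((bim (B.e (src a)) 1 : Λ ⊗[K] Λᵐᵒᵖ) • φ a (B.b (tgt a) l m)) - v ∈ B.filt G 1 ∧
      B.cell a (B.e (src a)) (B.b (tgt a) l m) = v + h u) :
    Function.Exact f g := by
  -- The defect of the homotopy raises the filtration. By left linearity it is enough to see this
  -- for cells with trivial left factor, which is what `H` provides.
  have hN : ∀ r, ∀ x ∈ B.filt G r, x - f (B.leftMap φ x) - h (g x) ∈ B.filt G (r + 1) := by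
    intro r x hx
    induction hx using Submodule.span_induction with
    | zero => simp only [map_zero, sub_zero]; exact zero_mem _
    | add a b _ _ ha hb =>
      simp only [map_add]
      convert add_mem ha hb using 1
      abel
    | smul c a _ ha =>
      -- Scalars act through left multiplication by elements of `Λ`; this is needed because `h` is
      -- only additive.
      have h1 : ∀ {N : Type _} [AddCommGroup N] [Module K N] [Module (Λ ⊗[K] Λᵐᵒᵖ) N]
        [IsScalarTower K (Λ ⊗[K] Λᵐᵒᵖ) N] (y : N),
          c • y = (bim (algebraMap K Λ c) 1 : Λ ⊗[K] Λᵐᵒᵖ) • y := fun y => by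
        rw [algebra_compatible_smul (Λ ⊗[K] Λᵐᵒᵖ) c y]; rfl
      rw [h1 a, leftMap_smul, map_smul, map_smul, hh, ← smul_sub, ← smul_sub, ← h1]
      exact Submodule.smul_mem _ _ ha
    | mem x hx =>
      obtain ⟨a, k, l, d, m, hd, hv, rfl⟩ := hx
      rw [cell_eq_smul, leftMap_smul, map_smul, map_smul, hh, ← smul_sub, ← smul_sub, leftMap_cell,
        e_mul_e, e_mul_b]
      obtain ⟨u, v, h1, h2, h3⟩ := H a l m hv
      have h4 : B.cell a (B.e (src a)) (B.b (tgt a) l m) -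
          f ((bim (B.e (src a)) 1 : Λ ⊗[K] Λᵐᵒᵖ) • φ a (B.b (tgt a) l m)) -
          h (g (B.cell a (B.e (src a)) (B.b (tgt a) l m))) ∈ B.filt G 1 := by
        rw [map_sub] at h1
        convert neg_mem (add_mem h1 h2) using 1
        nth_rw 1 [h3]
        abel
      have h5 := B.bim_smul_mem_filt k (src a) d h4
      refine Submodule.span_mono ?_ h5
      rintro _ ⟨g, k, l, d', m, hd', h, rfl⟩
      exact ⟨g, k, l, d', m, by omega, h, rfl⟩
  intro x
  constructor
  · intro hx
    -- For a cycle the term `h (g x)` disappears, so the cycle is a boundary modulo every step of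
    -- the filtration, and step `2 * n` is zero.
    have key : ∀ r, ∃ y, x - f y ∈ B.filt G r := by
      intro r
      induction r with
      | zero => exact ⟨0, by rw [filt_zero]; trivial⟩
      | succ r ih =>
        obtain ⟨y, hy⟩ := ih
        have h1 : g (x - f y) = 0 := by
          rw [map_sub, hx, ← LinearMap.comp_apply, hgf, LinearMap.zero_apply, sub_zero]
        have h2 := hN r _ hy
        rw [h1, map_zero, sub_zero, sub_sub, ← map_add] at h2
        exact ⟨_, h2⟩
    obtain ⟨y, hy⟩ := key (2 * n)
    rw [filt_top, Submodule.mem_bot, sub_eq_zero] at hy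
    exact ⟨y, hy.symm⟩
  · rintro ⟨y, rfl⟩
    rw [← LinearMap.comp_apply, hgf, LinearMap.zero_apply]

end Filtration

end PathBasis

end

noncomputable section

variable {K Λ : Type u} [Field K] [Ring Λ] [Algebra K Λ] {n : ℕ}

namespace PathBasis

variable (B : PathBasis K Λ n)

/-! ### Exactness -/

/-- Modulo longer left factors, only those terms of a differential survive whose arrows join the
right factor. The homotopies are designed to invert these leading terms; the next two lemmas record
those of `d₂` and `d₃`. -/
lemma d₁_cell_sub_mem (s : ℤ) (a : LArrow) (q : Λ) :
    B.d₁ s (B.cell a (B.e a.src) q) - -(a.sign s • B.cell a.src (B.e a.src) (B.arr a * q)) ∈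
      B.filt ℕ 1 := by
  rw [map_cell, d₁_gen, smul_sub, bim_smul_cell, bim_smul_zsmul_cell, e_mul_e, e_mul_arr,
    sub_neg_eq_add, sub_add_cancel]
  exact B.cell_mem_filt _ _ _ _ _

lemma d₂_cell_sub_mem (s : ℤ) (i : ℕ) (q : Λ) :
    B.d₂ s (B.cell i (B.e i) q) - (B.cell (LArrow.R i) (B.e i) (B.b (i + 1) i 1 * q) -
      (LArrow.L i).sign s • B.cell (LArrow.L i) (B.e i) (B.b (i - 1) i 1 * q)) ∈
      B.filt LArrow 1 := by
  rw [map_cell, d₂_gen]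
  simp only [smul_sub, smul_add, bim_smul_cell, bim_smul_zsmul_cell, e_mul_e, e_mul_b]
  have h1 := sub_mem (B.cell_mem_filt (LArrow.L (i + 1)) i (i + 1) 1 (B.e i * q))
    (B.cell_mem_filt (LArrow.opp i) i (i - 1) 1 (B.e i * q))
  convert h1 using 1
  abel

lemma d₃_cell_sub_mem (s : ℤ) (i : ℕ) (q : Λ) :
    B.d₃ s (B.cell i (B.e i) q) - B.cell i (B.e i) (B.b i i (2 * n - 1) * q) ∈
      B.filt ℕ 1 := by
  rw [map_cell, d₃_gen, Finset.smul_sum]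
  by_cases hi : i < n
  · rw [← Finset.add_sum_erase _ _ (Finset.mem_range.2 hi),
      ← Finset.add_sum_erase (Finset.HasAntidiagonal.antidiagonal (2 * n - 1)) _
        (Finset.HasAntidiagonal.mem_antidiagonal.2
        (show (0, 2 * n - 1).1 + (0, 2 * n - 1).2 = 2 * n - 1 from zero_add _)), smul_add,
      Finset.smul_sum, add_assoc]
    have h0 : pathSign s i i 0 = 1 := if_pos (by omega)
    have hmem : ∀ (j d m : ℕ) (z : ℤ), (j, d) ≠ (i, 0) →
        (bim (B.e i) q : Λ ⊗[K] Λᵐᵒᵖ) • z • B.cell j (B.b i j d) (B.b j i m) ∈ B.filt ℕ 1 := by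
      intro j d m z hd
      rw [bim_smul_zsmul_cell, e_mul_b]
      refine Submodule.smul_of_tower_mem _ z ?_
      rcases Nat.eq_zero_or_pos d with rfl | hd'
      · rw [B.b_eq_zero (i := i) (d := 0), map_zero, LinearMap.zero_apply]
        · exact zero_mem _
        · have : j ≠ i := fun h => hd (by rw [h])
          unfold ValidPath; omega
      · refine Submodule.span_mono ?_ (B.cell_mem_filt _ _ _ _ _)
        rintro _ ⟨g, k, l, d', m, hd', h, rfl⟩
        exact ⟨g, k, l, d', m, by omega, h, rfl⟩
    dsimp only
    rw [h0, one_smul, bim_smul_cell, e_mul_b, show B.b i i 0 = B.e i from rfl, add_sub_cancel_left]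
    refine add_mem (Submodule.sum_mem _ fun x hx => hmem _ _ _ _ ?_)
      (Submodule.sum_mem _ fun j hj => ?_)
    · intro h
      have h1 := (Finset.mem_erase.1 hx).1
      have h2 := Finset.HasAntidiagonal.mem_antidiagonal.1 (Finset.mem_erase.1 hx).2
      rw [Prod.mk.injEq] at h
      exact h1 (Prod.ext h.2 (by dsimp only; omega))
    · rw [Finset.smul_sum]
      refine Submodule.sum_mem _ fun x hx => hmem _ _ _ _ fun h => ?_
      exact (Finset.mem_erase.1 hj).1 (congrArg Prod.fst h)
  · rw [B.b_eq_zero (i := i) (d := 2 * n - 1) (by unfold ValidPath; omega), zero_mul, map_zero,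
      sub_zero]
    refine Submodule.sum_mem _ fun j _ => ?_
    rw [Finset.smul_sum]
    refine Submodule.sum_mem _ fun x _ => ?_
    rw [bim_smul_zsmul_cell, e_eq_zero B (not_lt.1 hi), zero_mul, map_zero, LinearMap.zero_apply,
      smul_zero]
    exact zero_mem _

/-- The left linear section of the augmentation. -/
def hAug : Λ →ₗ[K] B.PV := ∑ l ∈ Finset.range n, (B.cell l).flip (B.e l)

lemma hAug_apply (q : Λ) : B.hAug q = ∑ l ∈ Finset.range n, B.cell l q (B.e l) := by
  rw [hAug, LinearMap.sum_apply]; rfl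

lemma hAug_smul (p q : Λ) :
    B.hAug ((bim p 1 : Λ ⊗[K] Λᵐᵒᵖ) • q) = (bim p 1 : Λ ⊗[K] Λᵐᵒᵖ) • B.hAug q := by
  rw [hAug_apply, hAug_apply, Finset.smul_sum, bimodule_smul, mul_one]
  exact Finset.sum_congr rfl fun l _ => by rw [bim_smul_cell, mul_one]

lemma hAug_b (i l m : ℕ) : B.hAug (B.b i l m) = B.cell l (B.b i l m) (B.e l) := by
  rw [hAug_apply]
  by_cases h : l < n
  · rw [Finset.sum_eq_single_of_mem l (Finset.mem_range.2 h)]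
    intro j _ hj
    rw [cell_e, ends_src_nat, B.b_mul_e_of_ne (Ne.symm hj), map_zero, LinearMap.zero_apply]
  · rw [B.b_eq_zero (i := i) (d := m) (by unfold ValidPath; omega), map_zero,
      LinearMap.zero_apply]
    exact Finset.sum_eq_zero fun j _ => by rw [map_zero, LinearMap.zero_apply]

/-- The contracting homotopy in degree zero. -/
def h₀ (s : ℤ) (i : ℕ) : Λ →ₗ[K] B.PA := B.lin fun _ l m =>
  -- Removes the first arrow of the right factor in its normal form, which starts to the right
  -- whenever possible.
  if m = 0 then 0 else if ValidPath n (i + 1) l (m - 1) then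
    -B.cell (LArrow.R i) (B.e i) (B.b (i + 1) l (m - 1)) else
    -((LArrow.L i).sign s • B.cell (LArrow.L i) (B.e i) (B.b (i - 1) l (m - 1)))

/-- The contracting homotopy in degree one. -/
def h₁ (s : ℤ) : LArrow → Λ →ₗ[K] B.PV
  -- If the arrow can be prefixed to the path in normal form, the cell is already recovered through
  -- `h₀` and nothing is needed. Otherwise it is a leading term of `d₂`.
  | LArrow.R i => B.lin fun _ l m => if ValidPath n i l (m + 1) then 0 else
      B.cell i (B.e i) (B.b i l (m - 1))
  | LArrow.L i => B.lin fun _ l m =>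
      if ValidPath n i l (m + 1) ∧ ¬ ValidPath n (i + 1) l m then 0 else
      -((LArrow.L i).sign s • B.cell i (B.e i) (B.b i l (m - 1)))

/-- The contracting homotopy in degree two. -/
def h₂ (i : ℕ) : Λ →ₗ[K] B.PV := B.lin fun _ l m =>
  -- The socle path is the leading coefficient of `d₃`.
  if l = i ∧ m = 2 * n - 1 then B.cell i (B.e i) (B.e i) else 0

/-- To leading order `d₁` puts back the arrow removed by `h₀`. Only the trivial path has no arrow to
remove. -/
lemma d₁_h₀ {s : ℤ} (hs : s * s = 1) {i l m : ℕ} (h : ValidPath n i l m) :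
    B.d₁ s ((bim (B.e i) 1 : Λ ⊗[K] Λᵐᵒᵖ) • B.h₀ s i (B.b i l m)) -
      (if m = 0 then 0 else B.cell i (B.e i) (B.b i l m)) ∈ B.filt ℕ 1 := by
  rw [h₀, lin_b _ _ h]
  rcases Nat.eq_zero_or_pos m with rfl | hm
  · rw [if_pos rfl, if_pos rfl, smul_zero, map_zero, sub_zero]
    exact zero_mem _
  · rw [if_neg hm.ne', if_neg hm.ne']
    obtain ⟨m, rfl⟩ := Nat.exists_eq_succ_of_ne_zero hm.ne'
    rw [Nat.succ_eq_add_one, Nat.add_sub_cancel] at *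
    split_ifs with hA
    · have := B.d₁_cell_sub_mem s (LArrow.R i) (B.b (i + 1) l m)
      rw [arr, LArrow.src_R, LArrow.tgt_R, B.arrow_mul_b (Or.inl rfl), if_pos hA, LArrow.sign_R,
        one_smul] at this
      rw [smul_neg, bim_smul_cell, map_neg, e_mul_e, mul_one]
      convert neg_mem this using 1
      abel
    · have hB : ValidPath n (i - 1) l m := by
        unfold ValidPath at *
        rcases h with h | h <;> omega
      have := B.d₁_cell_sub_mem s (LArrow.L i) (B.b (i - 1) l m)
      rw [arr, LArrow.src_L, LArrow.tgt_L, B.arrow_mul_b (by unfold Neighbor; omega), if_pos hB]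
        at this
      rw [smul_neg, bim_smul_zsmul_cell, map_neg, e_mul_e, mul_one, map_zsmul]
      have h2 := neg_mem (Submodule.smul_of_tower_mem _ ((LArrow.L i).sign s) this)
      rw [smul_sub, smul_neg, smul_smul, LArrow.sign_mul_sign hs, one_smul] at h2
      convert h2 using 1
      abel

theorem exact_d₁_aug : Function.Exact (B.d₁ 1) B.aug := by
  refine B.exact_of_homotopy B.aug_comp_d₁ (B.h₀ 1) B.hAug.toAddMonoidHom
    (fun p x => B.hAug_smul p x) fun i l m h => ?_
  change ValidPath n i l m at h
  -- For `m = 0` the cell is `h u` itself. For `m > 0` the term `h u` has a left factor of positive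
  -- length and hence is negligible.
  refine ⟨B.b i l m, if m = 0 then 0 else B.cell i (B.e i) (B.b i l m) -
    B.cell l (B.b i l m) (B.e l), ?_, ?_, ?_⟩
  · rw [map_cell, aug_gen, bimodule_smul]
    dsimp only [ends_src_nat, ends_tgt_nat]
    rw [e_mul_e, e_mul_b, sub_self, map_zero]
    exact zero_mem _
  · have := B.d₁_h₀ (one_mul (1 : ℤ)) h
    split_ifs at this ⊢ with hm
    · exact this
    · have h2 := B.cell_mem_filt l i l m (B.e l)
      have h3 : B.cell l (B.b i l m) (B.e l) ∈ B.filt ℕ 1 := by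
        refine Submodule.span_mono ?_ h2
        rintro _ ⟨g, k, l, d', m, hd', h, rfl⟩
        exact ⟨g, k, l, d', m, by omega, h, rfl⟩
      convert add_mem this h3 using 1
      dsimp only [ends_src_nat, ends_tgt_nat]
      abel
  · dsimp only [ends_src_nat, ends_tgt_nat, LinearMap.toAddMonoidHom_coe]
    rw [hAug_b]
    split_ifs with hm
    · subst hm
      have : i = l := by unfold ValidPath at h; omega
      subst this
      exact (zero_add _).symm
    · rw [sub_add_cancel]

theorem exact_d₁_d₃ {s : ℤ} (hs : s * s = 1) : Function.Exact (B.d₁ (-s)) (B.d₃ s) := by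
  refine B.exact_of_homotopy (B.d₃_comp_d₁ hs) (B.h₀ (-s)) (B.leftMap B.h₂).toAddMonoidHom
    (fun p x => B.leftMap_smul _ p x) fun i l m h => ?_
  change ValidPath n i l m at h
  -- The leading term of `d₃` is zero unless `m = 0`, since the socle path cannot be prolonged; for
  -- `m = 0` it is the socle cell, which `h₂` sends back to the generator.
  refine ⟨B.cell i (B.e i) (B.b i i (2 * n - 1) * B.b i l m),
    if m = 0 then 0 else B.cell i (B.e i) (B.b i l m), B.leftMap_mem_filt _ (B.d₃_cell_sub_mem s i _),
    B.d₁_h₀ (by rw [neg_mul_neg, hs]) h, ?_⟩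
  dsimp only [ends_src_nat, ends_tgt_nat, LinearMap.toAddMonoidHom_coe]
  rw [b_mul, leftMap_cell]
  dsimp only [ends_src_nat, ends_tgt_nat]
  split_ifs with h2 h1 h1
  · subst h2
    have : l = i := by unfold ValidPath at h; omega
    subst this
    rw [e_mul_b, add_zero, h₂, lin_b _ _ h1.2.1, if_pos ⟨rfl, rfl⟩, bim_smul_cell, e_mul_e, e_mul_e,
      mul_one, zero_add, e]
  · refine absurd ⟨rfl, ?_, h⟩ h1
    subst h2
    unfold ValidPath at *
    rcases h with h | h <;> omega
  · rw [B.b_eq_zero (i := i) (d := 2 * n - 1 + m) (by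
      unfold ValidPath at *
      rcases h with h | h <;> omega), mul_zero, map_zero, smul_zero, add_zero]
  · rw [mul_zero, map_zero, smul_zero, add_zero]

lemma zero_bim_smul {M : Type*} [AddCommGroup M] [Module K M] [Module (Λ ⊗[K] Λᵐᵒᵖ) M]
    [IsScalarTower K (Λ ⊗[K] Λᵐᵒᵖ) M] (q : Λ) (x : M) : (bim 0 q : Λ ⊗[K] Λᵐᵒᵖ) • x = 0 :=
  (bimSMul M x).map_zero₂ q

lemma leftMap_h₀_cell (s : ℤ) (i l m : ℕ) :
    B.leftMap (B.h₀ s) (B.cell i (B.e i) (B.b i l (m + 1))) =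
      if ValidPath n i l (m + 1) then
        if ValidPath n (i + 1) l m then -B.cell (LArrow.R i) (B.e i) (B.b (i + 1) l m) else
          -((LArrow.L i).sign s • B.cell (LArrow.L i) (B.e i) (B.b (i - 1) l m))
      else 0 := by
  rw [leftMap_cell]
  dsimp only [ends_src_nat, ends_tgt_nat]
  rw [e_mul_e, e_mul_b]
  split_ifs with hT hA
  · rw [h₀, lin_b _ _ hT, if_neg (Nat.succ_ne_zero m), Nat.add_sub_cancel, if_pos hA, smul_neg,
      bim_smul_cell, e_mul_e, mul_one]
  · rw [h₀, lin_b _ _ hT, if_neg (Nat.succ_ne_zero m), Nat.add_sub_cancel, if_neg hA, smul_neg,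
      bim_smul_zsmul_cell, e_mul_e, mul_one]
  · rw [B.b_eq_zero hT, map_zero, smul_zero]

lemma smul_h₁_R (s : ℤ) {i l m : ℕ} (h : ValidPath n (i + 1) l m) :
    (bim (B.e i) 1 : Λ ⊗[K] Λᵐᵒᵖ) • B.h₁ s (LArrow.R i) (B.b (i + 1) l m) =
      if ValidPath n i l (m + 1) then 0 else B.cell i (B.e i) (B.b i l (m - 1)) := by
  rw [h₁, lin_b _ _ h]
  split_ifs
  · rw [smul_zero]
  · rw [bim_smul_cell, e_mul_e, mul_one]

lemma smul_h₁_L (s : ℤ) {i l m : ℕ} (h : ValidPath n (i - 1) l m) :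
    (bim (B.e i) 1 : Λ ⊗[K] Λᵐᵒᵖ) • B.h₁ s (LArrow.L i) (B.b (i - 1) l m) =
      if ValidPath n i l (m + 1) ∧ ¬ ValidPath n (i + 1) l m then 0 else
      -((LArrow.L i).sign s • B.cell i (B.e i) (B.b i l (m - 1))) := by
  rw [h₁, lin_b _ _ h]
  split_ifs
  · rw [smul_zero]
  · rw [smul_neg, bim_smul_zsmul_cell, e_mul_e, mul_one]

-- The cases are whether the arrow can be prefixed to the path at all (`hT`) and whether the
-- resulting path could start to the right (`hA`). A word in normal form is recovered by `h₀` alone.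
-- A word with zero product is, up to sign, a leading term of `d₂`.
set_option maxHeartbeats 1000000 in
theorem exact_d₂_d₁ {s : ℤ} (hs : s * s = 1) : Function.Exact (B.d₂ s) (B.d₁ s) := by
  refine B.exact_of_homotopy (B.d₁_comp_d₂ hs) (B.h₁ s) (B.leftMap (B.h₀ s)).toAddMonoidHom
    (fun p x => B.leftMap_smul _ p x) fun a l m h => ?_
  change ValidPath n a.tgt l m at h
  rcases a with i | i
  · have hA : ValidPath n (i + 1) l m := h
    by_cases hT : ValidPath n i l (m + 1)
    · refine ⟨_, 0, B.leftMap_mem_filt _ (B.d₁_cell_sub_mem s (LArrow.R i) _), ?_, ?_⟩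
      · dsimp only [ends_src_arrow, ends_tgt_arrow, LArrow.src_R, LArrow.tgt_R]
        rw [B.smul_h₁_R s hA, if_pos hT, map_zero, sub_zero]
        exact zero_mem _
      · dsimp only [ends_src_arrow, ends_tgt_arrow, LArrow.src_R, LArrow.tgt_R,
          LinearMap.toAddMonoidHom_coe, arr]
        rw [B.arrow_mul_b (Or.inl rfl), if_pos hA, map_neg, map_zsmul, leftMap_h₀_cell,
          if_pos hT, if_pos hA, LArrow.sign_R, one_smul, neg_neg, zero_add]
    · obtain ⟨m, rfl⟩ : ∃ m', m = m' + 1 := ⟨m - 1, by unfold ValidPath at *; omega⟩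
      have hS : ValidPath n i l m := by unfold ValidPath at *; omega
      have hB : ¬ ValidPath n (i - 1) l (m + 1) := by unfold ValidPath at *; omega
      refine ⟨_, B.cell (LArrow.R i) (B.e i) (B.b (i + 1) l (m + 1)),
        B.leftMap_mem_filt _ (B.d₁_cell_sub_mem s (LArrow.R i) _), ?_, ?_⟩
      · dsimp only [ends_src_arrow, ends_tgt_arrow, LArrow.src_R, LArrow.tgt_R]
        rw [B.smul_h₁_R s hA, if_neg hT, Nat.add_sub_cancel]
        have := B.d₂_cell_sub_mem s i (B.b i l m)
        rwa [B.arrow_mul_b (j := i) (i := i + 1) (Or.inr rfl), if_pos hS,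
          B.arrow_mul_b (j := i) (i := i - 1) (by unfold Neighbor; omega), if_pos hS,
          B.b_eq_zero hB, map_zero, smul_zero, sub_zero] at this
      · dsimp only [ends_src_arrow, ends_tgt_arrow, LArrow.src_R, LArrow.tgt_R,
          LinearMap.toAddMonoidHom_coe, arr]
        rw [B.arrow_mul_b (Or.inl rfl), if_pos hA, map_neg, map_zsmul, leftMap_h₀_cell, if_neg hT,
          smul_zero, neg_zero, add_zero]
  · have hB : ValidPath n (i - 1) l m := h
    by_cases hi : n ≤ i
    · refine ⟨_, 0, B.leftMap_mem_filt _ (B.d₁_cell_sub_mem s (LArrow.L i) _), ?_, ?_⟩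
      · dsimp only [ends_src_arrow, LArrow.src_L]
        rw [B.e_eq_zero hi, zero_bim_smul, map_zero, sub_zero]
        exact zero_mem _
      · dsimp only [ends_src_arrow, LArrow.src_L, LinearMap.toAddMonoidHom_coe]
        rw [B.e_eq_zero hi]
        simp only [map_zero, LinearMap.zero_apply, smul_zero, neg_zero, add_zero]
    rw [not_le] at hi
    by_cases hT : ValidPath n i l (m + 1)
    · by_cases hA : ValidPath n (i + 1) l m
      -- The word starts to the left although its normal form starts to the right: `d₂` exchanges
      -- the two, and `h₀` recovers the second.
      · obtain ⟨m, rfl⟩ : ∃ m', m = m' + 1 := ⟨m - 1, by unfold ValidPath at *; omega⟩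
        have hS : ValidPath n i l m := by unfold ValidPath at *; omega
        refine ⟨_, B.cell (LArrow.L i) (B.e i) (B.b (i - 1) l (m + 1)) -
            (LArrow.L i).sign s • B.cell (LArrow.R i) (B.e i) (B.b (i + 1) l (m + 1)),
          B.leftMap_mem_filt _ (B.d₁_cell_sub_mem s (LArrow.L i) _), ?_, ?_⟩
        · dsimp only [ends_src_arrow, ends_tgt_arrow, LArrow.src_L, LArrow.tgt_L]
          rw [B.smul_h₁_L s hB, if_neg fun h => h.2 hA, Nat.add_sub_cancel]
          have := B.d₂_cell_sub_mem s i (B.b i l m)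
          rw [B.arrow_mul_b (j := i) (i := i + 1) (Or.inr rfl), if_pos hS,
            B.arrow_mul_b (j := i) (i := i - 1) (by unfold Neighbor; omega), if_pos hS] at this
          have h2 := neg_mem (Submodule.smul_of_tower_mem _ ((LArrow.L i).sign s) this)
          rw [smul_sub, smul_sub, smul_smul, LArrow.sign_mul_sign hs, one_smul] at h2
          rw [map_neg, map_zsmul]
          convert h2 using 1
          abel
        · dsimp only [ends_src_arrow, ends_tgt_arrow, LArrow.src_L, LArrow.tgt_L,
            LinearMap.toAddMonoidHom_coe, arr]
          rw [B.arrow_mul_b (by unfold Neighbor; omega), if_pos hB, map_neg, map_zsmul,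
            leftMap_h₀_cell, if_pos hT, if_pos hA, smul_neg, neg_neg, sub_add_cancel]
      · refine ⟨_, 0, B.leftMap_mem_filt _ (B.d₁_cell_sub_mem s (LArrow.L i) _), ?_, ?_⟩
        · dsimp only [ends_src_arrow, ends_tgt_arrow, LArrow.src_L, LArrow.tgt_L]
          rw [B.smul_h₁_L s hB, if_pos ⟨hT, hA⟩, map_zero, sub_zero]
          exact zero_mem _
        · dsimp only [ends_src_arrow, ends_tgt_arrow, LArrow.src_L, LArrow.tgt_L,
            LinearMap.toAddMonoidHom_coe, arr]
          rw [B.arrow_mul_b (by unfold Neighbor; omega), if_pos hB, map_neg, map_zsmul,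
            leftMap_h₀_cell, if_pos hT, if_neg hA, smul_neg, neg_neg, smul_smul,
            LArrow.sign_mul_sign hs, one_smul, zero_add]
    · obtain ⟨m, rfl⟩ : ∃ m', m = m' + 1 := ⟨m - 1, by unfold ValidPath at *; omega⟩
      have hS : ValidPath n i l m := by unfold ValidPath at *; omega
      have hA : ¬ ValidPath n (i + 1) l (m + 1) := by unfold ValidPath at *; omega
      refine ⟨_, B.cell (LArrow.L i) (B.e i) (B.b (i - 1) l (m + 1)),
        B.leftMap_mem_filt _ (B.d₁_cell_sub_mem s (LArrow.L i) _), ?_, ?_⟩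
      · dsimp only [ends_src_arrow, ends_tgt_arrow, LArrow.src_L, LArrow.tgt_L]
        rw [B.smul_h₁_L s hB, if_neg fun h => hT h.1, Nat.add_sub_cancel]
        have := B.d₂_cell_sub_mem s i (B.b i l m)
        rw [B.arrow_mul_b (j := i) (i := i + 1) (Or.inr rfl), if_pos hS,
          B.arrow_mul_b (j := i) (i := i - 1) (by unfold Neighbor; omega), if_pos hS,
          B.b_eq_zero hA, map_zero, zero_sub] at this
        have h2 := neg_mem (Submodule.smul_of_tower_mem _ ((LArrow.L i).sign s) this)
        rw [smul_sub, smul_neg, smul_smul, LArrow.sign_mul_sign hs, one_smul] at h2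
        rw [map_neg, map_zsmul]
        convert h2 using 1
        abel
      · dsimp only [ends_src_arrow, ends_tgt_arrow, LArrow.src_L, LArrow.tgt_L,
          LinearMap.toAddMonoidHom_coe, arr]
        rw [B.arrow_mul_b (by unfold Neighbor; omega), if_pos hB, map_neg, map_zsmul,
          leftMap_h₀_cell, if_neg hT, smul_zero, neg_zero, add_zero]

-- The leading term of `d₂` on a cell is a difference of a cell on `R i` and one on `L i`. Exactly
-- one of them is sent back to the original cell by `h₁`, except for the socle path at `i`: neither
-- extension of it exists, and it comes from `d₃` through `h₂`.
set_option maxHeartbeats 1000000 in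
theorem exact_d₃_d₂ {s : ℤ} (hs : s * s = 1) : Function.Exact (B.d₃ s) (B.d₂ s) := by
  refine B.exact_of_homotopy (B.d₂_comp_d₃ hs) B.h₂ (B.leftMap (B.h₁ s)).toAddMonoidHom
    (fun p x => B.leftMap_smul _ p x) fun i l m h => ?_
  change ValidPath n i l m at h
  have hR : ∀ q, B.leftMap (B.h₁ s) (B.cell (LArrow.R i) (B.e i) q) =
      (bim (B.e i) 1 : Λ ⊗[K] Λᵐᵒᵖ) • B.h₁ s (LArrow.R i) (B.e (i + 1) * q) := fun q => by
    rw [leftMap_cell]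
    dsimp only [ends_src_arrow, ends_tgt_arrow, LArrow.src_R, LArrow.tgt_R]
    rw [e_mul_e]
  have hL : ∀ q, B.leftMap (B.h₁ s) (B.cell (LArrow.L i) (B.e i) q) =
      (bim (B.e i) 1 : Λ ⊗[K] Λᵐᵒᵖ) • B.h₁ s (LArrow.L i) (B.e (i - 1) * q) := fun q => by
    rw [leftMap_cell]
    dsimp only [ends_src_arrow, ends_tgt_arrow, LArrow.src_L, LArrow.tgt_L]
    rw [e_mul_e]
  have hR' : B.leftMap (B.h₁ s) (B.cell (LArrow.R i) (B.e i) (B.b (i + 1) l (m + 1))) =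
      if ValidPath n (i + 1) l (m + 1) ∧ ¬ ValidPath n i l (m + 2) then
        B.cell i (B.e i) (B.b i l m) else 0 := by
    rw [hR, e_mul_b]
    by_cases hA : ValidPath n (i + 1) l (m + 1)
    · rw [B.smul_h₁_R s hA, Nat.add_sub_cancel, ← ite_not]
      exact if_congr (by simp [hA]) rfl rfl
    · rw [B.b_eq_zero hA, map_zero, smul_zero, if_neg fun h => hA h.1]
  have hL' : (LArrow.L i).sign s • B.leftMap (B.h₁ s)
        (B.cell (LArrow.L i) (B.e i) (B.b (i - 1) l (m + 1))) =
      if ValidPath n (i - 1) l (m + 1) ∧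
        ¬ (ValidPath n i l (m + 2) ∧ ¬ ValidPath n (i + 1) l (m + 1)) then
        -B.cell i (B.e i) (B.b i l m) else 0 := by
    rw [hL, e_mul_b]
    by_cases hB : ValidPath n (i - 1) l (m + 1)
    · rw [B.smul_h₁_L s hB, Nat.add_sub_cancel, ← ite_not, smul_ite, smul_neg, smul_smul,
        LArrow.sign_mul_sign hs, one_smul, smul_zero]
      exact if_congr (by simp [hB]) rfl rfl
    · rw [B.b_eq_zero hB, map_zero, smul_zero, smul_zero, if_neg fun h => hB h.1]
  refine ⟨_, if l = i ∧ m = 2 * n - 1 then B.cell i (B.e i) (B.b i l m) else 0,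
    B.leftMap_mem_filt _ (B.d₂_cell_sub_mem s i _), ?_, ?_⟩
  · dsimp only [ends_src_nat, ends_tgt_nat]
    rw [h₂, lin_b _ _ h]
    split_ifs with hc
    · obtain ⟨rfl, rfl⟩ := hc
      rw [bim_smul_cell, e_mul_e, mul_one]
      have := B.d₃_cell_sub_mem s l (B.e l)
      rwa [b_mul_e] at this
    · rw [smul_zero, map_zero, sub_zero]
      exact zero_mem _
  · dsimp only [ends_src_nat, ends_tgt_nat, LinearMap.toAddMonoidHom_coe]
    rw [B.arrow_mul_b (j := i) (i := i + 1) (Or.inr rfl), if_pos h,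
      B.arrow_mul_b (j := i) (i := i - 1) (by unfold Neighbor; omega), if_pos h,
      map_sub, map_zsmul, hR', hL']
    clear hR hL hR' hL'
    by_cases hc : l = i ∧ m = 2 * n - 1
    · have hA : ¬ ValidPath n (i + 1) l (m + 1) := by unfold ValidPath; omega
      have hB : ¬ ValidPath n (i - 1) l (m + 1) := by unfold ValidPath; omega
      rw [if_pos hc, if_neg fun h => hA h.1, if_neg fun h => hB h.1, sub_zero, add_zero]
    rw [if_neg hc, zero_add]
    by_cases hA : ValidPath n (i + 1) l (m + 1)
    · by_cases hB : ValidPath n (i - 1) l (m + 1)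
      · have hT : ValidPath n i l (m + 2) := by
          clear hc
          unfold ValidPath at *
          rcases h with h | h <;> omega
        rw [if_neg fun h => h.2 hT, if_pos ⟨hB, fun h => h.2 hA⟩, sub_neg_eq_add, zero_add]
      · have hT : ¬ ValidPath n i l (m + 2) := by
          clear hc
          unfold ValidPath at *
          rcases h with h | h <;> omega
        rw [if_pos ⟨hA, hT⟩, if_neg fun h => hB h.1, sub_zero]
    · have hT : ¬ ValidPath n i l (m + 2) := by
        unfold ValidPath at *
        rcases h with h | h <;> omega
      have hB : ValidPath n (i - 1) l (m + 1) := by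
        clear hT
        unfold ValidPath at *
        rcases Nat.eq_zero_or_pos i with rfl | hi <;> rcases h with h | h <;> omega
      rw [if_neg fun h => hA h.1, if_pos ⟨hB, fun h => hT h.1⟩, sub_neg_eq_add, zero_add]

end PathBasis

end

noncomputable section

variable {K Λ : Type u} [Field K] [Ring Λ] [Algebra K Λ] {n : ℕ}

/-! ### The bimodule resolution -/

/-- The generators of the terms of the bimodule resolution. -/
def Gens : ℕ → Type
  | 0 => ℕ
  | 1 => LArrow
  | 2 => ℕ
  | 3 => ℕ
  | 4 => LArrow
  | 5 => ℕ
  | m + 6 => Gens m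

instance instEndsGens : ∀ m, Ends (Gens m)
  | 0 => inferInstanceAs (Ends ℕ)
  | 1 => inferInstanceAs (Ends LArrow)
  | 2 => inferInstanceAs (Ends ℕ)
  | 3 => inferInstanceAs (Ends ℕ)
  | 4 => inferInstanceAs (Ends LArrow)
  | 5 => inferInstanceAs (Ends ℕ)
  | m + 6 => instEndsGens m

namespace PathBasis

variable (B : PathBasis K Λ n)

/-- The differentials of the bimodule resolution. -/
def resD : ∀ m, B.Bimod (Gens (m + 1)) →ₗ[Λ ⊗[K] Λᵐᵒᵖ] B.Bimod (Gens m)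
  | 0 => B.d₁ 1
  | 1 => B.d₂ 1
  | 2 => B.d₃ 1
  | 3 => B.d₁ (-1)
  | 4 => B.d₂ (-1)
  | 5 => B.d₃ (-1)
  | m + 6 => resD m

lemma _root_.Nat.six_induction {p : ℕ → Prop} (h0 : p 0) (h1 : p 1) (h2 : p 2) (h3 : p 3)
    (h4 : p 4) (h5 : p 5) (h6 : ∀ m, p m → p (m + 6)) : ∀ m, p m
  | 0 => h0
  | 1 => h1
  | 2 => h2
  | 3 => h3
  | 4 => h4
  | 5 => h5
  | m + 6 => h6 m (Nat.six_induction h0 h1 h2 h3 h4 h5 h6 m)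

lemma exact_resD : ∀ m, Function.Exact (B.resD (m + 1)) (B.resD m) :=
  Nat.six_induction (B.exact_d₂_d₁ (s := 1) (by norm_num)) (B.exact_d₃_d₂ (s := 1) (by norm_num))
    (B.exact_d₁_d₃ (s := 1) (by norm_num)) (B.exact_d₂_d₁ (s := -1) (by norm_num))
    (B.exact_d₃_d₂ (s := -1) (by norm_num))
    (by
      have := B.exact_d₁_d₃ (s := -1) (by norm_num)
      rw [neg_neg] at this
      exact this) fun m h => h

lemma aug_surjective : Function.Surjective B.aug := by
  intro q
  refine ⟨∑ l ∈ Finset.range n, B.cell l q (B.e l), ?_⟩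
  rw [map_sum]
  refine (Finset.sum_congr rfl fun l _ => ?_).trans
    ((Finset.mul_sum (Finset.range n) B.e q).symm.trans ?_)
  · rw [map_cell, aug_gen, bimodule_smul, mul_assoc, e_mul_e]
  · exact (congrArg (q * ·) B.sum_b).trans (mul_one q)

/-- The bimodule resolution. -/
def res : BimoduleResolution K Λ where
  P m := ModuleCat.of _ (B.Bimod (Gens m))
  d := B.resD
  ε := B.aug
  projective m := by
    have : Module.Projective (Λ ⊗[K] Λᵐᵒᵖ) (B.Bimod (Gens m)) := inferInstance
    exact (IsProjective.iff_projective (R := Λ ⊗[K] Λᵐᵒᵖ) (B.Bimod (Gens m))).1 this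
  ε_surjective := B.aug_surjective
  exact_zero := B.exact_d₁_aug
  exact_succ := B.exact_resD

/-! ### The Euler operator -/

/-- The Euler derivation, which multiplies a path by its length. -/
def deg : Λ →ₗ[K] Λ := B.lin fun i j d => (d : K) • B.b i j d

lemma deg_b (i j d : ℕ) : B.deg (B.b i j d) = (d : K) • B.b i j d := by
  by_cases h : ValidPath n i j d
  · rw [deg, lin_b _ _ h]
  · rw [B.b_eq_zero h, map_zero, smul_zero]

lemma deg_e (i : ℕ) : B.deg (B.e i) = 0 := by
  rw [e, deg_b, Nat.cast_zero, zero_smul]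

lemma deg_mul (p q : Λ) : B.deg (p * q) = B.deg p * q + p * B.deg q := by
  have : (LinearMap.mul K Λ).compr₂ B.deg =
      (LinearMap.mul K Λ).comp B.deg + (LinearMap.mul K Λ).compl₂ B.deg := by
    refine B.linearMap_ext fun i j d h => B.linearMap_ext fun k l m h' => ?_
    simp only [LinearMap.compr₂_apply, LinearMap.mul_apply', LinearMap.add_apply,
      LinearMap.comp_apply, LinearMap.compl₂_apply, deg_b]
    rw [smul_mul_assoc, mul_smul_comm, b_mul]
    split_ifs
    · rw [deg_b, Nat.cast_add, add_smul]
    · rw [map_zero, smul_zero, smul_zero, add_zero]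
  exact DFunLike.congr_fun (DFunLike.congr_fun this p) q

section Euler

open Ends

variable {G : Type} [Ends G]

/-- The Euler operator, which multiplies a path by the length of its left factor. -/
def euler (G : Type) [Ends G] : B.Bimod G →ₗ[K] B.Bimod G :=
  Finsupp.lsum K (fun g => TensorProduct.lift
    (((B.cell g).comp B.deg).compl₂ (MulOpposite.opLinearEquiv K).symm.toLinearMap)) ∘ₗ
    (IdemModule.incl (B.idem (G := G))).restrictScalars K

lemma euler_cell (g : G) (p q : Λ) :
    B.euler G (B.cell g p q) = B.cell g (B.deg p) q := by
  have : IdemModule.incl (B.idem (G := G)) (B.cell g p q) =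
      Finsupp.single g (bim (p * B.e (src g)) (B.e (tgt g) * q)) := by
    rw [cell_apply, map_smul]
    refine (congrArg _ (IdemModule.incl_gen B.idem_mul_idem g)).trans ?_
    rw [Finsupp.smul_single, idem, smul_eq_mul, bim_mul_bim]
  rw [euler, LinearMap.comp_apply, LinearMap.restrictScalars_apply, this,
    Finsupp.lsum_single]
  refine Eq.trans (b := B.cell g (B.deg (p * B.e (src g))) (B.e (tgt g) * q)) rfl ?_
  rw [deg_mul, deg_e, mul_zero, add_zero, ← cell_e]

/-- The failure of the Euler operator to be bimodule linear is the same on all bimodules, so it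
cancels in commutators with bimodule maps. -/
lemma euler_smul (p q : Λ) (x : B.Bimod G) : B.euler G ((bim p q : Λ ⊗[K] Λᵐᵒᵖ) • x) =
    (bim (B.deg p) q : Λ ⊗[K] Λᵐᵒᵖ) • x + (bim p q : Λ ⊗[K] Λᵐᵒᵖ) • B.euler G x := by
  refine DFunLike.congr_fun (B.addHom_ext
    (f := (B.euler G).toAddMonoidHom.comp (DistribSMul.toAddMonoidHom _ (bim p q : Λ ⊗[K] Λᵐᵒᵖ)))
    (f' := DistribSMul.toAddMonoidHom _ (bim (B.deg p) q : Λ ⊗[K] Λᵐᵒᵖ) +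
      (DistribSMul.toAddMonoidHom _ (bim p q : Λ ⊗[K] Λᵐᵒᵖ)).comp
      (B.euler G).toAddMonoidHom) fun g p' q' => ?_) x
  change B.euler G ((bim p q : Λ ⊗[K] Λᵐᵒᵖ) • _) = (bim (B.deg p) q : Λ ⊗[K] Λᵐᵒᵖ) • _ +
    (bim p q : Λ ⊗[K] Λᵐᵒᵖ) • B.euler G _
  rw [bim_smul_cell, euler_cell, euler_cell, bim_smul_cell, bim_smul_cell, deg_mul, map_add,
    LinearMap.add_apply]

/-- The commutator of a bimodule map with the Euler operators. -/
def eulerComm {G G' : Type} [Ends G] [Ends G']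
    (f : B.Bimod G →ₗ[Λ ⊗[K] Λᵐᵒᵖ] B.Bimod G') : B.Bimod G →ₗ[Λ ⊗[K] Λᵐᵒᵖ] B.Bimod G' where
  toFun x := B.euler G' (f x) - f (B.euler G x)
  map_add' x y := by simp only [map_add]; abel
  map_smul' r x := by
    rw [RingHom.id_apply]
    induction r using TensorProduct.induction_on with
    | zero =>
      have h0 := zero_smul (Λ ⊗[K] Λᵐᵒᵖ) x
      have h1 := zero_smul (Λ ⊗[K] Λᵐᵒᵖ) (B.euler G' (f x) - f (B.euler G x))
      refine Eq.trans ?_ h1.symm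
      refine (congrArg (fun y => B.euler G' (f y) - f (B.euler G y)) h0).trans ?_
      simp only [map_zero, sub_zero]
    | tmul p q =>
      have h := B.euler_smul p q.unop x
      have h' := B.euler_smul p q.unop (f x)
      change B.euler G' (f ((bim p q.unop : Λ ⊗[K] Λᵐᵒᵖ) • x)) -
        f (B.euler G ((bim p q.unop : Λ ⊗[K] Λᵐᵒᵖ) • x)) = (bim p q.unop : Λ ⊗[K] Λᵐᵒᵖ) • _
      rw [h, map_smul, h', map_add, map_smul, map_smul, smul_sub]
      abel
    | add a b ha hb =>
      rw [add_smul, add_smul, ← ha, ← hb]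
      simp only [map_add]
      abel

lemma eulerComm_apply {G G' : Type} [Ends G] [Ends G']
    (f : B.Bimod G →ₗ[Λ ⊗[K] Λᵐᵒᵖ] B.Bimod G') (x : B.Bimod G) :
    B.eulerComm f x = B.euler G' (f x) - f (B.euler G x) := rfl

end Euler

end PathBasis

end

/-! ### Cochains, their classes, and products with `h`, `y` and central elements. -/

noncomputable section

variable {K Λ : Type u} [Field K] [Ring Λ] [Algebra K Λ] {n : ℕ}

namespace BimoduleResolution

variable {X : BimoduleResolution K Λ} {i j : ℕ}

lemma hc_zero (i : ℕ) : hc (X := X) i 0 = 0 := by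
  have h : (0 : X.P i →ₗ[Λ ⊗[K] Λᵐᵒᵖ] Λ) ∘ₗ X.d i = 0 := LinearMap.zero_comp _
  have := hc_add h h
  rwa [add_zero, left_eq_add] at this

lemma hc_neg {f : X.P i →ₗ[Λ ⊗[K] Λᵐᵒᵖ] Λ} (hf : f ∘ₗ X.d i = 0) : hc i (-f) = -hc i f := by
  have h : (-f) ∘ₗ X.d i = 0 := by rw [LinearMap.neg_comp, hf, neg_zero]
  have := hc_add hf h
  rw [add_neg_cancel, hc_zero] at this
  exact (neg_eq_of_add_eq_zero_right this.symm).symm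

lemma hc_sub {f g : X.P i →ₗ[Λ ⊗[K] Λᵐᵒᵖ] Λ} (hf : f ∘ₗ X.d i = 0) (hg : g ∘ₗ X.d i = 0) :
    hc i (f - g) = hc i f - hc i g := by
  have h : (-g) ∘ₗ X.d i = 0 := by rw [LinearMap.neg_comp, hg, neg_zero]
  rw [sub_eq_add_neg, hc_add hf h, hc_neg hg, sub_eq_add_neg]

lemma hc_eq_of_sub_eq {f g : X.P (i + 1) →ₗ[Λ ⊗[K] Λᵐᵒᵖ] Λ} (hf : f ∘ₗ X.d (i + 1) = 0)
    (φ : X.P i →ₗ[Λ ⊗[K] Λᵐᵒᵖ] Λ) (h : f - g = φ ∘ₗ X.d i) : hc (i + 1) f = hc (i + 1) g := by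
  have hφ : (φ ∘ₗ X.d i) ∘ₗ X.d (i + 1) = 0 := by
    rw [LinearMap.comp_assoc, d_comp_d, LinearMap.comp_zero]
  have hg : g ∘ₗ X.d (i + 1) = 0 := by
    have : g = f - φ ∘ₗ X.d i := by rw [← h, sub_sub_cancel]
    rw [this, LinearMap.sub_comp, hf, hφ, sub_zero]
  rw [← sub_eq_zero, ← hc_sub hf hg, hc_succ_eq_zero_iff (by rw [h, hφ])]
  exact ⟨φ, h⟩

lemma hc_cast {a b : ℕ} (h : a = b) (f : X.P b →ₗ[Λ ⊗[K] Λᵐᵒᵖ] Λ) :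
    hc a (f ∘ₗ X.cast h) = hc b f := by
  subst h
  rfl

lemma comp_cast_comp_d {a b : ℕ} (h : a = b) {f : X.P b →ₗ[Λ ⊗[K] Λᵐᵒᵖ] Λ} (hf : f ∘ₗ X.d b = 0) :
    (f ∘ₗ X.cast h) ∘ₗ X.d a = 0 := by
  subst h
  exact hf

lemma d_comp_cast {a b : ℕ} (h : a = b) (h' : a + 1 = b + 1) :
    X.cast h ∘ₗ X.d a = X.d b ∘ₗ X.cast h' := by
  subst h
  rfl

lemma cast_comp_cast {a b c : ℕ} (h : a = b) (h' : b = c) :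
    X.cast h' ∘ₗ X.cast h = X.cast (h.trans h') := by
  subst h h'
  rfl

/-- Products of a class of degree one with the class of `f`, by means of a partial lift. -/
lemma hc_one_mul_hc {g : X.P i →ₗ[Λ ⊗[K] Λᵐᵒᵖ] Λ} (hg : g ∘ₗ X.d i = 0)
    {f : X.P 1 →ₗ[Λ ⊗[K] Λᵐᵒᵖ] Λ} (hf : f ∘ₗ X.d 1 = 0)
    (F₀ : X.P i →ₗ[Λ ⊗[K] Λᵐᵒᵖ] X.P 0) (F₁ : X.P (i + 1) →ₗ[Λ ⊗[K] Λᵐᵒᵖ] X.P 1)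
    (h0 : X.ε ∘ₗ F₀ = g) (h1 : X.d 0 ∘ₗ F₁ = F₀ ∘ₗ X.d i)
    (hc' : (f ∘ₗ F₁) ∘ₗ X.d (i + 1) = 0) :
    hc 1 f * hc i g = hc (i + 1) (f ∘ₗ F₁) := by
  -- For a left factor of degree one only the components `0` and `1` of the lift matter; the others
  -- are set to zero.
  have h := hc_mul_hc hg hf (fun m => match m with
    | 0 => F₀ ∘ₗ X.cast (zero_add i)
    | 1 => F₁ ∘ₗ X.cast (add_comm 1 i)
    | _ => 0) (by
      change X.ε ∘ₗ F₀ ∘ₗ X.cast (zero_add i) = _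
      rw [← LinearMap.comp_assoc, h0]) (by
      intro m hm
      obtain rfl : m = 0 := by omega
      change X.d 0 ∘ₗ F₁ ∘ₗ X.cast (add_comm 1 i) =
        (F₀ ∘ₗ X.cast (zero_add i)) ∘ₗ X.d (0 + i) ∘ₗ X.cast _
      rw [← LinearMap.comp_assoc, h1, LinearMap.comp_assoc, LinearMap.comp_assoc,
        ← LinearMap.comp_assoc (X.cast _) (X.d (0 + i)) (X.cast (zero_add i)),
        d_comp_cast (zero_add i) (by omega), LinearMap.comp_assoc, cast_comp_cast]) (by
      exact comp_cast_comp_d (add_comm 1 i) hc')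
  refine h.trans ?_
  exact hc_cast (add_comm 1 i) (f ∘ₗ F₁)

end BimoduleResolution

instance : IsScalarTower K (Λ ⊗[K] Λᵐᵒᵖ) Λ :=
  ⟨fun r a m => by
    rw [Algebra.smul_def r a, mul_smul]
    exact BimoduleResolution.scalar_apply r (a • m)⟩

variable (K) in
/-- Left multiplication by a central element, on a bimodule. -/
def centralMul (M : Type*) [AddCommGroup M] [Module (Λ ⊗[K] Λᵐᵒᵖ) M] (z : Λ)
    (hz : ∀ p, z * p = p * z) : M →ₗ[Λ ⊗[K] Λᵐᵒᵖ] M where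
  toFun x := (bim z 1 : Λ ⊗[K] Λᵐᵒᵖ) • x
  map_add' x y := smul_add _ x y
  map_smul' r x := by
    rw [RingHom.id_apply, smul_smul, smul_smul]
    congr 1
    induction r using TensorProduct.induction_on with
    | zero => exact (mul_zero _).trans (zero_mul _).symm
    | tmul p q =>
      have h := bim_mul_bim (K := K) z 1 p q.unop
      have h' := bim_mul_bim (K := K) p q.unop z 1
      rw [hz, mul_one] at h
      rw [one_mul] at h'
      exact h.trans h'.symm
    | add a b ha hb => rw [mul_add, add_mul, ha, hb]

lemma centralMul_apply {M : Type*} [AddCommGroup M] [Module (Λ ⊗[K] Λᵐᵒᵖ) M] (z : Λ)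
    (hz : ∀ p, z * p = p * z) (x : M) :
    centralMul K M z hz x = (bim z 1 : Λ ⊗[K] Λᵐᵒᵖ) • x := rfl

lemma comp_centralMul {M M' : Type*} [AddCommGroup M] [Module (Λ ⊗[K] Λᵐᵒᵖ) M]
    [AddCommGroup M'] [Module (Λ ⊗[K] Λᵐᵒᵖ) M'] (z : Λ) (hz : ∀ p, z * p = p * z)
    (f : M →ₗ[Λ ⊗[K] Λᵐᵒᵖ] M') : f ∘ₗ centralMul K M z hz = centralMul K M' z hz ∘ₗ f := by
  ext x
  exact map_smul f _ x

namespace PathBasis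

variable (B : PathBasis K Λ n)

open BimoduleResolution

/-- The cochains of the resolution. -/
abbrev Cochain (m : ℕ) : Type u := B.Bimod (Gens m) →ₗ[Λ ⊗[K] Λᵐᵒᵖ] Λ

/-- The augmentation of the resolution. -/
def augCo : B.Cochain 0 := B.aug

/-- The class `h`, given by the augmentation in degree six. -/
def hCo : B.Cochain 6 := B.aug

/-- The class of a cochain, zero unless it is a cocycle. -/
def cl (m : ℕ) (f : B.Cochain m) : HochschildCohomology K Λ := hc (X := B.res) m f

/-- The identification of equal terms of the resolution. -/
def resCast {a b : ℕ} (h : a = b) : B.Bimod (Gens a) →ₗ[Λ ⊗[K] Λᵐᵒᵖ] B.Bimod (Gens b) :=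
  B.res.cast h

section

variable {B} {i j : ℕ}

lemma cl_zero (i : ℕ) : B.cl i 0 = 0 := hc_zero i

lemma cl_add {f g : B.Cochain i} (hf : f ∘ₗ B.resD i = 0) (hg : g ∘ₗ B.resD i = 0) :
    B.cl i (f + g) = B.cl i f + B.cl i g := hc_add (X := B.res) hf hg

lemma cl_smul (r : K) {f : B.Cochain i} (hf : f ∘ₗ B.resD i = 0) :
    B.cl i (r • f) = r • B.cl i f := by
  have h := hc_smul (X := B.res) r hf
  refine Eq.trans ?_ h
  refine congrArg (B.cl i) (LinearMap.ext fun x => ?_)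
  exact (scalar_apply r (f x)).symm

lemma cl_eq_of_sub_eq {f g : B.Cochain (i + 1)} (hf : f ∘ₗ B.resD (i + 1) = 0) (φ : B.Cochain i)
    (h : f - g = φ ∘ₗ B.resD i) : B.cl (i + 1) f = B.cl (i + 1) g :=
  hc_eq_of_sub_eq (X := B.res) hf φ h

lemma cl_succ_eq_zero_iff {f : B.Cochain (i + 1)} (hf : f ∘ₗ B.resD (i + 1) = 0) :
    B.cl (i + 1) f = 0 ↔ ∃ g : B.Cochain i, f = g ∘ₗ B.resD i :=
  hc_succ_eq_zero_iff (X := B.res) hf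

lemma cl_zero_eq_zero_iff {f : B.Cochain 0} (hf : f ∘ₗ B.resD 0 = 0) :
    B.cl 0 f = 0 ↔ f = 0 :=
  hc_zero_eq_zero_iff (X := B.res) hf

lemma cl_mem (i : ℕ) (f : B.Cochain i) : B.cl i f ∈ HochschildCohomology.component K Λ i := by
  by_cases hf : f ∘ₗ B.resD i = 0
  · exact ⟨_, (hc_of_cocycle (X := B.res) hf).symm⟩
  · have : B.cl i f = 0 := dif_neg hf
    rw [this]
    exact zero_mem _

variable (B) in
lemma exists_cl_eq {x : HochschildCohomology K Λ} (hx : x ∈ HochschildCohomology.component K Λ i) :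
    ∃ f : B.Cochain i, f ∘ₗ B.resD i = 0 ∧ B.cl i f = x := by
  obtain ⟨x, rfl⟩ := hx
  exact B.res.exists_hc_eq x

variable (B) in
lemma resD_comp_resD (i : ℕ) : B.resD i ∘ₗ B.resD (i + 1) = 0 := B.res.d_comp_d i

variable (B) in
lemma resD_resD (i : ℕ) (x) : B.resD i (B.resD (i + 1) x) = 0 :=
  DFunLike.congr_fun (B.resD_comp_resD i) x

lemma cl_comp_resD (f : B.Cochain i) : B.cl (i + 1) (f ∘ₗ B.resD i) = 0 := by
  rw [cl_succ_eq_zero_iff]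
  · exact ⟨f, rfl⟩
  · rw [LinearMap.comp_assoc, resD_comp_resD, LinearMap.comp_zero]

variable (B) in
lemma augCo_comp : B.augCo ∘ₗ B.resD 0 = 0 := B.aug_comp_d₁

variable (B) in
lemma hCo_comp : B.hCo ∘ₗ B.resD 6 = 0 := B.aug_comp_d₁

lemma cl_one : B.cl 0 B.augCo = 1 := hc_one (X := B.res)

/-- The product of two classes, by means of a lift to a chain map. -/
lemma cl_mul_cl {g : B.Cochain j} (hg : g ∘ₗ B.resD j = 0) {f : B.Cochain i}
    (hf : f ∘ₗ B.resD i = 0)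
    (G : ∀ m, B.Bimod (Gens (m + j)) →ₗ[Λ ⊗[K] Λᵐᵒᵖ] B.Bimod (Gens m))
    (h0 : B.augCo ∘ₗ G 0 = g ∘ₗ B.resCast (zero_add j))
    (hG : ∀ m < i, B.resD m ∘ₗ G (m + 1) =
      G m ∘ₗ B.resD (m + j) ∘ₗ B.resCast (by omega : m + 1 + j = m + j + 1))
    (hc' : (f ∘ₗ G i) ∘ₗ B.resD (i + j) = 0) :
    B.cl i f * B.cl j g = B.cl (i + j) (f ∘ₗ G i) :=
  hc_mul_hc (X := B.res) hg hf G h0 hG hc'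

/-- The cocycle of a central element. -/
def cen (B : PathBasis K Λ n) (z : Λ) (hz : ∀ p, z * p = p * z) : B.Cochain 0 :=
  centralMul K Λ z hz ∘ₗ B.augCo

lemma cen_comp (z : Λ) (hz : ∀ p, z * p = p * z) : B.cen z hz ∘ₗ B.resD 0 = 0 := by
  rw [cen, LinearMap.comp_assoc, augCo_comp, LinearMap.comp_zero]

lemma cl_cen_mul (z : Λ) (hz : ∀ p, z * p = p * z) {f : B.Cochain i} (hf : f ∘ₗ B.resD i = 0) :
    B.cl 0 (B.cen z hz) * B.cl i f = B.cl i (centralMul K Λ z hz ∘ₗ f) :=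
  hc_ε_mul (X := B.res) (centralMul K Λ z hz) hf

/-- Multiplication by `z` on all terms of the resolution is a chain map lifting `z`, since bimodule
maps commute with it. -/
lemma cl_mul_cen (z : Λ) (hz : ∀ p, z * p = p * z) {f : B.Cochain i} (hf : f ∘ₗ B.resD i = 0) :
    B.cl i f * B.cl 0 (B.cen z hz) = B.cl 0 (B.cen z hz) * B.cl i f := by
  rw [cl_cen_mul z hz hf, ← comp_centralMul]
  refine cl_mul_cl (i := i) (j := 0) (cen_comp z hz) hf
    (fun m => centralMul K (B.Bimod (Gens m)) z hz) ?_ ?_ ?_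
  · exact comp_centralMul z hz B.augCo
  · intro m _
    exact comp_centralMul z hz (B.resD m)
  · change (f ∘ₗ centralMul K _ z hz) ∘ₗ B.resD i = 0
    rw [comp_centralMul, LinearMap.comp_assoc, hf, LinearMap.comp_zero]

/-- Multiplication by `h` is the periodicity. -/
lemma cl_mul_h {f : B.Cochain i} (hf : f ∘ₗ B.resD i = 0) :
    B.cl i f * B.cl 6 B.hCo = B.cl (i + 6) f :=
  -- The resolution is literally periodic, so the augmentation in degree six is lifted by
  -- identities.
  cl_mul_cl (i := i) (j := 6) B.hCo_comp hf (fun _ => LinearMap.id) rfl (fun _ _ => rfl) hf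

variable (B) in
/-- The cocycle `y`, taking every arrow to itself. -/
def yCo : B.Cochain 1 := B.augCo ∘ₗ B.eulerComm (B.resD 0)

-- The Euler commutator of `d ∘ d = 0` vanishes. So, with alternating signs, the commutators with
-- the differentials form a chain map lowering the degree by one, and it lifts `y`.
variable (B) in
lemma resD_eulerComm (i : ℕ) (x) : B.resD i (B.eulerComm (B.resD (i + 1)) x) =
    -B.eulerComm (B.resD i) (B.resD (i + 1) x) := by
  rw [eulerComm_apply, eulerComm_apply, map_sub, resD_resD, resD_resD, map_zero]
  abel

lemma comp_eulerComm_apply {f : B.Cochain i} (hf : f ∘ₗ B.resD i = 0) (x) :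
    (f ∘ₗ B.eulerComm (B.resD i)) x = f (B.euler _ (B.resD i x)) := by
  rw [LinearMap.comp_apply, eulerComm_apply, map_sub, ← LinearMap.comp_apply f (B.resD i), hf,
    LinearMap.zero_apply, sub_zero]

lemma comp_eulerComm_cocycle {f : B.Cochain i} (hf : f ∘ₗ B.resD i = 0) :
    (f ∘ₗ B.eulerComm (B.resD i)) ∘ₗ B.resD (i + 1) = 0 := by
  ext x
  rw [LinearMap.comp_apply, comp_eulerComm_apply hf, resD_resD, map_zero, map_zero,
    LinearMap.zero_apply]

variable (B) in
lemma yCo_comp : B.yCo ∘ₗ B.resD 1 = 0 := comp_eulerComm_cocycle B.augCo_comp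

lemma cl_zsmul (z : ℤ) {f : B.Cochain i} (hf : f ∘ₗ B.resD i = 0) :
    B.cl i (z • f) = z • B.cl i f := by
  have h : z • f = (z : K) • f := (Int.cast_smul_eq_zsmul K z f).symm
  rw [h, cl_smul _ hf, Int.cast_smul_eq_zsmul]

lemma cl_mul_y {f : B.Cochain i} (hf : f ∘ₗ B.resD i = 0) :
    B.cl i f * B.cl 1 B.yCo = (-1 : ℤ) ^ i • B.cl (i + 1) (f ∘ₗ B.eulerComm (B.resD i)) := by
  have h := cl_mul_cl (i := i) (j := 1) B.yCo_comp hf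
    (fun m => (-1 : ℤ) ^ m • B.eulerComm (B.resD m)) ?_ ?_ ?_
  · rw [← cl_zsmul _ (comp_eulerComm_cocycle hf), h]
    refine congrArg (B.cl (i + 1)) (LinearMap.ext fun x => ?_)
    exact map_zsmul f _ _
  · rw [pow_zero, one_smul]
    rfl
  · intro m _
    refine LinearMap.ext fun x => ?_
    change B.resD m ((-1 : ℤ) ^ (m + 1) • B.eulerComm (B.resD (m + 1)) x) =
      (-1 : ℤ) ^ m • B.eulerComm (B.resD m) (B.resD (m + 1) x)
    rw [map_zsmul, resD_eulerComm, pow_succ, smul_neg, mul_neg_one, neg_smul, neg_neg]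
  · rw [LinearMap.comp_smul, LinearMap.smul_comp, comp_eulerComm_cocycle hf, smul_zero]

variable (B) in
lemma exists_lift {i : ℕ} {f : B.Cochain i} (hf : f ∘ₗ B.resD i = 0) :
    ∃ (F₀ : B.Bimod (Gens i) →ₗ[Λ ⊗[K] Λᵐᵒᵖ] B.Bimod (Gens 0))
      (F₁ : B.Bimod (Gens (i + 1)) →ₗ[Λ ⊗[K] Λᵐᵒᵖ] B.Bimod (Gens 1)),
      B.augCo ∘ₗ F₀ = f ∧ B.resD 0 ∘ₗ F₁ = F₀ ∘ₗ B.resD i := by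
  obtain ⟨F₀, hF₀⟩ := B.res.exists_lift B.augCo (0 : Λ →ₗ[Λ ⊗[K] Λᵐᵒᵖ] Λ)
    (fun x => ⟨fun _ => B.aug_surjective x, fun _ => rfl⟩) (i := i) f rfl
  let F₀' : B.Bimod (Gens i) →ₗ[Λ ⊗[K] Λᵐᵒᵖ] B.Bimod (Gens 0) := F₀
  have hF : B.augCo ∘ₗ F₀' = f := hF₀
  have h1 : B.augCo ∘ₗ (F₀' ∘ₗ B.resD i) = 0 := by
    rw [← LinearMap.comp_assoc, hF, hf]
  obtain ⟨F₁, hF₁⟩ := B.res.exists_lift (B.resD 0) B.augCo B.exact_d₁_aug (i := i + 1)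
    (F₀' ∘ₗ B.resD i) h1
  exact ⟨F₀', F₁, hF, hF₁⟩

lemma y_mul_cl {f : B.Cochain i} (hf : f ∘ₗ B.resD i = 0) :
    B.cl 1 B.yCo * B.cl i f = B.cl (i + 1) (f ∘ₗ B.eulerComm (B.resD i)) := by
  obtain ⟨F₀, F₁, h0, h1⟩ := B.exists_lift hf
  have hF₁ : ∀ x, B.resD 0 (F₁ x) = F₀ (B.resD i x) := fun x => DFunLike.congr_fun h1 x
  have hF₀ : ∀ x, B.augCo (F₀ x) = f x := fun x => DFunLike.congr_fun h0 x
  have key : (f ∘ₗ B.eulerComm (B.resD i)) - (B.yCo ∘ₗ F₁) =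
      (-(B.augCo ∘ₗ B.eulerComm F₀)) ∘ₗ B.resD i := by
    refine LinearMap.ext fun x => ?_
    rw [LinearMap.sub_apply, comp_eulerComm_apply hf, LinearMap.comp_apply, yCo,
      comp_eulerComm_apply B.augCo_comp, hF₁, LinearMap.comp_apply, LinearMap.neg_apply,
      LinearMap.comp_apply, eulerComm_apply, map_sub, hF₀]
    abel
  rw [cl_eq_of_sub_eq (comp_eulerComm_cocycle hf) _ key]
  refine hc_one_mul_hc (X := B.res) hf B.yCo_comp F₀ F₁ h0 h1 ?_
  have h3 : B.yCo ∘ₗ F₁ = (f ∘ₗ B.eulerComm (B.resD i)) -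
      (-(B.augCo ∘ₗ B.eulerComm F₀)) ∘ₗ B.resD i := by
    rw [← key, sub_sub_cancel]
  refine (congrArg (· ∘ₗ B.resD (i + 1)) h3).trans ?_
  rw [LinearMap.sub_comp, comp_eulerComm_cocycle hf, LinearMap.comp_assoc, resD_comp_resD,
    LinearMap.comp_zero, sub_zero]
  rfl

lemma y_mul_cl_eq {f : B.Cochain i} (hf : f ∘ₗ B.resD i = 0) :
    B.cl 1 B.yCo * B.cl i f = (-1 : ℤ) ^ i • (B.cl i f * B.cl 1 B.yCo) := by
  rw [cl_mul_y hf, y_mul_cl hf, smul_smul, ← mul_pow, neg_one_mul, neg_neg, one_pow, one_smul]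

end

end PathBasis

end

noncomputable section

variable {K Λ : Type u} [Field K] [Ring Λ] [Algebra K Λ] {n : ℕ}

namespace PathBasis

open Ends

variable (B : PathBasis K Λ n)

/-! ### Coefficients -/

lemma coef_e_mul_e (i j i' j' d : ℕ) (x : Λ) : B.coef i' j' d (B.e i * x * B.e j) =
    if i = i' ∧ j = j' then B.coef i' j' d x else 0 := by
  have : (B.coef i' j' d).comp ((LinearMap.mulRight K (B.e j)).comp (LinearMap.mulLeft K (B.e i))) =
      if i = i' ∧ j = j' then B.coef i' j' d else 0 := by
    refine B.linearMap_ext fun k l m h => ?_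
    simp only [LinearMap.comp_apply, LinearMap.mulLeft_apply, LinearMap.mulRight_apply]
    by_cases hk : i = k
    · by_cases hl : j = l
      · subst hk hl
        rw [e_mul_b, b_mul_e, coef_b]
        split_ifs with h1 h2 h2
        · rw [coef_b, if_pos h1]
        · exact absurd ⟨h1.1.1.symm, h1.1.2.1.symm⟩ h2
        · rw [coef_b, if_neg h1]
        · rfl
      · rw [mul_assoc, b_mul_e_of_ne B (Ne.symm hl), mul_zero, map_zero]
        split_ifs with h2
        · rw [coef_b, if_neg]; rintro ⟨⟨_, h4, _⟩, _⟩; exact hl (h2.2.trans h4)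
        · rfl
    · rw [e_mul_b_of_ne B hk, zero_mul, map_zero]
      split_ifs with h2
      · rw [coef_b, if_neg]; rintro ⟨⟨h3, _⟩, _⟩; exact hk (h2.1.trans h3)
      · rfl
  have h := DFunLike.congr_fun this x
  simp only [LinearMap.comp_apply, LinearMap.mulLeft_apply, LinearMap.mulRight_apply] at h
  rw [h]
  split_ifs <;> rfl

lemma coef_arrow_mul {i j : ℕ} (h : Neighbor i j) (l d : ℕ) (x : Λ) :
    B.coef i l (d + 1) (B.b i j 1 * x) =
      if ValidPath n i l (d + 1) then B.coef j l d x else 0 := by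
  have : (B.coef i l (d + 1)).comp (LinearMap.mulLeft K (B.b i j 1)) =
      if ValidPath n i l (d + 1) then B.coef j l d else 0 := by
    refine B.linearMap_ext fun k l' m hk => ?_
    rw [LinearMap.comp_apply, LinearMap.mulLeft_apply]
    by_cases hjk : j = k
    · subst hjk
      rw [B.arrow_mul_b h, if_pos hk, coef_b]
      split_ifs with h1 h2 h2
      · obtain ⟨⟨_, rfl, h3⟩, _⟩ := h1
        obtain rfl : d = m := by omega
        rw [coef_b, if_pos ⟨⟨rfl, rfl, rfl⟩, hk⟩]
      · exact absurd h1.2 h2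
      · rw [coef_b, if_neg]
        rintro ⟨⟨_, rfl, rfl⟩, _⟩
        exact h1 ⟨⟨rfl, rfl, rfl⟩, h2⟩
      · rfl
    · rw [B.b_mul_b_of_ne hjk, map_zero]
      split_ifs
      · rw [coef_b, if_neg]; rintro ⟨⟨h3, _⟩, _⟩; exact hjk h3
      · rfl
  have h' := DFunLike.congr_fun this x
  rw [LinearMap.comp_apply, LinearMap.mulLeft_apply] at h'
  rw [h']
  split_ifs <;> rfl

lemma coef_mul_arrow {j l : ℕ} (h : Neighbor j l) (i d : ℕ) (x : Λ) :
    B.coef i l (d + 1) (x * B.b j l 1) =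
      if ValidPath n i l (d + 1) then B.coef i j d x else 0 := by
  have : (B.coef i l (d + 1)).comp (LinearMap.mulRight K (B.b j l 1)) =
      if ValidPath n i l (d + 1) then B.coef i j d else 0 := by
    refine B.linearMap_ext fun k l' m hk => ?_
    rw [LinearMap.comp_apply, LinearMap.mulRight_apply]
    by_cases hjk : l' = j
    · subst hjk
      rw [B.b_mul_arrow h, if_pos hk, coef_b]
      split_ifs with h1 h2 h2
      · obtain ⟨⟨rfl, _, h3⟩, _⟩ := h1
        obtain rfl : d = m := by omega
        rw [coef_b, if_pos ⟨⟨rfl, rfl, rfl⟩, hk⟩]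
      · exact absurd h1.2 h2
      · rw [coef_b, if_neg]
        rintro ⟨⟨rfl, _, rfl⟩, _⟩
        exact h1 ⟨⟨rfl, rfl, rfl⟩, h2⟩
      · rfl
    · rw [B.b_mul_b_of_ne hjk, map_zero]
      split_ifs
      · rw [coef_b, if_neg]; rintro ⟨⟨_, h3, _⟩, _⟩; exact hjk h3.symm
      · rfl
  have h' := DFunLike.congr_fun this x
  rw [LinearMap.comp_apply, LinearMap.mulRight_apply] at h'
  rw [h']
  split_ifs <;> rfl

lemma coef_zero_arrow_mul (i j k l : ℕ) (x : Λ) :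
    B.coef k l 0 (B.b i j 1 * x) = 0 := by
  have : (B.coef k l 0).comp (LinearMap.mulLeft K (B.b i j 1)) = 0 := by
    refine B.linearMap_ext fun k l' m hk => ?_
    rw [LinearMap.comp_apply, LinearMap.mulLeft_apply, b_mul]
    split_ifs
    · rw [coef_b, if_neg]; · rfl
      rintro ⟨⟨_, _, h3⟩, _⟩; omega
    · rw [map_zero]; rfl
  exact DFunLike.congr_fun this x

lemma coef_zero_mul_arrow (i j k l : ℕ) (x : Λ) :
    B.coef k l 0 (x * B.b i j 1) = 0 := by
  have : (B.coef k l 0).comp (LinearMap.mulRight K (B.b i j 1)) = 0 := by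
    refine B.linearMap_ext fun k l' m hk => ?_
    rw [LinearMap.comp_apply, LinearMap.mulRight_apply, b_mul]
    split_ifs
    · rw [coef_b, if_neg]; · rfl
      rintro ⟨⟨_, _, h3⟩, _⟩; omega
    · rw [map_zero]; rfl
  exact DFunLike.congr_fun this x

lemma eq_sum_coef {i j : ℕ} {x : Λ} (hx : B.e i * x * B.e j = x) :
    x = ∑ d ∈ Finset.range (2 * n), B.coef i j d x • B.b i j d := by
  refine B.ext_coef fun i' j' d' h => ?_
  rw [map_sum]
  simp only [map_smul, coef_b, h, and_true, smul_eq_mul, mul_ite, mul_one, mul_zero]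
  have hd : d' < 2 * n := by unfold ValidPath at h; omega
  conv_lhs => rw [← hx, coef_e_mul_e]
  split_ifs with h1
  · obtain ⟨rfl, rfl⟩ := h1
    rw [Finset.sum_eq_single_of_mem d' (Finset.mem_range.2 hd)]
    · rw [if_pos ⟨rfl, rfl, rfl⟩]
    · intro d _ hne
      rw [if_neg fun h => hne h.2.2.symm]
  · symm
    refine Finset.sum_eq_zero fun d _ => if_neg ?_
    rintro ⟨rfl, rfl, _⟩
    exact h1 ⟨rfl, rfl⟩

section Elem

variable {G : Type} [Ends G]

lemma gen_eq_smul (g : G) : (bim (B.e (src g)) (B.e (tgt g)) : Λ ⊗[K] Λᵐᵒᵖ) • B.gen g = B.gen g :=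
  IdemModule.smul_gen B.idem_mul_idem g

lemma e_mul_apply_gen (f : B.Bimod G →ₗ[Λ ⊗[K] Λᵐᵒᵖ] Λ) (g : G) :
    B.e (src g) * f (B.gen g) * B.e (tgt g) = f (B.gen g) := by
  have h := (map_smul f (bim (B.e (src g)) (B.e (tgt g)) : Λ ⊗[K] Λᵐᵒᵖ) (B.gen g)).symm
  rw [bimodule_smul] at h
  exact h.trans (congrArg f (B.gen_eq_smul g))

lemma e_mul_apply_gen' (f : B.Bimod G →ₗ[Λ ⊗[K] Λᵐᵒᵖ] Λ) (g : G) :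
    B.e (src g) * f (B.gen g) = f (B.gen g) := by
  rw [← e_mul_apply_gen, ← mul_assoc, ← mul_assoc, e_mul_e]

lemma apply_gen_mul_e (f : B.Bimod G →ₗ[Λ ⊗[K] Λᵐᵒᵖ] Λ) (g : G) :
    f (B.gen g) * B.e (tgt g) = f (B.gen g) := by
  rw [← e_mul_apply_gen, mul_assoc, e_mul_e]

/-- The coefficient of a path in the value of a cochain. -/
def co (f : B.Bimod G →ₗ[Λ ⊗[K] Λᵐᵒᵖ] Λ) (g : G) (d : ℕ) : K :=
  B.coef (src g) (tgt g) d (f (B.gen g))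

lemma co_eq_zero {g : G} {d : ℕ} (h : ¬ ValidPath n (src g) (tgt g) d)
    (f : B.Bimod G →ₗ[Λ ⊗[K] Λᵐᵒᵖ] Λ) : B.co f g d = 0 := B.coef_eq_zero h _

lemma apply_gen (f : B.Bimod G →ₗ[Λ ⊗[K] Λᵐᵒᵖ] Λ) (g : G) : f (B.gen g) =
    ∑ d ∈ Finset.range (2 * n), B.co f g d • B.b (src g) (tgt g) d :=
  B.eq_sum_coef (B.e_mul_apply_gen f g)

lemma cochain_ext {f f' : B.Bimod G →ₗ[Λ ⊗[K] Λᵐᵒᵖ] Λ}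
    (h : ∀ g d, ValidPath n (src g) (tgt g) d → B.co f g d = B.co f' g d) : f = f' := by
  refine B.hom_ext fun g => ?_
  rw [apply_gen, apply_gen]
  refine Finset.sum_congr rfl fun d _ => ?_
  by_cases hd : ValidPath n (src g) (tgt g) d
  · rw [h g d hd]
  · rw [B.b_eq_zero hd, smul_zero, smul_zero]

lemma co_add (f f' : B.Bimod G →ₗ[Λ ⊗[K] Λᵐᵒᵖ] Λ) (g : G) (d : ℕ) :
    B.co (f + f') g d = B.co f g d + B.co f' g d := map_add _ _ _

lemma co_sub (f f' : B.Bimod G →ₗ[Λ ⊗[K] Λᵐᵒᵖ] Λ) (g : G) (d : ℕ) :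
    B.co (f - f') g d = B.co f g d - B.co f' g d := map_sub _ _ _

lemma co_smul (c : K) (f : B.Bimod G →ₗ[Λ ⊗[K] Λᵐᵒᵖ] Λ) (g : G) (d : ℕ) :
    B.co (c • f) g d = c * B.co f g d := map_smul _ _ _

lemma co_zero (g : G) (d : ℕ) : B.co (0 : B.Bimod G →ₗ[Λ ⊗[K] Λᵐᵒᵖ] Λ) g d = 0 := map_zero _

lemma co_sum {ι : Type*} (S : Finset ι) (f : ι → B.Bimod G →ₗ[Λ ⊗[K] Λᵐᵒᵖ] Λ) (g : G) (d : ℕ) :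
    B.co (∑ i ∈ S, f i) g d = ∑ i ∈ S, B.co (f i) g d := by
  rw [co, LinearMap.sum_apply, map_sum]
  rfl

variable [DecidableEq G]

/-- The elementary cochain with value a path on one generator. -/
def elem (g : G) (d : ℕ) : B.Bimod G →ₗ[Λ ⊗[K] Λᵐᵒᵖ] Λ :=
  B.lift fun g' => if g' = g then B.b (src g) (tgt g) d else 0

lemma elem_gen (g g' : G) (d : ℕ) :
    B.elem g d (B.gen g') = if g' = g then B.b (src g) (tgt g) d else 0 := by
  rw [elem, lift_gen]
  split_ifs with h
  · subst h
    rw [bimodule_smul, e_mul_b, b_mul_e]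
  · exact smul_zero _

lemma elem_eq_zero {g : G} {d : ℕ} (h : ¬ ValidPath n (src g) (tgt g) d) : B.elem g d = 0 := by
  refine B.hom_ext fun g' => ?_
  rw [elem_gen, B.b_eq_zero h, ite_self]
  rfl

lemma co_elem (g g' : G) (d d' : ℕ) : B.co (B.elem g d) g' d' =
    if (g' = g ∧ d' = d) ∧ ValidPath n (src g') (tgt g') d' then 1 else 0 := by
  rw [co, elem_gen]
  by_cases h : g' = g
  · subst h
    rw [if_pos rfl, coef_b]
    simp
  · rw [if_neg h, map_zero, if_neg fun h' => h h'.1.1]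

lemma eq_sum_elem (S : Finset G) (hS : ∀ g ∉ S, n ≤ src g ∨ n ≤ tgt g)
    (f : B.Bimod G →ₗ[Λ ⊗[K] Λᵐᵒᵖ] Λ) :
    f = ∑ g ∈ S, ∑ d ∈ Finset.range (2 * n), B.co f g d • B.elem g d := by
  refine B.cochain_ext fun g d hd => ?_
  simp only [co_sum, co_smul, co_elem, hd, and_true, mul_ite, mul_one, mul_zero]
  have hg : g ∈ S := by
    by_contra h
    have := hS g h
    unfold ValidPath at hd
    omega
  rw [Finset.sum_eq_single_of_mem g hg, Finset.sum_eq_single_of_mem d (Finset.mem_range.2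
    (by unfold ValidPath at hd; omega))]
  · rw [if_pos ⟨rfl, rfl⟩]
  · intro d' _ hne
    rw [if_neg fun h => hne h.2.symm]
  · intro g' _ hne
    exact Finset.sum_eq_zero fun d' _ => if_neg fun h => hne h.1.symm

lemma mem_of_elem_mem (S : Finset G) (hS : ∀ g ∉ S, n ≤ src g ∨ n ≤ tgt g)
    {T : Submodule K (B.Bimod G →ₗ[Λ ⊗[K] Λᵐᵒᵖ] Λ)} {f : B.Bimod G →ₗ[Λ ⊗[K] Λᵐᵒᵖ] Λ}
    (h : ∀ g d, B.co f g d ≠ 0 → B.elem g d ∈ T) : f ∈ T := by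
  rw [B.eq_sum_elem S hS f]
  refine Submodule.sum_mem _ fun g _ => Submodule.sum_mem _ fun d _ => ?_
  by_cases h0 : B.co f g d = 0
  · rw [h0, zero_smul]; exact T.zero_mem
  · exact T.smul_mem _ (h g d h0)

end Elem

lemma vertices_cover (i : ℕ) (h : i ∉ Finset.range n) : n ≤ src i ∨ n ≤ tgt i :=
  Or.inl (not_lt.1 fun h' => h (Finset.mem_range.2 h'))

/-! ### Coboundaries -/

/-- The coboundaries. -/
def bdry {G G' : Type} [Ends G] [Ends G'] (d : B.Bimod G →ₗ[Λ ⊗[K] Λᵐᵒᵖ] B.Bimod G') :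
    Submodule K (B.Bimod G →ₗ[Λ ⊗[K] Λᵐᵒᵖ] Λ) where
  carrier := {f | ∃ φ : B.Bimod G' →ₗ[Λ ⊗[K] Λᵐᵒᵖ] Λ, f = φ ∘ₗ d}
  add_mem' := by
    rintro _ _ ⟨φ, rfl⟩ ⟨ψ, rfl⟩
    exact ⟨φ + ψ, (LinearMap.add_comp _ _ _).symm⟩
  zero_mem' := ⟨0, (LinearMap.zero_comp _).symm⟩
  smul_mem' := by
    rintro c _ ⟨φ, rfl⟩
    exact ⟨c • φ, rfl⟩

variable {B} in
lemma cl_mem_span {i : ℕ} {S : Set (B.Cochain (i + 1))} (hS : ∀ f ∈ S, f ∘ₗ B.resD (i + 1) = 0)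
    {f : B.Cochain (i + 1)} (hf : f ∈ Submodule.span K S ⊔ B.bdry (B.resD i)) :
    B.cl (i + 1) f ∈ Submodule.span K (B.cl (i + 1) '' S) := by
  obtain ⟨g, hg, _, ⟨φ, rfl⟩, rfl⟩ := Submodule.mem_sup.1 hf
  have h : g ∘ₗ B.resD (i + 1) = 0 ∧ B.cl (i + 1) g ∈ Submodule.span K (B.cl (i + 1) '' S) := by
    clear hf
    induction hg using Submodule.span_induction with
    | zero => exact ⟨LinearMap.zero_comp _, by rw [cl_zero]; exact zero_mem _⟩
    | add a b _ _ ha hb =>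
      refine ⟨by rw [LinearMap.add_comp, ha.1, hb.1, add_zero], ?_⟩
      rw [cl_add ha.1 hb.1]
      exact add_mem ha.2 hb.2
    | smul c a _ ha =>
      refine ⟨by rw [LinearMap.smul_comp, ha.1, smul_zero], ?_⟩
      rw [cl_smul c ha.1]
      exact Submodule.smul_mem _ _ ha.2
    | mem a ha => exact ⟨hS a ha, Submodule.subset_span ⟨a, ha, rfl⟩⟩
  have h2 : (φ ∘ₗ B.resD i) ∘ₗ B.resD (i + 1) = 0 := by
    rw [LinearMap.comp_assoc, resD_comp_resD, LinearMap.comp_zero]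
  rw [cl_add h.1 h2, cl_comp_resD, add_zero]
  exact h.2

end PathBasis

end

/-! ### Coboundary formulas in coordinates. -/

noncomputable section

variable {K Λ : Type u} [Field K] [Ring Λ] [Algebra K Λ] {n : ℕ}

namespace PathBasis

open Ends

variable (B : PathBasis K Λ n)

lemma comp_d₁_gen (s : ℤ) (f : B.PV →ₗ[Λ ⊗[K] Λᵐᵒᵖ] Λ) (a : LArrow) :
    (f ∘ₗ B.d₁ s) (B.gen a) = B.arr a * f (B.gen a.tgt) - a.sign s • (f (B.gen a.src) * B.arr a) := by
  rw [LinearMap.comp_apply, d₁_gen, map_sub, map_zsmul, map_cell, map_cell, bimodule_smul,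
    bimodule_smul, mul_assoc]
  have h1 := B.apply_gen_mul_e f a.tgt
  have h2 := B.e_mul_apply_gen' f a.src
  dsimp only [ends_src_nat, ends_tgt_nat] at h1 h2
  rw [h1, h2]

lemma comp_d₂_gen (s : ℤ) (f : B.PA →ₗ[Λ ⊗[K] Λᵐᵒᵖ] Λ) (i : ℕ) : (f ∘ₗ B.d₂ s) (B.gen i) =
    B.b i (i + 1) 1 * f (B.gen (LArrow.L (i + 1))) + f (B.gen (LArrow.R i)) * B.b (i + 1) i 1 -
      B.b i (i - 1) 1 * f (B.gen (LArrow.opp i)) -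
      (LArrow.L i).sign s • (f (B.gen (LArrow.L i)) * B.b (i - 1) i 1) := by
  rw [LinearMap.comp_apply, d₂_gen, map_sub, map_sub, map_add, map_zsmul, map_cell, map_cell,
    map_cell, map_cell, bimodule_smul, bimodule_smul, bimodule_smul, bimodule_smul]
  have h1 := B.apply_gen_mul_e f (LArrow.L (i + 1))
  have h2 := B.apply_gen_mul_e f (LArrow.opp i)
  have h3 := B.e_mul_apply_gen' f (LArrow.R i)
  have h4 := B.e_mul_apply_gen' f (LArrow.L i)
  dsimp only [ends_src_arrow, ends_tgt_arrow, LArrow.src_R, LArrow.src_L, LArrow.tgt_L] at h1 h3 h4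
  rw [ends_tgt_arrow, LArrow.tgt_opp] at h2
  rw [Nat.add_sub_cancel] at h1
  rw [mul_assoc, h1, mul_assoc (B.b i (i - 1) 1), h2, h3, h4]

lemma comp_d₃_gen (s : ℤ) (f : B.PV →ₗ[Λ ⊗[K] Λᵐᵒᵖ] Λ) (k : ℕ) : (f ∘ₗ B.d₃ s) (B.gen k) =
    ∑ i ∈ Finset.range n, ∑ x ∈ Finset.HasAntidiagonal.antidiagonal (2 * n - 1),
      pathSign s k i x.1 • (B.b k i x.1 * f (B.gen i) * B.b i k x.2) := by
  rw [LinearMap.comp_apply, d₃_gen, map_sum]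
  refine Finset.sum_congr rfl fun i _ => ?_
  rw [map_sum]
  refine Finset.sum_congr rfl fun x _ => ?_
  rw [map_zsmul, map_cell, bimodule_smul]

lemma co_d₁ (s : ℤ) (f : B.PV →ₗ[Λ ⊗[K] Λᵐᵒᵖ] Λ) (a : LArrow) (d : ℕ) :
    B.co (f ∘ₗ B.d₁ s) a (d + 1) = if ValidPath n a.src a.tgt (d + 1) then
      B.co f a.tgt d - a.sign s • B.co f a.src d else 0 := by
  rw [co, comp_d₁_gen, map_sub, map_zsmul, arr, ends_src_arrow, ends_tgt_arrow,
    B.coef_arrow_mul a.neighbor, B.coef_mul_arrow a.neighbor]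
  split_ifs
  · rfl
  · rw [smul_zero, sub_zero]

lemma co_d₂ (s : ℤ) (f : B.PA →ₗ[Λ ⊗[K] Λᵐᵒᵖ] Λ) (i d : ℕ) :
    B.co (f ∘ₗ B.d₂ s) i (d + 1) = if ValidPath n i i (d + 1) then
      B.co f (LArrow.L (i + 1)) d + B.co f (LArrow.R i) d - B.co f (LArrow.opp i) d -
        (LArrow.L i).sign s • B.co f (LArrow.L i) d else 0 := by
  have h1 : Neighbor i (i - 1) := Or.inr rfl
  have h2 : Neighbor (i - 1) i := by unfold Neighbor; omega
  rw [co, comp_d₂_gen, map_sub, map_sub, map_add, map_zsmul]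
  dsimp only [ends_src_nat, ends_tgt_nat]
  rw [B.coef_arrow_mul (Or.inl rfl), B.coef_mul_arrow (j := i + 1) (l := i) (Or.inr rfl),
    B.coef_arrow_mul h1, B.coef_mul_arrow h2]
  split_ifs
  · unfold co
    rw [ends_src_arrow, ends_tgt_arrow, ends_src_arrow, ends_tgt_arrow, ends_src_arrow,
      ends_tgt_arrow, ends_src_arrow, ends_tgt_arrow, LArrow.src_opp, LArrow.tgt_opp]
    rfl
  · simp

lemma co_d₁_zero (s : ℤ) (f : B.PV →ₗ[Λ ⊗[K] Λᵐᵒᵖ] Λ) (a : LArrow) :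
    B.co (f ∘ₗ B.d₁ s) a 0 = 0 := by
  rw [co, comp_d₁_gen, map_sub, map_zsmul, arr, coef_zero_arrow_mul, coef_zero_mul_arrow,
    smul_zero, sub_zero]

lemma co_d₂_zero (s : ℤ) (f : B.PA →ₗ[Λ ⊗[K] Λᵐᵒᵖ] Λ) (i : ℕ) :
    B.co (f ∘ₗ B.d₂ s) i 0 = 0 := by
  rw [co, comp_d₂_gen, map_sub, map_sub, map_add, map_zsmul, coef_zero_arrow_mul,
    coef_zero_mul_arrow, coef_zero_arrow_mul, coef_zero_mul_arrow]
  simp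

/-- Weighted counts of the factorizations of `b k k (2 * n - 1)` through a vertex. -/
def wsum (n : ℕ) {A : Type*} [AddCommMonoid A] (w : ℕ → A) (k i : ℕ) : A :=
  ∑ x ∈ Finset.HasAntidiagonal.antidiagonal (2 * n - 1),
    if ValidPath n k i x.1 ∧ ValidPath n i k x.2 then w x.1 else 0

/-- In a factorisation of a socle path exactly one factor passes the loop an even number of times.
Exchanging lengths pairs `d` with `2 * n - 1 - d`, and the even lengths are `|k - i| + 2 * t` with
`t < n - max k i`. -/
lemma wsum_eq {A : Type*} [AddCommMonoid A] (w : ℕ → A) {k i : ℕ} (hk : k < n) (hi : i < n) :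
    wsum n w k i = ∑ t ∈ Finset.range (n - max k i),
      (w (max k i - min k i + 2 * t) + w (2 * n - 1 - (max k i - min k i + 2 * t))) := by
  let P : ℕ → Prop := fun d => (d + i + k) % 2 = 0 ∧ max k i - min k i ≤ d ∧ d + i + k + 2 ≤ 2 * n
  have hP : DecidablePred P := fun d => by unfold P; infer_instance
  have h1 : wsum n w k i = ∑ d ∈ Finset.range (2 * n), (if P d then w d else 0) +
      ∑ d ∈ Finset.range (2 * n), (if P (2 * n - 1 - d) then w d else 0) := by
    rw [wsum, Finset.Nat.sum_antidiagonal_eq_sum_range_succ_mk, ← Finset.sum_add_distrib,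
      Nat.succ_eq_add_one, show 2 * n - 1 + 1 = 2 * n by omega]
    refine Finset.sum_congr rfl fun d hd => ?_
    rw [Finset.mem_range] at hd
    dsimp only
    by_cases hp : (d + i + k) % 2 = 0
    · have e1 : ¬ P (2 * n - 1 - d) := by unfold P; omega
      rw [if_neg e1, add_zero]
      refine if_congr ?_ rfl rfl
      unfold P ValidPath
      omega
    · have e1 : ¬ P d := by unfold P; omega
      rw [if_neg e1, zero_add]
      refine if_congr ?_ rfl rfl
      unfold P ValidPath
      omega
  have h2 : ∑ d ∈ Finset.range (2 * n), (if P (2 * n - 1 - d) then w d else 0) =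
      ∑ d ∈ Finset.range (2 * n), if P d then w (2 * n - 1 - d) else 0 := by
    rw [← Finset.sum_range_reflect]
    refine Finset.sum_congr rfl fun d hd => ?_
    rw [Finset.mem_range] at hd
    rw [show 2 * n - 1 - (2 * n - 1 - d) = d by omega]
  rw [h1, h2, ← Finset.sum_filter, ← Finset.sum_filter, ← Finset.sum_add_distrib]
  symm
  refine Finset.sum_nbij (fun t => max k i - min k i + 2 * t) ?_ ?_ ?_ ?_
  · intro t ht
    rw [Finset.mem_range] at ht
    rw [Finset.mem_filter, Finset.mem_range]
    unfold P
    omega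
  · intro t _ t' _ h
    dsimp only at h
    omega
  · intro d hd
    rw [Finset.mem_coe, Finset.mem_filter, Finset.mem_range] at hd
    obtain ⟨hd, h3, h4, h5⟩ := hd
    refine ⟨(d - (max k i - min k i)) / 2, ?_, ?_⟩
    · rw [Finset.mem_coe, Finset.mem_range]; omega
    · dsimp only; omega
  · intro t _
    rfl

/-- For `s = 1` the two members of each pair have opposite signs, so `d₃ 1` induces zero on
cochains. For `s = -1` they add up, which produces the matrix `2 * (n - max k i)`. -/
lemma wsum_pathSign_one {k i : ℕ} (hk : k < n) (hi : i < n) : wsum n (pathSign 1 k i) k i = 0 := by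
  rw [wsum_eq _ hk hi]
  refine Finset.sum_eq_zero fun t ht => ?_
  rw [Finset.mem_range] at ht
  unfold pathSign
  rw [if_pos (by omega), if_neg (by omega)]
  rfl

lemma wsum_pathSign_neg_one {k i : ℕ} (hk : k < n) (hi : i < n) :
    wsum n (pathSign (-1) k i) k i = 2 * ((n : ℤ) - max k i) := by
  rw [wsum_eq _ hk hi]
  have : ∀ t ∈ Finset.range (n - max k i),
      pathSign (-1) k i (max k i - min k i + 2 * t) +
        pathSign (-1) k i (2 * n - 1 - (max k i - min k i + 2 * t)) = 2 := by
    intro t ht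
    unfold pathSign
    rw [neg_neg, ite_self, ite_self]
    rfl
  rw [Finset.sum_congr rfl this, Finset.sum_const, Finset.card_range, nsmul_eq_mul]
  push_cast [Nat.cast_sub (show max k i ≤ n by omega)]
  ring

lemma sum_b_mul_b_mul (c : ℕ → ℤ) {k i : ℕ} :
    ∑ x ∈ Finset.HasAntidiagonal.antidiagonal (2 * n - 1), c x.1 • (B.b k i x.1 * B.b i k x.2) =
      wsum n c k i • B.b k k (2 * n - 1) := by
  rw [wsum, Finset.sum_smul]
  refine Finset.sum_congr rfl fun x hx => ?_
  rw [b_mul, Finset.HasAntidiagonal.mem_antidiagonal.1 hx]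
  simp only [true_and]
  split_ifs
  · rfl
  · rw [smul_zero, zero_smul]

/-- Inserting a path of positive length into a factorisation of a socle path exceeds the maximal
length `2 * n - 1`. -/
lemma elem_d₃_gen (s : ℤ) {i : ℕ} (hi : i < n) (d k : ℕ) : (B.elem i d ∘ₗ B.d₃ s) (B.gen k) =
    if d = 0 then wsum n (pathSign s k i) k i • B.b k k (2 * n - 1) else 0 := by
  rw [comp_d₃_gen, Finset.sum_eq_single_of_mem i (Finset.mem_range.2 hi)]
  · simp only [elem_gen, if_true]
    split_ifs with h
    · subst h
      rw [← B.sum_b_mul_b_mul]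
      refine Finset.sum_congr rfl fun x _ => ?_
      rw [show B.b (src i) (tgt i) 0 = B.e i from rfl, b_mul_e]
    · refine Finset.sum_eq_zero fun x hx => ?_
      rw [Finset.HasAntidiagonal.mem_antidiagonal] at hx
      dsimp only [ends_src_nat, ends_tgt_nat]
      rw [b_mul]
      split_ifs with h1
      · rw [b_mul]
        split_ifs with h2
        · rw [B.b_eq_zero, smul_zero]
          unfold ValidPath at *; omega
        · rw [smul_zero]
      · rw [zero_mul, smul_zero]
  · intro j _ hj
    refine Finset.sum_eq_zero fun x _ => ?_
    rw [elem_gen, if_neg hj, mul_zero, zero_mul, smul_zero]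

lemma sum_elem (f : B.PV →ₗ[Λ ⊗[K] Λᵐᵒᵖ] Λ) : f =
    ∑ i ∈ Finset.range n, ∑ d ∈ Finset.range (2 * n), B.co f i d • B.elem i d :=
  B.eq_sum_elem _ vertices_cover f

lemma comp_d₃_gen_eq (s : ℤ) (f : B.PV →ₗ[Λ ⊗[K] Λᵐᵒᵖ] Λ) (k : ℕ) : (f ∘ₗ B.d₃ s) (B.gen k) =
    (∑ i ∈ Finset.range n, B.co f i 0 * (wsum n (pathSign s k i) k i : ℤ)) •
      B.b k k (2 * n - 1) := by
  conv_lhs => rw [B.sum_elem f]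
  rw [LinearMap.comp_apply, LinearMap.sum_apply, Finset.sum_smul]
  refine Finset.sum_congr rfl fun i hi => ?_
  rw [Finset.mem_range] at hi
  rw [LinearMap.sum_apply, Finset.sum_eq_single_of_mem 0 (Finset.mem_range.2 (by omega))]
  · rw [LinearMap.smul_apply, ← LinearMap.comp_apply, B.elem_d₃_gen s hi, if_pos rfl,
      ← Int.cast_smul_eq_zsmul K, smul_smul]
  · intro d _ hd
    rw [LinearMap.smul_apply, ← LinearMap.comp_apply, B.elem_d₃_gen s hi, if_neg hd, smul_zero]

lemma comp_d₃_one (f : B.PV →ₗ[Λ ⊗[K] Λᵐᵒᵖ] Λ) : f ∘ₗ B.d₃ 1 = 0 := by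
  refine B.hom_ext fun k => ?_
  rw [comp_d₃_gen_eq, LinearMap.zero_apply]
  by_cases hk : k < n
  · rw [Finset.sum_eq_zero, zero_smul]
    intro i hi
    rw [wsum_pathSign_one hk (Finset.mem_range.1 hi), Int.cast_zero, mul_zero]
  · rw [B.b_eq_zero (by unfold ValidPath; omega), smul_zero]

lemma co_d₃ (s : ℤ) (f : B.PV →ₗ[Λ ⊗[K] Λᵐᵒᵖ] Λ) (k d : ℕ) : B.co (f ∘ₗ B.d₃ s) k d =
    if k < n ∧ d = 2 * n - 1 then
      ∑ i ∈ Finset.range n, B.co f i 0 * (wsum n (pathSign s k i) k i : ℤ) else 0 := by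
  rw [co, comp_d₃_gen_eq, map_smul, coef_b]
  dsimp only [ends_src_nat, ends_tgt_nat]
  by_cases h : k < n ∧ d = 2 * n - 1
  · rw [if_pos h, if_pos, smul_eq_mul, mul_one]
    refine ⟨⟨rfl, rfl, h.2⟩, ?_⟩
    unfold ValidPath; omega
  · rw [if_neg h, if_neg, smul_zero]
    rintro ⟨⟨_, _, h1⟩, h2⟩
    refine h ⟨?_, h1⟩
    unfold ValidPath at h2; omega

end PathBasis

end

/-! ### Coboundaries of elementary cochains. -/

noncomputable section

variable {K Λ : Type u} [Field K] [Ring Λ] [Algebra K Λ] {n : ℕ}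

namespace LArrow

lemma opp_eq_R (i j : ℕ) : opp j = R i ↔ j = i + 1 := by
  unfold opp
  split_ifs with h
  · simp [h]
  · simp; omega

lemma opp_eq_L (i j : ℕ) : opp j = L i ↔ j = 0 ∧ i = 0 := by
  unfold opp
  split_ifs with h
  · simp [h, eq_comm]
  · simp [h]

end LArrow

namespace PathBasis

open Ends

variable (B : PathBasis K Λ n)

lemma elem_R_d₂ (s : ℤ) {i d : ℕ} (h : ValidPath n i (i + 1) d) :
    B.elem (LArrow.R i) d ∘ₗ B.d₂ s = B.elem i (d + 1) - B.elem (i + 1) (d + 1) := by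
  refine B.hom_ext fun j => ?_
  rw [comp_d₂_gen, LinearMap.sub_apply]
  simp only [elem_gen, LArrow.opp_eq_R, reduceCtorEq, if_false, mul_zero, zero_mul, smul_zero,
    zero_add, sub_zero, LArrow.R.injEq, ends_src_nat, ends_tgt_nat, ends_src_arrow, ends_tgt_arrow,
    LArrow.src_R, LArrow.tgt_R]
  by_cases h1 : j = i
  · subst h1
    rw [if_pos rfl, if_pos rfl, if_neg (by omega), if_neg (by omega), mul_zero, sub_zero,
      B.b_mul_arrow (i := j + 1) (j := j) (Or.inr rfl), if_pos h, sub_zero]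
  · by_cases h2 : j = i + 1
    · subst h2
      rw [if_neg (by omega), if_pos rfl, if_neg (by omega), if_pos rfl, zero_mul, zero_sub,
        Nat.add_sub_cancel, B.arrow_mul_b (i := i + 1) (j := i) (Or.inr rfl), if_pos h, zero_sub]
    · rw [if_neg h1, if_neg h2, if_neg h1, if_neg h2, zero_mul, mul_zero]

/-- The loop is its own opposite and therefore occurs twice in the relation at `0`. The two
occurrences add for `s = 1` and cancel for `s = -1`; the resulting factor `2` must be invertible. -/
lemma elem_L_zero_d₂ (s : ℤ) {d : ℕ} (h : ValidPath n 0 0 d) :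
    B.elem (LArrow.L 0) d ∘ₗ B.d₂ s = -(1 + s) • B.elem 0 (d + 1) := by
  refine B.hom_ext fun j => ?_
  rw [comp_d₂_gen, LinearMap.smul_apply]
  simp only [elem_gen, LArrow.opp_eq_L, reduceCtorEq, if_false, mul_zero, zero_mul,
    add_zero, zero_sub, LArrow.L.injEq, ends_src_nat, ends_tgt_nat, ends_src_arrow, ends_tgt_arrow,
    LArrow.src_L, LArrow.tgt_L, and_true, Nat.succ_ne_zero]
  by_cases h1 : j = 0
  · subst h1
    rw [if_pos rfl, if_pos rfl, B.arrow_mul_b (i := 0) (j := 0 - 1) (Or.inr rfl), if_pos h,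
      B.b_mul_arrow (i := 0 - 1) (j := 0) (Or.inr rfl), if_pos h, LArrow.sign_L_zero,
      neg_smul, add_smul, one_smul, neg_add, ← sub_eq_add_neg]
  · rw [if_neg h1, if_neg h1, mul_zero, zero_mul, smul_zero, smul_zero, neg_zero, sub_zero]

lemma elem_zero_d₁ (s : ℤ) {d : ℕ} (h : ValidPath n 0 0 d) :
    B.elem 0 d ∘ₗ B.d₁ s = (B.elem (LArrow.L 1) (d + 1) - B.elem (LArrow.R 0) (d + 1)) +
      (1 - s) • B.elem (LArrow.L 0) (d + 1) := by
  refine B.hom_ext fun a => ?_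
  rw [comp_d₁_gen, LinearMap.add_apply, LinearMap.sub_apply, LinearMap.smul_apply]
  rcases a with j | j
  · simp only [elem_gen, reduceCtorEq, if_false, LArrow.src_R, LArrow.tgt_R, arr, Nat.succ_ne_zero,
      LArrow.sign_R, one_smul, smul_zero, add_zero, zero_sub, mul_zero, LArrow.R.injEq,
      ends_src_arrow, ends_tgt_arrow, ends_src_nat, ends_tgt_nat, zero_add]
    split_ifs with h1
    · subst h1
      rw [B.b_mul_arrow (Or.inl rfl), if_pos h]
    · rw [zero_mul]
  · simp only [elem_gen, reduceCtorEq, if_false, LArrow.src_L, LArrow.tgt_L, arr,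
      sub_zero, LArrow.L.injEq,
      ends_src_arrow, ends_tgt_arrow, ends_src_nat, ends_tgt_nat]
    rcases j with _ | _ | j
    · rw [if_pos rfl, if_pos rfl, if_neg (by omega), zero_add, LArrow.sign_L_zero,
        B.arrow_mul_b (i := 0) (j := 0 - 1) (Or.inr rfl), if_pos h,
        B.b_mul_arrow (i := 0) (j := 0 - 1) (Or.inr rfl), if_pos h, sub_smul, one_smul]
    · have := B.arrow_mul_b (i := 1) (j := 0) (Or.inr rfl) 0 d
      rw [if_pos h] at this
      simp [this]
    · rw [if_neg (by omega), if_neg (by omega), if_neg (by omega), if_neg (by omega)]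
      simp

lemma elem_succ_d₁ (s : ℤ) {i d : ℕ} (h : ValidPath n (i + 1) (i + 1) d) :
    B.elem (i + 1) d ∘ₗ B.d₁ s = (B.elem (LArrow.L (i + 2)) (d + 1) -
      B.elem (LArrow.R (i + 1)) (d + 1)) -
      (B.elem (LArrow.L (i + 1)) (d + 1) - B.elem (LArrow.R i) (d + 1)) := by
  refine B.hom_ext fun a => ?_
  rw [comp_d₁_gen, LinearMap.sub_apply, LinearMap.sub_apply, LinearMap.sub_apply]
  rcases a with j | j
  · simp only [elem_gen, reduceCtorEq, if_false, LArrow.src_R, LArrow.tgt_R, arr,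
      LArrow.sign_R, one_smul, zero_sub, LArrow.R.injEq, Nat.add_right_cancel_iff, sub_neg_eq_add,
      ends_src_arrow, ends_tgt_arrow, ends_src_nat, ends_tgt_nat]
    by_cases h1 : j = i
    · subst h1
      rw [if_pos rfl, if_pos rfl, if_neg (by omega), if_neg (by omega),
        B.arrow_mul_b (Or.inl rfl), if_pos h]
      simp
    · rw [if_neg h1, if_neg h1]
      split_ifs with h2
      · subst h2
        rw [B.b_mul_arrow (Or.inl rfl), if_pos h]
        simp
      · simp
  · simp only [elem_gen, reduceCtorEq, if_false, LArrow.src_L, LArrow.tgt_L, arr,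
      sub_zero, LArrow.L.injEq,
      ends_src_arrow, ends_tgt_arrow, ends_src_nat, ends_tgt_nat]
    by_cases h1 : j = i + 2
    · subst h1
      have := B.arrow_mul_b (i := i + 2) (j := i + 1) (Or.inr rfl) (i + 1) d
      rw [if_pos h] at this
      simp [show i + 2 - 1 = i + 1 by omega, this]
    · rw [if_neg h1, if_neg (show ¬ j - 1 = i + 1 by omega), mul_zero]
      split_ifs with h2
      · subst h2
        rw [B.b_mul_arrow (i := i + 1) (j := i + 1 - 1) (Or.inr rfl), if_pos h, LArrow.sign_L_succ,
          one_smul]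
      · simp

variable {B}

/-! ### The cohomology in degrees `2` to `6` -/

lemma sub_mem_bdry_d₂ (s : ℤ) {i m : ℕ} (hm : 1 ≤ m)
    (h : ValidPath n i (i + 1) (m - 1)) :
    B.elem i m - B.elem (i + 1) m ∈ B.bdry (B.d₂ s) := by
  have := B.elem_R_d₂ s h
  rw [Nat.sub_add_cancel hm] at this
  exact ⟨_, this.symm⟩

/-- Boundaries of cochains on right arrows identify elementary cochains of equal positive length at
neighbouring vertices. This transports them away from the loop. -/
lemma elem_succ_mem_of_elem_mem (s : ℤ) {T : Submodule K (B.PV →ₗ[Λ ⊗[K] Λᵐᵒᵖ] Λ)}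
    (hT : B.bdry (B.d₂ s) ≤ T) {i m : ℕ} (hm : 1 ≤ m) (h : B.elem i m ∈ T) :
    B.elem (i + 1) m ∈ T := by
  by_cases hv : ValidPath n (i + 1) (i + 1) m
  · have h1 := hT (sub_mem_bdry_d₂ (B := B) s (i := i) hm (by unfold ValidPath at *; omega))
    have := T.sub_mem h h1
    rwa [sub_sub_cancel] at this
  · rw [B.elem_eq_zero hv]
    exact T.zero_mem

lemma elem_mem_of_elem_zero_mem (s : ℤ) {T : Submodule K (B.PV →ₗ[Λ ⊗[K] Λᵐᵒᵖ] Λ)}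
    (hT : B.bdry (B.d₂ s) ≤ T) {m : ℕ} (hm : 1 ≤ m) (h : B.elem 0 m ∈ T) (i : ℕ) :
    B.elem i m ∈ T := by
  induction i with
  | zero => exact h
  | succ i ih => exact elem_succ_mem_of_elem_mem s hT hm ih

lemma smul_mem_cancel {V : Type*} [AddCommGroup V] [Module K V] {T : Submodule K V} {v : V}
    (h2 : (2 : K) ≠ 0) (h : (-2 : ℤ) • v ∈ T) : v ∈ T := by
  rw [← Int.cast_smul_eq_zsmul K] at h
  push_cast at h
  exact (T.smul_mem_iff (neg_ne_zero.2 h2)).1 h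

/-- At the vertex `0` it is a coboundary up to the factor `-2`, and the other vertices follow by
transport. -/
lemma elem_mem_bdry_d₂_one (h2 : (2 : K) ≠ 0) (i : ℕ) {m : ℕ} (hm : 1 ≤ m) :
    B.elem i m ∈ B.bdry (B.d₂ 1) := by
  refine elem_mem_of_elem_zero_mem 1 le_rfl hm ?_ i
  by_cases hv : ValidPath n 0 0 (m - 1)
  · have := B.elem_L_zero_d₂ 1 hv
    rw [Nat.sub_add_cancel hm] at this
    exact smul_mem_cancel h2 ⟨_, this.symm⟩
  · rw [B.elem_eq_zero]
    · exact zero_mem _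
    · dsimp only [ends_src_nat, ends_tgt_nat]
      unfold ValidPath at *; omega

lemma mem_of_d₂_one (h2 : (2 : K) ≠ 0) (f : B.PV →ₗ[Λ ⊗[K] Λᵐᵒᵖ] Λ) :
    f ∈ Submodule.span K (Set.range fun j : Fin n => B.elem (j : ℕ) 0) ⊔ B.bdry (B.d₂ 1) := by
  refine B.mem_of_elem_mem (Finset.range n) vertices_cover fun i m h => ?_
  rcases Nat.eq_zero_or_pos m with rfl | hm
  · refine Submodule.mem_sup_left (Submodule.subset_span ⟨⟨i, ?_⟩, rfl⟩)
    by_contra hi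
    exact h (B.co_eq_zero (by dsimp only [ends_src_nat]; unfold ValidPath; omega) f)
  · exact Submodule.mem_sup_right (elem_mem_bdry_d₂_one h2 i hm)

lemma co_zero_of_mem_bdry_d₂ {s : ℤ} {f : B.PV →ₗ[Λ ⊗[K] Λᵐᵒᵖ] Λ} (hf : f ∈ B.bdry (B.d₂ s))
    (i : ℕ) : B.co f i 0 = 0 := by
  obtain ⟨φ, rfl⟩ := hf
  exact B.co_d₂_zero s φ i

/-- The cocycle condition on `R i` makes coefficients of equal length agree at neighbouring
vertices. Odd lengths below `2 * n - 1` can be pushed right until no such path exists. On the loop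
the condition reads `c = s * c`, which kills the even lengths when `s = -1`. -/
lemma eq_sum_X_add_sum_omega {s : ℤ} (hs : s = 1 ∨ s = -1) (h2 : (2 : K) ≠ 0)
    {f : B.PV →ₗ[Λ ⊗[K] Λᵐᵒᵖ] Λ}
    (hf : f ∘ₗ B.d₁ s = 0) : (∀ i d, d % 2 = 1 → d + 1 < 2 * n → B.co f i d = 0) ∧
      (∀ i d, d % 2 = 0 → ValidPath n i i d → B.co f i d = B.co f 0 d) ∧
      (s = -1 → ∀ i d, d % 2 = 0 → B.co f i d = 0) := by
  have hc : ∀ (a : LArrow) d, ValidPath n a.src a.tgt (d + 1) → B.co f a.tgt d = a.sign s • B.co f a.src d := by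
    intro a d h
    have := B.co_d₁ s f a d
    rw [hf, co_zero, if_pos h] at this
    exact (sub_eq_zero.1 this.symm)
  have h2' : ∀ i d, d % 2 = 0 → ValidPath n i i d → B.co f i d = B.co f 0 d := by
    intro i d hd
    induction i with
    | zero => intro _; rfl
    | succ i ih =>
      intro h
      rw [← ih (by unfold ValidPath at *; omega)]
      have := hc (LArrow.R i) d (by
        dsimp only [LArrow.src_R, LArrow.tgt_R]; unfold ValidPath at *; omega)
      rwa [LArrow.sign_R, one_smul] at this
  refine ⟨?_, h2', ?_⟩
  · intro i d hd hd'
    have key : ∀ m i, n ≤ m + i → B.co f i d = 0 := by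
      intro m
      induction m with
      | zero => intro i h; exact B.co_eq_zero (by
          dsimp only [ends_src_nat]; unfold ValidPath; omega) f
      | succ m ih =>
        intro i h
        by_cases hv : ValidPath n i i d
        · have := hc (LArrow.R i) d (by
            dsimp only [LArrow.src_R, LArrow.tgt_R]; unfold ValidPath at *; omega)
          rw [LArrow.sign_R, one_smul] at this
          exact this.symm.trans (ih (i + 1) (by omega))
        · exact B.co_eq_zero hv f
    exact key n i (by omega)
  · rintro rfl i d hd
    by_cases hv : ValidPath n i i d
    · rw [h2' i d hd hv]
      have := hc (LArrow.L 0) d (by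
        dsimp only [LArrow.src_L, LArrow.tgt_L]; unfold ValidPath at *; omega)
      rw [LArrow.sign_L_zero, neg_smul, one_smul, eq_neg_iff_add_eq_zero] at this
      dsimp only [LArrow.src_L, LArrow.tgt_L] at this
      rw [Nat.zero_sub, ← two_mul] at this
      exact (mul_eq_zero.1 this).resolve_left h2
    · exact B.co_eq_zero hv f

lemma mem_of_d₁_neg_one (h2 : (2 : K) ≠ 0) {f : B.PV →ₗ[Λ ⊗[K] Λᵐᵒᵖ] Λ}
    (hf : f ∘ₗ B.d₁ (-1) = 0) :
    f ∈ Submodule.span K (Set.range fun k : Fin n => B.elem (k : ℕ) (2 * n - 1)) := by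
  obtain ⟨h1, _, h3⟩ := eq_sum_X_add_sum_omega (Or.inr rfl) h2 hf
  refine B.mem_of_elem_mem (Finset.range n) vertices_cover fun i d h => ?_
  have hv : ValidPath n i i d := by
    by_contra hv; exact h (B.co_eq_zero hv f)
  rcases Nat.mod_two_eq_zero_or_one d with hd | hd
  · exact absurd (h3 rfl i d hd) h
  · by_cases hd' : d + 1 < 2 * n
    · exact absurd (h1 i d hd hd') h
    · obtain rfl : d = 2 * n - 1 := by unfold ValidPath at hv; omega
      exact Submodule.subset_span ⟨⟨i, by unfold ValidPath at hv; omega⟩, rfl⟩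

variable (B) in
/-- The central cochains `X ^ k`. -/
def xCo (k : ℕ) : B.PV →ₗ[Λ ⊗[K] Λᵐᵒᵖ] Λ := ∑ i ∈ Finset.range n, B.elem i (2 * k)

lemma co_xCo (k i d : ℕ) : B.co (B.xCo k) i d = if d = 2 * k ∧ ValidPath n i i d then 1 else 0 := by
  rw [xCo, co_sum]
  simp only [co_elem]
  by_cases h : d = 2 * k ∧ ValidPath n i i d
  · rw [if_pos h, Finset.sum_eq_single_of_mem i (Finset.mem_range.2
      (by have := h.2; unfold ValidPath at this; omega))]
    · exact if_pos ⟨⟨rfl, h.1⟩, h.2⟩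
    · intro j _ hj
      exact if_neg fun h => hj h.1.1.symm
  · rw [if_neg h]
    exact Finset.sum_eq_zero fun j _ => if_neg fun h' => h ⟨h'.1.2, h'.2⟩

lemma mem_of_d₁_one (h2 : (2 : K) ≠ 0) {f : B.PV →ₗ[Λ ⊗[K] Λᵐᵒᵖ] Λ}
    (hf : f ∘ₗ B.d₁ 1 = 0) :
    f ∈ Submodule.span K (Set.range fun k : Fin n => B.xCo k) ⊔
      Submodule.span K (Set.range fun k : Fin n => B.elem (k : ℕ) (2 * n - 1)) := by
  obtain ⟨h1, h3, _⟩ := eq_sum_X_add_sum_omega (Or.inl rfl) h2 hf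
  -- The combination of the `X ^ k` with the same even coefficients at vertex `0`, hence at all
  -- vertices. Only socle coefficients remain in `f - g`.
  set g := ∑ k : Fin n, B.co f 0 (2 * k) • B.xCo k
  have hg : ∀ i d, ValidPath n i i d → d % 2 = 0 → B.co g i d = B.co f 0 d := by
    intro i d hv hd
    have hk : d / 2 < n := by unfold ValidPath at hv; omega
    rw [co_sum, Finset.sum_eq_single_of_mem (⟨d / 2, hk⟩ : Fin n) (Finset.mem_univ _)]
    · rw [co_smul, co_xCo, if_pos ⟨(Nat.mul_div_cancel' (Nat.dvd_of_mod_eq_zero hd)).symm, hv⟩,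
        mul_one, Nat.mul_div_cancel' (Nat.dvd_of_mod_eq_zero hd)]
    · intro k _ hk
      rw [co_smul, co_xCo, if_neg, mul_zero]
      rintro ⟨h, _⟩
      exact hk (Fin.ext (by simp only; omega))
  rw [← sub_add_cancel f g, add_comm]
  refine add_mem (Submodule.mem_sup_left (Submodule.sum_mem _ fun k _ => Submodule.smul_mem _ _
    (Submodule.subset_span ⟨k, rfl⟩))) (Submodule.mem_sup_right ?_)
  refine B.mem_of_elem_mem (Finset.range n) vertices_cover fun i d h => ?_
  have hv : ValidPath n i i d := by
    by_contra hv; exact h (B.co_eq_zero hv _)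
  rcases Nat.mod_two_eq_zero_or_one d with hd | hd
  · refine absurd ?_ h
    rw [co_sub, hg i d hv hd, h3 i d hd hv, sub_self]
  · by_cases hd' : d + 1 < 2 * n
    · refine absurd ?_ h
      rw [co_sub, h1 i d hd hd', co_sum, Finset.sum_eq_zero, sub_zero]
      intro k _
      rw [co_smul, co_xCo, if_neg, mul_zero]
      rintro ⟨h, _⟩
      omega
    · obtain rfl : d = 2 * n - 1 := by unfold ValidPath at hv; omega
      exact Submodule.subset_span ⟨⟨i, by unfold ValidPath at hv; omega⟩, rfl⟩

lemma elem_d₃_neg_one {i : ℕ} : B.elem i 0 ∘ₗ B.d₃ (-1) =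
    ∑ k ∈ Finset.range n, ((2 * ((n : ℤ) - max k i) : ℤ) : K) •
      (if i < n then B.elem k (2 * n - 1) else 0) := by
  by_cases hi : i < n
  · refine B.cochain_ext fun k d hd => ?_
    have hk : k < n := by unfold ValidPath at hd; dsimp only [ends_src_nat] at hd; omega
    rw [co_d₃]
    have hl : ∑ j ∈ Finset.range n, B.co (B.elem i 0) j 0 * ((wsum n (pathSign (-1) k j) k j : ℤ) : K) =
        ((2 * ((n : ℤ) - max k i) : ℤ) : K) := by
      rw [Finset.sum_eq_single_of_mem i (Finset.mem_range.2 hi)]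
      · rw [co_elem, if_pos ⟨⟨rfl, rfl⟩, by dsimp only [ends_src_nat, ends_tgt_nat]; unfold ValidPath; omega⟩,
          wsum_pathSign_neg_one hk hi, one_mul]
      · intro j _ hj
        rw [co_elem, if_neg fun h => hj h.1.1, zero_mul]
    rw [hl, co_sum, Finset.sum_eq_single_of_mem k (Finset.mem_range.2 hk)]
    · rw [co_smul, if_pos hi, co_elem]
      by_cases hd' : d = 2 * n - 1
      · rw [if_pos ⟨hk, hd'⟩, if_pos ⟨⟨rfl, hd'⟩, hd⟩, mul_one]
      · rw [if_neg fun h => hd' h.2, if_neg fun h => hd' h.1.2, mul_zero]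
    · intro j _ hj
      rw [co_smul, if_pos hi, co_elem, if_neg fun h => hj h.1.1.symm, mul_zero]
  · rw [B.elem_eq_zero (by dsimp only [ends_src_nat]; unfold ValidPath; omega), LinearMap.zero_comp]
    simp only [if_neg hi, smul_zero, Finset.sum_const_zero]

/-- The matrix `2 * (n - max k i)` is invertible once `2` is: differences of consecutive columns are
twice the partial sums of the socle cochains, and differences of partial sums isolate each of them.
-/
lemma omega_mem_bdry_d₃ (h2 : (2 : K) ≠ 0) (i : ℕ) : B.elem i (2 * n - 1) ∈ B.bdry (B.d₃ (-1)) := by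
  by_cases hi : i < n
  · have hdiff : ∀ j < n, (B.elem j 0 - B.elem (j + 1) 0) ∘ₗ B.d₃ (-1) =
        ∑ k ∈ Finset.range n, (if k ≤ j then (2 : K) else 0) • B.elem k (2 * n - 1) := by
      intro j hj
      rw [LinearMap.sub_comp, elem_d₃_neg_one, elem_d₃_neg_one, ← Finset.sum_sub_distrib]
      refine Finset.sum_congr rfl fun k hk => ?_
      rw [Finset.mem_range] at hk
      rw [if_pos hj]
      by_cases hj' : j + 1 < n
      · rw [if_pos hj']
        refine (sub_smul _ _ _).symm.trans ?_
        congr 1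
        split_ifs with h
        · rw [max_eq_right h, max_eq_right (show k ≤ j + 1 by omega)]
          push_cast; ring
        · rw [max_eq_left (show j ≤ k by omega), max_eq_left (show j + 1 ≤ k by omega), sub_self]
      · rw [if_neg hj', smul_zero, sub_zero, if_pos (show k ≤ j by omega),
          max_eq_right (show k ≤ j by omega)]
        congr 1
        obtain rfl : n = j + 1 := by omega
        push_cast; ring
    have hS : ∀ j < n, ∑ k ∈ Finset.range n, (if k ≤ j then (2 : K) else 0) •
        B.elem k (2 * n - 1) = (2 : K) • ∑ k ∈ Finset.range (j + 1), B.elem k (2 * n - 1) := by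
      intro j hj
      rw [Finset.smul_sum]
      rw [← Finset.sum_subset (Finset.range_mono (show j + 1 ≤ n by omega))]
      · refine Finset.sum_congr rfl fun k hk => ?_
        rw [Finset.mem_range] at hk
        rw [if_pos (by omega)]
      · intro k _ hk
        rw [Finset.mem_range] at hk
        rw [if_neg (by omega), zero_smul]
    have hmem : ∀ j < n, ∑ k ∈ Finset.range (j + 1), B.elem k (2 * n - 1) ∈
        B.bdry (B.d₃ (-1)) := by
      intro j hj
      rw [← Submodule.smul_mem_iff _ h2, ← hS j hj]
      exact ⟨_, (hdiff j hj).symm⟩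
    have h1 := hmem i hi
    rw [Finset.sum_range_succ] at h1
    rcases Nat.eq_zero_or_pos i with rfl | hi0
    · rwa [Finset.sum_range_zero, zero_add] at h1
    · obtain ⟨i, rfl⟩ := Nat.exists_eq_succ_of_ne_zero hi0.ne'
      exact (Submodule.add_mem_iff_right _ (hmem i (by omega))).1 h1
  · rw [B.elem_eq_zero (by dsimp only [ends_src_nat]; unfold ValidPath; omega)]
    exact zero_mem _

lemma mem_of_d₁_one' (h2 : (2 : K) ≠ 0) {f : B.PV →ₗ[Λ ⊗[K] Λᵐᵒᵖ] Λ}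
    (hf : f ∘ₗ B.d₁ 1 = 0) :
    f ∈ Submodule.span K (Set.range fun k : Fin n => B.xCo k) ⊔ B.bdry (B.d₃ (-1)) := by
  refine (sup_le le_sup_left ((Submodule.span_le.2 ?_).trans le_sup_right) :
    Submodule.span K (Set.range fun k : Fin n => B.xCo k) ⊔
      Submodule.span K (Set.range fun k : Fin n => B.elem (k : ℕ) (2 * n - 1)) ≤ _)
    (mem_of_d₁_one h2 hf)
  rintro _ ⟨k, rfl⟩
  exact omega_mem_bdry_d₃ h2 k

/-- The same matrix, now by differences of rows. The auxiliary row `D n` is zero, which supplies the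
last difference. -/
lemma co_zero_of_comp_d₃ (h2 : (2 : K) ≠ 0) {f : B.PV →ₗ[Λ ⊗[K] Λᵐᵒᵖ] Λ}
    (hf : f ∘ₗ B.d₃ (-1) = 0) (i : ℕ) : B.co f i 0 = 0 := by
  by_cases hi : n ≤ i
  · exact B.co_eq_zero (by dsimp only [ends_src_nat]; unfold ValidPath; omega) f
  let D : ℕ → K := fun k => ∑ i ∈ Finset.range n, B.co f i 0 * ((n : K) - ((max k i : ℕ) : K))
  have hD : ∀ k ≤ n, D k = 0 := by
    intro k hk
    rcases hk.lt_or_eq with hk | rfl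
    · have := B.co_d₃ (-1) f k (2 * n - 1)
      rw [hf, co_zero, if_pos ⟨hk, rfl⟩] at this
      refine (mul_eq_zero.1 (Eq.trans ?_ this.symm)).resolve_left h2
      rw [Finset.mul_sum]
      refine Finset.sum_congr rfl fun i hi => ?_
      have hm : (((max k i : ℕ) : ℤ) : K) = ((max k i : ℕ) : K) := Int.cast_natCast _
      rw [wsum_pathSign_neg_one hk (Finset.mem_range.1 hi), Int.cast_mul, Int.cast_sub, hm,
        Int.cast_natCast, Int.cast_ofNat]
      ring
    · refine Finset.sum_eq_zero fun i hi => ?_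
      rw [max_eq_left (Finset.mem_range.1 hi).le, sub_self, mul_zero]
  have hsum : ∀ k < n, ∑ i ∈ Finset.range (k + 1), B.co f i 0 = 0 := by
    intro k hk
    have h : D k - D (k + 1) = 0 := by rw [hD k hk.le, hD (k + 1) hk, sub_zero]
    rw [← Finset.sum_sub_distrib] at h
    rw [← h, ← Finset.sum_subset (Finset.range_mono (show k + 1 ≤ n by omega))]
    · refine Finset.sum_congr rfl fun i hi => ?_
      rw [Finset.mem_range] at hi
      rw [max_eq_left (by omega), max_eq_left (by omega)]
      push_cast; ring
    · intro i _ hi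
      rw [Finset.mem_range] at hi
      rw [max_eq_right (by omega), max_eq_right (by omega), sub_self]
  have h1 := hsum i (by omega)
  rw [Finset.sum_range_succ] at h1
  rcases Nat.eq_zero_or_pos i with rfl | hi0
  · rwa [Finset.sum_range_zero, zero_add] at h1
  · obtain ⟨i, rfl⟩ := Nat.exists_eq_succ_of_ne_zero hi0.ne'
    rwa [hsum i (by omega), zero_add] at h1

/-- Length zero is excluded by the cocycle condition. Modulo boundaries, cochains of even positive
length are moved right until they leave the valid range, and those of odd length are moved to the
vertex `0`. -/
lemma mem_of_d₃_neg_one (h2 : (2 : K) ≠ 0) {f : B.PV →ₗ[Λ ⊗[K] Λᵐᵒᵖ] Λ}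
    (hf : f ∘ₗ B.d₃ (-1) = 0) :
    f ∈ Submodule.span K (Set.range fun k : Fin n => B.elem 0 (2 * k + 1)) ⊔
      B.bdry (B.d₂ (-1)) := by
  set T := Submodule.span K (Set.range fun k : Fin n => B.elem 0 (2 * (k : ℕ) + 1)) ⊔
      B.bdry (B.d₂ (-1))
  have hT : B.bdry (B.d₂ (-1)) ≤ T := le_sup_right
  refine B.mem_of_elem_mem (Finset.range n) vertices_cover fun i d h => ?_
  have hv : ValidPath n i i d := by
    by_contra hv; exact h (B.co_eq_zero hv _)
  rcases Nat.eq_zero_or_pos d with rfl | hd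
  · exact absurd (co_zero_of_comp_d₃ h2 hf i) h
  rcases Nat.mod_two_eq_zero_or_one d with hd' | hd'
  · have key : ∀ m i, n ≤ m + i → B.elem i d ∈ T := by
      intro m
      induction m with
      | zero =>
        intro i h
        rw [B.elem_eq_zero (by dsimp only [ends_src_nat]; unfold ValidPath; omega)]
        exact T.zero_mem
      | succ m ih =>
        intro i h
        by_cases hv : ValidPath n i i d
        · have h1 := hT (sub_mem_bdry_d₂ (B := B) (-1) (i := i) hd (by unfold ValidPath at *; omega))
          have := T.add_mem h1 (ih (i + 1) (by omega))
          rwa [sub_add_cancel] at this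
        · rw [B.elem_eq_zero hv]
          exact T.zero_mem
    exact key n i (by omega)
  · refine elem_mem_of_elem_zero_mem (-1) hT hd (Submodule.mem_sup_left (Submodule.subset_span
      ⟨⟨d / 2, by unfold ValidPath at hv; omega⟩, ?_⟩)) i
    dsimp only
    congr 1
    omega

/-- A functional vanishing on coboundaries: the sum over the vertices telescopes, and for `s = -1`
the loop contributes nothing. It detects the coefficients of the cochains `elem 0 (2 * k + 1)`. -/
lemma sum_co_of_mem_bdry_d₂ {f : B.PV →ₗ[Λ ⊗[K] Λᵐᵒᵖ] Λ} (hf : f ∈ B.bdry (B.d₂ (-1))) (k : ℕ) :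
    ∑ i ∈ Finset.range n, B.co f i (2 * k + 1) = 0 := by
  obtain ⟨φ, rfl⟩ := hf
  let c : ℕ → K := fun i => if i = 0 then 0 else
    B.co φ (LArrow.L i) (2 * k) + B.co φ (LArrow.R (i - 1)) (2 * k)
  have h1 : ∀ i, B.co (φ ∘ₗ B.d₂ (-1)) i (2 * k + 1) = c (i + 1) - c i := by
    intro i
    rw [co_d₂]
    split_ifs with hv
    · unfold c
      rw [if_neg (Nat.succ_ne_zero i), Nat.add_sub_cancel]
      split_ifs with h0
      · subst h0
        rw [LArrow.opp, if_pos rfl, LArrow.sign_L_zero, neg_smul, one_smul]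
        abel
      · obtain ⟨i, rfl⟩ := Nat.exists_eq_succ_of_ne_zero h0
        rw [LArrow.opp, if_neg h0, LArrow.sign_L_succ, one_smul]
        abel
    · unfold c
      rw [if_neg (Nat.succ_ne_zero i), Nat.add_sub_cancel,
        B.co_eq_zero (g := LArrow.L (i + 1)) (by
          dsimp only [ends_src_arrow, ends_tgt_arrow, LArrow.src_L, LArrow.tgt_L]
          unfold ValidPath at *; omega),
        B.co_eq_zero (g := LArrow.R i) (by
          dsimp only [ends_src_arrow, ends_tgt_arrow, LArrow.src_R, LArrow.tgt_R]
          unfold ValidPath at *; omega)]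
      split_ifs with h0
      · simp
      · obtain ⟨i, rfl⟩ := Nat.exists_eq_succ_of_ne_zero h0
        rw [B.co_eq_zero (g := LArrow.L (i + 1)) (by
            dsimp only [ends_src_arrow, ends_tgt_arrow, LArrow.src_L, LArrow.tgt_L]
            unfold ValidPath at *; omega),
          B.co_eq_zero (g := LArrow.R (i + 1 - 1)) (by
            dsimp only [ends_src_arrow, ends_tgt_arrow, LArrow.src_R, LArrow.tgt_R]
            unfold ValidPath at *; omega)]
        simp
  rw [Finset.sum_congr rfl fun i _ => h1 i, Finset.sum_range_sub]
  unfold c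
  rw [if_pos rfl, sub_zero]
  split_ifs with h0
  · rfl
  · rw [B.co_eq_zero (g := LArrow.L n) (by
        dsimp only [ends_src_arrow, LArrow.src_L]; unfold ValidPath; omega),
      B.co_eq_zero (g := LArrow.R (n - 1)) (by
        dsimp only [ends_tgt_arrow, LArrow.tgt_R]; unfold ValidPath; omega), add_zero]

end PathBasis

end

noncomputable section

variable {K Λ : Type u} [Field K] [Ring Λ] [Algebra K Λ] {n : ℕ}

namespace PathBasis

open Ends

variable {B : PathBasis K Λ n}

/-! ### The cohomology in degrees `1` and `4` -/

lemma mem_of_co_R_eq_neg {T : Submodule K (B.PA →ₗ[Λ ⊗[K] Λᵐᵒᵖ] Λ)}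
    {f : B.PA →ₗ[Λ ⊗[K] Λᵐᵒᵖ] Λ}
    (hf : ∀ i d, B.co f (LArrow.R i) d = -B.co f (LArrow.L (i + 1)) d)
    (h0 : ∀ d, B.co f (LArrow.L 0) d ≠ 0 → B.elem (LArrow.L 0) d ∈ T)
    (hu : ∀ i d, B.elem (LArrow.L (i + 1)) d - B.elem (LArrow.R i) d ∈ T) : f ∈ T := by
  have key : f = ∑ d ∈ Finset.range (2 * n), B.co f (LArrow.L 0) d • B.elem (LArrow.L 0) d +
      ∑ i ∈ Finset.range n, ∑ d ∈ Finset.range (2 * n), B.co f (LArrow.L (i + 1)) d •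
        (B.elem (LArrow.L (i + 1)) d - B.elem (LArrow.R i) d) := by
    refine B.cochain_ext fun a d hd => ?_
    have hd' : d ∈ Finset.range (2 * n) := Finset.mem_range.2 (by
      dsimp only [ends_src_arrow, ends_tgt_arrow] at hd; unfold ValidPath at hd; omega)
    simp only [co_add, co_sum, co_smul, co_sub, co_elem, hd, and_true]
    rcases a with i | _ | i
    · have hi : i ∈ Finset.range n := Finset.mem_range.2 (by
        dsimp only [ends_src_arrow, LArrow.src_R] at hd; unfold ValidPath at hd; omega)
      rw [Finset.sum_eq_zero (by simp), zero_add, Finset.sum_eq_single_of_mem i hi,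
        Finset.sum_eq_single_of_mem d hd', hf]
      · simp
      · intro d' _ h
        simp [Ne.symm h]
      · intro j _ h
        simp [Ne.symm h]
    · rw [Finset.sum_eq_single_of_mem d hd', Finset.sum_eq_zero (by simp)]
      · simp
      · intro d' _ h
        simp [Ne.symm h]
    · have hi : i ∈ Finset.range n := Finset.mem_range.2 (by
        dsimp only [ends_tgt_arrow, LArrow.tgt_L] at hd; unfold ValidPath at hd; omega)
      rw [Finset.sum_eq_zero (by simp), zero_add, Finset.sum_eq_single_of_mem i hi,
        Finset.sum_eq_single_of_mem d hd']
      · simp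
      · intro d' _ h
        simp [Ne.symm h]
      · intro j _ h
        simp [Ne.symm h]
  rw [key]
  refine T.add_mem (T.sum_mem fun d _ => ?_)
    (T.sum_mem fun i _ => T.sum_mem fun d _ => T.smul_mem _ (hu i d))
  by_cases h : B.co f (LArrow.L 0) d = 0
  · rw [h, zero_smul]; exact T.zero_mem
  · exact T.smul_mem _ (h0 d h)

/-- The cocycle condition at a vertex equates the sums of the two coefficients on the edges to its
right and left. So this sum is constant along the graph and is determined by the loop. -/
lemma co_L_add_co_R {s : ℤ} {f : B.PA →ₗ[Λ ⊗[K] Λᵐᵒᵖ] Λ} (hf : f ∘ₗ B.d₂ s = 0) {d : ℕ} {i : ℕ}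
    (h : ValidPath n i i (d + 1)) :
    B.co f (LArrow.L (i + 1)) d + B.co f (LArrow.R i) d = (1 + s) • B.co f (LArrow.L 0) d := by
  have hc : ∀ i, ValidPath n i i (d + 1) → B.co f (LArrow.L (i + 1)) d + B.co f (LArrow.R i) d =
      B.co f (LArrow.opp i) d + (LArrow.L i).sign s • B.co f (LArrow.L i) d := by
    intro i h
    have := B.co_d₂ s f i d
    rw [hf, co_zero, if_pos h, sub_sub] at this
    exact sub_eq_zero.1 this.symm
  induction i with
  | zero =>
    rw [hc 0 h, LArrow.opp, if_pos rfl, LArrow.sign_L_zero, add_smul, one_smul]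
  | succ i ih =>
    rw [hc _ h, LArrow.opp, if_neg (Nat.succ_ne_zero i), LArrow.sign_L_succ, one_smul,
      ← ih (by unfold ValidPath at *; omega), Nat.add_sub_cancel, add_comm]

lemma elem_sub_elem_mem {s : ℤ} {T : Submodule K (B.PA →ₗ[Λ ⊗[K] Λᵐᵒᵖ] Λ)}
    (hT : B.bdry (B.d₁ s) ≤ T) {m : ℕ}
    (h : (1 - s) • B.elem (LArrow.L 0) m ∈ T) (i : ℕ) :
    B.elem (LArrow.L (i + 1)) m - B.elem (LArrow.R i) m ∈ T := by
  by_cases hv : ValidPath n i (i + 1) m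
  · obtain ⟨m, rfl⟩ : ∃ d, m = d + 1 := ⟨m - 1, by unfold ValidPath at hv; omega⟩
    induction i with
    | zero =>
      have h1 := hT ⟨_, (B.elem_zero_d₁ s (d := m) (by unfold ValidPath at *; omega)).symm⟩
      have := T.sub_mem h1 h
      rwa [add_sub_cancel_right] at this
    | succ i ih =>
      have h1 := hT ⟨_, (B.elem_succ_d₁ s (i := i) (d := m)
        (by unfold ValidPath at *; omega)).symm⟩
      have := T.add_mem h1 (ih (by unfold ValidPath at *; omega))
      rwa [sub_add_cancel] at this
  · rw [B.elem_eq_zero (g := LArrow.R i) hv, B.elem_eq_zero (g := LArrow.L (i + 1)), sub_zero]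
    · exact T.zero_mem
    · dsimp only [ends_src_arrow, ends_tgt_arrow, LArrow.src_L, LArrow.tgt_L]
      unfold ValidPath at *; omega

/-- The antisymmetric cochain on an edge is moved right until it vanishes, so it is a boundary on
every edge. Subtracting the one next to the loop from the boundary of `elem 0` leaves twice the loop
cochain. -/
lemma elem_L_zero_odd_mem (h2 : (2 : K) ≠ 0) {m : ℕ} (hm : m % 2 = 1) :
    B.elem (LArrow.L 0) m ∈ B.bdry (B.d₁ (-1)) := by
  by_cases hv : ValidPath n 0 0 m
  · have key : ∀ t i, n ≤ t + i →
        B.elem (LArrow.L (i + 1)) m - B.elem (LArrow.R i) m ∈ B.bdry (B.d₁ (-1)) := by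
      have h0 : ∀ i, ¬ ValidPath n i (i + 1) m →
          B.elem (LArrow.L (i + 1)) m - B.elem (LArrow.R i) m ∈ B.bdry (B.d₁ (-1)) := by
        intro i hi
        rw [B.elem_eq_zero (g := LArrow.R i) hi, B.elem_eq_zero (g := LArrow.L (i + 1)), sub_zero]
        · exact zero_mem _
        · dsimp only [ends_src_arrow, ends_tgt_arrow, LArrow.src_L, LArrow.tgt_L]
          unfold ValidPath at *; omega
      intro t
      induction t with
      | zero => intro i hi; exact h0 i (by unfold ValidPath; omega)
      | succ t ih =>
        intro i hi
        by_cases hi' : ValidPath n i (i + 1) m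
        · obtain ⟨m, rfl⟩ : ∃ d, m = d + 1 := ⟨m - 1, by omega⟩
          have h1 : _ ∈ B.bdry (B.d₁ (-1)) := ⟨_, (B.elem_succ_d₁ (-1) (i := i) (d := m)
            (by unfold ValidPath at *; omega)).symm⟩
          have := sub_mem (ih (i + 1) (by omega)) h1
          rwa [sub_sub_cancel] at this
        · exact h0 i hi'
    obtain ⟨m, rfl⟩ : ∃ d, m = d + 1 := ⟨m - 1, by omega⟩
    have h1 : _ ∈ B.bdry (B.d₁ (-1)) := ⟨_, (B.elem_zero_d₁ (-1) (d := m)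
      (by unfold ValidPath at *; omega)).symm⟩
    have h3 := sub_mem h1 (key n 0 (by omega))
    rw [add_sub_cancel_left, show (1 - -1 : ℤ) = 2 from rfl, ← Int.cast_smul_eq_zsmul K] at h3
    push_cast at h3
    exact (Submodule.smul_mem_iff _ h2).1 h3
  · rw [B.elem_eq_zero hv]
    exact zero_mem _

lemma mem_of_d₂_neg_one (h2 : (2 : K) ≠ 0) {f : B.PA →ₗ[Λ ⊗[K] Λᵐᵒᵖ] Λ}
    (hf : f ∘ₗ B.d₂ (-1) = 0) :
    f ∈ Submodule.span K (Set.range fun k : Fin n => B.elem (LArrow.L 0) (2 * k)) ⊔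
      B.bdry (B.d₁ (-1)) := by
  have h0 : ∀ d, B.elem (LArrow.L 0) d ∈ Submodule.span K
      (Set.range fun k : Fin n => B.elem (LArrow.L 0) (2 * k)) ⊔ B.bdry (B.d₁ (-1)) := by
    intro d
    rcases Nat.mod_two_eq_zero_or_one d with hd | hd
    · by_cases hv : ValidPath n 0 0 d
      · refine Submodule.mem_sup_left (Submodule.subset_span
          ⟨⟨d / 2, by unfold ValidPath at hv; omega⟩, ?_⟩)
        dsimp only
        congr 1
        omega
      · rw [B.elem_eq_zero hv]
        exact zero_mem _
    · exact Submodule.mem_sup_right (elem_L_zero_odd_mem h2 hd)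
  refine mem_of_co_R_eq_neg (fun i d => ?_) (fun d _ => h0 d)
    (fun i d => elem_sub_elem_mem le_sup_right (zsmul_mem (h0 d) _) i)
  by_cases hv : ValidPath n i (i + 1) d
  · have := co_L_add_co_R hf (i := i) (d := d) (by unfold ValidPath at *; omega)
    rw [add_neg_cancel, zero_smul] at this
    exact eq_neg_of_add_eq_zero_right this
  · rw [B.co_eq_zero (g := LArrow.R i) hv, B.co_eq_zero (g := LArrow.L (i + 1)), neg_zero]
    dsimp only [ends_src_arrow, ends_tgt_arrow, LArrow.src_L, LArrow.tgt_L]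
    unfold ValidPath at *; omega

variable (B) in
/-- The cocycles `X ^ k * y`. -/
def xyCo (k : ℕ) : B.PA →ₗ[Λ ⊗[K] Λᵐᵒᵖ] Λ := B.lift fun a => B.b a.src a.tgt (2 * k + 1)

variable (B) in
lemma xyCo_gen (k : ℕ) (a : LArrow) : B.xyCo k (B.gen a) = B.b a.src a.tgt (2 * k + 1) := by
  rw [xyCo, lift_gen, bimodule_smul, ends_src_arrow, ends_tgt_arrow, e_mul_b, b_mul_e]

lemma co_xyCo (k : ℕ) (a : LArrow) (d : ℕ) : B.co (B.xyCo k) a d =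
    if d = 2 * k + 1 ∧ ValidPath n a.src a.tgt d then 1 else 0 := by
  rw [co, xyCo_gen, coef_b]
  simp

lemma xyCo_comp (k : ℕ) : B.xyCo k ∘ₗ B.d₂ 1 = 0 := by
  refine B.cochain_ext fun i d hd => ?_
  rw [co_zero]
  obtain _ | d := d
  · exact B.co_d₂_zero 1 _ i
  dsimp only [ends_src_nat, ends_tgt_nat] at hd
  rw [co_d₂, if_pos hd]
  simp only [co_xyCo]
  have hs : (LArrow.L i).sign 1 = 1 := by unfold LArrow.sign; split_ifs <;> rfl
  rw [hs, one_smul]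
  by_cases hk : d = 2 * k + 1
  · subst hk
    simp only [LArrow.src_opp, LArrow.tgt_opp, LArrow.src_L, LArrow.src_R, LArrow.tgt_L,
      LArrow.tgt_R]
    rw [if_pos ⟨trivial, by unfold ValidPath at *; omega⟩, if_pos ⟨trivial, by unfold ValidPath at *; omega⟩,
      if_pos ⟨trivial, by unfold ValidPath at *; omega⟩, if_pos ⟨trivial, by unfold ValidPath at *; omega⟩]
    ring
  · simp [hk]

lemma mem_of_d₂_one' (h2 : (2 : K) ≠ 0) {f : B.PA →ₗ[Λ ⊗[K] Λᵐᵒᵖ] Λ}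
    (hf : f ∘ₗ B.d₂ 1 = 0) :
    f ∈ Submodule.span K (Set.range fun k : Fin n => B.xyCo k) ⊔ B.bdry (B.d₁ 1) := by
  set g := ∑ k : Fin n, B.co f (LArrow.L 0) (2 * k + 1) • B.xyCo k with hg
  have hgc : g ∘ₗ B.d₂ 1 = 0 := by
    refine LinearMap.ext fun x => ?_
    rw [hg, LinearMap.comp_apply, LinearMap.sum_apply]
    refine Finset.sum_eq_zero fun k _ => ?_
    rw [LinearMap.smul_apply, ← LinearMap.comp_apply, xyCo_comp, LinearMap.zero_apply, smul_zero]
  have hfg : (f - g) ∘ₗ B.d₂ 1 = 0 := by rw [LinearMap.sub_comp, hf, hgc, sub_zero]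
  have hg0 : ∀ d, d % 2 = 1 → ValidPath n 0 0 d →
      B.co g (LArrow.L 0) d = B.co f (LArrow.L 0) d := by
    intro d hd hv
    have hk : d / 2 < n := by unfold ValidPath at hv; omega
    rw [co_sum, Finset.sum_eq_single_of_mem (⟨d / 2, hk⟩ : Fin n) (Finset.mem_univ _)]
    · have hd' : 2 * (d / 2) + 1 = d := by omega
      rw [co_smul, co_xyCo, hd', if_pos ⟨rfl, hv⟩, mul_one]
    · intro k _ hk
      rw [co_smul, co_xyCo, if_neg, mul_zero]
      rintro ⟨h, _⟩
      exact hk (Fin.ext (by simp only; omega))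
  have key : ∀ d, B.co (f - g) (LArrow.L 0) d = 0 := by
    intro d
    by_cases hv : ValidPath n 0 0 d
    · rcases Nat.mod_two_eq_zero_or_one d with hd | hd
      · have hz : ∀ i, n ≤ i ∨ ¬ ValidPath n i (i + 1) d → B.co (f - g) (LArrow.L (i + 1)) d +
            B.co (f - g) (LArrow.R i) d = 0 := by
          intro i hi
          rw [B.co_eq_zero (g := LArrow.R i), B.co_eq_zero (g := LArrow.L (i + 1)), add_zero]
          · dsimp only [ends_src_arrow, ends_tgt_arrow, LArrow.src_L, LArrow.tgt_L]
            unfold ValidPath at *; omega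
          · dsimp only [ends_src_arrow, ends_tgt_arrow, LArrow.src_R, LArrow.tgt_R]
            unfold ValidPath at *; omega
        -- At the vertex `d / 2` the path of length `d + 1` still exists, but the edge to its right
        -- carries no path of length `d`. So twice the loop coefficient is zero.
        have h3 := co_L_add_co_R hfg (i := d / 2) (d := d) (by unfold ValidPath at *; omega)
        rw [hz (d / 2) (Or.inr (by unfold ValidPath; omega)), one_add_one_eq_two,
          ← Int.cast_smul_eq_zsmul K] at h3
        push_cast at h3
        exact (mul_eq_zero.1 h3.symm).resolve_left h2
      · rw [co_sub, hg0 d hd hv, sub_self]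
    · exact B.co_eq_zero hv _
  rw [← sub_add_cancel f g, add_comm]
  refine add_mem (Submodule.mem_sup_left (Submodule.sum_mem _ fun k _ => Submodule.smul_mem _ _
    (Submodule.subset_span ⟨k, rfl⟩))) (Submodule.mem_sup_right ?_)
  refine mem_of_co_R_eq_neg (fun i d => ?_) (fun d h => absurd (key d) h)
    (fun i d => elem_sub_elem_mem le_rfl (by rw [sub_self, zero_smul]; exact zero_mem _) i)
  by_cases hv : ValidPath n i (i + 1) d
  · have := co_L_add_co_R hfg (i := i) (d := d) (by unfold ValidPath at *; omega)
    rw [key, smul_zero] at this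
    exact eq_neg_of_add_eq_zero_right this
  · rw [B.co_eq_zero (g := LArrow.R i) hv, B.co_eq_zero (g := LArrow.L (i + 1)), neg_zero]
    dsimp only [ends_src_arrow, ends_tgt_arrow, LArrow.src_L, LArrow.tgt_L]
    unfold ValidPath at *; omega

lemma co_L_zero_of_mem_bdry_d₁_one {f : B.PA →ₗ[Λ ⊗[K] Λᵐᵒᵖ] Λ} (hf : f ∈ B.bdry (B.d₁ 1))
    (d : ℕ) : B.co f (LArrow.L 0) d = 0 := by
  obtain ⟨φ, rfl⟩ := hf
  obtain _ | d := d
  · exact B.co_d₁_zero 1 φ _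
  · rw [co_d₁, LArrow.sign_L_zero, one_smul]
    exact (if_congr Iff.rfl (sub_self _) rfl).trans (ite_self _)

/-- A functional vanishing on coboundaries: for even positive length, the coboundary of `φ` takes
twice the coefficient of `φ` at `0` on the loop, while its coefficients on the right arrows
telescope to minus that coefficient. It detects the cochains on the loop. -/
lemma co_add_sum_of_mem_bdry_d₁ {f : B.PA →ₗ[Λ ⊗[K] Λᵐᵒᵖ] Λ} (hf : f ∈ B.bdry (B.d₁ (-1)))
    {k : ℕ} (hk : k < n) :
    B.co f (LArrow.L 0) (2 * k) + 2 * ∑ i ∈ Finset.range n, B.co f (LArrow.R i) (2 * k) = 0 := by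
  obtain ⟨φ, rfl⟩ := hf
  obtain _ | k := k
  · rw [mul_zero, co_d₁_zero, Finset.sum_eq_zero fun i _ => B.co_d₁_zero _ φ _]
    simp
  · have h1 : ∀ i, B.co (φ ∘ₗ B.d₁ (-1)) (LArrow.R i) (2 * (k + 1)) =
        B.co φ (i + 1) (2 * k + 1) - B.co φ i (2 * k + 1) := by
      intro i
      have := B.co_d₁ (-1) φ (LArrow.R i) (2 * k + 1)
      rw [LArrow.sign_R, one_smul, LArrow.src_R, LArrow.tgt_R] at this
      refine this.trans ?_
      split_ifs with hv
      · rfl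
      · rw [B.co_eq_zero (g := i), B.co_eq_zero (g := i + 1), sub_zero]
        · dsimp only [ends_src_nat, ends_tgt_nat]
          unfold ValidPath at *; omega
        · dsimp only [ends_src_nat, ends_tgt_nat]
          unfold ValidPath at *; omega
    rw [Finset.sum_congr rfl fun i _ => h1 i, Finset.sum_range_sub fun i => B.co φ i (2 * k + 1),
      B.co_eq_zero (g := n) (by dsimp only [ends_src_nat]; unfold ValidPath; omega)]
    have := B.co_d₁ (-1) φ (LArrow.L 0) (2 * k + 1)
    rw [LArrow.sign_L_zero, neg_smul, one_smul, LArrow.src_L, LArrow.tgt_L, if_pos] at this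
    · rw [show 2 * (k + 1) = 2 * k + 1 + 1 by ring, this]
      ring
    · unfold ValidPath; omega

end PathBasis

end

noncomputable section

variable {K Λ : Type u} [Field K] [Ring Λ] [Algebra K Λ] {n : ℕ}

namespace PathBasis

open Ends

variable {B : PathBasis K Λ n}

/-! ### Bases of the cohomology spaces -/

lemma xCo_comp (k : ℕ) : B.xCo k ∘ₗ B.d₁ 1 = 0 := by
  refine B.cochain_ext fun a d hd => ?_
  rw [co_zero]
  obtain _ | d := d
  · exact B.co_d₁_zero 1 _ a
  dsimp only [ends_src_arrow, ends_tgt_arrow] at hd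
  rw [co_d₁, if_pos hd, co_xCo, co_xCo]
  have hs : a.sign 1 = 1 := by unfold LArrow.sign; split_ifs <;> rfl
  rw [hs, one_smul, sub_eq_zero]
  refine if_congr (and_congr_right fun h => ?_) rfl rfl
  rcases a with i | i <;>
  · dsimp only [LArrow.src_R, LArrow.tgt_R, LArrow.src_L, LArrow.tgt_L] at *
    unfold ValidPath at *
    omega

lemma omega_comp (s : ℤ) (k : ℕ) : B.elem k (2 * n - 1) ∘ₗ B.d₁ s = 0 := by
  refine B.cochain_ext fun a d hd => ?_
  rw [co_zero]
  obtain _ | d := d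
  · exact B.co_d₁_zero s _ a
  dsimp only [ends_src_arrow, ends_tgt_arrow] at hd
  rw [co_d₁, if_pos hd, co_elem, co_elem, if_neg, if_neg, smul_zero, sub_zero]
  all_goals
    rintro ⟨⟨h1, h2⟩, _⟩
    rcases a with i | i <;>
    · dsimp only [LArrow.src_R, LArrow.tgt_R, LArrow.src_L, LArrow.tgt_L] at *
      unfold ValidPath at *
      omega

lemma elem_L_zero_comp {k : ℕ} (hk : k < n) : B.elem (LArrow.L 0) (2 * k) ∘ₗ B.d₂ (-1) = 0 := by
  rw [B.elem_L_zero_d₂ (-1) (by unfold ValidPath; omega), add_neg_cancel, neg_zero, zero_smul]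

lemma elem_succ_comp (s : ℤ) (i d : ℕ) : B.elem i (d + 1) ∘ₗ B.d₃ s = 0 := by
  refine B.cochain_ext fun k m _ => ?_
  rw [co_zero, co_d₃]
  split_ifs
  · refine Finset.sum_eq_zero fun j _ => ?_
    rw [co_elem, if_neg, zero_mul]
    rintro ⟨⟨_, h⟩, _⟩
    omega
  · rfl

variable (B) in
/-- Cocycles whose classes form bases of the cohomology spaces, in positive degrees. -/
def basisCo : ∀ i, Fin n → B.Cochain i
  | 0, k => B.xCo k
  | 1, k => B.xyCo k
  | 2, k => (B.elem (k : ℕ) 0 : B.PV →ₗ[Λ ⊗[K] Λᵐᵒᵖ] Λ)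
  | 3, k => (B.elem (k : ℕ) (2 * n - 1) : B.PV →ₗ[Λ ⊗[K] Λᵐᵒᵖ] Λ)
  | 4, k => (B.elem (LArrow.L 0) (2 * k) : B.PA →ₗ[Λ ⊗[K] Λᵐᵒᵖ] Λ)
  | 5, k => (B.elem 0 (2 * k + 1) : B.PV →ₗ[Λ ⊗[K] Λᵐᵒᵖ] Λ)
  | i + 6, k => basisCo i k

lemma basisCo_comp (k : Fin n) : ∀ i, B.basisCo i k ∘ₗ B.resD i = 0 :=
  Nat.six_induction (xCo_comp k) (xyCo_comp k) (B.comp_d₃_one _) (omega_comp _ _)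
    (elem_L_zero_comp k.2) (elem_succ_comp _ _ _) fun _ h => h

lemma mem_span_basisCo (h2 : (2 : K) ≠ 0) : ∀ i (f : B.Cochain (i + 1)),
    f ∘ₗ B.resD (i + 1) = 0 →
      f ∈ Submodule.span K (Set.range (B.basisCo (i + 1))) ⊔ B.bdry (B.resD i) :=
  Nat.six_induction (fun _ hf => mem_of_d₂_one' h2 hf) (fun f _ => mem_of_d₂_one h2 f)
    (fun _ hf => Submodule.mem_sup_left (mem_of_d₁_neg_one h2 hf))
    (fun _ hf => mem_of_d₂_neg_one h2 hf) (fun _ hf => mem_of_d₃_neg_one h2 hf)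
    (fun _ hf => mem_of_d₁_one' h2 hf) fun _ h => h

section

variable {G : Type} [Ends G] (a : Fin n → K)

lemma co_sum_smul (f : Fin n → B.Bimod G →ₗ[Λ ⊗[K] Λᵐᵒᵖ] Λ) (g : G) (d : ℕ) :
    B.co (∑ k, a k • f k) g d = ∑ k, a k * B.co (f k) g d := by
  rw [co_sum]
  simp only [co_smul]

end

lemma sum_mul_ite (a : Fin n → K) (k : Fin n) {p : Fin n → Prop} [DecidablePred p]
    (h : ∀ j, p j ↔ j = k) : ∑ j, a j * (if p j then 1 else 0) = a k := by
  simp [h]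

lemma eq_zero_of_sum_xyCo_mem_bdry (a : Fin n → K)
    (h : ∑ k : Fin n, a k • B.xyCo k ∈ B.bdry (B.d₁ 1)) (k : Fin n) : a k = 0 := by
  have := co_L_zero_of_mem_bdry_d₁_one h (2 * k + 1)
  rw [co_sum_smul] at this
  refine Eq.trans ?_ this
  simp only [co_xyCo]
  refine (sum_mul_ite a k fun j => ?_).symm
  dsimp only [LArrow.src_L, LArrow.tgt_L]
  rw [Fin.ext_iff]
  unfold ValidPath
  omega

lemma eq_zero_of_sum_elem_zero_mem_bdry (a : Fin n → K)
    (h : ∑ k : Fin n, a k • B.elem (k : ℕ) 0 ∈ B.bdry (B.d₂ 1)) (k : Fin n) : a k = 0 := by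
  have := co_zero_of_mem_bdry_d₂ h k
  rw [co_sum_smul] at this
  refine Eq.trans ?_ this
  simp only [co_elem, and_true]
  refine (sum_mul_ite a k fun j => ?_).symm
  dsimp only [ends_src_nat, ends_tgt_nat]
  rw [Fin.ext_iff]
  unfold ValidPath
  omega

lemma eq_zero_of_sum_omega_eq_zero (a : Fin n → K)
    (h : ∑ k : Fin n, a k • B.elem (k : ℕ) (2 * n - 1) = 0) (k : Fin n) : a k = 0 := by
  have := B.co_sum_smul a (fun k : Fin n => B.elem (k : ℕ) (2 * n - 1)) (k : ℕ) (2 * n - 1)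
  rw [h, co_zero] at this
  refine Eq.trans ?_ this.symm
  simp only [co_elem, and_true]
  refine (sum_mul_ite a k fun j => ?_).symm
  dsimp only [ends_src_nat, ends_tgt_nat]
  rw [Fin.ext_iff]
  unfold ValidPath
  omega

lemma eq_zero_of_sum_elem_L_zero_mem_bdry (a : Fin n → K)
    (h : ∑ k : Fin n, a k • B.elem (LArrow.L 0) (2 * k) ∈ B.bdry (B.d₁ (-1))) (k : Fin n) :
    a k = 0 := by
  have := co_add_sum_of_mem_bdry_d₁ h k.2
  have h0 : ∑ i ∈ Finset.range n, B.co (∑ k : Fin n, a k • B.elem (LArrow.L 0) (2 * k))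
      (LArrow.R i) (2 * k) = 0 := by
    refine Finset.sum_eq_zero fun i _ => ?_
    rw [co_sum_smul]
    refine Finset.sum_eq_zero fun j _ => ?_
    rw [co_elem, if_neg, mul_zero]
    simp
  rw [h0, mul_zero, add_zero, co_sum_smul] at this
  refine Eq.trans ?_ this
  simp only [co_elem, true_and]
  refine (sum_mul_ite a k fun j => ?_).symm
  dsimp only [ends_src_arrow, ends_tgt_arrow, LArrow.src_L, LArrow.tgt_L]
  rw [Fin.ext_iff]
  unfold ValidPath
  omega

lemma eq_zero_of_sum_elem_odd_mem_bdry (a : Fin n → K)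
    (h : ∑ k : Fin n, a k • B.elem 0 (2 * (k : ℕ) + 1) ∈ B.bdry (B.d₂ (-1))) (k : Fin n) :
    a k = 0 := by
  have := sum_co_of_mem_bdry_d₂ h k
  rw [Finset.sum_eq_single_of_mem 0 (Finset.mem_range.2 k.pos), co_sum_smul] at this
  · refine Eq.trans ?_ this
    simp only [co_elem, true_and]
    refine (sum_mul_ite a k fun j => ?_).symm
    dsimp only [ends_src_nat, ends_tgt_nat]
    rw [Fin.ext_iff]
    unfold ValidPath
    omega
  · intro i _ hi
    rw [co_sum_smul]
    refine Finset.sum_eq_zero fun j _ => ?_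
    rw [co_elem, if_neg fun h => hi h.1.1, mul_zero]

/-- Coboundaries of `d₃` are concentrated in the odd length `2 * n - 1`, whereas `X ^ k` has even
length `2 * k`. -/
lemma eq_zero_of_sum_xCo_mem_bdry (a : Fin n → K)
    (h : ∑ k : Fin n, a k • B.xCo k ∈ B.bdry (B.d₃ (-1))) (k : Fin n) : a k = 0 := by
  obtain ⟨φ, hφ⟩ := h
  have := B.co_sum_smul a (fun k => B.xCo k) 0 (2 * k)
  rw [hφ, co_d₃, if_neg (by omega)] at this
  refine Eq.trans ?_ this.symm
  simp only [co_xCo]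
  refine (sum_mul_ite a k fun j => ?_).symm
  rw [Fin.ext_iff]
  unfold ValidPath
  omega

lemma eq_zero_of_sum_basisCo_mem_bdry (a : Fin n → K) : ∀ i,
    ∑ k, a k • B.basisCo (i + 1) k ∈ B.bdry (B.resD i) → ∀ k, a k = 0 :=
  Nat.six_induction (fun h => eq_zero_of_sum_xyCo_mem_bdry a h)
    (fun h => eq_zero_of_sum_elem_zero_mem_bdry a h)
    (fun ⟨φ, hφ⟩ => eq_zero_of_sum_omega_eq_zero a (hφ.trans (B.comp_d₃_one φ)))
    (fun h => eq_zero_of_sum_elem_L_zero_mem_bdry a h)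
    (fun h => eq_zero_of_sum_elem_odd_mem_bdry a h)
    (fun h => eq_zero_of_sum_xCo_mem_bdry a h) fun _ h => h

variable (B) in
lemma component_eq_span (h2 : (2 : K) ≠ 0) (i : ℕ) : HochschildCohomology.component K Λ (i + 1) =
    Submodule.span K (Set.range fun k => B.cl (i + 1) (B.basisCo (i + 1) k)) := by
  refine le_antisymm (fun x hx => ?_) (Submodule.span_le.2 ?_)
  · obtain ⟨f, hf, rfl⟩ := B.exists_cl_eq hx
    have h := cl_mem_span (S := Set.range (B.basisCo (i + 1)))
      (by rintro _ ⟨k, rfl⟩; exact basisCo_comp k (i + 1)) (mem_span_basisCo h2 i f hf)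
    rwa [← Set.range_comp] at h
  · rintro _ ⟨k, rfl⟩
    exact cl_mem _ _

lemma cl_sum {i : ℕ} (a : Fin n → K) {f : Fin n → B.Cochain i} (hf : ∀ k, f k ∘ₗ B.resD i = 0)
    (s : Finset (Fin n)) :
    (∑ k ∈ s, a k • f k) ∘ₗ B.resD i = 0 ∧
      B.cl i (∑ k ∈ s, a k • f k) = ∑ k ∈ s, a k • B.cl i (f k) := by
  induction s using Finset.induction_on with
  | empty => exact ⟨LinearMap.zero_comp _, cl_zero i⟩
  | insert k s hk ih =>
    rw [Finset.sum_insert hk, Finset.sum_insert hk]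
    have h : (a k • f k) ∘ₗ B.resD i = 0 := by rw [LinearMap.smul_comp, hf, smul_zero]
    refine ⟨by rw [LinearMap.add_comp, h, ih.1, add_zero], ?_⟩
    rw [cl_add h ih.1, ih.2, cl_smul _ (hf k)]

variable (B) in
lemma linearIndependent_cl (i : ℕ) :
    LinearIndependent K fun k => B.cl (i + 1) (B.basisCo (i + 1) k) := by
  refine Fintype.linearIndependent_iff.2 fun a h => ?_
  obtain ⟨h1, h3⟩ := cl_sum a (fun k => basisCo_comp (B := B) k (i + 1)) Finset.univ
  rw [← h3, cl_succ_eq_zero_iff h1] at h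
  exact eq_zero_of_sum_basisCo_mem_bdry a i h

variable (B) in
/-- The cocycles `X ^ k` and `ω_k` of degree zero. -/
def basisCo₀ : Fin n ⊕ Fin n → B.Cochain 0
  | Sum.inl k => B.xCo k
  | Sum.inr k => (B.elem (k : ℕ) (2 * n - 1) : B.PV →ₗ[Λ ⊗[K] Λᵐᵒᵖ] Λ)

lemma basisCo₀_comp (t : Fin n ⊕ Fin n) : B.basisCo₀ t ∘ₗ B.resD 0 = 0 := by
  cases t with
  | inl k => exact xCo_comp k
  | inr k => exact omega_comp _ _

variable (B) in
lemma component_zero_eq_span (h2 : (2 : K) ≠ 0) : HochschildCohomology.component K Λ 0 =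
    Submodule.span K (Set.range fun t => B.cl 0 (B.basisCo₀ t)) := by
  refine le_antisymm (fun x hx => ?_) (Submodule.span_le.2 ?_)
  · obtain ⟨f, hf, rfl⟩ := B.exists_cl_eq hx
    have h : f ∈ Submodule.span K (Set.range B.basisCo₀) := by
      refine (sup_le (Submodule.span_mono ?_) (Submodule.span_mono ?_) :
        Submodule.span K (Set.range fun k : Fin n => B.xCo k) ⊔
        Submodule.span K (Set.range fun k : Fin n => B.elem (k : ℕ) (2 * n - 1)) ≤ _)
        (mem_of_d₁_one h2 hf)
      · rintro _ ⟨k, rfl⟩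
        exact ⟨Sum.inl k, rfl⟩
      · rintro _ ⟨k, rfl⟩
        exact ⟨Sum.inr k, rfl⟩
    clear hf hx
    have key : f ∘ₗ B.resD 0 = 0 ∧
        B.cl 0 f ∈ Submodule.span K (Set.range fun t => B.cl 0 (B.basisCo₀ t)) := by
      induction h using Submodule.span_induction with
      | zero => exact ⟨LinearMap.zero_comp _, by rw [cl_zero]; exact zero_mem _⟩
      | add a b _ _ ha hb =>
        refine ⟨by rw [LinearMap.add_comp, ha.1, hb.1, add_zero], ?_⟩
        rw [cl_add ha.1 hb.1]
        exact add_mem ha.2 hb.2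
      | smul c a _ ha =>
        refine ⟨by rw [LinearMap.smul_comp, ha.1, smul_zero], ?_⟩
        rw [cl_smul c ha.1]
        exact Submodule.smul_mem _ _ ha.2
      | mem a ha =>
        obtain ⟨t, rfl⟩ := ha
        exact ⟨basisCo₀_comp t, Submodule.subset_span ⟨t, rfl⟩⟩
    exact key.2
  · rintro _ ⟨k, rfl⟩
    exact cl_mem _ _

variable (B) in
lemma linearIndependent_cl_zero : LinearIndependent K fun t => B.cl 0 (B.basisCo₀ t) := by
  refine Fintype.linearIndependent_iff.2 fun a h => ?_
  rw [Fintype.sum_sum_type] at h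
  obtain ⟨h1, h3⟩ := cl_sum (a ∘ Sum.inl) (fun k => basisCo₀_comp (B := B) (Sum.inl k)) Finset.univ
  obtain ⟨h1', h3'⟩ := cl_sum (a ∘ Sum.inr) (fun k => basisCo₀_comp (B := B) (Sum.inr k))
    Finset.univ
  have h5 := (congrArg₂ (· + ·) h3 h3').trans h
  rw [← cl_add h1 h1', cl_zero_eq_zero_iff (by rw [LinearMap.add_comp, h1, h1', add_zero])] at h5
  have h6 : ∀ i d, (∑ k, a (Sum.inl k) * B.co (B.xCo k) i d) +
      ∑ k : Fin n, a (Sum.inr k) * B.co (B.elem (k : ℕ) (2 * n - 1)) i d = 0 := by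
    intro i d
    have := congrArg (fun f : B.PV →ₗ[Λ ⊗[K] Λᵐᵒᵖ] Λ => B.co f i d) h5
    refine Eq.trans ?_ (this.trans (B.co_zero i d))
    refine (congrArg₂ (· + ·) ?_ ?_).trans (B.co_add _ _ _ _).symm
    · exact (B.co_sum_smul (a ∘ Sum.inl) (fun k => B.xCo k) i d).symm
    · exact (B.co_sum_smul (a ∘ Sum.inr) (fun k => B.elem (k : ℕ) (2 * n - 1)) i d).symm
  rintro (k | k)
  · refine Eq.trans ?_ (h6 0 (2 * k))
    simp only [co_xCo, co_elem]
    rw [sum_mul_ite (fun k => a (Sum.inl k)) k, Finset.sum_eq_zero, add_zero]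
    · intro j _
      rw [if_neg, mul_zero]
      rintro ⟨⟨_, h⟩, _⟩
      omega
    · intro j
      rw [Fin.ext_iff]
      unfold ValidPath
      omega
  · refine Eq.trans ?_ (h6 k (2 * n - 1))
    simp only [co_xCo, co_elem, and_true]
    rw [sum_mul_ite (fun k => a (Sum.inr k)) k, Finset.sum_eq_zero, zero_add]
    · intro j _
      rw [if_neg, mul_zero]
      rintro ⟨h, _⟩
      omega
    · intro j
      dsimp only [ends_src_nat, ends_tgt_nat]
      rw [Fin.ext_iff]
      unfold ValidPath
      omega

end PathBasis

end

noncomputable section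

variable {K Λ : Type u} [Field K] [Ring Λ] [Algebra K Λ] {n : ℕ}

lemma LArrow.sign_mul (s t : ℤ) (a : LArrow) : a.sign s * a.sign t = a.sign (s * t) := by
  unfold LArrow.sign; split_ifs <;> simp

namespace PathBasis

open Ends

variable (B : PathBasis K Λ n)

/-! ### Chain maps lifting the cocycles of degree three -/

lemma omega_mul_b (k i d : ℕ) : B.b k k (2 * n - 1) * B.b k i d =
    if d = 0 ∧ i = k then B.b k k (2 * n - 1) else 0 := by
  rw [b_mul]
  split_ifs with h1 h2 h2
  · rw [h2.1, h2.2, add_zero]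
  · refine B.b_eq_zero fun h => h2 ?_
    unfold ValidPath at *; omega
  · refine (B.b_eq_zero fun h => h1 ?_).symm
    unfold ValidPath at *; omega
  · rfl

lemma b_mul_omega (k i d : ℕ) : B.b i k d * B.b k k (2 * n - 1) =
    if d = 0 ∧ i = k then B.b k k (2 * n - 1) else 0 := by
  rw [b_mul]
  split_ifs with h1 h2 h2
  · rw [h2.1, h2.2, zero_add]
  · refine B.b_eq_zero fun h => h2 ?_
    unfold ValidPath at *; omega
  · refine (B.b_eq_zero fun h => h1 ?_).symm
    unfold ValidPath at *; omega
  · rfl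

lemma arr_mul_omega (i j k : ℕ) : B.b i j 1 * B.b k k (2 * n - 1) = 0 := by
  by_cases h : j = k
  · subst h
    rw [b_mul_omega, if_neg (by omega)]
  · exact B.b_mul_b_of_ne h

lemma omega_mul_arr (i j k : ℕ) : B.b k k (2 * n - 1) * B.b i j 1 = 0 := by
  by_cases h : k = i
  · subst h
    rw [omega_mul_b, if_neg (by omega)]
  · exact B.b_mul_b_of_ne h

/-- The lift of the cocycle `elem k (2 * n - 1)` in degrees divisible by three. -/
def omV (k : ℕ) : B.PV →ₗ[Λ ⊗[K] Λᵐᵒᵖ] B.PV :=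
  B.lift fun i => if i = k then B.cell k (B.b k k (2 * n - 1)) (B.e k) else 0

/-- The lift of the cocycle `elem k (2 * n - 1)` in degrees congruent to one modulo three. -/
def omA (k : ℕ) : B.PA →ₗ[Λ ⊗[K] Λᵐᵒᵖ] B.PA :=
  -- The chain map joins terms three degrees apart, where the twists of the loop are opposite; the
  -- sign on the loop compensates for this.
  B.lift fun a => if a.src = k then a.sign (-1) • B.cell a (B.b k k (2 * n - 1)) (B.e a.tgt) else 0

lemma omV_gen (k i : ℕ) : B.omV k (B.gen i) =
    if i = k then B.cell k (B.b k k (2 * n - 1)) (B.e k) else 0 := by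
  rw [omV, lift_gen]
  split_ifs with h
  · subst h
    rw [bim_smul_cell, ends_src_nat, ends_tgt_nat, e_mul_b, e_mul_e]
  · exact smul_zero _

lemma omA_gen (k : ℕ) (a : LArrow) : B.omA k (B.gen a) =
    if a.src = k then a.sign (-1) • B.cell a (B.b k k (2 * n - 1)) (B.e a.tgt) else 0 := by
  rw [omA, lift_gen]
  split_ifs with h
  · subst h
    rw [bim_smul_zsmul_cell, ends_src_arrow, ends_tgt_arrow, e_mul_b, e_mul_e]
  · exact smul_zero _

lemma aug_comp_omV (k : ℕ) : B.aug ∘ₗ B.omV k = B.elem k (2 * n - 1) := by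
  refine B.hom_ext fun i => ?_
  rw [LinearMap.comp_apply, omV_gen, elem_gen]
  split_ifs
  · rw [map_cell, aug_gen, bimodule_smul, b_mul_e, b_mul_e]; rfl
  · exact map_zero _

lemma omV_cell_of_mul_eq_zero (k i : ℕ) {p : Λ} (q : Λ) (hp : p * B.b k k (2 * n - 1) = 0) :
    B.omV k (B.cell i p q) = 0 := by
  rw [map_cell, omV_gen]
  split_ifs
  · rw [bim_smul_cell, hp, map_zero, LinearMap.zero_apply]
  · exact smul_zero _

lemma omA_cell_of_mul_eq_zero (k : ℕ) (a : LArrow) {p : Λ} (q : Λ)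
    (hp : p * B.b k k (2 * n - 1) = 0) : B.omA k (B.cell a p q) = 0 := by
  rw [map_cell, omA_gen]
  split_ifs
  · rw [bim_smul_zsmul_cell, hp, map_zero, LinearMap.zero_apply, smul_zero]
  · exact smul_zero _

/-- Socle elements kill arrows, so on both sides only the terms of the differential with the arrow
in the right factor survive. The same holds for `d₂`. -/
lemma d₁_comp_omA (s : ℤ) (k : ℕ) : B.d₁ s ∘ₗ B.omA k = B.omV k ∘ₗ B.d₁ (-s) := by
  refine B.hom_ext fun a => ?_
  rw [LinearMap.comp_apply, LinearMap.comp_apply, omA_gen, d₁_gen, map_sub, map_zsmul, arr,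
    B.omV_cell_of_mul_eq_zero _ _ _ (B.arr_mul_omega _ _ _), map_cell B (B.omV k), omV_gen, zero_sub]
  split_ifs with h
  · subst h
    rw [map_zsmul, map_cell, d₁_gen, smul_sub, bim_smul_cell, bim_smul_zsmul_cell, arr,
      omega_mul_arr, map_zero, LinearMap.zero_apply, zero_sub, bim_smul_cell, b_mul_e, e_mul_b,
      e_mul_b, b_mul_e, smul_neg, smul_smul, LArrow.sign_mul, neg_one_mul]
  · rw [map_zero, smul_zero, smul_zero, neg_zero]

lemma d₂_comp_omV (s : ℤ) (k : ℕ) : B.d₂ s ∘ₗ B.omV k = B.omA k ∘ₗ B.d₂ (-s) := by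
  refine B.hom_ext fun i => ?_
  rw [LinearMap.comp_apply, LinearMap.comp_apply, omV_gen, d₂_gen, map_sub, map_sub, map_add,
    map_zsmul, B.omA_cell_of_mul_eq_zero _ _ _ (B.arr_mul_omega _ _ _),
    B.omA_cell_of_mul_eq_zero _ _ _ (B.arr_mul_omega _ _ _), map_cell B (B.omA k),
    map_cell B (B.omA k), omA_gen, omA_gen, LArrow.src_R, LArrow.src_L]
  split_ifs with h
  · subst h
    rw [map_cell, d₂_gen, smul_sub, smul_sub, smul_add, bim_smul_cell, bim_smul_cell,
      bim_smul_cell, bim_smul_zsmul_cell, omega_mul_arr, map_zero, LinearMap.zero_apply,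
      omega_mul_arr, map_zero, LinearMap.zero_apply, bim_smul_zsmul_cell, bim_smul_zsmul_cell,
      b_mul_e, b_mul_e, b_mul_e, e_mul_b, LArrow.tgt_R, LArrow.tgt_L, e_mul_b, e_mul_b,
      LArrow.sign_R, one_smul, smul_smul, LArrow.sign_mul, neg_mul_neg, mul_one]
  · simp only [map_zero, smul_zero, sub_zero, add_zero]

/-- The socle path forces the left factor of a factorisation to be trivial. That term always has
sign `1`, so the parameters of the two differentials are irrelevant. -/
lemma d₃_comp_omV (s t : ℤ) {k : ℕ} (hk : k < n) : B.d₃ s ∘ₗ B.omV k = B.omV k ∘ₗ B.d₃ t := by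
  have h1 : (0, 2 * n - 1) ∈ Finset.HasAntidiagonal.antidiagonal (2 * n - 1) :=
    Finset.HasAntidiagonal.mem_antidiagonal.2 (zero_add _)
  have h2 : ∀ s, pathSign s k k 0 = 1 := fun s => if_pos (by omega)
  refine B.hom_ext fun i => ?_
  rw [LinearMap.comp_apply, LinearMap.comp_apply, omV_gen, d₃_gen, map_sum,
    Finset.sum_eq_single_of_mem k (Finset.mem_range.2 hk)]
  · rw [map_sum, Finset.sum_eq_single_of_mem _ h1]
    · by_cases h : i = k
      · subst h
        rw [if_pos rfl, map_zsmul, h2, map_cell B (B.omV i), omV_gen, if_pos rfl, bim_smul_cell,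
          b_mul_omega, if_pos ⟨rfl, rfl⟩, map_cell, d₃_gen, Finset.smul_sum,
          Finset.sum_eq_single_of_mem i (Finset.mem_range.2 hk)]
        · rw [Finset.smul_sum, Finset.sum_eq_single_of_mem _ h1]
          · rw [h2, bim_smul_zsmul_cell, omega_mul_b, if_pos ⟨rfl, rfl⟩, e_mul_b, b_mul_e]
          · rintro ⟨d, e⟩ hx hne
            rw [Finset.HasAntidiagonal.mem_antidiagonal] at hx
            rw [bim_smul_zsmul_cell, omega_mul_b, if_neg, map_zero, LinearMap.zero_apply, smul_zero]
            rintro ⟨rfl, _⟩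
            exact hne (Prod.ext rfl (by simpa using hx))
        · intro j _ hj
          rw [Finset.smul_sum]
          refine Finset.sum_eq_zero fun x _ => ?_
          rw [bim_smul_zsmul_cell, omega_mul_b, if_neg (fun h => hj h.2), map_zero,
            LinearMap.zero_apply, smul_zero]
      · rw [if_neg h, map_zero, map_zsmul, B.omV_cell_of_mul_eq_zero, smul_zero]
        rw [b_mul_omega, if_neg fun h' => h h'.2]
    · rintro ⟨d, e⟩ hx hne
      rw [Finset.HasAntidiagonal.mem_antidiagonal] at hx
      rw [map_zsmul, B.omV_cell_of_mul_eq_zero, smul_zero]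
      rw [b_mul_omega, if_neg]
      rintro ⟨rfl, _⟩
      exact hne (Prod.ext rfl (by simpa using hx))
  · intro j _ hj
    rw [map_sum]
    refine Finset.sum_eq_zero fun x _ => ?_
    rw [map_zsmul, map_cell, omV_gen, if_neg hj, smul_zero, smul_zero]

/-- The chain map lifting the cocycle `elem k (2 * n - 1)` of degree three. -/
def omLift (k : ℕ) : ∀ m, B.Bimod (Gens (m + 3)) →ₗ[Λ ⊗[K] Λᵐᵒᵖ] B.Bimod (Gens m)
  | 0 => B.omV k
  | 1 => B.omA k
  | 2 => B.omV k
  | 3 => B.omV k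
  | 4 => B.omA k
  | 5 => B.omV k
  | m + 6 => omLift k m

variable {B} in
lemma cl_mul_cl_omega {i k : ℕ} (hk : k < n) {f : B.Cochain i} (hf : f ∘ₗ B.resD i = 0) (hi : i ≤ 6)
    (hc : (f ∘ₗ B.omLift k i) ∘ₗ B.resD (i + 3) = 0) :
    B.cl i f * B.cl 3 (B.elem k (2 * n - 1) : B.PV →ₗ[Λ ⊗[K] Λᵐᵒᵖ] Λ) =
      B.cl (i + 3) (f ∘ₗ B.omLift k i) := by
  refine cl_mul_cl (i := i) (j := 3) (omega_comp (-1) k) hf (B.omLift k) (B.aug_comp_omV k) ?_ hc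
  intro m hm
  have hm' : m < 6 := by omega
  clear hc hf hm
  interval_cases m
  · exact B.d₁_comp_omA 1 k
  · exact B.d₂_comp_omV 1 k
  · exact B.d₃_comp_omV 1 (-1) hk
  · exact (B.d₁_comp_omA (-1) k).trans (by rw [neg_neg]; rfl)
  · exact (B.d₂_comp_omV (-1) k).trans (by rw [neg_neg]; rfl)
  · exact B.d₃_comp_omV (-1) 1 hk

/-! ### The chain map lifting the cocycle of degree four -/

/-- The map sending the loop to its vertex. -/
def tauA : B.PA →ₗ[Λ ⊗[K] Λᵐᵒᵖ] B.PV :=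
  B.lift fun a => if a = LArrow.L 0 then B.cell 0 (B.e 0) (B.e 0) else 0

/-- The map sending the vertex of the loop to the loop. -/
def tauV : B.PV →ₗ[Λ ⊗[K] Λᵐᵒᵖ] B.PA :=
  B.lift fun i => if i = 0 then B.cell (LArrow.L 0) (B.e 0) (B.e 0) else 0

lemma tauA_gen (a : LArrow) : B.tauA (B.gen a) =
    if a = LArrow.L 0 then B.cell 0 (B.e 0) (B.e 0) else 0 := by
  rw [tauA, lift_gen]
  split_ifs with h
  · subst h
    rw [bim_smul_cell, ends_src_arrow, ends_tgt_arrow, LArrow.src_L, LArrow.tgt_L, e_mul_e]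
  · exact smul_zero _

lemma tauV_gen (i : ℕ) : B.tauV (B.gen i) =
    if i = 0 then B.cell (LArrow.L 0) (B.e 0) (B.e 0) else 0 := by
  rw [tauV, lift_gen]
  split_ifs with h
  · subst h
    rw [bim_smul_cell, ends_src_nat, ends_tgt_nat, e_mul_e]
  · exact smul_zero _

lemma aug_comp_tauA : B.aug ∘ₗ B.tauA = B.elem (LArrow.L 0) 0 := by
  refine B.hom_ext fun a => ?_
  rw [LinearMap.comp_apply, tauA_gen, elem_gen]
  split_ifs
  · rw [map_cell, aug_gen, bimodule_smul, e_mul_e, e_mul_e]; rfl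
  · exact map_zero _

lemma tauA_comp_d₂ (s : ℤ) : B.tauA ∘ₗ B.d₂ s = -(B.d₁ (-s) ∘ₗ B.tauV) := by
  refine B.hom_ext fun i => ?_
  rw [LinearMap.comp_apply, LinearMap.neg_apply, LinearMap.comp_apply, tauV_gen, d₂_gen, map_sub,
    map_sub, map_add, map_zsmul, map_cell, map_cell, map_cell, map_cell, tauA_gen, tauA_gen,
    tauA_gen, tauA_gen, if_neg (by simp), if_neg (by simp), smul_zero, smul_zero, add_zero,
    zero_sub]
  by_cases h : i = 0
  · subst h
    rw [if_pos (show LArrow.opp 0 = LArrow.L 0 from rfl), if_pos rfl, if_pos rfl,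
      map_cell, d₁_gen, arr, smul_sub, bim_smul_cell, bim_smul_cell, bim_smul_cell,
      bim_smul_zsmul_cell, LArrow.sign_L_zero, LArrow.sign_L_zero]
    dsimp only [LArrow.src_L, LArrow.tgt_L]
    rw [Nat.zero_sub, b_mul_e, e_mul_e, e_mul_b, neg_smul]
    abel
  · rw [if_neg (by simp [LArrow.opp, h]), if_neg (by simpa using h), if_neg h, map_zero]
    simp only [smul_zero, neg_zero, sub_zero]

/-- The parity indicator of a path. -/
def par (k i d : ℕ) : ℤ := if (d + i + k) % 2 = 0 then 1 else 0

lemma par_congr {k i d k' i' d' : ℕ} (h : (d + i + k) % 2 = (d' + i' + k') % 2) :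
    par k i d = par k' i' d' := by
  unfold par; rw [h]

/-- Separating the two parities of the left factor allows `d₃` to be compared with `hom₂`, which
retains only the even ones. -/
lemma pathSign_eq (s : ℤ) (k i d : ℕ) : pathSign s k i d = par k i d - s * par k i (d + 1) := by
  unfold pathSign par
  split_ifs <;> omega

/-- The homotopy occurring in the lift of the cocycle of degree four. -/
def hom₂ : B.PV →ₗ[Λ ⊗[K] Λᵐᵒᵖ] B.PV :=
  B.lift fun k => ∑ i ∈ Finset.range n, ∑ x ∈ Finset.HasAntidiagonal.antidiagonal (2 * n - 2),
    par k i x.1 • B.cell i (B.b k i x.1) (B.b i k x.2)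

lemma hom₂_gen (k : ℕ) : B.hom₂ (B.gen k) =
    ∑ i ∈ Finset.range n, ∑ x ∈ Finset.HasAntidiagonal.antidiagonal (2 * n - 2),
      par k i x.1 • B.cell i (B.b k i x.1) (B.b i k x.2) := by
  rw [hom₂, lift_gen, Finset.smul_sum]
  refine Finset.sum_congr rfl fun i _ => ?_
  rw [Finset.smul_sum]
  refine Finset.sum_congr rfl fun x _ => ?_
  rw [smul_comm, bim_smul_cell, ends_src_nat, ends_tgt_nat, e_mul_b, b_mul_e]

end PathBasis

end

noncomputable section

variable {K Λ : Type u} [Field K] [Ring Λ] [Algebra K Λ] {n : ℕ}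

namespace PathBasis

open Ends

variable (B : PathBasis K Λ n)

lemma par_smul_congr {M : Type*} [AddCommGroup M] {k i d : ℕ} {x y : M}
    (h : (d + i + k) % 2 = 0 → x = y) : par k i d • x = par k i d • y := by
  unfold par
  split_ifs with h'
  · rw [h h']
  · rw [zero_smul, zero_smul]

/-- The same telescoping as for `d₂ ∘ d₃`. Without the sign of odd paths the two loop terms at the
vertex `0` no longer cancel; they are the even and the odd part of `d₃ (-s)`, transferred to the
loop by `tauV`. -/
lemma d₂_comp_hom₂ {s : ℤ} (hs : s * s = 1) (hn : 1 ≤ n) :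
    B.d₂ s ∘ₗ B.hom₂ = -s • (B.tauV ∘ₗ B.d₃ (-s)) := by
  have hN : 2 * n - 1 = 2 * n - 2 + 1 := by omega
  refine B.hom_ext fun k => ?_
  let A : LArrow → B.PA := fun g => ∑ x ∈ Finset.HasAntidiagonal.antidiagonal (2 * n - 2 + 1),
    par k g.src x.1 • B.cell g (B.b k g.src x.1) (B.b g.tgt k x.2)
  let O : B.PA := ∑ x ∈ Finset.HasAntidiagonal.antidiagonal (2 * n - 2 + 1),
    par k 0 (x.1 + 1) • B.cell (LArrow.L 0) (B.b k 0 x.1) (B.b 0 k x.2)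
  have key : ∀ i ∈ Finset.range n, B.d₂ s (∑ x ∈ Finset.HasAntidiagonal.antidiagonal (2 * n - 2),
      par k i x.1 • B.cell i (B.b k i x.1) (B.b i k x.2)) =
      (A (LArrow.L (i + 1)) + A (LArrow.R i)) -
        if i = 0 then O + s • A (LArrow.L 0) else (A (LArrow.L i) + A (LArrow.R (i - 1))) := by
    intro i hi
    rw [Finset.mem_range] at hi
    rw [map_sum]
    have h1 : ∀ (g : LArrow), g.src ≠ g.tgt → par k g.src 0 • B.cell g (B.b k g.src 0)
        (B.b g.tgt k (2 * n - 2 + 1)) = 0 := by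
      intro g hg
      by_cases hv : ValidPath n k g.src 0
      · rw [B.b_eq_zero (i := g.tgt), map_zero, smul_zero]
        unfold ValidPath at *; omega
      · rw [B.b_eq_zero hv, map_zero, LinearMap.zero_apply, smul_zero]
    have h2 : ∀ (g : LArrow), par k g.src (2 * n - 2 + 1) •
        B.cell g (B.b k g.src (2 * n - 2 + 1)) (B.b g.tgt k 0) = 0 := by
      intro g
      refine (par_smul_congr fun h => ?_).trans (smul_zero _)
      rw [B.b_eq_zero (i := k), map_zero, LinearMap.zero_apply]
      unfold ValidPath; omega
    have hA : ∑ x ∈ Finset.HasAntidiagonal.antidiagonal (2 * n - 2), par k i x.1 •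
        B.cell (LArrow.L (i + 1)) (B.b k i x.1 * B.b i (i + 1) 1) (B.b i k x.2) =
        A (LArrow.L (i + 1)) := by
      refine sum_shift_left (h1 _ (by simp)) fun d m hd => ?_
      dsimp only [LArrow.src_L, LArrow.tgt_L]
      rw [par_congr (k' := k) (i' := i + 1) (d' := d + 1) (by omega)]
      refine par_smul_congr fun h => ?_
      rw [B.b_mul_arrow_left _ (Or.inl rfl) (by unfold ValidPath; omega), Nat.add_sub_cancel]
    have hR : ∑ x ∈ Finset.HasAntidiagonal.antidiagonal (2 * n - 2), par k i x.1 •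
        B.cell (LArrow.R i) (B.b k i x.1) (B.b (i + 1) i 1 * B.b i k x.2) =
        A (LArrow.R i) := by
      refine sum_shift_right (h2 _) fun d m hd => ?_
      dsimp only [LArrow.src_R, LArrow.tgt_R]
      refine par_smul_congr fun h => ?_
      rw [B.arrow_mul_b_right _ (j := i + 1) (i := i) (Or.inr rfl) (by unfold ValidPath; omega)]
    have hL : ∑ x ∈ Finset.HasAntidiagonal.antidiagonal (2 * n - 2), par k i x.1 •
        B.cell (LArrow.L i) (B.b k i x.1) (B.b (i - 1) i 1 * B.b i k x.2) =
        A (LArrow.L i) := by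
      refine sum_shift_right (h2 _) fun d m hd => ?_
      dsimp only [LArrow.src_L, LArrow.tgt_L]
      refine par_smul_congr fun h => ?_
      rw [B.arrow_mul_b_right _ (by unfold Neighbor; omega) (by unfold ValidPath; omega)]
    have hO : ∑ x ∈ Finset.HasAntidiagonal.antidiagonal (2 * n - 2), par k i x.1 •
        B.cell (LArrow.opp i) (B.b k i x.1 * B.b i (i - 1) 1) (B.b i k x.2) =
        if i = 0 then O else A (LArrow.R (i - 1)) := by
      split_ifs with h
      · subst h
        refine sum_shift_left ?_ fun d m hd => ?_
        · refine (par_smul_congr fun h => ?_).trans (smul_zero _)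
          rw [B.b_eq_zero (i := k), map_zero, LinearMap.zero_apply]
          unfold ValidPath; omega
        · dsimp only
          rw [par_congr (k' := k) (i' := 0) (d' := d + 1 + 1) (by omega)]
          refine par_smul_congr fun h => ?_
          rw [B.b_mul_arrow_left _ (by unfold Neighbor; omega) (by unfold ValidPath; omega)]
          rfl
      · obtain ⟨i, rfl⟩ := Nat.exists_eq_succ_of_ne_zero h
        refine sum_shift_left (h1 _ (by simp)) fun d m hd => ?_
        rw [LArrow.opp, if_neg h]
        dsimp only [LArrow.src_R, LArrow.tgt_R, Nat.succ_eq_add_one, Nat.add_sub_cancel]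
        rw [par_congr (k' := k) (i' := i) (d' := d + 1) (by omega)]
        refine par_smul_congr fun h => ?_
        rw [B.b_mul_arrow_left _ (by unfold Neighbor; omega) (by unfold ValidPath; omega),
          Nat.add_sub_cancel]
    have : ∀ x ∈ Finset.HasAntidiagonal.antidiagonal (2 * n - 2),
        B.d₂ s (par k i x.1 • B.cell i (B.b k i x.1) (B.b i k x.2)) =
        par k i x.1 •
            B.cell (LArrow.L (i + 1)) (B.b k i x.1 * B.b i (i + 1) 1) (B.b i k x.2) +
          par k i x.1 •
            B.cell (LArrow.R i) (B.b k i x.1) (B.b (i + 1) i 1 * B.b i k x.2) -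
          par k i x.1 •
            B.cell (LArrow.opp i) (B.b k i x.1 * B.b i (i - 1) 1) (B.b i k x.2) -
          (LArrow.L i).sign s • par k i x.1 •
            B.cell (LArrow.L i) (B.b k i x.1) (B.b (i - 1) i 1 * B.b i k x.2) := by
      intro x _
      rw [map_zsmul, map_cell, d₂_gen]
      simp only [smul_sub, smul_add, bim_smul_cell, bim_smul_zsmul_cell, b_mul_e, e_mul_b]
      rw [smul_comm (LArrow.sign _ _)]
    rw [Finset.sum_congr rfl this, Finset.sum_sub_distrib, Finset.sum_sub_distrib,
      Finset.sum_add_distrib, ← Finset.smul_sum, hA, hR, hL, hO]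
    split_ifs with h
    · subst h
      rw [LArrow.sign_L_zero]; abel
    · obtain ⟨i, rfl⟩ := Nat.exists_eq_succ_of_ne_zero h
      rw [LArrow.sign_L_succ, one_smul]; abel
  have htel : ∀ m, ∑ i ∈ Finset.range (m + 1), ((A (LArrow.L (i + 1)) + A (LArrow.R i)) -
      if i = 0 then O + s • A (LArrow.L 0) else (A (LArrow.L i) + A (LArrow.R (i - 1)))) =
      A (LArrow.L (m + 1)) + A (LArrow.R m) - (O + s • A (LArrow.L 0)) := by
    intro m
    induction m with
    | zero => simp
    | succ m ih =>
      rw [Finset.sum_range_succ, ih, if_neg (Nat.succ_ne_zero m), Nat.add_sub_cancel]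
      abel
  have h1 : A (LArrow.L (n - 1 + 1)) = 0 := Finset.sum_eq_zero fun x _ => by
    rw [B.b_eq_zero (by unfold ValidPath; dsimp only [LArrow.src_L]; omega), map_zero,
      LinearMap.zero_apply, smul_zero]
  have h2 : A (LArrow.R (n - 1)) = 0 := Finset.sum_eq_zero fun x _ => by
    rw [B.b_eq_zero (i := (LArrow.R (n - 1)).tgt)
      (by unfold ValidPath; dsimp only [LArrow.tgt_R]; omega), map_zero, smul_zero]
  have hR : (B.tauV ∘ₗ B.d₃ (-s)) (B.gen k) = A (LArrow.L 0) + s • O := by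
    rw [LinearMap.comp_apply, d₃_gen, map_sum,
      Finset.sum_eq_single_of_mem 0 (Finset.mem_range.2 hn)]
    · rw [map_sum, hN, Finset.smul_sum, ← Finset.sum_add_distrib]
      refine Finset.sum_congr rfl fun x _ => ?_
      rw [map_zsmul, map_cell, tauV_gen, if_pos rfl, bim_smul_cell, b_mul_e, e_mul_b, pathSign_eq,
        neg_mul, sub_neg_eq_add, add_smul, mul_smul]
      rfl
    · intro i _ hi
      rw [map_sum]
      refine Finset.sum_eq_zero fun x _ => ?_
      rw [map_zsmul, map_cell, tauV_gen, if_neg hi, smul_zero, smul_zero]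
  rw [LinearMap.smul_apply, hR, LinearMap.comp_apply, hom₂_gen, map_sum, Finset.sum_congr rfl key]
  obtain ⟨m, rfl⟩ : ∃ m, n = m + 1 := ⟨n - 1, by omega⟩
  rw [Nat.add_sub_cancel] at h1 h2
  rw [htel, h1, h2, smul_add, smul_smul, neg_mul, hs, neg_smul, neg_smul, one_smul]
  abel

/-- An arrow other than the loop does not change the parity class of a path, so both halves of `d₁`
give the same sum. The loop exchanges the parities, and the difference of the two sums is `d₃ s` up
to the sign `-s`. -/
lemma hom₂_comp_d₁ {s : ℤ} (hs : s * s = 1) (hn : 1 ≤ n) :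
    B.hom₂ ∘ₗ B.d₁ s = -s • (B.d₃ s ∘ₗ B.tauA) := by
  have hN : 2 * n - 1 = 2 * n - 2 + 1 := by omega
  refine B.hom_ext fun a => ?_
  let S : (ℕ → ℕ → ℤ) → B.PV := fun w => ∑ i ∈ Finset.range n,
    ∑ x ∈ Finset.HasAntidiagonal.antidiagonal (2 * n - 2 + 1),
      w i x.1 • B.cell i (B.b a.src i x.1) (B.b i a.tgt x.2)
  have h1 : (bim (B.arr a) (B.e a.tgt) : Λ ⊗[K] Λᵐᵒᵖ) • B.hom₂ (B.gen a.tgt) =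
      S fun i d => par a.tgt i (d + 1) := by
    rw [hom₂_gen, Finset.smul_sum]
    refine Finset.sum_congr rfl fun i hi => ?_
    rw [Finset.smul_sum]
    refine sum_shift_left ?_ fun d m hd => ?_
    · refine (par_smul_congr fun h => ?_).trans (smul_zero _)
      rcases a with j | j
      · simp only [LArrow.src_R, LArrow.tgt_R] at *
        rw [B.b_eq_zero (i := i) (by unfold ValidPath; omega), map_zero]
      · simp only [LArrow.src_L, LArrow.tgt_L] at *
        by_cases hv : ValidPath n j i 0
        · rw [B.b_eq_zero (i := i) (by unfold ValidPath at *; omega), map_zero]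
        · rw [B.b_eq_zero hv, map_zero, LinearMap.zero_apply]
    · dsimp only
      rw [bim_smul_zsmul_cell, b_mul_e, par_congr (k' := a.tgt) (i' := i) (d' := d + 1 + 1) (by omega)]
      refine par_smul_congr fun h => ?_
      rw [arr, B.arrow_mul_b_left _ a.neighbor]
      rw [Finset.mem_range] at hi
      rcases a with j | j
      · simp only [LArrow.src_R, LArrow.tgt_R] at *; unfold ValidPath; omega
      · simp only [LArrow.src_L, LArrow.tgt_L] at *; unfold ValidPath; omega
  have h2 : (bim (B.e a.src) (B.arr a) : Λ ⊗[K] Λᵐᵒᵖ) • B.hom₂ (B.gen a.src) =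
      S fun i d => par a.src i d := by
    rw [hom₂_gen, Finset.smul_sum]
    refine Finset.sum_congr rfl fun i hi => ?_
    rw [Finset.smul_sum]
    refine sum_shift_right ?_ fun d m hd => ?_
    · refine (par_smul_congr fun h => ?_).trans (smul_zero _)
      rw [B.b_eq_zero (j := i), map_zero, LinearMap.zero_apply]
      unfold ValidPath; omega
    · dsimp only
      rw [bim_smul_zsmul_cell, e_mul_b]
      refine par_smul_congr fun h => ?_
      rw [arr, B.b_mul_arrow_right _ a.neighbor]
      rw [Finset.mem_range] at hi
      rcases a with j | j
      · simp only [LArrow.src_R, LArrow.tgt_R] at *; unfold ValidPath; omega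
      · simp only [LArrow.src_L, LArrow.tgt_L] at *; unfold ValidPath; omega
  rw [LinearMap.comp_apply, d₁_gen, map_sub, map_zsmul, map_cell, map_cell, h1, h2,
    LinearMap.smul_apply, LinearMap.comp_apply, tauA_gen]
  by_cases h : a = LArrow.L 0
  · subst h
    rw [if_pos rfl, map_cell, d₃_gen, LArrow.sign_L_zero, Finset.smul_sum, Finset.smul_sum,
      Finset.smul_sum, ← Finset.sum_sub_distrib]
    refine Finset.sum_congr rfl fun i _ => ?_
    rw [Finset.smul_sum, Finset.smul_sum, Finset.smul_sum, hN, ← Finset.sum_sub_distrib]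
    refine Finset.sum_congr rfl fun x _ => ?_
    rw [bim_smul_zsmul_cell, e_mul_b, b_mul_e, smul_smul, smul_smul, ← sub_smul, pathSign_eq]
    refine congrArg₂ (· • ·) ?_ rfl
    dsimp only [LArrow.src_L, LArrow.tgt_L]
    linear_combination (par 0 i (x.1 + 1)) * (-hs)
  · have hs' : a.sign s = 1 := if_neg h
    rw [if_neg h, map_zero, smul_zero, hs', one_smul, sub_eq_zero]
    refine Finset.sum_congr rfl fun i _ => Finset.sum_congr rfl fun x _ => ?_
    congr 1
    refine par_congr ?_
    rcases a with j | j
    · simp only [LArrow.src_R, LArrow.tgt_R]; omega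
    · simp only [LArrow.src_L, LArrow.tgt_L, LArrow.L.injEq] at *; omega

/-- The chain map lifting the cocycle `elem (L 0) 0` of degree four. -/
def gaLift : ∀ m, B.Bimod (Gens (m + 4)) →ₗ[Λ ⊗[K] Λᵐᵒᵖ] B.Bimod (Gens m)
  | 0 => B.tauA
  | 1 => -B.tauV
  | 2 => B.hom₂
  | 3 => -B.tauA
  | 4 => B.tauV
  | 5 => B.hom₂
  | m + 6 => gaLift m

lemma elem_L_zero_zero_comp : B.elem (LArrow.L 0) 0 ∘ₗ B.d₂ (-1) = 0 := by
  by_cases hv : ValidPath n 0 0 0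
  · rw [B.elem_L_zero_d₂ (-1) hv, add_neg_cancel, neg_zero, zero_smul]
  · rw [B.elem_eq_zero hv, LinearMap.zero_comp]

variable {B} in
lemma cl_mul_cl_gamma (hn : 1 ≤ n) {i : ℕ} {f : B.Cochain i} (hf : f ∘ₗ B.resD i = 0) (hi : i ≤ 6)
    (hc : (f ∘ₗ B.gaLift i) ∘ₗ B.resD (i + 4) = 0) :
    B.cl i f * B.cl 4 (B.elem (LArrow.L 0) 0 : B.PA →ₗ[Λ ⊗[K] Λᵐᵒᵖ] Λ) =
      B.cl (i + 4) (f ∘ₗ B.gaLift i) := by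
  refine cl_mul_cl (i := i) (j := 4) B.elem_L_zero_zero_comp hf B.gaLift B.aug_comp_tauA ?_ hc
  intro m hm
  have hm' : m < 6 := by omega
  clear hc hf hm
  interval_cases m
  · have h : B.d₁ 1 ∘ₗ (-B.tauV) = B.tauA ∘ₗ B.d₂ (-1) := by
      rw [tauA_comp_d₂, neg_neg, LinearMap.comp_neg]
    exact h
  · have h : B.d₂ 1 ∘ₗ B.hom₂ = (-B.tauV) ∘ₗ B.d₃ (-1) := by
      rw [B.d₂_comp_hom₂ (by norm_num) hn, neg_smul, one_smul, LinearMap.neg_comp]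
    exact h
  · have h : B.d₃ 1 ∘ₗ (-B.tauA) = B.hom₂ ∘ₗ B.d₁ 1 := by
      rw [B.hom₂_comp_d₁ (by norm_num) hn, neg_smul, one_smul, LinearMap.comp_neg]
    exact h
  · have h : B.d₁ (-1) ∘ₗ B.tauV = (-B.tauA) ∘ₗ B.d₂ 1 := by
      rw [LinearMap.neg_comp, tauA_comp_d₂, neg_neg]
    exact h
  · have h : B.d₂ (-1) ∘ₗ B.hom₂ = B.tauV ∘ₗ B.d₃ 1 := by
      rw [B.d₂_comp_hom₂ (by norm_num) hn, neg_neg, one_smul]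
    exact h
  · have h : B.d₃ (-1) ∘ₗ B.tauA = B.hom₂ ∘ₗ B.d₁ (-1) := by
      rw [B.hom₂_comp_d₁ (by norm_num) hn, neg_neg, one_smul]
    exact h

end PathBasis

end

noncomputable section

variable {K Λ : Type u} [Field K] [Ring Λ] [Algebra K Λ] {n : ℕ}

namespace PathBasis

open Ends

variable (B : PathBasis K Λ n)

/-! ### Products with central elements -/

/-- The central element `X`. -/
def xElt : Λ := ∑ i ∈ Finset.range n, B.b i i 2

lemma xElt_mul_b (i j d : ℕ) : B.xElt * B.b i j d =
    if ValidPath n i i 2 ∧ ValidPath n i j d then B.b i j (d + 2) else 0 := by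
  rw [xElt, Finset.sum_mul]
  by_cases hi : i < n
  · rw [Finset.sum_eq_single_of_mem i (Finset.mem_range.2 hi), b_mul, add_comm 2 d]
    · simp
    · intro k _ hk
      exact B.b_mul_b_of_ne hk
  · rw [if_neg (by unfold ValidPath; omega), Finset.sum_eq_zero]
    intro k _
    rw [B.b_eq_zero (i := i) (by unfold ValidPath; omega), mul_zero]

lemma b_mul_xElt (i j d : ℕ) : B.b i j d * B.xElt =
    if ValidPath n i j d ∧ ValidPath n j j 2 then B.b i j (d + 2) else 0 := by
  rw [xElt, Finset.mul_sum]
  by_cases hj : j < n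
  · rw [Finset.sum_eq_single_of_mem j (Finset.mem_range.2 hj), b_mul]
    · simp
    · intro k _ hk
      exact B.b_mul_b_of_ne (Ne.symm hk)
  · rw [if_neg (by unfold ValidPath; omega), Finset.sum_eq_zero]
    intro k _
    rw [B.b_eq_zero (i := i) (by unfold ValidPath; omega), zero_mul]

lemma xElt_mul (p : Λ) : B.xElt * p = p * B.xElt := by
  have : LinearMap.mulLeft K B.xElt = LinearMap.mulRight K B.xElt := by
    refine B.linearMap_ext fun i j d h => ?_
    rw [LinearMap.mulLeft_apply, LinearMap.mulRight_apply, xElt_mul_b, b_mul_xElt]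
    by_cases h' : ValidPath n i j (d + 2)
    · refine if_congr ?_ rfl rfl
      unfold ValidPath at *; omega
    · rw [B.b_eq_zero h', ite_self, ite_self]
  exact DFunLike.congr_fun this p

lemma omega_mul (k : ℕ) (p : Λ) : B.b k k (2 * n - 1) * p = p * B.b k k (2 * n - 1) := by
  have : LinearMap.mulLeft K (B.b k k (2 * n - 1)) = LinearMap.mulRight K (B.b k k (2 * n - 1)) := by
    refine B.linearMap_ext fun i j d h => ?_
    rw [LinearMap.mulLeft_apply, LinearMap.mulRight_apply]
    by_cases hi : k = i
    · subst hi
      rw [omega_mul_b]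
      by_cases hj : j = k
      · subst hj
        rw [b_mul_omega]
      · rw [B.b_mul_b_of_ne hj, if_neg fun h => hj h.2]
    · rw [B.b_mul_b_of_ne hi]
      by_cases hj : j = k
      · subst hj
        rw [b_mul_omega, if_neg fun h => hi h.2.symm]
      · rw [B.b_mul_b_of_ne hj]
  exact DFunLike.congr_fun this p

lemma xCo_gen (k i : ℕ) : B.xCo k (B.gen i) = B.b i i (2 * k) := by
  rw [xCo, LinearMap.sum_apply]
  simp only [elem_gen, ends_src_nat, ends_tgt_nat]
  rw [Finset.sum_ite_eq]
  split_ifs with h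
  · rfl
  · rw [Finset.mem_range] at h
    exact (B.b_eq_zero (by unfold ValidPath; omega)).symm

lemma xCo_zero : B.xCo 0 = B.aug := B.hom_ext fun i => by rw [xCo_gen, aug_gen]; rfl

section

variable {G : Type} [Ends G] {z : Λ} (hz : ∀ p, z * p = p * z)

lemma centralMul_comp_gen (f : B.Bimod G →ₗ[Λ ⊗[K] Λᵐᵒᵖ] Λ) (g : G) :
    (centralMul K Λ z hz ∘ₗ f) (B.gen g) = z * f (B.gen g) := by
  rw [LinearMap.comp_apply, centralMul_apply, bimodule_smul, mul_one]

variable [DecidableEq G]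

lemma xElt_comp_elem {g : G} {d : ℕ} (h : ValidPath n (src g) (tgt g) (d + 2) →
    ValidPath n (src g) (src g) 2 ∧ ValidPath n (src g) (tgt g) d) :
    centralMul K Λ B.xElt B.xElt_mul ∘ₗ B.elem g d = B.elem g (d + 2) := by
  refine B.hom_ext fun g' => ?_
  rw [centralMul_comp_gen, elem_gen, elem_gen]
  split_ifs
  · rw [xElt_mul_b]
    split_ifs with h'
    · rfl
    · exact (B.b_eq_zero fun h'' => h' (h h'')).symm
  · rw [mul_zero]

end

lemma xElt_comp_xCo (k : ℕ) : centralMul K Λ B.xElt B.xElt_mul ∘ₗ B.xCo k = B.xCo (k + 1) := by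
  refine B.hom_ext fun i => ?_
  rw [centralMul_comp_gen, xCo_gen, xCo_gen, xElt_mul_b]
  split_ifs with h
  · rfl
  · refine (B.b_eq_zero fun h' => h ?_).symm
    unfold ValidPath at *; omega

lemma xElt_comp_xyCo (k : ℕ) : centralMul K Λ B.xElt B.xElt_mul ∘ₗ B.xyCo k = B.xyCo (k + 1) := by
  refine B.hom_ext fun a => ?_
  rw [centralMul_comp_gen, xyCo_gen, xyCo_gen, xElt_mul_b]
  split_ifs with h
  · rfl
  · refine (B.b_eq_zero fun h' => h ?_).symm
    rcases a with i | i
    · simp only [LArrow.src_R, LArrow.tgt_R] at *; unfold ValidPath at *; omega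
    · simp only [LArrow.src_L, LArrow.tgt_L] at *; unfold ValidPath at *; omega

lemma omega_comp_xCo (k j : ℕ) : centralMul K Λ _ (B.omega_mul k) ∘ₗ B.xCo (j + 1) = 0 := by
  refine B.hom_ext fun i => ?_
  rw [centralMul_comp_gen, xCo_gen, LinearMap.zero_apply]
  by_cases h : k = i
  · subst h
    rw [omega_mul_b, if_neg (by omega)]
  · exact B.b_mul_b_of_ne h

lemma omega_comp_xyCo (k j : ℕ) : centralMul K Λ _ (B.omega_mul k) ∘ₗ B.xyCo j = 0 := by
  refine B.hom_ext fun a => ?_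
  rw [centralMul_comp_gen, xyCo_gen, LinearMap.zero_apply]
  by_cases h : k = a.src
  · subst h
    rw [omega_mul_b, if_neg (by omega)]
  · exact B.b_mul_b_of_ne h

lemma omega_comp_aug (k : ℕ) : centralMul K Λ _ (B.omega_mul k) ∘ₗ B.aug = B.elem k (2 * n - 1) := by
  refine B.hom_ext fun i => ?_
  rw [centralMul_comp_gen, aug_gen, elem_gen]
  split_ifs with h
  · subst h; rw [b_mul_e]; rfl
  · exact B.b_mul_e_of_ne (Ne.symm h)

lemma omega_comp_elem (k i d : ℕ) : centralMul K Λ _ (B.omega_mul k) ∘ₗ B.elem i d =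
    if d = 0 ∧ i = k then B.elem k (2 * n - 1) else 0 := by
  refine B.hom_ext fun j => ?_
  rw [centralMul_comp_gen, elem_gen]
  by_cases hi : i = k
  · subst hi
    by_cases hj : j = i
    · subst hj
      rw [if_pos rfl, ends_src_nat, ends_tgt_nat, omega_mul_b]
      split_ifs
      · rw [elem_gen, if_pos rfl]; rfl
      · rfl
    · rw [if_neg hj, mul_zero]
      split_ifs
      · rw [elem_gen, if_neg hj]
      · rfl
  · rw [if_neg (c := d = 0 ∧ i = k) fun h => hi h.2, LinearMap.zero_apply]
    split_ifs
    · exact B.b_mul_b_of_ne (Ne.symm hi)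
    · exact mul_zero _

lemma omega_comp_elem_L_zero (k : ℕ) : centralMul K Λ _ (B.omega_mul k) ∘ₗ B.elem (LArrow.L 0) 0 =
    if k = 0 then B.elem (LArrow.L 0) (2 * n - 1) else 0 := by
  refine B.hom_ext fun a => ?_
  rw [centralMul_comp_gen, elem_gen]
  by_cases ha : a = LArrow.L 0
  · subst ha
    rw [if_pos rfl]
    dsimp only [ends_src_arrow, ends_tgt_arrow, LArrow.src_L, LArrow.tgt_L]
    split_ifs with hk
    · subst hk
      rw [omega_mul_b, if_pos ⟨rfl, rfl⟩, elem_gen, if_pos rfl]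
      rfl
    · exact B.b_mul_b_of_ne hk
  · rw [if_neg ha, mul_zero]
    split_ifs
    · rw [elem_gen, if_neg ha]
    · rfl

/-! ### The classes of the generators -/

/-- The class `X`. -/
def clX : HochschildCohomology K Λ := B.cl 0 (B.xCo 1)

/-- The classes of the elements of the socle. -/
def clOm (k : ℕ) : HochschildCohomology K Λ :=
  B.cl 0 (B.elem k (2 * n - 1) : B.PV →ₗ[Λ ⊗[K] Λᵐᵒᵖ] Λ)

/-- The class `y`. -/
def clY : HochschildCohomology K Λ := B.cl 1 B.yCo

/-- The classes of degree two. -/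
def clZ (k : ℕ) : HochschildCohomology K Λ := B.cl 2 (B.elem k 0 : B.PV →ₗ[Λ ⊗[K] Λᵐᵒᵖ] Λ)

/-- The classes of degree three. -/
def clW (k : ℕ) : HochschildCohomology K Λ :=
  B.cl 3 (B.elem k (2 * n - 1) : B.PV →ₗ[Λ ⊗[K] Λᵐᵒᵖ] Λ)

/-- The class of degree four. -/
def clG : HochschildCohomology K Λ := B.cl 4 (B.elem (LArrow.L 0) 0 : B.PA →ₗ[Λ ⊗[K] Λᵐᵒᵖ] Λ)

/-- The class of degree six. -/
def clH : HochschildCohomology K Λ := B.cl 6 B.hCo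

variable {B}

lemma clX_mul {i : ℕ} {f : B.Cochain i} (hf : f ∘ₗ B.resD i = 0) :
    B.clX * B.cl i f = B.cl i (centralMul K Λ B.xElt B.xElt_mul ∘ₗ f) := by
  rw [← cl_cen_mul _ _ hf]
  have h : B.xCo 1 = centralMul K Λ B.xElt B.xElt_mul ∘ₗ B.aug := by
    rw [← xCo_zero, xElt_comp_xCo]
  exact congrArg (B.cl 0 · * _) h

lemma mul_clX {i : ℕ} {f : B.Cochain i} (hf : f ∘ₗ B.resD i = 0) :
    B.cl i f * B.clX = B.clX * B.cl i f := by
  have h : B.xCo 1 = centralMul K Λ B.xElt B.xElt_mul ∘ₗ B.aug := by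
    rw [← xCo_zero, xElt_comp_xCo]
  have := cl_mul_cen B.xElt B.xElt_mul hf
  unfold clX
  rw [h]
  exact this

lemma clOm_mul (k : ℕ) {i : ℕ} {f : B.Cochain i} (hf : f ∘ₗ B.resD i = 0) :
    B.clOm k * B.cl i f = B.cl i (centralMul K Λ _ (B.omega_mul k) ∘ₗ f) := by
  rw [← cl_cen_mul _ _ hf]
  exact congrArg (B.cl 0 · * _) (B.omega_comp_aug k).symm

lemma mul_clOm (k : ℕ) {i : ℕ} {f : B.Cochain i} (hf : f ∘ₗ B.resD i = 0) :
    B.cl i f * B.clOm k = B.clOm k * B.cl i f := by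
  have := cl_mul_cen _ (B.omega_mul k) hf
  unfold clOm
  rw [← omega_comp_aug]
  exact this

lemma clX_pow (k : ℕ) : B.clX ^ k = B.cl 0 (B.xCo k) := by
  induction k with
  | zero =>
    rw [pow_zero, xCo_zero]
    exact cl_one.symm
  | succ k ih =>
    rw [pow_succ', ih]
    exact (clX_mul (i := 0) (xCo_comp k)).trans (congrArg (B.cl 0) (B.xElt_comp_xCo k))

lemma clX_pow_eq_zero : B.clX ^ n = 0 := by
  rw [clX_pow]
  refine Eq.trans (congrArg (B.cl 0) (B.hom_ext fun i => ?_)) (cl_zero 0)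
  rw [xCo_gen]
  exact B.b_eq_zero (by unfold ValidPath; omega)

lemma yCo_eq : B.yCo = B.xyCo 0 := by
  refine B.hom_ext (G := LArrow) fun a => ?_
  refine (comp_eulerComm_apply B.augCo_comp (B.gen a)).trans ?_
  have : B.aug (B.euler ℕ (B.d₁ 1 (B.gen a))) = B.arr a := by
    rw [d₁_gen, map_sub, map_zsmul, euler_cell, euler_cell, deg_e, arr, deg_b, map_zero,
      LinearMap.zero_apply, smul_zero, sub_zero, map_cell, aug_gen, bimodule_smul, Nat.cast_one,
      one_smul, b_mul_e, b_mul_e]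
  exact this.trans (B.xyCo_gen 0 a).symm

lemma clX_pow_mul_clY (k : ℕ) : B.clX ^ k * B.clY = B.cl 1 (B.xyCo k) := by
  induction k with
  | zero => rw [pow_zero, one_mul, clY, yCo_eq]
  | succ k ih =>
    rw [pow_succ', mul_assoc, ih]
    exact (clX_mul (i := 1) (xyCo_comp k)).trans (congrArg (B.cl 1) (B.xElt_comp_xyCo k))

lemma cl_eq_zero_of_mem_bdry {i : ℕ} {f : B.Cochain (i + 1)} (hf : f ∈ B.bdry (B.resD i)) :
    B.cl (i + 1) f = 0 := by
  obtain ⟨φ, rfl⟩ := hf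
  exact cl_comp_resD φ

/-- The product has values of length two, and in degree two cochains with values of positive length
are coboundaries. -/
lemma clX_mul_clZ (h2 : (2 : K) ≠ 0) (k : ℕ) : B.clX * B.clZ k = 0 := by
  refine (clX_mul (i := 2) (B.comp_d₃_one _)).trans ((congrArg (B.cl 2)
    (B.xElt_comp_elem (g := k) (d := 0) ?_)).trans
    (cl_eq_zero_of_mem_bdry (i := 1) (elem_mem_bdry_d₂_one h2 k (by omega))))
  dsimp only [ends_src_nat, ends_tgt_nat]
  unfold ValidPath; omega

lemma elem_L_zero_comp' (k : ℕ) : B.elem (LArrow.L 0) (2 * k) ∘ₗ B.d₂ (-1) = 0 := by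
  by_cases hk : k < n
  · exact elem_L_zero_comp hk
  · rw [B.elem_eq_zero, LinearMap.zero_comp]
    dsimp only [ends_src_arrow, ends_tgt_arrow, LArrow.src_L, LArrow.tgt_L]
    unfold ValidPath; omega

lemma clX_pow_mul_clG (k : ℕ) : B.clX ^ k * B.clG =
    B.cl 4 (B.elem (LArrow.L 0) (2 * k) : B.PA →ₗ[Λ ⊗[K] Λᵐᵒᵖ] Λ) := by
  induction k with
  | zero => rw [pow_zero, one_mul]; rfl
  | succ k ih =>
    rw [pow_succ', mul_assoc, ih]
    refine (clX_mul (i := 4) (elem_L_zero_comp' k)).trans (congrArg (B.cl 4)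
      (B.xElt_comp_elem (g := LArrow.L 0) (d := 2 * k) ?_))
    dsimp only [ends_src_arrow, ends_tgt_arrow, LArrow.src_L, LArrow.tgt_L]
    unfold ValidPath; omega

lemma clX_pow_mul_cl_five (k : ℕ) :
    B.clX ^ k * B.cl 5 (B.elem 0 1 : B.PV →ₗ[Λ ⊗[K] Λᵐᵒᵖ] Λ) =
      B.cl 5 (B.elem 0 (2 * k + 1) : B.PV →ₗ[Λ ⊗[K] Λᵐᵒᵖ] Λ) := by
  induction k with
  | zero => rw [pow_zero, one_mul]
  | succ k ih =>
    rw [pow_succ', mul_assoc, ih]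
    refine (clX_mul (i := 5) (elem_succ_comp _ _ _)).trans (congrArg (B.cl 5)
      (B.xElt_comp_elem (g := 0) (d := 2 * k + 1) ?_))
    dsimp only [ends_src_nat, ends_tgt_nat]
    unfold ValidPath; omega

/-- The Euler operator keeps only those terms of `d₂` which carry an arrow on the left, and among
them only the term of the loop is seen by `γ`. -/
lemma clG_mul_clY : B.clG * B.clY = -B.cl 5 (B.elem 0 1 : B.PV →ₗ[Λ ⊗[K] Λᵐᵒᵖ] Λ) := by
  have h4 : B.elem (LArrow.L 0) 0 ∘ₗ B.d₂ (-1) = 0 := B.elem_L_zero_zero_comp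
  have h5 : (B.elem 0 1 : B.PV →ₗ[Λ ⊗[K] Λᵐᵒᵖ] Λ) ∘ₗ B.d₃ (-1) = 0 := elem_succ_comp _ _ _
  have e : (B.elem (LArrow.L 0) 0 : B.PA →ₗ[Λ ⊗[K] Λᵐᵒᵖ] Λ) ∘ₗ B.eulerComm (B.d₂ (-1)) =
      (-1 : ℤ) • B.elem 0 1 := by
    refine B.hom_ext fun i => ?_
    refine (comp_eulerComm_apply (i := 4) h4 (B.gen i)).trans ?_
    have : B.elem (LArrow.L 0) 0 (B.euler LArrow (B.d₂ (-1) (B.gen i))) =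
        (-1 : ℤ) • B.elem 0 1 (B.gen i) := by
      rw [d₂_gen]
      simp only [map_sub, map_add, map_zsmul, euler_cell, deg_e, deg_b, Nat.cast_one, one_smul,
        map_zero, LinearMap.zero_apply, add_zero, smul_zero, sub_zero, map_cell, elem_gen,
        LArrow.opp_eq_L, if_false, LArrow.L.injEq, Nat.succ_ne_zero, and_true,
        zero_sub, bimodule_smul]
      split_ifs with h
      · subst h
        rw [neg_smul, one_smul]
        simp only [ends_src_arrow, ends_tgt_arrow, LArrow.src_L, LArrow.tgt_L, Nat.zero_sub,
          ends_src_nat, ends_tgt_nat]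
        congr 1
        exact (congrArg (· * B.e 0) (B.b_mul_e 0 0 1)).trans (B.b_mul_e 0 0 1)
      · simp
    exact this
  refine (cl_mul_y (i := 4) h4).trans ?_
  rw [show ((-1 : ℤ) ^ 4) = 1 by norm_num, one_smul]
  refine (congrArg (B.cl 5) e).trans ?_
  refine (cl_zsmul (i := 5) (-1) h5).trans ?_
  rw [neg_smul, one_smul]

end PathBasis

end

noncomputable section

variable {K Λ : Type u} [Field K] [Ring Λ] [Algebra K Λ] {n : ℕ}

namespace PathBasis

open Ends

variable {B : PathBasis K Λ n}

/-! ### Products of the generators -/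

lemma clOm_mul_clX (k : ℕ) : B.clOm k * B.clX = 0 :=
  (clOm_mul (i := 0) k (xCo_comp 1)).trans
    ((congrArg (B.cl 0) (B.omega_comp_xCo k 0)).trans (cl_zero 0))

lemma clOm_mul_clOm (hn : 1 ≤ n) (k j : ℕ) : B.clOm k * B.clOm j = 0 :=
  (clOm_mul (i := 0) k (omega_comp 1 j)).trans
    ((congrArg (B.cl 0) ((B.omega_comp_elem k j _).trans
      (if_neg fun h => by omega))).trans (cl_zero 0))

lemma clOm_mul_clY (k : ℕ) : B.clOm k * B.clY = 0 := by
  rw [clY, yCo_eq]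
  exact (clOm_mul (i := 1) k (xyCo_comp 0)).trans
    ((congrArg (B.cl 1) (B.omega_comp_xyCo k 0)).trans (cl_zero 1))

/-- A socle element annihilates all values of positive length and turns trivial paths into socle
paths. In degree two, and likewise below in degrees four and six, the resulting cochains are
coboundaries. -/
lemma clOm_mul_clZ (h2 : (2 : K) ≠ 0) (hn : 1 ≤ n) (k j : ℕ) : B.clOm k * B.clZ j = 0 := by
  refine (clOm_mul (i := 2) k (B.comp_d₃_one _)).trans
    ((congrArg (B.cl 2) (B.omega_comp_elem k j 0)).trans ?_)
  split_ifs
  · exact cl_eq_zero_of_mem_bdry (i := 1) (elem_mem_bdry_d₂_one h2 k (by omega))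
  · exact cl_zero 2

lemma clOm_mul_clG (h2 : (2 : K) ≠ 0) (hn : 1 ≤ n) (k : ℕ) : B.clOm k * B.clG = 0 := by
  refine (clOm_mul (i := 4) k B.elem_L_zero_zero_comp).trans
    ((congrArg (B.cl 4) (B.omega_comp_elem_L_zero k)).trans ?_)
  split_ifs
  · exact cl_eq_zero_of_mem_bdry (i := 3) (elem_L_zero_odd_mem h2 (by omega))
  · exact cl_zero 4

lemma clOm_mul_clH (h2 : (2 : K) ≠ 0) (k : ℕ) : B.clOm k * B.clH = 0 :=
  (clOm_mul (i := 6) k B.hCo_comp).trans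
    ((congrArg (B.cl 6) (B.omega_comp_aug k)).trans
      (cl_eq_zero_of_mem_bdry (i := 5) (omega_mem_bdry_d₃ h2 k)))

lemma clY_mul {i : ℕ} {f : B.Cochain i} (hf : f ∘ₗ B.resD i = 0) :
    B.clY * B.cl i f = (-1 : ℤ) ^ i • (B.cl i f * B.clY) := y_mul_cl_eq hf

lemma clY_sq (h2 : (2 : K) ≠ 0) : B.clY * B.clY = 0 := by
  have h := clY_mul (B := B) B.yCo_comp
  rw [pow_one, neg_smul, one_smul, ← clY, eq_neg_iff_add_eq_zero, ← two_smul K] at h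
  exact (smul_eq_zero_iff_right h2).1 h

/-- The coefficients of the products `z * y`. -/
def theta (n j k : ℕ) : ℤ := -((2 * min j k + 1) * ((n : ℤ) - max j k))

/-- Paired lengths have opposite signs, so each pair contributes `d - (2 * n - 1 - d)`. Over the
even lengths `d` this is an arithmetic progression. -/
lemma wsum_mul_pathSign {k j : ℕ} (hk : k < n) (hj : j < n) :
    wsum n (fun d => (d : ℤ) * pathSign 1 k j d) k j = theta n j k := by
  rw [wsum_eq _ hk hj]
  have : ∀ t ∈ Finset.range (n - max k j),
      ((max k j - min k j + 2 * t : ℕ) : ℤ) * pathSign 1 k j (max k j - min k j + 2 * t) +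
        ((2 * n - 1 - (max k j - min k j + 2 * t) : ℕ) : ℤ) *
          pathSign 1 k j (2 * n - 1 - (max k j - min k j + 2 * t)) =
      (2 * max k j - 2 * min k j - 2 * n + 1 : ℤ) + t * 4 := by
    intro t ht
    rw [Finset.mem_range] at ht
    unfold pathSign
    rw [if_pos (by omega), if_neg (by omega)]
    omega
  rw [Finset.sum_congr rfl this, Finset.sum_add_distrib, Finset.sum_const, Finset.card_range,
    nsmul_eq_mul, ← Finset.sum_mul]
  have h2 : (∑ t ∈ Finset.range (n - max k j), (t : ℤ)) * 2 =
      ((n - max k j : ℕ) : ℤ) * ((n - max k j : ℕ) - 1) := by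
    generalize n - max k j = N
    induction N with
    | zero => simp
    | succ N ih => rw [Finset.sum_range_succ, add_mul, ih]; push_cast; ring
  have h3 : ((n - max k j : ℕ) : ℤ) = n - max k j := by omega
  rw [h3] at h2 ⊢
  unfold theta
  rw [min_comm j k, max_comm j k]
  linear_combination 2 * h2

lemma elem_zero_comp_eulerComm {j : ℕ} (hj : j < n) :
    (B.elem j 0 : B.PV →ₗ[Λ ⊗[K] Λᵐᵒᵖ] Λ) ∘ₗ B.eulerComm (B.d₃ 1) =
      ∑ k : Fin n, (theta n j k : K) • B.elem (k : ℕ) (2 * n - 1) := by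
  refine B.hom_ext fun k => ?_
  refine (comp_eulerComm_apply (i := 2) (B.comp_d₃_one _) (B.gen k)).trans ?_
  have h : B.elem j 0 (B.euler ℕ (B.d₃ 1 (B.gen k))) =
      wsum n (fun d => (d : ℤ) * pathSign 1 k j d) k j • B.b k k (2 * n - 1) := by
    rw [d₃_gen, map_sum, map_sum, Finset.sum_eq_single_of_mem j (Finset.mem_range.2 hj)]
    · rw [map_sum, map_sum, ← B.sum_b_mul_b_mul]
      refine Finset.sum_congr rfl fun x _ => ?_
      rw [map_zsmul, map_zsmul, euler_cell, deg_b, map_smul, LinearMap.smul_apply,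
        LinearMap.map_smul_of_tower, map_cell, elem_gen, if_pos rfl, bimodule_smul,
        Nat.cast_smul_eq_nsmul, ← natCast_zsmul, smul_smul, mul_comm (x.1 : ℤ)]
      exact congrArg (fun p => (pathSign 1 k j x.1 * (x.1 : ℤ)) • (p * B.b j k x.2)) (B.b_mul_e k j x.1)
    · intro i _ hi
      rw [map_sum, map_sum]
      refine Finset.sum_eq_zero fun x _ => ?_
      rw [map_zsmul, map_zsmul, euler_cell, map_cell, elem_gen, if_neg hi, smul_zero, smul_zero]
  refine Eq.trans h ?_
  rw [LinearMap.sum_apply]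
  by_cases hk : k < n
  · rw [wsum_mul_pathSign hk hj, Finset.sum_eq_single_of_mem ⟨k, hk⟩ (Finset.mem_univ _)]
    · rw [LinearMap.smul_apply, elem_gen, if_pos rfl, Int.cast_smul_eq_zsmul]
      rfl
    · intro i _ hi
      rw [LinearMap.smul_apply, elem_gen, if_neg fun h => hi (Fin.ext h.symm), smul_zero]
  · rw [B.b_eq_zero (by unfold ValidPath; omega), smul_zero, Finset.sum_eq_zero]
    intro i _
    rw [LinearMap.smul_apply, elem_gen, if_neg (by omega), smul_zero]

lemma clZ_mul_clY {j : ℕ} (hj : j < n) :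
    B.clZ j * B.clY = ∑ k : Fin n, (theta n j k : K) • B.clW k := by
  refine (cl_mul_y (i := 2) (B.comp_d₃_one _)).trans ?_
  rw [show ((-1 : ℤ) ^ 2) = 1 by norm_num, one_smul]
  refine (congrArg (B.cl 3) (elem_zero_comp_eulerComm hj)).trans ?_
  exact (cl_sum (i := 3) (fun k : Fin n => (theta n j k : K))
    (fun k => omega_comp (B := B) (-1) (k : ℕ)) Finset.univ).2

/-- A closed path of length `2 * n - 2` exists only at the vertex `0`. It has `n - j` even
factorisations through `j`, with left lengths `j + 2 * t`. -/
lemma elem_comp_hom₂ {j : ℕ} (hj : j < n) : B.elem j 0 ∘ₗ B.hom₂ = ((n : K) - j) • B.xCo (n - 1) := by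
  refine B.hom_ext fun k => ?_
  rw [LinearMap.comp_apply, hom₂_gen, map_sum, Finset.sum_eq_single_of_mem j (Finset.mem_range.2 hj),
    LinearMap.smul_apply, xCo_gen, map_sum]
  · have h : ∀ x ∈ Finset.HasAntidiagonal.antidiagonal (2 * n - 2),
        B.elem j 0 (par k j x.1 • B.cell j (B.b k j x.1) (B.b j k x.2)) =
        (if (x.1 + j) % 2 = 0 ∧ j ≤ x.1 ∧ x.1 + j + 2 ≤ 2 * n then (1 : K) else 0) •
          B.b k k (2 * (n - 1)) := by
      rintro ⟨d, e⟩ hx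
      rw [Finset.HasAntidiagonal.mem_antidiagonal] at hx
      dsimp only at hx
      rw [map_zsmul, map_cell, elem_gen, if_pos rfl, bimodule_smul]
      dsimp only [ends_src_nat, ends_tgt_nat]
      rw [show B.b j j 0 = B.e j from rfl, b_mul_e, b_mul, hx, show 2 * n - 2 = 2 * (n - 1) by omega]
      by_cases hk : k = 0
      · subst hk
        unfold par
        by_cases hp : (d + j) % 2 = 0
        · rw [if_pos (show (d + j + 0) % 2 = 0 from hp), one_smul]
          by_cases hv : j ≤ d ∧ d + j + 2 ≤ 2 * n
          · rw [if_pos ⟨rfl, by unfold ValidPath; omega⟩, if_pos ⟨hp, hv⟩, one_smul]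
          · rw [if_neg (fun h => hv (by unfold ValidPath at h; omega)), if_neg fun h => hv h.2,
              zero_smul]
        · rw [if_neg (show ¬ (d + j + 0) % 2 = 0 from hp), zero_smul, if_neg fun h => hp h.1,
            zero_smul]
      · rw [B.b_eq_zero (i := k) (j := k) (by unfold ValidPath; omega), smul_zero, ite_self,
          smul_zero]
    rw [Finset.sum_congr rfl h, ← Finset.sum_smul]
    congr 1
    rw [Finset.Nat.sum_antidiagonal_eq_sum_range_succ_mk, Finset.sum_boole,
      ← Nat.cast_sub hj.le, ← Finset.card_range (n - j)]
    congr 1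
    symm
    refine Finset.card_nbij (fun t => j + 2 * t) (fun t ht => ?_) (fun t _ t' _ h => ?_)
      (fun d hd => ?_)
    · rw [Finset.mem_coe, Finset.mem_range] at ht
      rw [Finset.mem_coe, Finset.mem_filter, Finset.mem_range]
      dsimp only
      omega
    · dsimp only at h
      omega
    · rw [Finset.mem_coe, Finset.mem_filter, Finset.mem_range] at hd
      refine ⟨(d - j) / 2, ?_, ?_⟩
      · rw [Finset.mem_coe, Finset.mem_range]; omega
      · dsimp only at hd ⊢; omega
  · intro i _ hi
    rw [map_sum]
    refine Finset.sum_eq_zero fun x _ => ?_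
    rw [map_zsmul, map_cell, elem_gen, if_neg hi, smul_zero, smul_zero]

lemma clX_pow_mul_clH (k : ℕ) : B.clX ^ k * B.clH = B.cl 6 (B.xCo k) := by
  rw [clX_pow]
  exact cl_mul_h (i := 0) (xCo_comp k)

lemma clZ_mul_clG (hn : 1 ≤ n) {j : ℕ} (hj : j < n) :
    B.clZ j * B.clG = ((n : K) - j) • (B.clX ^ (n - 1) * B.clH) := by
  have h6 : (((n : K) - j) • B.xCo (n - 1) : B.PV →ₗ[Λ ⊗[K] Λᵐᵒᵖ] Λ) ∘ₗ B.d₁ 1 = 0 := by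
    rw [LinearMap.smul_comp, xCo_comp, smul_zero]
  have e : B.elem j 0 ∘ₗ B.hom₂ = _ := elem_comp_hom₂ hj
  rw [clX_pow_mul_clH]
  refine (cl_mul_cl_gamma hn (i := 2) (B.comp_d₃_one _) (by norm_num) ?_).trans
    ((congrArg (B.cl 6) e).trans (cl_smul (i := 6) _ (xCo_comp (n - 1))))
  exact (congrArg (· ∘ₗ B.d₁ 1) e).trans h6

lemma elem_comp_tauV : B.elem (LArrow.L 0) 0 ∘ₗ B.tauV = B.elem 0 0 := by
  refine B.hom_ext fun i => ?_
  rw [LinearMap.comp_apply, tauV_gen, elem_gen]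
  split_ifs with h
  · rw [map_cell, elem_gen, if_pos rfl, bimodule_smul]
    exact (congrArg (· * B.e 0) (B.b_mul_e 0 0 0)).trans (B.b_mul_e 0 0 0)
  · exact map_zero _

lemma clZ_mul_clH (j : ℕ) :
    B.clZ j * B.clH = B.cl 8 (B.elem j 0 : B.PV →ₗ[Λ ⊗[K] Λᵐᵒᵖ] Λ) :=
  cl_mul_h (i := 2) (B.comp_d₃_one _)

/-- In degree four the lift of `γ` is `tauV`, which turns the loop cochain back into the cochain of
vertex `0`, now in degree eight. -/
lemma clG_sq (hn : 1 ≤ n) : B.clG * B.clG = B.clZ 0 * B.clH := by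
  rw [clZ_mul_clH]
  refine (cl_mul_cl_gamma hn (i := 4) B.elem_L_zero_zero_comp (by norm_num) ?_).trans
    (congrArg (B.cl 8) B.elem_comp_tauV)
  exact (congrArg (· ∘ₗ B.d₃ 1) B.elem_comp_tauV).trans (B.comp_d₃_one _)

lemma clH_mul_clG (hn : 1 ≤ n) : B.clH * B.clG = B.clG * B.clH := by
  refine (cl_mul_cl_gamma hn (i := 6) B.hCo_comp (by norm_num) ?_).trans
    ((congrArg (B.cl 10) B.aug_comp_tauA).trans (cl_mul_h (i := 4) B.elem_L_zero_zero_comp).symm)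
  exact (congrArg (· ∘ₗ B.d₂ (-1)) B.aug_comp_tauA).trans B.elem_L_zero_zero_comp

lemma clH_mul_clW {k : ℕ} (hk : k < n) : B.clH * B.clW k = B.clW k * B.clH := by
  refine (cl_mul_cl_omega hk (i := 6) B.hCo_comp le_rfl ?_).trans
    ((congrArg (B.cl 9) (B.aug_comp_omV k)).trans (cl_mul_h (i := 3) (omega_comp (-1) k)).symm)
  exact (congrArg (· ∘ₗ B.d₁ (-1)) (B.aug_comp_omV k)).trans (omega_comp (-1) k)

lemma elem_comp_omV (j k : ℕ) : B.elem j 0 ∘ₗ B.omV k = if j = k then B.elem k (2 * n - 1) else 0 := by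
  refine B.hom_ext fun i => ?_
  rw [LinearMap.comp_apply, omV_gen]
  by_cases hi : i = k
  · subst hi
    rw [if_pos rfl, map_cell, elem_gen, bimodule_smul]
    split_ifs with h1 h2 h2
    · subst h1
      rw [elem_gen, if_pos rfl]
      exact (congrArg (· * B.e i) (B.b_mul_e i i _)).trans (B.b_mul_e i i _)
    · exact absurd h1.symm h2
    · exact absurd h2.symm h1
    · rw [mul_zero, zero_mul]; rfl
  · rw [if_neg hi, map_zero]
    split_ifs
    · rw [elem_gen, if_neg hi]
    · rfl

/-- Socle cochains at neighbouring vertices differ by a coboundary of `d₂ (-1)`; hence all of them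
represent the same class in degree five. -/
lemma cl_five_omega {k : ℕ} (hk : k < n) :
    B.cl 5 (B.elem k (2 * n - 1) : B.PV →ₗ[Λ ⊗[K] Λᵐᵒᵖ] Λ) =
      B.cl 5 (B.elem 0 (2 * n - 1) : B.PV →ₗ[Λ ⊗[K] Λᵐᵒᵖ] Λ) := by
  have hc : ∀ k, (B.elem k (2 * n - 1) : B.PV →ₗ[Λ ⊗[K] Λᵐᵒᵖ] Λ) ∘ₗ B.d₃ (-1) = 0 := by
    intro k
    rw [show 2 * n - 1 = 2 * n - 2 + 1 by omega]
    exact elem_succ_comp _ _ _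
  induction k with
  | zero => rfl
  | succ k ih =>
    rw [← ih (by omega)]
    obtain ⟨φ, hφ⟩ := sub_mem_bdry_d₂ (B := B) (-1) (i := k) (m := 2 * n - 1) (by omega)
      (by unfold ValidPath; omega)
    exact (cl_eq_of_sub_eq (i := 4) (hc k) φ hφ).symm

lemma clX_pow_mul_clG_mul_clY (k : ℕ) : B.clX ^ k * B.clG * B.clY =
    -B.cl 5 (B.elem 0 (2 * k + 1) : B.PV →ₗ[Λ ⊗[K] Λᵐᵒᵖ] Λ) := by
  rw [mul_assoc, clG_mul_clY, mul_neg, clX_pow_mul_cl_five]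

/-- Up to sign the classes `clZ j` and `clW k` are dual bases for the product with values in the
line of `X ^ (n - 1) γ y`. This replaces a lift of `z_j` in what follows. -/
lemma clZ_mul_clW {j k : ℕ} (hk : k < n) :
    B.clZ j * B.clW k = if j = k then -(B.clX ^ (n - 1) * B.clG * B.clY) else 0 := by
  have hc : (B.elem j 0 ∘ₗ B.omV k) ∘ₗ B.d₃ (-1) = 0 := by
    rw [elem_comp_omV]
    split_ifs
    · rw [show 2 * n - 1 = 2 * n - 2 + 1 by omega]
      exact elem_succ_comp _ _ _
    · exact LinearMap.zero_comp _
  refine (cl_mul_cl_omega hk (i := 2) (B.comp_d₃_one _) (by norm_num) hc).trans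
    ((congrArg (B.cl 5) (elem_comp_omV j k)).trans ?_)
  split_ifs
  · rw [clX_pow_mul_clG_mul_clY, neg_neg, show 2 * (n - 1) + 1 = 2 * n - 1 by omega]
    exact cl_five_omega hk
  · exact cl_zero 5

lemma elem_comp_omA (k : ℕ) : B.elem (LArrow.L 0) 0 ∘ₗ B.omA k =
    if k = 0 then (-1 : ℤ) • B.elem (LArrow.L 0) (2 * n - 1) else 0 := by
  refine B.hom_ext fun a => ?_
  rw [LinearMap.comp_apply, omA_gen]
  by_cases ha : a = LArrow.L 0
  · subst ha
    rw [LArrow.src_L]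
    by_cases hk : k = 0
    · subst hk
      rw [if_pos rfl, if_pos rfl, map_zsmul, map_cell, elem_gen, if_pos rfl, bimodule_smul,
        LinearMap.smul_apply, elem_gen, if_pos rfl, LArrow.sign_L_zero]
      congr 1
      exact (congrArg (· * B.e 0) (B.b_mul_e 0 0 _)).trans (B.b_mul_e 0 0 _)
    · rw [if_neg (Ne.symm hk), if_neg hk, map_zero, LinearMap.zero_apply]
  · have h1 : (if k = 0 then (-1 : ℤ) • B.elem (LArrow.L 0) (2 * n - 1) else 0) (B.gen a) = 0 := by
      split_ifs
      · rw [LinearMap.smul_apply, elem_gen, if_neg ha, smul_zero]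
      · rfl
    rw [h1]
    split_ifs
    · rw [map_zsmul, map_cell, elem_gen, if_neg ha, smul_zero, smul_zero]
    · exact map_zero _

lemma xyCo_last (hn : 1 ≤ n) : B.xyCo (n - 1) = B.elem (LArrow.L 0) (2 * n - 1) := by
  refine B.hom_ext fun a => ?_
  rw [xyCo_gen, elem_gen, show 2 * (n - 1) + 1 = 2 * n - 1 by omega]
  split_ifs with h
  · subst h; rfl
  · refine B.b_eq_zero ?_
    rcases a with i | i
    · simp only [LArrow.src_R, LArrow.tgt_R]; unfold ValidPath; omega
    · simp only [LArrow.L.injEq, LArrow.src_L, LArrow.tgt_L] at *; unfold ValidPath; omega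

lemma clG_mul_clW (hn : 1 ≤ n) {k : ℕ} (hk : k < n) :
    B.clG * B.clW k = if k = 0 then -(B.clX ^ (n - 1) * B.clY * B.clH) else 0 := by
  have hL : B.elem (LArrow.L 0) (2 * n - 1) ∘ₗ B.d₂ 1 = 0 := by
    rw [← xyCo_last hn, xyCo_comp]
  have hc : (B.elem (LArrow.L 0) 0 ∘ₗ B.omA k) ∘ₗ B.d₂ 1 = 0 := by
    rw [elem_comp_omA]
    split_ifs
    · rw [LinearMap.smul_comp, hL, smul_zero]
    · exact LinearMap.zero_comp _
  refine (cl_mul_cl_omega hk (i := 4) B.elem_L_zero_zero_comp (by norm_num) hc).trans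
    ((congrArg (B.cl 7) (elem_comp_omA k)).trans ?_)
  split_ifs
  · refine (cl_zsmul (i := 7) (-1) hL).trans ?_
    rw [neg_smul, one_smul, clX_pow_mul_clY, xyCo_last hn]
    exact congrArg Neg.neg (cl_mul_h (i := 1) hL).symm
  · exact cl_zero 7

end PathBasis

end

/-! ### The matrix `theta`, monomial bases, and products of even classes. -/

noncomputable section

variable {K Λ : Type u} [Field K] [Ring Λ] [Algebra K Λ] {n : ℕ}

namespace PathBasis

open Ends

lemma theta_symm (n j k : ℕ) : theta n j k = theta n k j := by
  unfold theta
  rw [min_comm, max_comm]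

lemma theta_self_right {j : ℕ} (hj : j ≤ n) : theta n j n = 0 := by
  unfold theta
  rw [max_eq_right hj, sub_self, mul_zero, neg_zero]

lemma theta_zero_right (n j : ℕ) : theta n j 0 = -((n : ℤ) - j) := by
  unfold theta
  simp

lemma theta_of_le {j k : ℕ} (h : j ≤ k) : theta n j k = -((2 * j + 1) * ((n : ℤ) - k)) := by
  unfold theta
  rw [min_eq_left h, max_eq_right h]

lemma theta_of_ge {j k : ℕ} (h : k ≤ j) : theta n j k = -((2 * k + 1) * ((n : ℤ) - j)) := by
  rw [theta_symm, theta_of_le h]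

/-- The second difference of `theta` in its second argument. -/
lemma theta_diff {j k : ℕ} : theta n j (k + 1) - 2 * theta n j k +
      (if k = 0 then -theta n j 0 else theta n j (k - 1)) =
    if j = k then (2 * n + 1 : ℤ) else 0 := by
  rcases Nat.lt_trichotomy j k with h | rfl | h
  · rw [if_neg (by omega), if_neg (by omega), theta_of_le (by omega), theta_of_le h.le,
      theta_of_le (by omega)]
    push_cast [show 1 ≤ k by omega]
    ring
  · rw [if_pos rfl, theta_of_le (k := j + 1) (by omega), theta_of_le le_rfl]
    rcases Nat.eq_zero_or_pos j with rfl | hj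
    · rw [if_pos rfl, theta_of_le le_rfl]
      push_cast
      ring
    · rw [if_neg (by omega), theta_of_ge (by omega)]
      push_cast [show 1 ≤ j by omega]
      ring
  · rw [if_neg (show ¬ j = k by omega), theta_of_ge (k := k + 1) (by omega), theta_of_ge h.le]
    rcases Nat.eq_zero_or_pos k with rfl | hk
    · rw [if_pos rfl, theta_of_ge h.le]
      push_cast
      ring
    · rw [if_neg (by omega), theta_of_ge (by omega)]
      push_cast [show 1 ≤ k by omega]
      ring

/-- By `theta_diff` a tridiagonal matrix, with boundary values `0` at `n` and minus the value at `0`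
beyond the loop, inverts `theta` up to `2 * n + 1`. This is where that number must be nonzero. -/
lemma eq_zero_of_sum_theta (hK : (2 * n + 1 : K) ≠ 0) {a : Fin n → K}
    (h : ∀ k : Fin n, ∑ j, a j * (theta n j k : K) = 0) : a = 0 := by
  have h' : ∀ k ≤ n, ∑ j, a j * (theta n j k : K) = 0 := fun k hk => by
    rcases hk.lt_or_eq with hk | rfl
    · exact h ⟨k, hk⟩
    · exact Finset.sum_eq_zero fun j _ => by
        rw [theta_self_right j.2.le, Int.cast_zero, mul_zero]
  funext k
  have h1 : ∑ j, a j * ((if (j : ℕ) = k then (2 * n + 1 : ℤ) else 0 : ℤ) : K) = 0 := by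
    have h2 : ∀ j : Fin n, a j * ((if (j : ℕ) = k then (2 * n + 1 : ℤ) else 0 : ℤ) : K) =
        a j * (theta n j (k + 1) : K) - 2 * (a j * (theta n j k : K)) +
          (if (k : ℕ) = 0 then -(a j * (theta n j 0 : K)) else a j * (theta n j (k - 1) : K)) := by
      intro j
      rw [← theta_diff]
      split_ifs <;> push_cast <;> ring
    rw [Finset.sum_congr rfl fun j _ => h2 j, Finset.sum_add_distrib, Finset.sum_sub_distrib,
      ← Finset.mul_sum, h' _ k.2, h' _ k.2.le]
    split_ifs
    · rw [Finset.sum_neg_distrib, h' 0 (by omega)]; ring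
    · rw [h' _ (by omega)]; ring
  rw [Finset.sum_eq_single k (fun j _ hj => by
    rw [if_neg (fun e => hj (Fin.ext e)), Int.cast_zero, mul_zero]) (by simp), if_pos rfl] at h1
  push_cast at h1
  exact (mul_eq_zero.1 h1).resolve_right hK

/-- The monomials in the generators. -/
def mono (B : PathBasis K Λ n) : ℕ → Fin n → HochschildCohomology K Λ
  | 0, k => B.clX ^ (k : ℕ)
  | 1, k => B.clX ^ (k : ℕ) * B.clY
  | 2, k => B.clZ k
  | 3, k => B.clZ k * B.clY
  | 4, k => B.clX ^ (k : ℕ) * B.clG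
  | 5, k => B.clX ^ (k : ℕ) * B.clG * B.clY
  | i + 6, k => mono B i k * B.clH

variable (K) in
/-- The coefficients of the monomials in the basis of cocycles. -/
def monoCoeff {n : ℕ} : ℕ → Fin n → Fin n → K
  | 0, k, l => if k = l then 1 else 0
  | 1, k, l => if k = l then 1 else 0
  | 2, k, l => if k = l then 1 else 0
  | 3, k, l => theta n k l
  | 4, k, l => if k = l then 1 else 0
  | 5, k, l => if k = l then -1 else 0
  | i + 6, k, l => monoCoeff i k l

lemma eq_zero_of_sum_monoCoeff (hK : (2 * n + 1 : K) ≠ 0) {a : Fin n → K} : ∀ i,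
    (∀ l : Fin n, ∑ k, a k * monoCoeff K i k l = 0) → a = 0 := by
  have h : ∀ c : K, c ≠ 0 → (∀ l : Fin n, ∑ k, a k * (if k = l then c else 0) = 0) → a = 0 :=
    fun c hc h => funext fun l => by
      have := h l
      rw [Finset.sum_eq_single l (fun k _ hk => by rw [if_neg hk, mul_zero]) (by simp),
        if_pos rfl] at this
      exact (mul_eq_zero.1 this).resolve_right hc
  exact Nat.six_induction (h 1 one_ne_zero) (h 1 one_ne_zero) (h 1 one_ne_zero)
    (eq_zero_of_sum_theta hK) (h 1 one_ne_zero) (h (-1) (neg_ne_zero.2 one_ne_zero)) fun _ h => h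

variable {B : PathBasis K Λ n}

lemma mono_eq_sum (k : Fin n) : ∀ i, B.mono i k =
    ∑ l, monoCoeff K i k l • B.cl i (B.basisCo i l) := by
  have h : ∀ (c : K) (f : Fin n → HochschildCohomology K Λ),
      ∑ l, (if k = l then c else 0) • f l = c • f k := fun c f => by
    rw [Finset.sum_eq_single k (fun l _ hl => by rw [if_neg hl.symm, zero_smul]) (by simp),
      if_pos rfl]
  have h1 : ∀ f : Fin n → HochschildCohomology K Λ,
      ∑ l, (if k = l then (1 : K) else 0) • f l = f k := fun f => by rw [h, one_smul]
  refine Nat.six_induction ?_ ?_ ?_ ?_ ?_ ?_ ?_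
  · exact (clX_pow k).trans (h1 fun l => B.cl 0 (B.basisCo 0 l)).symm
  · exact (clX_pow_mul_clY k).trans (h1 fun l => B.cl 1 (B.basisCo 1 l)).symm
  · exact (h1 _).symm
  · exact clZ_mul_clY k.2
  · exact (clX_pow_mul_clG k).trans (h1 fun l => B.cl 4 (B.basisCo 4 l)).symm
  · refine (clX_pow_mul_clG_mul_clY k).trans (((h (-1) _).trans ?_).symm)
    rw [neg_one_smul]
    rfl
  · intro i hi
    refine (congrArg (· * B.clH) hi).trans ?_
    rw [Finset.sum_mul]
    refine Finset.sum_congr rfl fun l _ => ?_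
    rw [smul_mul_assoc]
    exact congrArg _ (cl_mul_h (basisCo_comp l i))

lemma sum_mono (a : Fin n → K) (i : ℕ) : ∑ k, a k • B.mono i k =
    ∑ l, (∑ k, a k * monoCoeff K i k l) • B.cl i (B.basisCo i l) := by
  simp only [mono_eq_sum, Finset.smul_sum, Finset.sum_smul, smul_smul]
  exact Finset.sum_comm

variable (B) in
lemma linearIndependent_mono (hK : (2 * n + 1 : K) ≠ 0) (i : ℕ) :
    LinearIndependent K (B.mono (i + 1)) := by
  refine Fintype.linearIndependent_iff.2 fun a h => ?_
  rw [sum_mono] at h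
  exact congrFun (eq_zero_of_sum_monoCoeff hK (i + 1)
    (Fintype.linearIndependent_iff.1 (B.linearIndependent_cl i) _ h))

lemma mono_mem (i : ℕ) (k : Fin n) : B.mono i k ∈ HochschildCohomology.component K Λ i := by
  rw [mono_eq_sum]
  exact sum_mem fun l _ => Submodule.smul_mem _ _ (cl_mem _ _)

variable (B) in
lemma component_eq_span_mono (h2 : (2 : K) ≠ 0) (hK : (2 * n + 1 : K) ≠ 0) (i : ℕ) :
    HochschildCohomology.component K Λ (i + 1) =
      Submodule.span K (Set.range (B.mono (i + 1))) := by
  have hc := B.component_eq_span h2 i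
  have : FiniteDimensional K (HochschildCohomology.component K Λ (i + 1)) := by
    rw [hc]
    exact FiniteDimensional.span_of_finite K (Set.finite_range _)
  refine (Submodule.eq_of_le_of_finrank_eq (Submodule.span_le.2 ?_) ?_).symm
  · rintro _ ⟨k, rfl⟩
    exact mono_mem _ k
  · rw [finrank_span_eq_card (B.linearIndependent_mono hK i), hc,
      finrank_span_eq_card (B.linearIndependent_cl i)]

lemma clH_mul_clY : B.clH * B.clY = B.clY * B.clH := by
  refine Eq.trans ?_ (clY_mul (i := 6) B.hCo_comp).symm
  rw [Even.neg_one_pow (by decide), one_smul]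
  rfl

lemma mono_mul_clY (k : Fin n) : ∀ i, Even i → B.mono i k * B.clY = B.mono (i + 1) k := by
  refine Nat.six_induction (fun _ => rfl) (fun h => by simp at h) (fun _ => rfl)
    (fun h => absurd h (by decide)) (fun _ => rfl) (fun h => absurd h (by decide)) fun i hi h => ?_
  refine Eq.trans ?_ (congrArg (· * B.clH) (hi (by simpa [Nat.even_add, show Even 6 by decide] using h)))
  refine (mul_assoc (B.mono i k) B.clH B.clY).trans ?_
  rw [clH_mul_clY, mul_assoc]

/-- In even positive degree multiplication by `y` carries the monomial basis to the monomial basis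
of the next degree. Degree zero is different, because `y` kills the socle classes. -/
lemma mul_clY_injective (h2 : (2 : K) ≠ 0) (hK : (2 * n + 1 : K) ≠ 0) {i : ℕ} (hi : Even i)
    (h0 : i ≠ 0) {u v : HochschildCohomology K Λ} (hu : u ∈ HochschildCohomology.component K Λ i)
    (hv : v ∈ HochschildCohomology.component K Λ i) (h : u * B.clY = v * B.clY) : u = v := by
  obtain ⟨i, rfl⟩ := Nat.exists_eq_succ_of_ne_zero h0
  have hs := sub_mem hu hv
  rw [Nat.succ_eq_add_one, B.component_eq_span_mono h2 hK i,
    Submodule.mem_span_range_iff_exists_fun] at hs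
  obtain ⟨a, ha⟩ := hs
  have h0 : ∑ k, a k • B.mono (i + 1 + 1) k = 0 := by
    rw [← sub_eq_zero, ← sub_mul, ← ha, Finset.sum_mul] at h
    refine Eq.trans (Finset.sum_congr rfl fun k _ => ?_) h
    rw [smul_mul_assoc, mono_mul_clY k _ hi]
  have ha0 := Fintype.linearIndependent_iff.1 (B.linearIndependent_mono hK (i + 1)) a h0
  rw [← sub_eq_zero, ← ha]
  exact Finset.sum_eq_zero fun k _ => by rw [ha0, zero_smul]

lemma mul_mem_component {i j : ℕ} {u v : HochschildCohomology K Λ}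
    (hu : u ∈ HochschildCohomology.component K Λ i)
    (hv : v ∈ HochschildCohomology.component K Λ j) :
    u * v ∈ HochschildCohomology.component K Λ (i + j) := by
  obtain ⟨a, rfl⟩ := hu
  obtain ⟨b, rfl⟩ := hv
  exact ⟨_, (DirectSum.of_mul_of (A := HH K Λ) a b).symm⟩

lemma clZ_mem (k : ℕ) : B.clZ k ∈ HochschildCohomology.component K Λ 2 := cl_mem _ _

lemma clG_mem : B.clG ∈ HochschildCohomology.component K Λ 4 := cl_mem _ _

lemma clH_mem : B.clH ∈ HochschildCohomology.component K Λ 6 := cl_mem _ _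

lemma clX_pow_mem (k : ℕ) : B.clX ^ k ∈ HochschildCohomology.component K Λ 0 := by
  rw [clX_pow]
  exact cl_mem _ _

section

variable (h2 : (2 : K) ≠ 0) (hK : (2 * n + 1 : K) ≠ 0)

include h2 hK

/-- After multiplication by `y`, the factor `z_k y` is expanded in the classes `clW l`, and duality
with `z_j` selects the single coefficient `theta n k j`. -/
lemma clZ_mul_clZ {j k : ℕ} (hj : j < n) (hk : k < n) :
    B.clZ j * B.clZ k = -(theta n j k : K) • (B.clX ^ (n - 1) * B.clG) := by
  refine mul_clY_injective (B := B) h2 hK (i := 2 + 2) (by decide) (by decide)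
    (mul_mem_component (clZ_mem j) (clZ_mem k)) (Submodule.smul_mem _ _ ?_) ?_
  · exact mul_mem_component (i := 0) (j := 4) (clX_pow_mem _) clG_mem
  rw [mul_assoc, clZ_mul_clY hk, Finset.mul_sum,
    Finset.sum_eq_single (⟨j, hj⟩ : Fin n) (fun l _ hl => ?_) (by simp)]
  · rw [mul_smul_comm, clZ_mul_clW hj, if_pos rfl, smul_neg, ← neg_smul, smul_mul_assoc,
      theta_symm]
  · rw [mul_smul_comm, clZ_mul_clW l.2, if_neg (fun e => hl (Fin.ext e.symm)), smul_zero]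

/-- Since no lift of `z_j` is available, the left side is not computed directly. Both sides are
compared after multiplication by `y`, where only `clW 0` pairs nontrivially with `γ`. -/
lemma clG_mul_clZ (hn : 1 ≤ n) {j : ℕ} (hj : j < n) : B.clG * B.clZ j = B.clZ j * B.clG := by
  refine mul_clY_injective (B := B) h2 hK (i := 4 + 2) (by decide) (by decide)
    (mul_mem_component clG_mem (clZ_mem j)) ?_ ?_
  · exact mul_mem_component (i := 2) (j := 4) (clZ_mem j) clG_mem
  rw [clZ_mul_clG hn hj, mul_assoc, clZ_mul_clY hj, Finset.mul_sum,
    Finset.sum_eq_single (⟨0, hn⟩ : Fin n) (fun l _ hl => ?_) (by simp)]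
  · rw [mul_smul_comm, clG_mul_clW hn hn, if_pos rfl, smul_neg, ← neg_smul, smul_mul_assoc,
      theta_zero_right, mul_assoc, mul_assoc, clH_mul_clY]
    push_cast
    rw [neg_neg]
  · rw [mul_smul_comm, clG_mul_clW hn l.2, if_neg (fun e => hl (Fin.ext e)), smul_zero]

lemma clH_mul_clZ {j : ℕ} (hj : j < n) : B.clH * B.clZ j = B.clZ j * B.clH := by
  refine mul_clY_injective (B := B) h2 hK (i := 6 + 2) (by decide) (by decide)
    (mul_mem_component clH_mem (clZ_mem j)) ?_ ?_
  · exact mul_mem_component (i := 2) (j := 6) (clZ_mem j) clH_mem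
  rw [mul_assoc, mul_assoc (B.clZ j), clH_mul_clY, ← mul_assoc (B.clZ j), clZ_mul_clY hj,
    Finset.mul_sum, Finset.sum_mul]
  refine Finset.sum_congr rfl fun l _ => ?_
  rw [mul_smul_comm, smul_mul_assoc, clH_mul_clW l.2]

end

end PathBasis

end

noncomputable section

/-! ### Monomials in the presented algebra -/

namespace PresentationL

variable (K : Type u) [Field K] {n : ℕ}

/-- The generators of the presented algebra. -/
def gen (g : GenL n) : GradedCommAlgebra K (GenL.deg (n := n)) (RelL K n) :=
  RingQuot.mkAlgHom K _ (FreeAlgebra.ι K g)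

variable {K}

lemma gen_comm (a b : GenL n) :
    gen K a * gen K b = (-1 : K) ^ (a.deg * b.deg) • (gen K b * gen K a) := by
  have h := RingQuot.mkAlgHom_rel K
    (GradedCommRel.comm (K := K) (deg := GenL.deg (n := n)) (rel := RelL K n) a b)
  rwa [map_mul, map_smul, map_mul] at h

lemma gen_commute {a b : GenL n} (h : Even b.deg) : Commute (gen K a) (gen K b) := by
  have := gen_comm (K := K) a b
  rwa [(h.mul_left _).neg_one_pow, one_smul] at this

lemma commute_x₀ (g : GenL n) : Commute (gen K g) (gen K .x₀) :=
  gen_commute (show Even 0 by decide)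

lemma commute_z (g : GenL n) (j : Fin n) : Commute (gen K g) (gen K (.z j)) :=
  gen_commute (show Even 2 by decide)

lemma commute_γ (g : GenL n) : Commute (gen K g) (gen K .γ) :=
  gen_commute (show Even 4 by decide)

lemma commute_h (g : GenL n) : Commute (gen K g) (gen K .h) :=
  gen_commute (show Even 6 by decide)

lemma of_rel {r s : FreeAlgebra K (GenL n)} (h : RelL K n r s) :
    RingQuot.mkAlgHom K (GradedCommRel K (GenL.deg (n := n)) (RelL K n)) r =
      RingQuot.mkAlgHom K _ s :=
  RingQuot.mkAlgHom_rel K (GradedCommRel.of _ _ h)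

lemma x_mul (i : Fin n) (g : GenL n) : gen K (.x i) * gen K g = 0 := by
  have h := of_rel (K := K) (RelL.x_mul i g)
  rwa [map_mul, map_zero] at h

lemma mul_x (i : Fin n) (g : GenL n) : gen K g * gen K (.x i) = 0 := by
  rw [gen_comm, x_mul, smul_zero]

lemma x₀_pow : gen K (.x₀ : GenL n) ^ n = 0 := by
  have h := of_rel (K := K) (n := n) RelL.x₀_pow
  rwa [map_pow, map_zero] at h

lemma y_mul_y : gen K (.y : GenL n) * gen K .y = 0 := by
  have h := of_rel (K := K) (n := n) RelL.y_sq
  rwa [map_pow, map_zero, pow_two] at h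

lemma x₀_mul_z (j : Fin n) : gen K .x₀ * gen K (.z j) = 0 := by
  have h := of_rel (K := K) (n := n) (RelL.x₀_mul_z j)
  rwa [map_mul, map_zero] at h

lemma γ_mul_γ (hn : 0 < n) :
    gen K (.γ : GenL n) * gen K .γ = gen K (.z ⟨0, hn⟩) * gen K .h := by
  have h := of_rel (K := K) (n := n) (RelL.γ_sq hn)
  rwa [map_pow, map_mul, pow_two] at h

lemma exists_z_mul_γ (j : Fin n) :
    ∃ c : K, gen K (.z j) * gen K .γ = c • (gen K .x₀ ^ (n - 1) * gen K .h) := by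
  have h := of_rel (K := K) (n := n) (RelL.z_mul_γ j)
  rw [map_mul, map_smul, map_mul, map_pow] at h
  exact ⟨_, h⟩

lemma exists_z_mul_z (j k : Fin n) :
    ∃ c : K, gen K (.z j) * gen K (.z k) = c • (gen K .x₀ ^ (n - 1) * gen K .γ) := by
  have key : ∀ j k : Fin n, j ≤ k →
      ∃ c : K, gen K (.z j) * gen K (.z k) = c • (gen K .x₀ ^ (n - 1) * gen K .γ) := by
    intro j k hjk
    have h := of_rel (K := K) (n := n) (RelL.z_mul_z j k hjk)
    rw [map_mul, map_smul, map_mul, map_pow] at h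
    exact ⟨_, h⟩
  rcases le_total j k with h | h
  · exact key j k h
  · rw [(commute_z _ k).eq]
    exact key k j h

variable (K) in
/-- The monomials spanning the presented algebra, apart from the generators `x i`. -/
def mono : ℕ → Fin n → GradedCommAlgebra K (GenL.deg (n := n)) (RelL K n)
  | 0, k => gen K .x₀ ^ (k : ℕ)
  | 1, k => gen K .x₀ ^ (k : ℕ) * gen K .y
  | 2, k => gen K (.z k)
  | 3, k => gen K (.z k) * gen K .y
  | 4, k => gen K .x₀ ^ (k : ℕ) * gen K .γ
  | 5, k => gen K .x₀ ^ (k : ℕ) * gen K .γ * gen K .y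
  | i + 6, k => mono i k * gen K .h

variable (K n) in
/-- The span of the monomials of degree `i`. -/
def monoSpan : ℕ → Submodule K (GradedCommAlgebra K (GenL.deg (n := n)) (RelL K n))
  | 0 => Submodule.span K (Set.range (Sum.elim (mono K 0) fun k : Fin n => gen K (.x k)))
  | i + 1 => Submodule.span K (Set.range (mono K (i + 1)))

lemma mono_mem (k : Fin n) : ∀ i, mono K i k ∈ monoSpan K n i
  | 0 => Submodule.subset_span ⟨Sum.inl k, rfl⟩
  | _ + 1 => Submodule.subset_span ⟨k, rfl⟩

lemma x_mem (k : Fin n) : gen K (.x k) ∈ monoSpan K n 0 :=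
  Submodule.subset_span ⟨Sum.inr k, rfl⟩

lemma monoSpan_le {S : Submodule K (GradedCommAlgebra K (GenL.deg (n := n)) (RelL K n))} {i : ℕ}
    (hm : ∀ k, mono K i k ∈ S) (hx : i = 0 → ∀ k, gen K (.x k) ∈ S) : monoSpan K n i ≤ S := by
  cases i with
  | zero =>
    refine Submodule.span_le.2 ?_
    rintro _ ⟨k | k, rfl⟩
    exacts [hm k, hx rfl k]
  | succ i =>
    refine Submodule.span_le.2 ?_
    rintro _ ⟨k, rfl⟩
    exact hm k

lemma x₀_pow_mem (k : ℕ) : gen K (.x₀ : GenL n) ^ k ∈ monoSpan K n 0 := by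
  by_cases h : k < n
  · exact mono_mem ⟨k, h⟩ 0
  · rw [pow_eq_zero_of_le (not_lt.1 h) x₀_pow]
    exact zero_mem _

lemma x₀_pow_mul_γ_mem (k : ℕ) : gen K (.x₀ : GenL n) ^ k * gen K .γ ∈ monoSpan K n 4 := by
  by_cases h : k < n
  · exact mono_mem ⟨k, h⟩ 4
  · rw [pow_eq_zero_of_le (not_lt.1 h) x₀_pow, zero_mul]
    exact zero_mem _

lemma x₀_pow_mul_z_mem (k : ℕ) (j : Fin n) :
    gen K .x₀ ^ k * gen K (.z j) ∈ monoSpan K n 2 := by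
  cases k with
  | zero =>
    rw [pow_zero, one_mul]
    exact mono_mem j 2
  | succ k =>
    rw [pow_succ, mul_assoc, x₀_mul_z, mul_zero]
    exact zero_mem _

lemma x_mul_pow_mul (j : Fin n) (k : ℕ) (g : GenL n) :
    gen K (.x j) * (gen K .x₀ ^ k * gen K g) = 0 := by
  cases k with
  | zero => rw [pow_zero, one_mul, x_mul]
  | succ k => rw [pow_succ', ← mul_assoc, ← mul_assoc, x_mul, zero_mul, zero_mul]

lemma mul_h_mem {i : ℕ} {a : GradedCommAlgebra K (GenL.deg (n := n)) (RelL K n)}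
    (ha : a ∈ monoSpan K n i) : a * gen K .h ∈ monoSpan K n (i + 6) := by
  refine (monoSpan_le (S := (monoSpan K n (i + 6)).comap (LinearMap.mulRight K (gen K .h)))
    (fun k => mono_mem k (i + 6)) fun _ k => ?_) ha
  rw [Submodule.mem_comap, LinearMap.mulRight_apply, x_mul]
  exact zero_mem _

lemma mono_mul_y_mem (k : Fin n) : ∀ i, mono K i k * gen K .y ∈ monoSpan K n (i + 1) := by
  have h : ∀ (a : GradedCommAlgebra K (GenL.deg (n := n)) (RelL K n)) i,
      a * gen K .y * gen K .y ∈ monoSpan K n i := fun a i => by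
    rw [mul_assoc, y_mul_y, mul_zero]
    exact zero_mem _
  refine Nat.six_induction (mono_mem k 1) (h _ _) (mono_mem k 3) (h _ _) (mono_mem k 5) (h _ _)
    fun i hi => ?_
  have := mul_h_mem hi
  rwa [mul_assoc, (commute_h _).eq,
    ← mul_assoc] at this

lemma mul_y_mem {i : ℕ} {a : GradedCommAlgebra K (GenL.deg (n := n)) (RelL K n)}
    (ha : a ∈ monoSpan K n i) : a * gen K .y ∈ monoSpan K n (i + 1) := by
  refine (monoSpan_le (S := (monoSpan K n (i + 1)).comap (LinearMap.mulRight K (gen K .y)))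
    (fun k => mono_mul_y_mem k i) fun _ k => ?_) ha
  rw [Submodule.mem_comap, LinearMap.mulRight_apply, x_mul]
  exact zero_mem _

/-- Final factors `y` and `h` can be split off, since the spans are stable under right
multiplication by them. It remains to test the monomials of degrees `0`, `2` and `4`. -/
lemma gen_mul_mono_mem {g : GenL n}
    (h0 : ∀ k : ℕ, gen K g * gen K .x₀ ^ k ∈ monoSpan K n (g.deg + 0))
    (h2 : ∀ k, gen K g * gen K (.z k) ∈ monoSpan K n (g.deg + 2))
    (h4 : ∀ k : ℕ, gen K g * (gen K .x₀ ^ k * gen K .γ) ∈ monoSpan K n (g.deg + 4)) (k : Fin n) :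
    ∀ i, gen K g * mono K i k ∈ monoSpan K n (g.deg + i) := by
  have hy : ∀ {a : GradedCommAlgebra K (GenL.deg (n := n)) (RelL K n)} {i : ℕ},
      gen K g * a ∈ monoSpan K n (g.deg + i) →
        gen K g * (a * gen K .y) ∈ monoSpan K n (g.deg + (i + 1)) := fun {a i} h => by
    rw [← mul_assoc]
    exact mul_y_mem h
  refine Nat.six_induction (h0 k) (hy (h0 k)) (h2 k) (hy (h2 k)) (h4 k) (hy (h4 k)) fun i hi => ?_
  have := mul_h_mem hi
  rwa [mul_assoc] at this

lemma γ_mul_mem (k : ℕ) :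
    gen K (.γ : GenL n) * (gen K .x₀ ^ k * gen K .γ) ∈ monoSpan K n 8 := by
  have hc := commute_x₀ (K := K) (.γ : GenL n)
  -- For `n = 0` the relation `x₀ ^ n = 0` says `1 = 0`; otherwise the generator `z` of index `0`
  -- needed for `γ ^ 2` exists.
  rcases Nat.eq_zero_or_pos n with hn | hn
  · have h : gen K (.x₀ : GenL n) ^ n = 0 := x₀_pow
    have h1 : (1 : GradedCommAlgebra K (GenL.deg (n := n)) (RelL K n)) = 0 := by
      rw [← h, hn, pow_zero]
    rw [← one_mul (gen K (.γ : GenL n) * _), h1, zero_mul]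
    exact zero_mem _
  · rw [← mul_assoc, (hc.pow_right k).eq, mul_assoc, γ_mul_γ hn, ← mul_assoc]
    exact mul_h_mem (x₀_pow_mul_z_mem k _)

/-- Each relation rewrites a generator times a monomial as a scalar multiple of a spanning element.
As the generators preserve the spans, every word lies in the span of its degree; this bounds the
presented algebra from above. -/
lemma gen_mul_mem {g : GenL n} {i : ℕ} {a : GradedCommAlgebra K (GenL.deg (n := n)) (RelL K n)}
    (ha : a ∈ monoSpan K n i) : gen K g * a ∈ monoSpan K n (g.deg + i) := by
  refine (monoSpan_le (S := (monoSpan K n (g.deg + i)).comap (LinearMap.mulLeft K (gen K g)))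
    (fun k => ?_) fun _ k => ?_) ha
  · rw [Submodule.mem_comap, LinearMap.mulLeft_apply]
    refine gen_mul_mono_mem ?_ ?_ ?_ k i
    all_goals intro k
    · cases g with
      | x₀ =>
        rw [← pow_succ']
        exact x₀_pow_mem (k + 1)
      | x j =>
        cases k with
        | zero =>
          rw [pow_zero, mul_one]
          exact x_mem j
        | succ k =>
          rw [pow_succ, x_mul_pow_mul]
          exact zero_mem _
      | y =>
        rw [((commute_x₀ _).pow_right k).eq]
        exact mul_y_mem (x₀_pow_mem k)
      | z j =>
        rw [((commute_x₀ _).pow_right k).eq]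
        exact x₀_pow_mul_z_mem k j
      | γ =>
        rw [((commute_x₀ _).pow_right k).eq]
        exact x₀_pow_mul_γ_mem k
      | h =>
        rw [((commute_x₀ _).pow_right k).eq]
        exact mul_h_mem (x₀_pow_mem k)
    · cases g with
      | x₀ =>
        rw [x₀_mul_z]
        exact zero_mem _
      | x j =>
        rw [x_mul]
        exact zero_mem _
      | y =>
        rw [(commute_z _ k).eq]
        exact mul_y_mem (mono_mem k 2)
      | z j =>
        obtain ⟨c, hc⟩ := exists_z_mul_z (K := K) j k
        rw [hc]
        exact Submodule.smul_mem _ c (x₀_pow_mul_γ_mem _)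
      | γ =>
        obtain ⟨c, hc⟩ := exists_z_mul_γ (K := K) k
        rw [(commute_z _ k).eq, hc]
        exact Submodule.smul_mem _ c (mul_h_mem (x₀_pow_mem _))
      | h =>
        rw [(commute_z _ k).eq]
        exact mul_h_mem (mono_mem k 2)
    · cases g with
      | x₀ =>
        rw [← mul_assoc, ← pow_succ']
        exact x₀_pow_mul_γ_mem (k + 1)
      | x j =>
        rw [x_mul_pow_mul]
        exact zero_mem _
      | y =>
        rw [((commute_x₀ _).pow_right k).mul_right (commute_γ _)]
        exact mul_y_mem (x₀_pow_mul_γ_mem k)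
      | z j =>
        obtain ⟨c, hc⟩ := exists_z_mul_γ (K := K) j
        rw [← mul_assoc,
          ((commute_x₀ _).pow_right k).eq,
          mul_assoc, hc, mul_smul_comm, ← mul_assoc, ← pow_add]
        exact Submodule.smul_mem _ c (mul_h_mem (x₀_pow_mem _))
      | γ => exact γ_mul_mem k
      | h =>
        rw [((commute_x₀ _).pow_right k).mul_right (commute_γ _)]
        exact mul_h_mem (x₀_pow_mul_γ_mem k)
  · rw [Submodule.mem_comap, LinearMap.mulLeft_apply, mul_x]
    exact zero_mem _

lemma word_mem (w : List (GenL n)) :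
    RingQuot.mkAlgHom K (GradedCommRel K (GenL.deg (n := n)) (RelL K n))
      (w.map (FreeAlgebra.ι K)).prod ∈ monoSpan K n (w.map GenL.deg).sum := by
  induction w with
  | nil =>
    simp only [List.map_nil, List.prod_nil, List.sum_nil, map_one]
    rw [← pow_zero (gen K .x₀)]
    exact x₀_pow_mem 0
  | cons g w ih =>
    simp only [List.map_cons, List.prod_cons, map_mul, List.sum_cons]
    exact gen_mul_mem ih

lemma component_le (d : ℕ) :
    GradedCommAlgebra.component K (GenL.deg (n := n)) (RelL K n) d ≤ monoSpan K n d := by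
  refine Submodule.span_le.2 ?_
  rintro _ ⟨w, rfl, rfl⟩
  exact word_mem w

lemma gen_mem (g : GenL n) :
    gen K g ∈ GradedCommAlgebra.component K (GenL.deg (n := n)) (RelL K n) g.deg :=
  Submodule.subset_span ⟨[g], by simp, by simp [gen]⟩

lemma mul_gen_mem {a : GradedCommAlgebra K (GenL.deg (n := n)) (RelL K n)} {d : ℕ}
    (ha : a ∈ GradedCommAlgebra.component K (GenL.deg (n := n)) (RelL K n) d) (g : GenL n) :
    a * gen K g ∈ GradedCommAlgebra.component K (GenL.deg (n := n)) (RelL K n) (d + g.deg) := by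
  refine (Submodule.span_le (p := (GradedCommAlgebra.component K (GenL.deg (n := n)) (RelL K n)
    (d + g.deg)).comap (LinearMap.mulRight K (gen K g)))).2 ?_ ha
  rintro _ ⟨w, rfl, rfl⟩
  refine Submodule.subset_span ⟨w ++ [g], by simp, ?_⟩
  rw [List.map_append, List.prod_append, map_mul]
  simp [gen]

lemma x₀_pow_mem_component (k : ℕ) : gen K (.x₀ : GenL n) ^ k ∈
    GradedCommAlgebra.component K (GenL.deg (n := n)) (RelL K n) 0 := by
  induction k with
  | zero => exact Submodule.subset_span ⟨[], by simp, by simp⟩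
  | succ k ih =>
    rw [pow_succ]
    exact mul_gen_mem ih .x₀

lemma mono_mem_component (k : Fin n) : ∀ i, mono K i k ∈
    GradedCommAlgebra.component K (GenL.deg (n := n)) (RelL K n) i :=
  Nat.six_induction (x₀_pow_mem_component k) (mul_gen_mem (x₀_pow_mem_component k) .y)
    (gen_mem (.z k)) (mul_gen_mem (gen_mem (.z k)) .y) (mul_gen_mem (x₀_pow_mem_component k) .γ)
    (mul_gen_mem (mul_gen_mem (x₀_pow_mem_component k) .γ) .y) fun _ h => mul_gen_mem h .h

lemma component_eq (d : ℕ) :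
    GradedCommAlgebra.component K (GenL.deg (n := n)) (RelL K n) d = monoSpan K n d :=
  le_antisymm (component_le d)
    (monoSpan_le (fun k => mono_mem_component k d) fun h k => h ▸ gen_mem (.x k))

lemma iSup_monoSpan : ⨆ d, monoSpan K n d = ⊤ := by
  have key : ∀ b : FreeAlgebra K (GenL n), ∀ a ∈ ⨆ d, monoSpan K n d,
      RingQuot.mkAlgHom K (GradedCommRel K (GenL.deg (n := n)) (RelL K n)) b * a ∈
        ⨆ d, monoSpan K n d := by
    intro b
    induction b using FreeAlgebra.induction with
    | grade0 r =>
      intro a ha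
      rw [AlgHom.commutes, ← Algebra.smul_def]
      exact Submodule.smul_mem _ r ha
    | grade1 g =>
      intro a ha
      refine (iSup_le fun d => ?_ : ⨆ d, monoSpan K n d ≤
        (⨆ d, monoSpan K n d).comap (LinearMap.mulLeft K (gen K g))) ha
      exact fun a ha => Submodule.mem_iSup_of_mem (g.deg + d) (gen_mul_mem ha)
    | mul b c hb hc =>
      intro a ha
      rw [map_mul, mul_assoc]
      exact hb _ (hc a ha)
    | add b c hb hc =>
      intro a ha
      rw [map_add, add_mul]
      exact add_mem (hb a ha) (hc a ha)
  refine eq_top_iff.2 fun a _ => ?_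
  obtain ⟨b, rfl⟩ := RingQuot.mkAlgHom_surjective K
    (GradedCommRel K (GenL.deg (n := n)) (RelL K n)) a
  have h := key b 1 (Submodule.mem_iSup_of_mem 0 (pow_zero (gen K (.x₀ : GenL n)) ▸ x₀_pow_mem 0))
  rwa [mul_one] at h

end PresentationL

end

/-! ### Comparison of the presented algebra with the Hochschild cohomology ring. -/

noncomputable section

variable {K Λ : Type u} [Field K] [Ring Λ] [Algebra K Λ] {n : ℕ}

namespace PathBasis

variable (B : PathBasis K Λ n)

/-- The images of the generators of the presented algebra. -/
def genImage : GenL n → HochschildCohomology K Λ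
  | .x₀ => B.clX
  | .x i => B.clOm i
  | .y => B.clY
  -- The signs of the images of `z`, `γ` and `h` bring the computed products into the form of the
  -- relations: the alternating ones account for the signs in `z_j z_k` and `z_j γ`, and `γ ^ 2 =
  -- z_1 h` persists because `z_1` and `h` both change sign.
  | .z j => (-1 : K) ^ ((j : ℕ) + 1) • B.clZ j
  | .γ => -B.clG
  | .h => -B.clH

lemma genImage_mem : ∀ g : GenL n, B.genImage g ∈ HochschildCohomology.component K Λ g.deg
  | .x₀ => cl_mem _ _
  | .x _ => cl_mem _ _
  | .y => cl_mem _ _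
  | .z j => Submodule.smul_mem _ _ (clZ_mem (j : ℕ))
  | .γ => neg_mem clG_mem
  | .h => neg_mem clH_mem

variable {B}

lemma commute_clX {i : ℕ} {u : HochschildCohomology K Λ}
    (hu : u ∈ HochschildCohomology.component K Λ i) : u * B.clX = B.clX * u := by
  obtain ⟨f, hf, rfl⟩ := B.exists_cl_eq hu
  exact mul_clX hf

lemma commute_clOm (k : ℕ) {i : ℕ} {u : HochschildCohomology K Λ}
    (hu : u ∈ HochschildCohomology.component K Λ i) : u * B.clOm k = B.clOm k * u := by
  obtain ⟨f, hf, rfl⟩ := B.exists_cl_eq hu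
  exact mul_clOm k hf

lemma clY_mul_of_mem {i : ℕ} {u : HochschildCohomology K Λ}
    (hu : u ∈ HochschildCohomology.component K Λ i) :
    B.clY * u = (-1 : K) ^ i • (u * B.clY) := by
  obtain ⟨f, hf, rfl⟩ := B.exists_cl_eq hu
  rw [clY_mul hf, ← Int.cast_smul_eq_zsmul K]
  push_cast
  rfl

section

variable (h2 : (2 : K) ≠ 0) (hK : (2 * n + 1 : K) ≠ 0) (hn : 1 ≤ n)

include h2 hK hn

/-- Classes of degree zero are central and `y` commutes with everything up to the graded sign, both
by general arguments. For the remaining pairs, all of even degree, commutativity comes from the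
explicit products. -/
lemma genImage_comm (a b : GenL n) : B.genImage a * B.genImage b =
    (-1 : K) ^ (a.deg * b.deg) • (B.genImage b * B.genImage a) := by
  have h0 : ∀ {u v : HochschildCohomology K Λ} {d : ℕ}, Even d → u * v = v * u →
      u * v = (-1 : K) ^ d • (v * u) := fun hd h => by rw [hd.neg_one_pow, one_smul, h]
  have hx : ∀ c d : GenL n, c.deg = 0 →
      B.genImage d * B.genImage c = B.genImage c * B.genImage d := by
    intro c d hc
    cases c with
    | x₀ => exact commute_clX (B.genImage_mem d)
    | x i => exact commute_clOm _ (B.genImage_mem d)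
    | y => exact absurd hc (show ¬ 1 = 0 by decide)
    | z j => exact absurd hc (show ¬ 2 = 0 by decide)
    | γ => exact absurd hc (show ¬ 4 = 0 by decide)
    | h => exact absurd hc (show ¬ 6 = 0 by decide)
  by_cases ha : a.deg = 0
  · exact h0 (by rw [ha, zero_mul]; exact Even.zero) (hx a b ha).symm
  by_cases hb : b.deg = 0
  · exact h0 (by rw [hb, mul_zero]; exact Even.zero) (hx b a hb)
  have hzz : ∀ j k : Fin n, B.genImage (.z j) * B.genImage (.z k) =
      B.genImage (.z k) * B.genImage (.z j) := fun j k => by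
    unfold genImage
    rw [smul_mul_smul_comm, smul_mul_smul_comm, clZ_mul_clZ h2 hK j.2 k.2,
      clZ_mul_clZ h2 hK k.2 j.2, theta_symm, mul_comm ((-1 : K) ^ _)]
  have hgz : ∀ j : Fin n, B.genImage .γ * B.genImage (.z j) =
      B.genImage (.z j) * B.genImage .γ := fun j => by
    unfold genImage
    rw [neg_mul, mul_neg, mul_smul_comm, smul_mul_assoc, clG_mul_clZ h2 hK hn j.2]
  have hhz : ∀ j : Fin n, B.genImage .h * B.genImage (.z j) =
      B.genImage (.z j) * B.genImage .h := fun j => by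
    unfold genImage
    rw [neg_mul, mul_neg, mul_smul_comm, smul_mul_assoc, clH_mul_clZ h2 hK j.2]
  have hhg : B.genImage .h * B.genImage .γ = B.genImage .γ * B.genImage .h := by
    unfold genImage
    rw [neg_mul_neg, neg_mul_neg, clH_mul_clG hn]
  by_cases hay : a = .y
  · subst hay
    rw [show GenL.y.deg * b.deg = b.deg from one_mul _]
    exact clY_mul_of_mem (B.genImage_mem b)
  by_cases hby : b = .y
  · subst hby
    rw [show a.deg * GenL.y.deg = a.deg from mul_one _]
    refine Eq.trans ?_ (congrArg _ (clY_mul_of_mem (B.genImage_mem a)).symm)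
    rw [smul_smul, ← mul_pow, neg_one_mul, neg_neg, one_pow, one_smul]
    rfl
  have hd : Even (a.deg * b.deg) := by
    refine Even.mul_right ?_ _
    cases a with
    | x₀ => exact Even.zero
    | x i => exact Even.zero
    | y => exact absurd rfl hay
    | z j => exact (show Even 2 by decide)
    | γ => exact (show Even 4 by decide)
    | h => exact (show Even 6 by decide)
  refine h0 hd ?_
  cases a with
  | x₀ => exact absurd rfl ha
  | x i => exact absurd rfl ha
  | y => exact absurd rfl hay
  | z j =>
    cases b with
    | x₀ => exact absurd rfl hb
    | x i => exact absurd rfl hb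
    | y => exact absurd rfl hby
    | z k => exact hzz j k
    | γ => exact (hgz j).symm
    | h => exact (hhz j).symm
  | γ =>
    cases b with
    | x₀ => exact absurd rfl hb
    | x i => exact absurd rfl hb
    | y => exact absurd rfl hby
    | z k => exact hgz k
    | γ => rfl
    | h => exact hhg.symm
  | h =>
    cases b with
    | x₀ => exact absurd rfl hb
    | x i => exact absurd rfl hb
    | y => exact absurd rfl hby
    | z k => exact hhz k
    | γ => exact hhg
    | h => rfl

lemma genImage_rel {r s : FreeAlgebra K (GenL n)}
    (h : GradedCommRel K (GenL.deg (n := n)) (RelL K n) r s) :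
    FreeAlgebra.lift K B.genImage r = FreeAlgebra.lift K B.genImage s := by
  cases h with
  | comm a b =>
    simp only [map_mul, map_smul, FreeAlgebra.lift_ι_apply]
    exact genImage_comm h2 hK hn a b
  | of r s h =>
    cases h with
    | x_mul i ξ =>
      simp only [map_mul, map_zero, FreeAlgebra.lift_ι_apply]
      cases ξ with
      | x₀ => exact clOm_mul_clX _
      | x j => exact clOm_mul_clOm hn _ _
      | y => exact clOm_mul_clY _
      | z j => exact (mul_smul_comm _ _ _).trans ((congrArg _ (clOm_mul_clZ h2 hn _ _)).trans (smul_zero _))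
      | γ => exact (mul_neg _ _).trans ((congrArg _ (clOm_mul_clG h2 hn _)).trans neg_zero)
      | h => exact (mul_neg _ _).trans ((congrArg _ (clOm_mul_clH h2 _)).trans neg_zero)
    | x₀_pow =>
      simp only [map_pow, map_zero, FreeAlgebra.lift_ι_apply]
      exact clX_pow_eq_zero
    | y_sq =>
      rw [map_pow, map_zero, FreeAlgebra.lift_ι_apply, pow_two]
      exact clY_sq h2
    | x₀_mul_z j =>
      simp only [map_mul, map_zero, FreeAlgebra.lift_ι_apply]
      exact (mul_smul_comm _ _ _).trans ((congrArg _ (clX_mul_clZ h2 _)).trans (smul_zero _))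
    | z_mul_z j k hjk =>
      simp only [map_mul, map_smul, map_pow, FreeAlgebra.lift_ι_apply]
      unfold genImage
      rw [smul_mul_smul_comm, clZ_mul_clZ h2 hK j.2 k.2, theta_of_le hjk, mul_neg, smul_neg,
        ← neg_smul, smul_smul]
      congr 1
      -- The exponent uses subtraction of natural numbers, which is exact because `j ≤ k`. Its
      -- parity is opposite to that of `(j + 1) + (k + 1)`.
      have hs : (-1 : K) ^ ((k + 1 : ℕ) - (j + 1 : ℕ) + 1) =
          -((-1) ^ ((j : ℕ) + 1) * (-1) ^ ((k : ℕ) + 1)) := by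
        obtain ⟨t, ht⟩ := Nat.exists_eq_add_of_le (Fin.le_def.1 hjk)
        rw [ht, show (j : ℕ) + t + 1 - (j + 1) + 1 = t + 1 by omega, ← pow_add,
          show (j : ℕ) + 1 + (j + t + 1) = 2 * (j + 1) + t by ring, pow_add _ (2 * _),
          pow_mul, pow_succ, neg_one_sq, one_pow, one_mul, mul_neg_one]
      rw [hs]
      push_cast
      ring
    | z_mul_γ j =>
      simp only [map_mul, map_smul, map_pow, FreeAlgebra.lift_ι_apply]
      unfold genImage
      rw [mul_neg, mul_neg, smul_neg, smul_mul_assoc, clZ_mul_clG hn j.2, smul_smul]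
      congr 2
      push_cast
      ring
    | γ_sq h0 =>
      rw [map_pow, map_mul, FreeAlgebra.lift_ι_apply, FreeAlgebra.lift_ι_apply,
        FreeAlgebra.lift_ι_apply, pow_two]
      have hz : B.genImage (.z ⟨0, h0⟩) = -B.clZ 0 := by
        refine (congrArg (· • B.clZ 0) (pow_one (-1 : K))).trans (neg_one_smul K _)
      rw [hz]
      exact (neg_mul_neg _ _).trans ((clG_sq hn).trans (neg_mul_neg _ _).symm)

/-- The homomorphism from the presented algebra to the Hochschild cohomology ring. -/
def presentationHom : GradedCommAlgebra K (GenL.deg (n := n)) (RelL K n) →ₐ[K]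
    HochschildCohomology K Λ :=
  RingQuot.liftAlgHom K ⟨FreeAlgebra.lift K B.genImage, fun _ _ h => genImage_rel h2 hK hn h⟩

lemma presentationHom_gen (g : GenL n) :
    presentationHom (B := B) h2 hK hn (PresentationL.gen K g) = B.genImage g := by
  unfold presentationHom PresentationL.gen
  rw [RingQuot.liftAlgHom_mkAlgHom_apply]
  exact FreeAlgebra.lift_ι_apply _ _

/-- The scalars are the signs of `genImage`. Being units, they do not affect linear independence or
spans. -/
lemma exists_presentationHom_mono (k : Fin n) : ∀ i, ∃ c : Kˣ,
    presentationHom (B := B) h2 hK hn (PresentationL.mono K i k) = c • B.mono i k := by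
  have hp : ∀ m : ℕ, presentationHom (B := B) h2 hK hn (PresentationL.gen K .x₀ ^ m) =
      B.clX ^ m := fun m => by
    rw [map_pow, presentationHom_gen]
    rfl
  have hz : presentationHom (B := B) h2 hK hn (PresentationL.gen K (.z k)) =
      ((-1 : Kˣ) ^ ((k : ℕ) + 1)) • B.clZ k := by
    rw [presentationHom_gen, Units.smul_def]
    push_cast
    rfl
  have hg : presentationHom (B := B) h2 hK hn (PresentationL.gen K .γ) = -B.clG :=
    presentationHom_gen h2 hK hn _
  have hy : presentationHom (B := B) h2 hK hn (PresentationL.gen K .y) = B.clY :=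
    presentationHom_gen h2 hK hn _
  have hh : presentationHom (B := B) h2 hK hn (PresentationL.gen K .h) = -B.clH :=
    presentationHom_gen h2 hK hn _
  have hneg : ∀ v : HochschildCohomology K Λ, -v = (-1 : Kˣ) • v := fun v => by
    rw [Units.smul_def, Units.val_neg, Units.val_one, neg_one_smul]
  refine Nat.six_induction ⟨1, ?_⟩ ⟨1, ?_⟩ ⟨_, hz⟩ ⟨(-1 : Kˣ) ^ ((k : ℕ) + 1), ?_⟩ ⟨-1, ?_⟩
    ⟨-1, ?_⟩ ?_
  · exact (hp k).trans (one_smul _ _).symm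
  · refine (map_mul _ _ _).trans ?_
    rw [hp, hy, one_smul]
    rfl
  · refine (map_mul _ _ _).trans ?_
    rw [hz, hy, smul_mul_assoc]
    rfl
  · refine (map_mul _ _ _).trans ?_
    rw [hp, hg, mul_neg, hneg]
    rfl
  · refine (map_mul _ _ _).trans ?_
    rw [map_mul, hp, hg, hy, mul_neg, neg_mul, hneg]
    rfl
  · rintro i ⟨c, hc⟩
    refine ⟨-c, (map_mul _ _ _).trans ?_⟩
    rw [hc, hh, mul_neg, smul_mul_assoc, ← smul_neg, hneg, smul_smul, mul_neg_one]
    rfl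

variable (B)

/-- The spanning families of the homogeneous components of the presented algebra. -/
lemma exists_family (d : ℕ) : ∃ (ι : Type) (v : ι → GradedCommAlgebra K (GenL.deg (n := n)) (RelL K n)),
    PresentationL.monoSpan K n d = Submodule.span K (Set.range v) ∧
    LinearIndependent K (presentationHom (B := B) h2 hK hn ∘ v) ∧
    Submodule.span K (Set.range (presentationHom (B := B) h2 hK hn ∘ v)) =
      HochschildCohomology.component K Λ d := by
  cases d with
  | zero =>
    refine ⟨_, _, rfl, ?_⟩
    have h : presentationHom (B := B) h2 hK hn ∘ Sum.elim (PresentationL.mono K 0)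
        (fun k : Fin n => PresentationL.gen K (.x k)) = fun t => B.cl 0 (B.basisCo₀ t) := by
      funext t
      rcases t with k | k
      · refine (map_pow _ _ _).trans ?_
        rw [presentationHom_gen]
        exact clX_pow _
      · exact presentationHom_gen h2 hK hn _
    rw [h]
    exact ⟨B.linearIndependent_cl_zero, (B.component_zero_eq_span h2).symm⟩
  | succ d =>
    refine ⟨_, _, rfl, ?_⟩
    choose c hc using fun k => exists_presentationHom_mono (B := B) h2 hK hn k (d + 1)
    have h : presentationHom (B := B) h2 hK hn ∘ PresentationL.mono K (d + 1) =
        c • B.mono (d + 1) := funext hc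
    rw [h, B.component_eq_span_mono h2 hK d]
    refine ⟨(B.linearIndependent_mono hK d).units_smul c, le_antisymm (Submodule.span_le.2 ?_)
      (Submodule.span_le.2 ?_)⟩
    · rintro _ ⟨k, rfl⟩
      exact Submodule.smul_mem _ (c k : K) (Submodule.subset_span ⟨k, rfl⟩)
    · rintro _ ⟨k, rfl⟩
      have := Submodule.smul_mem _ ((c k)⁻¹ : Kˣ).val (Submodule.subset_span
        (R := K) (s := Set.range (c • B.mono (d + 1))) ⟨k, rfl⟩)
      rwa [Pi.smul_apply', ← Units.smul_def, inv_smul_smul] at this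

lemma map_monoSpan (d : ℕ) : (PresentationL.monoSpan K n d).map
    (presentationHom (B := B) h2 hK hn).toLinearMap = HochschildCohomology.component K Λ d := by
  obtain ⟨ι, v, h, -, hs⟩ := B.exists_family h2 hK hn d
  rw [h, Submodule.map_span, ← Set.range_comp]
  exact hs

lemma eq_zero_of_presentationHom {d : ℕ}
    {a : GradedCommAlgebra K (GenL.deg (n := n)) (RelL K n)}
    (ha : a ∈ PresentationL.monoSpan K n d) (h0 : presentationHom (B := B) h2 hK hn a = 0) :
    a = 0 := by
  obtain ⟨ι, v, h, hi, -⟩ := B.exists_family h2 hK hn d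
  rw [h] at ha
  exact Submodule.disjoint_def.1 (Submodule.range_ker_disjoint
    (f := (presentationHom (B := B) h2 hK hn).toLinearMap) hi) a ha h0

/-- An element is a sum of members of the spans `monoSpan`, and their images lie in different
summands of the direct sum. So injectivity in each degree, where the spanning family has independent
images, is enough. -/
lemma presentationHom_injective : Function.Injective (presentationHom (B := B) h2 hK hn) := by
  refine (injective_iff_map_eq_zero _).2 fun a h0 => ?_
  have ha : a ∈ ⨆ d, PresentationL.monoSpan K n d := by
    rw [PresentationL.iSup_monoSpan]
    trivial
  obtain ⟨f, hf, rfl⟩ := (Submodule.mem_iSup_iff_exists_finsupp _ _).1 ha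
  refine Finset.sum_eq_zero fun d hd => B.eq_zero_of_presentationHom h2 hK hn (hf d) ?_
  have hm : ∀ d, ∃ u : HH K Λ d, DirectSum.lof K ℕ (HH K Λ) d u =
      presentationHom (B := B) h2 hK hn (f d) := fun d => by
    have := Submodule.mem_map_of_mem (f := (presentationHom (B := B) h2 hK hn).toLinearMap) (hf d)
    rwa [map_monoSpan] at this
  choose u hu using hm
  have h1 := congrArg (DirectSum.component K ℕ (HH K Λ) d) h0
  rw [Finsupp.sum, map_sum, map_sum, map_zero, Finset.sum_eq_single d (fun e _ he => by
    rw [← hu, DirectSum.component.of, dif_neg he]) (fun h => absurd hd h), ← hu,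
    DirectSum.component.lof_self] at h1
  rw [← hu, h1, map_zero]

lemma presentationHom_surjective : Function.Surjective (presentationHom (B := B) h2 hK hn) := by
  intro x
  induction x using DirectSum.induction_on with
  | zero => exact ⟨0, map_zero _⟩
  | of d u =>
    have h : DirectSum.lof K ℕ (HH K Λ) d u ∈ HochschildCohomology.component K Λ d := ⟨u, rfl⟩
    rw [← B.map_monoSpan h2 hK hn] at h
    obtain ⟨a, -, ha⟩ := h
    exact ⟨a, ha⟩
  | add x y hx hy =>
    obtain ⟨a, rfl⟩ := hx
    obtain ⟨b, rfl⟩ := hy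
    exact ⟨a + b, map_add _ a b⟩

end

end PathBasis

end

/-- `HH^*(P(𝕃ₙ))` is isomorphic, as a graded `K`-algebra, to the graded commutative algebra with
the generators `GenL n` and the relations `RelL K n`. -/
theorem theorem1p1 (K : Type u) [Field K] [IsAlgClosed K] (n : ℕ) (hn : 1 ≤ n)
    (hK2 : ringChar K ≠ 2) (hKn : ¬ ringChar K ∣ 2 * n + 1) :
    ∃ φ : GradedCommAlgebra K (GenL.deg (n := n)) (RelL K n) ≃ₐ[K]
        HochschildCohomology K ((graphL n).PreprojectiveAlgebra K),
      ∀ d : ℕ,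
        (GradedCommAlgebra.component K (GenL.deg (n := n)) (RelL K n) d).map φ.toLinearMap =
          HochschildCohomology.component K ((graphL n).PreprojectiveAlgebra K) d := by
  -- The two conditions on the characteristic enter only through the nonvanishing of `2` and of `2 *
  -- n + 1` in `K`.
  have h2 : (2 : K) ≠ 0 := Ring.two_ne_zero hK2
  have hK : (2 * n + 1 : K) ≠ 0 := fun h => hKn ((ringChar.spec K _).1 (by exact_mod_cast h))
  let B := PreprojectiveL.pathBasis K n
  refine ⟨AlgEquiv.ofBijective (PathBasis.presentationHom (B := B) h2 hK hn)
    ⟨B.presentationHom_injective h2 hK hn, B.presentationHom_surjective h2 hK hn⟩, fun d => ?_⟩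
  rw [PresentationL.component_eq]
  exact B.map_monoSpan h2 hK hn d
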